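/- Let $k\in\{0,1,2,\dots\}$, let $m\ge k+2$ be real, and let $\frac k2<\mu_1<\mu_2<\frac{k+1}2$. On $\mathbf R^2$ let $L^2(m)$ be the space of real functions with $\|f\|_m=\bigl(\int(1+|\xi|^2)^m|f(\xi)|^2\,d\xi\bigr)^{1/2}<\infty$, let $\mathcal L w=\Delta w+\frac12\,\xi\cdot\nabla w+w$, and let $\mathbf v(\xi)=\frac1{2\pi}\int\frac{(\xi-\eta)^\perp}{|\xi-\eta|^2}w(\eta)\,d\eta$, with $(x_1,x_2)^\perp=(-x_2,x_1)$, be the velocity field of $w$. Let $\chi:L^2(m)\to\mathbf R$ be a bounded, globally Lipschitz $C^\infty$ function with $\chi(w)=1$ for $\|w\|_m\le1$ and $\chi(w)=0$ for $\|w\|_m\ge2$, and put $\chi_{r_0}(w)=\chi(w/r_0)$. Let $\Phi_\tau^{m}$ and $\Phi_\tau^{r_0,m}$ be the semiflows defined by $$\text{(1)}\quad \partial_\tau w=\mathcal L w-(\mathbf v\cdot\nabla)w,\qquad\qquad \text{(2)}\quad \partial_\tau w=\mathcal L w-(\mathbf v\cdot\nabla)(\chi_{r_0}(w)w),$$ in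 the sense of the integral equation $w(\tau)=e^{\tau\mathcal L}w(0)-\int_0^\tau e^{-\frac12(\tau-s)}\,\nabla\cdot e^{(\tau-s)\mathcal L}\bigl(c(w(s))\mathbf v(s)w(s)\bigr)ds$ with $w\in C^0([0,\infty),L^2(m))$, where $c=1$ for (1) and $c=\chi_{r_0}$ for (2). Let $P_k$ be the spectral projection of $e^{\mathcal L}$ for the eigenvalues $e^{-j/2}$, $0\le j\le k$: $P_kf=\sum_{|\alpha|\le k}\bigl(\int H_\alpha f\,d\xi\bigr)\phi_\alpha$, with $\phi_\alpha=\partial^\alpha\bigl(\frac1{4\pi}e^{-|\xi|^2/4}\bigr)$ and $H_\alpha=\frac{2^{|\alpha|}}{\alpha!}e^{|\xi|^2/4}\partial^\alpha e^{-|\xi|^2/4}$. Let $E_c=P_kL^2(m)$ and $E_s=(1-P_k)L^2(m)$. Call $W\subset L^2(m)$ a center manifold of $\Phi^{r_0,m}$ if * $W=\{w_c+g(w_c): w_c\in E_c\}$ for a $C^1$, globally Lipschitz map $g:E_c\to E_s$ with $g(0)=0$ and $Dg(0)=0$; * the restriction of $\Phi^{r_0,m}_\tau$ to $W$ extends to a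 Lipschitz flow on $W$; $\Phi_\tau^{r_0,m}(W)=W$ for all $\tau\ge0$; and every $w_0\in W$ is the end point $w(0)=w_0$ of a unique negative semi-orbit $\{w(\tau)\}_{\tau\le0}$ of $\Phi^{r_0,m}$ in $W$; * negative semi-orbits in $W$ satisfy $\limsup_{\tau\to-\infty}|\tau|^{-1}\ln\|w(\tau)\|_m\le\mu_1$, and conversely every negative semi-orbit of $\Phi^{r_0,m}$ with $\limsup_{\tau\to-\infty}|\tau|^{-1}\ln\|w(\tau)\|_m\le\mu_2$ lies in $W$. (The last condition determines $W$ uniquely.) Then for all sufficiently small $r_0>0$ (depending on $k,m,\mu_1,\mu_2,\chi$) equation (2) has a unique global solution for every initial value in $L^2(m)$, equation (1) has a unique global solution for every initial value with $\|w_0\|_m<r_0$, the center manifold $W_c$ of $\Phi^{r_0,m}$ exists, and $W_c^{loc}=W_c\cap\{w:\|w\|_m<r_0\}$ has the following properties. 1. $W_c^{loc}$ is locally invariant under $\Phi^m_\tau$: a trajectory of $\Phi^m$ starting in $W_c^{loc}$ stays in $W_c^{loc}$ as long as it stays in $\{\|w\|_m<r_0\}$, and through every point of $W_c^{loc}$ there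 is an orbit of $\Phi^m$ in $W_c^{loc}$ defined on an open time interval around $0$. 2. If $\{w(\tau)\}_{\tau\le0}$ is a negative semi-orbit of $\Phi^m$ with $\|w(\tau)\|_m<r_0$ for all $\tau\le0$, then $w(\tau)\in W_c^{loc}$ for all $\tau\le0$. 3. For every $\mu<\mu_2$ there are $r_2>0$ and $C>0$ such that for every $\tilde w_0\in L^2(m)$ with $\|\tilde w_0\|_m\le r_2$ (for which (1) has a unique global solution) there is $w_0\in W_c^{loc}$ with $\Phi_\tau^m(w_0)\in W_c^{loc}$ for all $\tau\ge0$ and $$\|\Phi_\tau^m(\tilde w_0)-\Phi_\tau^m(w_0)\|_m\le C e^{-\mu\tau},\qquad\tau\ge0;$$ if moreover $\mu>\frac k2$, then $w_0$ with these properties is unique. -/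

import Mathlib

open Set Filter Topology MeasureTheory
open scoped ContDiff ENNReal NNReal

noncomputable section

namespace RescaledVorticity

/-- The plane `ℝ²` with its Euclidean norm. -/
abbrev Plane : Type := EuclideanSpace ℝ (Fin 2)

/-- The measure `(1 + |ξ|²)^m dξ` on the plane. -/
def weightMeasure (m : ℝ) : Measure Plane :=
  (volume : Measure Plane).withDensity fun ξ => ENNReal.ofReal ((1 + ‖ξ‖ ^ 2) ^ m)

/-- The weighted space `L²(m)`, with norm `‖f‖_m = (∫ (1 + |ξ|²)^m |f(ξ)|² dξ)^(1/2)`.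
The weight is positive, so almost everywhere means the same as for Lebesgue measure. -/
abbrev L2m (m : ℝ) : Type := Lp ℝ 2 (weightMeasure m)

/-- Rotation by a right angle, `(x₁, x₂) ↦ (-x₂, x₁)`. -/
def perp (x : Plane) : Plane := !₂[-(x 1), x 0]

/-- The velocity field given by the Biot-Savart law. -/
def biotSavart (w : Plane → ℝ) (ξ : Plane) : Plane :=
  (1 / (2 * Real.pi)) • ∫ η, (w η / ‖ξ - η‖ ^ 2) • perp (ξ - η)

/-- `a(τ) = 1 - e^(-τ)`. -/
def aTime (τ : ℝ) : ℝ := 1 - Real.exp (-τ)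

/-- The semigroup `e^(τ𝓛)`, `τ > 0`, generated by `𝓛 w = Δw + ½ ξ·∇w + w`:
`(e^(τ𝓛) f)(ξ) = e^τ / (4π a(τ)) ∫ exp(-|ξ - η|² / (4 a(τ))) f(e^(τ/2) η) dη`. -/
def linSemigroup (τ : ℝ) (f : Plane → ℝ) (ξ : Plane) : ℝ :=
  Real.exp τ / (4 * Real.pi * aTime τ) *
    ∫ η, Real.exp (-‖ξ - η‖ ^ 2 / (4 * aTime τ)) * f (Real.exp (τ / 2) • η)

/-- The function `∇ · e^(τ𝓛) F`, `τ > 0`, for a vector field `F`; the derivative has been carried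
to the Gaussian kernel, `∇_ξ exp(-|ξ - η|² / (4a)) = -(ξ - η) / (2a) exp(-|ξ - η|² / (4a))`. -/
def divLinSemigroup (τ : ℝ) (F : Plane → Plane) (ξ : Plane) : ℝ :=
  Real.exp τ / (4 * Real.pi * aTime τ) *
    ∫ η, Real.exp (-‖ξ - η‖ ^ 2 / (4 * aTime τ)) *
      (-(inner ℝ (ξ - η) (F (Real.exp (τ / 2) • η))) / (2 * aTime τ))

/-- The vector field `c(w) w v`, where `v` is the velocity field of the vorticity `w`. -/
def flux {m : ℝ} (c : L2m m → ℝ) (w : L2m m) (ξ : Plane) : Plane :=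
  (c w * w ξ) • biotSavart w ξ

/-- `w ∈ C⁰([0, ∞), L²(m))` is a (mild) solution of `∂_τ w = 𝓛 w - (v · ∇)(c(w) w)`, that is,
`w(τ) = e^(τ𝓛) w(0) - ∫₀^τ e^(-(τ - s)/2) ∇ · e^((τ - s)𝓛) (v(s) c(w(s)) w(s)) ds`.
Only the values of `w` at nonnegative times matter. -/
def IsMildSolution {m : ℝ} (c : L2m m → ℝ) (w : ℝ → L2m m) : Prop :=
  ContinuousOn w (Ici 0) ∧
    ∀ τ : ℝ, 0 < τ → ∀ᵐ ξ ∂(volume : Measure Plane),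
      w τ ξ = linSemigroup τ (w 0) ξ -
        ∫ s in (0 : ℝ)..τ,
          Real.exp (-(τ - s) / 2) * divLinSemigroup (τ - s) (flux c (w s)) ξ

/-- There is one and only one global solution with initial value `w₀`. -/
def WellPosedAt {m : ℝ} (c : L2m m → ℝ) (w₀ : L2m m) : Prop :=
  (∃ w : ℝ → L2m m, IsMildSolution c w ∧ w 0 = w₀) ∧
    ∀ w w' : ℝ → L2m m, IsMildSolution c w → IsMildSolution c w' → w 0 = w₀ → w' 0 = w₀ →
      EqOn w w' (Ici 0)

open Classical in
/-- The semiflow of `∂_τ w = 𝓛 w - (v · ∇)(c(w) w)`: `semiflow c τ w₀` is the value at time `τ`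
of the solution with initial value `w₀`. -/
def semiflow {m : ℝ} (c : L2m m → ℝ) (τ : ℝ) (w₀ : L2m m) : L2m m :=
  if h : ∃ w : ℝ → L2m m, IsMildSolution c w ∧ w 0 = w₀ then h.choose τ else 0

/-- The rescaled vorticity equation itself, `c = 1`. -/
def noCut (m : ℝ) : L2m m → ℝ := fun _ => 1

/-- `χ_r(w) = χ(w / r)`. -/
def rescaleCut {m : ℝ} (χ : L2m m → ℝ) (r : ℝ) : L2m m → ℝ := fun w => χ (r⁻¹ • w)

/-- Admissible cut-off functions on `L²(m)`. -/
structure IsCutoff {m : ℝ} (χ : L2m m → ℝ) : Prop where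
  smooth : ContDiff ℝ ∞ χ
  bounded : ∃ M : ℝ, ∀ w, |χ w| ≤ M
  lipschitz : ∃ K : ℝ≥0, LipschitzWith K χ
  eq_one : ∀ w, ‖w‖ ≤ 1 → χ w = 1
  eq_zero : ∀ w, 2 ≤ ‖w‖ → χ w = 0

/-- Partial derivative in the direction of the `i`-th coordinate. -/
def pderiv (i : Fin 2) (f : Plane → ℝ) (ξ : Plane) : ℝ :=
  fderiv ℝ f ξ (EuclideanSpace.single i 1)

/-- `∂^α = ∂₁^α₁ ∂₂^α₂`. -/
def multiDeriv (α : ℕ × ℕ) (f : Plane → ℝ) : Plane → ℝ :=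
  (pderiv 0)^[α.1] ((pderiv 1)^[α.2] f)

/-- The Hermite functions `φ_α = ∂^α φ₀`, `φ₀(ξ) = (4π)⁻¹ exp(-|ξ|²/4)`: eigenfunctions of
`e^(τ𝓛)` with eigenvalue `e^(-|α|τ/2)`. -/
def hermiteFun (α : ℕ × ℕ) : Plane → ℝ :=
  multiDeriv α fun ξ => 1 / (4 * Real.pi) * Real.exp (-‖ξ‖ ^ 2 / 4)

/-- The Hermite polynomials `H_α(ξ) = (2^|α| / α!) e^(|ξ|²/4) ∂^α (e^(-|ξ|²/4))`, which are
biorthogonal to the Hermite functions: `∫ H_α φ_β = δ_{αβ}`. -/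
def hermitePoly (α : ℕ × ℕ) (ξ : Plane) : ℝ :=
  2 ^ (α.1 + α.2) / ((α.1.factorial : ℝ) * (α.2.factorial : ℝ)) * Real.exp (‖ξ‖ ^ 2 / 4) *
    multiDeriv α (fun η => Real.exp (-‖η‖ ^ 2 / 4)) ξ

/-- The spectral projection of `e^𝓛` for the eigenvalues `1, e^(-1/2), …, e^(-k/2)`:
`P_k f = ∑_{|α| ≤ k} (∫ H_α f) φ_α`. -/
def specProj (k : ℕ) (f : Plane → ℝ) (ξ : Plane) : ℝ :=
  ∑ n ∈ Finset.range (k + 1), ∑ α ∈ Finset.HasAntidiagonal.antidiagonal n,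
    (∫ η, hermitePoly α η * f η) * hermiteFun α ξ

/-- `E_c = P_k L²(m)`, the span of the Hermite functions `φ_α` with `|α| ≤ k`. -/
def centerSpace (k : ℕ) (m : ℝ) : Submodule ℝ (L2m m) :=
  Submodule.span ℝ {f : L2m m | ∃ α : ℕ × ℕ, α.1 + α.2 ≤ k ∧
    ∀ᵐ ξ ∂(volume : Measure Plane), f ξ = hermiteFun α ξ}

/-- `E_s = (1 - P_k) L²(m)`, the kernel of `P_k`. -/
def stableSpace (k : ℕ) (m : ℝ) : Set (L2m m) :=
  {f | ∀ᵐ ξ ∂(volume : Measure Plane), specProj k f ξ = 0}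

/-- `w : (-∞, 0] → X` is a negative semi-orbit of the semiflow `Φ`
(values at positive times do not matter). -/
def IsNegSemiOrbit {X : Type*} (Φ : ℝ → X → X) (w : ℝ → X) : Prop :=
  ∀ τ s : ℝ, 0 ≤ s → τ + s ≤ 0 → w (τ + s) = Φ s (w τ)

/-- `limsup_{τ → -∞} |τ|⁻¹ ln ‖w(τ)‖`, as an extended real number, with `ln 0 = -∞`. -/
def backwardRate {X : Type*} [NormedAddCommGroup X] (w : ℝ → X) : EReal :=
  limsup (fun τ : ℝ => ((1 / |τ| : ℝ) : EReal) * ENNReal.log ‖w τ‖ₑ) atBot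

/-- `W` is the center manifold of the semiflow `Φ` on `L²(m)`: the graph of a `C¹`, globally
Lipschitz map `g : E_c → E_s` with `g(0) = 0`, `Dg(0) = 0`, on which `Φ` extends to a Lipschitz
flow, and which is characterized by the growth of negative semi-orbits. The last two fields
determine `W`: it consists of the end points `w(0)` of the negative semi-orbits whose rate is
at most `μ₂`. -/
structure IsCenterManifold (k : ℕ) (m μ₁ μ₂ : ℝ) (Φ : ℝ → L2m m → L2m m)
    (W : Set (L2m m)) : Prop where
  graph : ∃ g : centerSpace k m → L2m m,
    (∀ x, g x ∈ stableSpace k m) ∧ ContDiff ℝ 1 g ∧ (∃ K : ℝ≥0, LipschitzWith K g) ∧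
      g 0 = 0 ∧ fderiv ℝ g 0 = 0 ∧ W = {w | ∃ x : centerSpace k m, w = (x : L2m m) + g x}
  flow : ∃ Ψ : ℝ → W → W,
    Continuous (fun p : ℝ × W => Ψ p.1 p.2) ∧ (∀ w, Ψ 0 w = w) ∧
      (∀ s t w, Ψ (s + t) w = Ψ s (Ψ t w)) ∧ (∀ τ, ∃ K : ℝ≥0, LipschitzWith K (Ψ τ)) ∧
        ∀ τ, 0 ≤ τ → ∀ w : W, (Ψ τ w : L2m m) = Φ τ w
  image_eq : ∀ τ, 0 ≤ τ → Φ τ '' W = W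
  negSemiOrbit : ∀ w₀ ∈ W,
    (∃ w : ℝ → L2m m, IsNegSemiOrbit Φ w ∧ (∀ τ ≤ 0, w τ ∈ W) ∧ w 0 = w₀) ∧
      ∀ w w' : ℝ → L2m m, IsNegSemiOrbit Φ w → IsNegSemiOrbit Φ w' →
        (∀ τ ≤ 0, w τ ∈ W) → (∀ τ ≤ 0, w' τ ∈ W) → w 0 = w₀ → w' 0 = w₀ → EqOn w w' (Iic 0)
  rate_le : ∀ w : ℝ → L2m m, IsNegSemiOrbit Φ w → (∀ τ ≤ 0, w τ ∈ W) →
    backwardRate w ≤ ((μ₁ : ℝ) : EReal)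
  mem_of_rate_le : ∀ w : ℝ → L2m m, IsNegSemiOrbit Φ w →
    backwardRate w ≤ ((μ₂ : ℝ) : EReal) → ∀ τ ≤ 0, w τ ∈ W

/-- `W`, a subset of the ball `‖w‖ < r`, is locally invariant under `Φ`: a trajectory starting in
`W` can leave `W` in forward time only by leaving the ball, and through every point of `W` there
is an orbit in `W` on an open time interval around `0`. -/
def IsLocallyInvariant {X : Type*} [NormedAddCommGroup X] (Φ : ℝ → X → X) (r : ℝ)
    (W : Set X) : Prop :=
  (∀ w₀ ∈ W, ∀ T : ℝ, 0 ≤ T → (∀ τ ∈ Icc 0 T, ‖Φ τ w₀‖ < r) → ∀ τ ∈ Icc 0 T, Φ τ w₀ ∈ W) ∧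
    ∀ w₀ ∈ W, ∃ δ : ℝ, 0 < δ ∧ ∃ w : ℝ → X, w 0 = w₀ ∧ (∀ τ ∈ Ioo (-δ) δ, w τ ∈ W) ∧
      ∀ τ s : ℝ, 0 ≤ s → τ ∈ Ioo (-δ) δ → τ + s ∈ Ioo (-δ) δ → w (τ + s) = Φ s (w τ)

/-- The trajectory of `w₀` stays in `W` and approaches that of `w₁` at the rate `C e^(-μτ)`. -/
def TracksIn {X : Type*} [NormedAddCommGroup X] (Φ : ℝ → X → X) (W : Set X) (μ C : ℝ)
    (w₁ w₀ : X) : Prop :=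
  w₀ ∈ W ∧ (∀ τ : ℝ, 0 ≤ τ → Φ τ w₀ ∈ W) ∧
    ∀ τ : ℝ, 0 ≤ τ → ‖Φ τ w₁ - Φ τ w₀‖ ≤ C * Real.exp (-μ * τ)

end RescaledVorticity

end

open RescaledVorticity

open RescaledVorticity

namespace RescaledVorticity

/-! ### Fixed points in spaces of geometrically weighted sequences. -/

section WeightedSequences

/-! The equation is treated as an abstract problem w(τ) = S(τ)w(0) + ∫₀^τ B(τ-s)(p(w(s)), w(s)) ds
in a Banach space. Here S is a strongly continuous semigroup and B is a smoothing bilinear kernel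
with ‖B(t)‖ ≲ t^(-3/4) for small t (`SmoothingPair`). The center manifold theory is proved at this
level. The concrete equation enters only through `exists_smoothingPair` (kernel estimates),
`exists_spectralSplit` (the spectral gap) and `isMildSolution_iff` (pointwise and Bochner solutions
are the same).

Truncation at radius r makes the quadratic term globally Lipschitz with a constant O(r)
(`CutoffBounds.bilLipOn_cutId`). The time-t₀ map of the truncated flow is therefore S(t₀) + R with R
of class C¹, of small Lipschitz constant, and with DR(0) = 0. For large t₀ the linear part has a
pronounced gap: its inverse on E_c is at most C e^(kt₀/2), its size on E_s at most C e^(-νt₀), and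
μ₁ as well as some μ₂' > μ₂ lie strictly between k/2 and ν. So t₀ is chosen first and r afterwards
(`exists_gapFlow`).

For such a map (`GapMap`) the backward orbits of slow growth with a given central component are the
fixed points of a Lyapunov–Perron map on sequences. It contracts in every weight lⁿ with l₁ ≤ l ≤
l₂. Existence in the weight l₁ and uniqueness in the weight l₂ give a graph that contains exactly
the backward orbits growing at most like l₂ⁿ. The room between the two weights also makes the graph
C¹, because error terms that are small entry by entry become uniformly small when the weight
increases (`eventually_forall_le_mul_pow`). Tracking is the analogous problem forward in time, for
the difference of two orbits (`GapMap.exists_tracking`). `GapFlow` passes from multiples of t₀ to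
all times; the manifold is invariant at every time since it is characterized by growth. By the same
characterization every center manifold in the sense of the statement is the constructed one
(`GapFlow.eq_manifold`).

For the equation without truncation, the only obstruction to decay of small data is the eigenvalue
1, which belongs to the mass ∫ w, and the nonlinear flow conserves the mass. Hence small data stay
small (`norm_le_of_conserved`). A truncation at a slightly larger radius is then never felt, which
yields global solutions and the agreement of the two semiflows inside the ball
(`exists_localAgreement`). The local assertions follow from the global ones. Uniqueness in the
tracking statement rests on smaller balls, where the nonlinearity is so weak that two distinct
orbits on the manifold cannot approach each other faster than about e^(-kτ/2)
(`exists_unique_radius`).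

On the analytic side, the bounds in L²(m) come from a Schur test with Gaussian kernels and from
weighted Cauchy–Schwarz for the Biot–Savart kernel. The decay on E_s, at every rate below (k+1)/2,
is obtained by splitting the argument at |y| = e^(t/2). Far out the weight gains e^(-(m-1)t/2). Near
the origin the heat kernel is replaced by its Taylor remainder in y, which is allowed because
functions in E_s are orthogonal to all polynomials of degree at most k (`exists_norm_heatS_sub_le`).
-/

theorem le_of_halving {d : ℕ → ℝ} {l K₀ : ℝ} (hl : 0 < l) (hd : ∃ K, 0 ≤ K ∧ ∀ n, d n ≤ K * l ^ n)
    (hK₀ : 0 ≤ K₀)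
    (h : ∀ K, 0 ≤ K → (∀ n, d n ≤ K * l ^ n) → ∀ n, d n ≤ (K / 2 + K₀) * l ^ n) :
    ∀ n, d n ≤ 2 * K₀ * l ^ n := by
  obtain ⟨K, hK, hd⟩ := hd
  have key : ∀ j : ℕ, ∀ n, d n ≤ (2 * K₀ + K * (1 / 2) ^ j) * l ^ n := by
    intro j
    induction j with
    | zero =>
      intro n
      refine (hd n).trans (mul_le_mul_of_nonneg_right ?_ (pow_pos hl n).le)
      simp only [pow_zero, mul_one]; linarith
    | succ j ih =>
      intro n
      calc d n ≤ _ := h _ (by positivity) ih n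
        _ = _ := by ring
  intro n
  -- The initial constant `K`, of which only finiteness is known, is halved at each round and leaves
  -- no trace in the limit.
  have hlim : Tendsto (fun j : ℕ => (2 * K₀ + K * (1 / 2 : ℝ) ^ j) * l ^ n) atTop
      (𝓝 ((2 * K₀ + K * 0) * l ^ n)) :=
    ((tendsto_const_nhds.add ((tendsto_pow_atTop_nhds_zero_of_lt_one (by norm_num)
      (by norm_num)).const_mul K))).mul_const _
  rw [mul_zero, add_zero] at hlim
  exact ge_of_tendsto hlim (Eventually.of_forall fun j => key j n)

/-- Nearest-neighbour weights `a, b, c` (and `e` at the left end) that contract by a factor `1/2`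
in the norm `sup_n l⁻ⁿ ‖y n‖`. -/
structure NbrWeights (l a b c e : ℝ) : Prop where
  l_pos : 0 < l
  a_nonneg : 0 ≤ a
  b_nonneg : 0 ≤ b
  c_nonneg : 0 ≤ c
  e_nonneg : 0 ≤ e
  sum_le : a / l + b + c * l ≤ 1 / 2
  zero_le : e + c * l ≤ 1 / 2

theorem NbrWeights.le_half {l a b c e : ℝ} (h : NbrWeights l a b c e) {d : ℕ → ℝ} {K : ℝ}
    (hK : 0 ≤ K) (hd : ∀ n, d n ≤ K * l ^ n) :
    e * d 0 + c * d 1 ≤ K / 2 ∧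
      ∀ n, a * d n + b * d (n + 1) + c * d (n + 2) ≤ K / 2 * l ^ (n + 1) := by
  obtain ⟨hl, ha, hb, hc, he, h1, h2⟩ := h
  constructor
  · have h3 : e * d 0 ≤ e * (K * l ^ 0) := mul_le_mul_of_nonneg_left (hd 0) he
    have h4 : c * d 1 ≤ c * (K * l ^ 1) := mul_le_mul_of_nonneg_left (hd 1) hc
    have h5 : (e + c * l) * K ≤ 1 / 2 * K := mul_le_mul_of_nonneg_right h2 hK
    simp only [pow_zero, pow_one] at h3 h4
    nlinarith
  · intro n
    have h3 : a * d n ≤ a * (K * l ^ n) := mul_le_mul_of_nonneg_left (hd _) ha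
    have h4 : b * d (n + 1) ≤ b * (K * l ^ (n + 1)) := mul_le_mul_of_nonneg_left (hd _) hb
    have h5 : c * d (n + 2) ≤ c * (K * l ^ (n + 2)) := mul_le_mul_of_nonneg_left (hd _) hc
    have h6 : (a / l + b + c * l) * (K * l ^ (n + 1)) ≤ 1 / 2 * (K * l ^ (n + 1)) :=
      mul_le_mul_of_nonneg_right h1 (by positivity)
    have h7 : (a / l + b + c * l) * (K * l ^ (n + 1)) =
        a * (K * l ^ n) + b * (K * l ^ (n + 1)) + c * (K * l ^ (n + 2)) := by
      field_simp
      ring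
    linarith

/-- The right-hand side is absorbed into the left. This is legitimate only because the weighted norm
of `d` is assumed finite; the contraction factor 1/2 turns into the factor 2 in the conclusion. -/
theorem NbrWeights.le {l a b c e : ℝ} (h : NbrWeights l a b c e) {d : ℕ → ℝ} {K₀ : ℝ}
    (hd : ∃ K, 0 ≤ K ∧ ∀ n, d n ≤ K * l ^ n) (hK₀ : 0 ≤ K₀)
    (h0 : d 0 ≤ K₀ + (e * d 0 + c * d 1))
    (hs : ∀ n, d (n + 1) ≤ K₀ * l ^ (n + 1) + (a * d n + b * d (n + 1) + c * d (n + 2))) :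
    ∀ n, d n ≤ 2 * K₀ * l ^ n := by
  refine le_of_halving h.l_pos hd hK₀ fun K hK hdK n => ?_
  obtain ⟨h1, h2⟩ := h.le_half hK hdK
  cases n with
  | zero => simp only [pow_zero]; linarith
  | succ n => have := h2 n; have := hs n; linarith

variable {E : Type*} [NormedAddCommGroup E]

/-- `T` maps sequences to sequences and is Lipschitz with nearest-neighbour weights. -/
structure NbrLipschitz (T : (ℕ → E) → ℕ → E) (a b c e : ℝ) : Prop where
  zero : ∀ y y', ‖T y 0 - T y' 0‖ ≤ e * ‖y 0 - y' 0‖ + c * ‖y 1 - y' 1‖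
  succ : ∀ y y' n, ‖T y (n + 1) - T y' (n + 1)‖ ≤
    a * ‖y n - y' n‖ + b * ‖y (n + 1) - y' (n + 1)‖ + c * ‖y (n + 2) - y' (n + 2)‖

theorem NbrLipschitz.eq_of_fixed {T : (ℕ → E) → ℕ → E} {l a b c e : ℝ}
    (hT : NbrLipschitz T a b c e) (h : NbrWeights l a b c e) {y y' : ℕ → E}
    (hy : T y = y) (hy' : T y' = y') (hb : ∃ K, 0 ≤ K ∧ ∀ n, ‖y n - y' n‖ ≤ K * l ^ n) :
    y = y' := by
  have := h.le (d := fun n => ‖y n - y' n‖) (K₀ := 0) hb le_rfl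
    (by have := hT.zero y y'; rw [hy, hy'] at this; simpa using this)
    (fun n => by have := hT.succ y y' n; rw [hy, hy'] at this; simpa using this)
  funext n
  have h1 := this n
  simp only [mul_zero, zero_mul] at h1
  exact sub_eq_zero.1 (norm_le_zero_iff.1 h1)

/-- Picard iteration from the zero sequence converges geometrically in each entry. Each entry of `T
y` depends on at most three entries of `y`, so entrywise convergence suffices to pass to the limit,
and no Banach space of weighted sequences is needed. -/
theorem NbrLipschitz.exists_fixed [CompleteSpace E] {T : (ℕ → E) → ℕ → E} {l a b c e K₀ : ℝ}
    (hT : NbrLipschitz T a b c e) (h : NbrWeights l a b c e) (hK₀ : 0 ≤ K₀)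
    (h0 : ∀ n, ‖T 0 n‖ ≤ K₀ * l ^ n) :
    ∃ y, T y = y ∧ ∀ n, ‖y n‖ ≤ 2 * K₀ * l ^ n := by
  let Y : ℕ → ℕ → E := fun j => T^[j] 0
  have hYs : ∀ j, Y (j + 1) = T (Y j) := fun j => Function.iterate_succ_apply' T j 0
  have hstep : ∀ j n, ‖Y (j + 1) n - Y j n‖ ≤ K₀ * (1 / 2) ^ j * l ^ n := by
    intro j
    induction j with
    | zero => intro n; simpa [Y] using h0 n
    | succ j ih =>
      obtain ⟨h1, h2⟩ := h.le_half (by positivity) ih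
      intro n
      rw [hYs (j + 1), hYs j]
      rw [hYs j] at h1 h2
      cases n with
      | zero =>
        refine (hT.zero _ _).trans (h1.trans (le_of_eq ?_))
        ring
      | succ n =>
        refine (hT.succ _ _ n).trans ((h2 n).trans (le_of_eq ?_))
        ring
  have hstep' : ∀ n j, dist (Y j n) (Y (j + 1) n) ≤ K₀ * l ^ n * (1 / 2) ^ j := by
    intro n j
    rw [dist_comm, dist_eq_norm]
    exact (hstep j n).trans (le_of_eq (by ring))
  have hlim : ∀ n, ∃ z, Tendsto (fun j => Y j n) atTop (𝓝 z) := fun n =>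
    cauchySeq_tendsto_of_complete
      (cauchySeq_of_le_geometric (1 / 2) (K₀ * l ^ n) (by norm_num) (hstep' n))
  choose y hy using hlim
  refine ⟨y, ?_, fun n => ?_⟩
  · have hd : ∀ n, Tendsto (fun j => ‖Y j n - y n‖) atTop (𝓝 0) := fun n =>
      tendsto_iff_norm_sub_tendsto_zero.1 (hy n)
    funext n
    refine tendsto_nhds_unique (tendsto_iff_norm_sub_tendsto_zero.2 ?_)
      ((tendsto_add_atTop_iff_nat 1).2 (hy n))
    simp only [hYs]
    cases n with
    | zero =>
      refine squeeze_zero (fun _ => norm_nonneg _) (fun j => hT.zero (Y j) y) ?_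
      simpa using ((hd 0).const_mul e).add ((hd 1).const_mul c)
    | succ n =>
      refine squeeze_zero (fun _ => norm_nonneg _) (fun j => hT.succ (Y j) y n) ?_
      simpa using (((hd n).const_mul a).add ((hd (n + 1)).const_mul b)).add
        ((hd (n + 2)).const_mul c)
  · have h1 := dist_le_of_le_geometric_of_tendsto₀ (1 / 2) (K₀ * l ^ n) (by norm_num)
      (hstep' n) (hy n)
    have h2 : Y 0 n = 0 := rfl
    rw [h2, dist_zero_left] at h1
    exact h1.trans (le_of_eq (by ring))

/-- For large n the ratio (l₁/l₂)ⁿ makes the known bound small enough; the finitely many remaining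
entries are small by assumption. This trade of weight for uniformity in n is the source of
differentiability below. -/
theorem eventually_forall_le_mul_pow {ι : Type*} {f : Filter ι} {r : ι → ℕ → ℝ} {C l₁ l₂ : ℝ}
    (h1 : 0 < l₁) (h12 : l₁ < l₂)
    (hr : ∀ᶠ i in f, ∀ n, r i n ≤ C * l₁ ^ n)
    (hr' : ∀ n, ∀ η > 0, ∀ᶠ i in f, r i n ≤ η) {η : ℝ} (hη : 0 < η) :
    ∀ᶠ i in f, ∀ n, r i n ≤ η * l₂ ^ n := by
  have hl2 : 0 < l₂ := h1.trans h12
  have h3 : Tendsto (fun n : ℕ => C * (l₁ / l₂) ^ n) atTop (𝓝 (C * 0)) :=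
    (tendsto_pow_atTop_nhds_zero_of_lt_one (by positivity) ((div_lt_one hl2).2 h12)).const_mul C
  rw [mul_zero] at h3
  obtain ⟨N, hN⟩ := eventually_atTop.1 (h3.eventually_lt_const hη)
  have h4 : ∀ᶠ i in f, ∀ n ∈ Finset.range N, r i n ≤ η * l₂ ^ n :=
    (Finset.eventually_all _).2 fun n _ => hr' n _ (by positivity)
  filter_upwards [hr, h4] with i hi hi' n
  by_cases hn : n < N
  · exact hi' n (Finset.mem_range.2 hn)
  · refine (hi n).trans ?_
    have := (hN n (not_lt.1 hn)).le
    rw [div_pow, ← mul_div_assoc, div_le_iff₀ (by positivity)] at this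
    exact this

end WeightedSequences

/-! ### The Lyapunov–Perron method for maps with a spectral gap: existence of the graph. -/

section GapMap

variable {X : Type*} [NormedAddCommGroup X] [NormedSpace ℝ X]

/-- `x ↦ Λ x + R x` is a small perturbation of a linear map with a spectral gap: `Λ` commutes with
the projection `P`, `A` inverts `Λ` on the range of `P`, the growth of `Λ` on the kernel of `P` is
at most `β ≪ 1 / l₂`, and that of `A` at most `α ≪ l₁ < l₂`. -/
structure GapMap (Λ A P : X →L[ℝ] X) (R : X → X) (α β q ε l₁ l₂ : ℝ) : Prop where
  proj : ∀ x, P (P x) = P x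
  comm : ∀ x, P (Λ x) = Λ (P x)
  left_inv : ∀ x, A (Λ x) = P x
  right_inv : ∀ x, Λ (A x) = P x
  inv_proj : ∀ x, A (P x) = A x
  norm_inv : ‖A‖ ≤ α
  norm_stable : ‖Λ - P.comp Λ‖ ≤ β
  norm_compl : ‖ContinuousLinearMap.id ℝ X - P‖ ≤ q
  norm_proj : ‖P‖ ≤ q
  rem_zero : R 0 = 0
  rem_lip : ∀ x y, ‖R x - R y‖ ≤ ε * ‖x - y‖
  eps_nonneg : 0 ≤ ε
  l₁_pos : 0 < l₁
  l₁_lt : l₁ < l₂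
  gap : α / l₁ + α * ε + (β + q * ε) * l₂ ≤ 1 / 4
  gap_proj : (β + q * ε) * l₂ * q ≤ 1 / 8

/-- Backward orbits of `F` ending at `x`. -/
def IsBackwardOrbit (F : X → X) (x : X) (y : ℕ → X) : Prop :=
  y 0 = x ∧ ∀ n, F (y (n + 1)) = y n

namespace GapMap

variable {Λ A P : X →L[ℝ] X} {R : X → X} {α β q ε l₁ l₂ : ℝ}

theorem α_nonneg (h : GapMap Λ A P R α β q ε l₁ l₂) : 0 ≤ α := (norm_nonneg _).trans h.norm_inv
theorem β_nonneg (h : GapMap Λ A P R α β q ε l₁ l₂) : 0 ≤ β := (norm_nonneg _).trans h.norm_stable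
theorem q_nonneg (h : GapMap Λ A P R α β q ε l₁ l₂) : 0 ≤ q := (norm_nonneg _).trans h.norm_proj
theorem l₂_pos (h : GapMap Λ A P R α β q ε l₁ l₂) : 0 < l₂ := h.l₁_pos.trans h.l₁_lt
theorem c_nonneg (h : GapMap Λ A P R α β q ε l₁ l₂) : 0 ≤ β + q * ε :=
  add_nonneg h.β_nonneg (mul_nonneg h.q_nonneg h.eps_nonneg)

/-- The contraction holds for the whole interval of rates: `l₁` serves existence, `l₂` uniqueness,
and both together the regularity of the graph. -/
theorem weights (h : GapMap Λ A P R α β q ε l₁ l₂) {l : ℝ} (hl : l ∈ Icc l₁ l₂) {e : ℝ}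
    (he : 0 ≤ e) (he' : e ≤ 1 / 4) : NbrWeights l α (α * ε) (β + q * ε) e := by
  have hα := h.α_nonneg
  have hc := h.c_nonneg
  have hl0 := h.l₁_pos.trans_le hl.1
  have h1 : α / l ≤ α / l₁ := div_le_div_of_nonneg_left hα h.l₁_pos hl.1
  have h2 : (β + q * ε) * l ≤ (β + q * ε) * l₂ := mul_le_mul_of_nonneg_left hl.2 hc
  have h3 := h.gap
  have h4 : 0 ≤ α / l₁ := div_nonneg hα h.l₁_pos.le
  have h5 := mul_nonneg hα h.eps_nonneg
  exact ⟨hl0, hα, h5, hc, he, by linarith, by linarith⟩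

/-- These weights are for tracking, which runs forward: the past neighbour carries the stable
weight, the future one the weight of the inverse. The 1/4 in the boundary weight is the Lipschitz
constant of `graphMap`. -/
theorem weights_inv (h : GapMap Λ A P R α β q ε l₁ l₂) :
    NbrWeights l₂⁻¹ (β + q * ε) (α * ε) α (α * ε + 1 / 4) := by
  have hα := h.α_nonneg
  have hc := h.c_nonneg
  have h1 : α / l₂ ≤ α / l₁ := div_le_div_of_nonneg_left hα h.l₁_pos h.l₁_lt.le
  have h3 := h.gap
  have h4 : 0 ≤ α / l₁ := div_nonneg hα h.l₁_pos.le
  have h5 := mul_nonneg hα h.eps_nonneg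
  have h6 := mul_nonneg hc h.l₂_pos.le
  refine ⟨inv_pos.2 h.l₂_pos, hc, h5, hα, by positivity, ?_, ?_⟩
  · rw [div_inv_eq_mul, ← div_eq_mul_inv]; linarith
  · rw [← div_eq_mul_inv]; linarith

/-- The component of `Λ y + R y` in the kernel of `P`. -/
def stablePart (Λ P : X →L[ℝ] X) (R : X → X) (y : X) : X :=
  (Λ y + R y) - P (Λ y + R y)

theorem stablePart_sub (h : GapMap Λ A P R α β q ε l₁ l₂) (y y' : X) :
    ‖stablePart Λ P R y - stablePart Λ P R y'‖ ≤ (β + q * ε) * ‖y - y'‖ := by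
  have h1 : stablePart Λ P R y - stablePart Λ P R y' = (Λ - P.comp Λ) (y - y') +
      (ContinuousLinearMap.id ℝ X - P) (R y - R y') := by
    simp only [stablePart, map_add, map_sub, sub_apply,
      ContinuousLinearMap.comp_apply, ContinuousLinearMap.id_apply]
    abel
  rw [h1, add_mul]
  refine (norm_add_le _ _).trans (add_le_add (ContinuousLinearMap.le_of_opNorm_le _ h.norm_stable _)
    ((ContinuousLinearMap.le_of_opNorm_le _ h.norm_compl _).trans ?_))
  rw [mul_assoc]
  exact mul_le_mul_of_nonneg_left (h.rem_lip _ _) h.q_nonneg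

theorem inv_sub (h : GapMap Λ A P R α β q ε l₁ l₂) (a a' b b' : X) :
    ‖A (a - R b) - A (a' - R b')‖ ≤ α * ‖a - a'‖ + α * ε * ‖b - b'‖ := by
  have h1 : A (a - R b) - A (a' - R b') = A (a - a') - A (R b - R b') := by
    simp only [map_sub]; abel
  rw [h1]
  refine (norm_sub_le _ _).trans (add_le_add (ContinuousLinearMap.le_of_opNorm_le _ h.norm_inv _)
    ((ContinuousLinearMap.le_of_opNorm_le _ h.norm_inv _).trans ?_))
  rw [mul_assoc]
  exact mul_le_mul_of_nonneg_left (h.rem_lip _ _) h.α_nonneg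

/-- The Lyapunov–Perron map for backward orbits `y` with `P (y 0) = P x`. -/
def lpMap (Λ A P : X →L[ℝ] X) (R : X → X) (x : X) (y : ℕ → X) : ℕ → X
  | 0 => P x + stablePart Λ P R (y 1)
  | n + 1 => A (y n - R (y (n + 1))) + stablePart Λ P R (y (n + 2))

theorem lpMap_lipschitz (h : GapMap Λ A P R α β q ε l₁ l₂) (x : X) :
    NbrLipschitz (lpMap Λ A P R x) α (α * ε) (β + q * ε) 0 where
  zero y y' := by
    simp only [lpMap, add_sub_add_left_eq_sub, zero_mul, zero_add]
    exact h.stablePart_sub _ _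
  succ y y' n := by
    simp only [lpMap]
    rw [add_sub_add_comm]
    exact (norm_add_le _ _).trans (add_le_add (h.inv_sub _ _ _ _) (h.stablePart_sub _ _))

theorem proj_inv (h : GapMap Λ A P R α β q ε l₁ l₂) (x : X) : P (A x) = A x := by
  rw [← h.left_inv, h.right_inv, h.inv_proj]

theorem proj_stablePart (h : GapMap Λ A P R α β q ε l₁ l₂) (y : X) :
    P (stablePart Λ P R y) = 0 := by
  rw [stablePart, map_sub, h.proj, sub_self]

/-- The two components of the orbit equation are solved in opposite directions: in the range of `P`
for the older point, by means of `A`, and in the kernel of `P` for the newer one. The equation at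
index 0 prescribes only the central component of the end point. -/
theorem lpMap_fixed_iff (h : GapMap Λ A P R α β q ε l₁ l₂) (x : X) (y : ℕ → X) :
    lpMap Λ A P R x y = y ↔ P (y 0) = P x ∧ ∀ n, Λ (y (n + 1)) + R (y (n + 1)) = y n := by
  constructor
  · intro hy
    have hy0 : y 0 = P x + stablePart Λ P R (y 1) := (congrFun hy 0).symm
    have hys : ∀ n, y (n + 1) = A (y n - R (y (n + 1))) + stablePart Λ P R (y (n + 2)) :=
      fun n => (congrFun hy (n + 1)).symm
    have hP0 : P (y 0) = P x := by rw [hy0, map_add, h.proj, h.proj_stablePart, add_zero]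
    have hP : ∀ n, P (y (n + 1)) = A (y n - R (y (n + 1))) := fun n => by
      conv_lhs => rw [hys n]
      rw [map_add, h.proj_inv, h.proj_stablePart, add_zero]
    have hQ : ∀ n, y n - P (y n) = stablePart Λ P R (y (n + 1)) := by
      intro n
      cases n with
      | zero => rw [hP0]; nth_rewrite 1 [hy0]; abel
      | succ n => rw [hP n]; nth_rewrite 1 [hys n]; abel
    refine ⟨hP0, fun n => ?_⟩
    have h1 : P (Λ (y (n + 1))) = P (y n) - P (R (y (n + 1))) := by
      rw [h.comm, hP, h.right_inv, map_sub]
    have h2 := hQ n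
    rw [stablePart, map_add, h1] at h2
    have h3 : P (y n) - P (R (y (n + 1))) + P (R (y (n + 1))) = P (y n) := by abel
    rw [h3] at h2
    exact (sub_left_injective h2).symm
  · rintro ⟨h0, hs⟩
    have hQ : ∀ n, stablePart Λ P R (y (n + 1)) = y n - P (y n) := fun n => by
      rw [stablePart, hs]
    have hA : ∀ n, A (y n - R (y (n + 1))) = P (y (n + 1)) := fun n => by
      rw [← h.left_inv, ← hs n, add_sub_cancel_right]
    funext n
    cases n with
    | zero => simp only [lpMap]; rw [hQ, ← h0]; abel
    | succ n => simp only [lpMap]; rw [hQ, hA]; abel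

theorem l₁_mem (h : GapMap Λ A P R α β q ε l₁ l₂) : l₁ ∈ Icc l₁ l₂ := ⟨le_rfl, h.l₁_lt.le⟩
theorem l₂_mem (h : GapMap Λ A P R α β q ε l₁ l₂) : l₂ ∈ Icc l₁ l₂ := ⟨h.l₁_lt.le, le_rfl⟩

theorem exists_lpFixed [CompleteSpace X] (h : GapMap Λ A P R α β q ε l₁ l₂) (x : X) :
    ∃ y, lpMap Λ A P R x y = y ∧ ∀ n, ‖y n‖ ≤ 2 * ‖P x‖ * l₁ ^ n := by
  refine (h.lpMap_lipschitz x).exists_fixed (h.weights h.l₁_mem le_rfl (by norm_num))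
    (norm_nonneg _) fun n => ?_
  have hl := h.l₁_pos
  have h0 : stablePart Λ P R 0 = 0 := by simp [stablePart, h.rem_zero]
  cases n with
  | zero => simp [lpMap, h0]
  | succ n => simp [lpMap, h0, h.rem_zero]; positivity

variable [CompleteSpace X]

/-- The backward orbit of slow growth with given central component at its end. -/
noncomputable def lpSeq (h : GapMap Λ A P R α β q ε l₁ l₂) (x : X) : ℕ → X := (h.exists_lpFixed x).choose

theorem lpSeq_fixed (h : GapMap Λ A P R α β q ε l₁ l₂) (x : X) :
    lpMap Λ A P R x (h.lpSeq x) = h.lpSeq x := (h.exists_lpFixed x).choose_spec.1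

theorem lpSeq_norm_le (h : GapMap Λ A P R α β q ε l₁ l₂) (x : X) (n : ℕ) :
    ‖h.lpSeq x n‖ ≤ 2 * ‖P x‖ * l₁ ^ n := (h.exists_lpFixed x).choose_spec.2 n

theorem lpSeq_sub_le (h : GapMap Λ A P R α β q ε l₁ l₂) (x x' : X) (n : ℕ) :
    ‖h.lpSeq x n - h.lpSeq x' n‖ ≤ 2 * ‖P x - P x'‖ * l₁ ^ n := by
  have hl := h.l₁_pos
  refine (h.weights h.l₁_mem le_rfl (by norm_num)).le (d := fun n => ‖h.lpSeq x n - h.lpSeq x' n‖)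
    ⟨2 * ‖P x‖ + 2 * ‖P x'‖, by positivity, fun n => ?_⟩ (norm_nonneg _) ?_ (fun n => ?_) n
  · have := h.lpSeq_norm_le x n
    have := h.lpSeq_norm_le x' n
    have := norm_sub_le (h.lpSeq x n) (h.lpSeq x' n)
    simp only [add_mul]
    linarith
  · have h1 := (h.lpMap_lipschitz x).zero (h.lpSeq x) (h.lpSeq x')
    have h2 : h.lpSeq x 0 - h.lpSeq x' 0 = (P x - P x') +
        (lpMap Λ A P R x (h.lpSeq x) 0 - lpMap Λ A P R x (h.lpSeq x') 0) := by
      nth_rewrite 1 [← h.lpSeq_fixed x]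
      nth_rewrite 1 [← h.lpSeq_fixed x']
      simp only [lpMap]; abel
    nth_rewrite 1 [h2]
    exact (norm_add_le _ _).trans (add_le_add le_rfl h1)
  · have h1 := (h.lpMap_lipschitz x).succ (h.lpSeq x) (h.lpSeq x') n
    have h2 : lpMap Λ A P R x (h.lpSeq x') (n + 1) = h.lpSeq x' (n + 1) := by
      nth_rewrite 2 [← h.lpSeq_fixed x']; rfl
    rw [h2, h.lpSeq_fixed] at h1
    have : 0 ≤ ‖P x - P x'‖ * l₁ ^ (n + 1) := by positivity
    linarith

/-- Uniqueness is taken in the larger class of growth `l₂ ^ n`, although `lpSeq` grows only like `l₁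
^ n`. A backward orbit with the weaker bound thus satisfies the stronger one, which is what places
it on the manifold. -/
theorem eq_lpSeq (h : GapMap Λ A P R α β q ε l₁ l₂) {x : X} {y : ℕ → X}
    (hy : lpMap Λ A P R x y = y) (hb : ∃ K, ∀ n, ‖y n‖ ≤ K * l₂ ^ n) : y = h.lpSeq x := by
  obtain ⟨K, hK⟩ := hb
  have hl := h.l₁_pos
  have hl2 := h.l₂_pos
  have hK0 : 0 ≤ K := by have := (norm_nonneg _).trans (hK 0); simpa using this
  refine (h.lpMap_lipschitz x).eq_of_fixed (h.weights h.l₂_mem le_rfl (by norm_num)) hy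
    (h.lpSeq_fixed x) ⟨K + 2 * ‖P x‖, by positivity, fun n => ?_⟩
  have h1 := h.lpSeq_norm_le x n
  have h2 : l₁ ^ n ≤ l₂ ^ n := pow_le_pow_left₀ hl.le h.l₁_lt.le n
  have h3 : 2 * ‖P x‖ * l₁ ^ n ≤ 2 * ‖P x‖ * l₂ ^ n :=
    mul_le_mul_of_nonneg_left h2 (by positivity)
  have := norm_sub_le (y n) (h.lpSeq x n)
  have := hK n
  rw [add_mul]
  linarith

/-- The map whose graph is the center manifold, as a function on the whole space that depends only
on the central component. -/
noncomputable def graphMap (h : GapMap Λ A P R α β q ε l₁ l₂) (x : X) : X := h.lpSeq x 0 - P x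

theorem graphMap_eq (h : GapMap Λ A P R α β q ε l₁ l₂) (x : X) :
    h.graphMap x = stablePart Λ P R (h.lpSeq x 1) := by
  rw [graphMap]
  nth_rewrite 1 [← h.lpSeq_fixed x]
  simp [lpMap]

theorem proj_graphMap (h : GapMap Λ A P R α β q ε l₁ l₂) (x : X) : P (h.graphMap x) = 0 := by
  rw [graphMap_eq, h.proj_stablePart]

theorem graphMap_sub_le_proj (h : GapMap Λ A P R α β q ε l₁ l₂) (x x' : X) :
    ‖h.graphMap x - h.graphMap x'‖ ≤ 2 * ((β + q * ε) * l₂) * ‖P x - P x'‖ := by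
  rw [graphMap_eq, graphMap_eq]
  refine (h.stablePart_sub _ _).trans ((mul_le_mul_of_nonneg_left (h.lpSeq_sub_le x x' 1)
    h.c_nonneg).trans ?_)
  rw [pow_one]
  have h1 := mul_le_mul_of_nonneg_left h.l₁_lt.le
    (mul_nonneg h.c_nonneg (norm_nonneg (P x - P x')))
  linarith

/-- The hypothesis `gap_proj` is there for this bound: measured by the full vector, the Lipschitz
constant picks up the norm of `P`. -/
theorem graphMap_sub_le (h : GapMap Λ A P R α β q ε l₁ l₂) (x x' : X) :
    ‖h.graphMap x - h.graphMap x'‖ ≤ 1 / 4 * ‖x - x'‖ := by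
  refine (h.graphMap_sub_le_proj x x').trans ?_
  have h1 : ‖P x - P x'‖ ≤ q * ‖x - x'‖ := by
    rw [← map_sub]; exact ContinuousLinearMap.le_of_opNorm_le _ h.norm_proj _
  have h2 := h.gap_proj
  have h3 : 0 ≤ (β + q * ε) * l₂ := mul_nonneg h.c_nonneg h.l₂_pos.le
  calc 2 * ((β + q * ε) * l₂) * ‖P x - P x'‖ ≤ 2 * ((β + q * ε) * l₂) * (q * ‖x - x'‖) :=
        mul_le_mul_of_nonneg_left h1 (by positivity)
    _ = 2 * ((β + q * ε) * l₂ * q) * ‖x - x'‖ := by ring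
    _ ≤ 1 / 4 * ‖x - x'‖ := mul_le_mul_of_nonneg_right (by linarith) (norm_nonneg _)

theorem graphMap_sub_le_proj' (h : GapMap Λ A P R α β q ε l₁ l₂) (x x' : X) :
    ‖h.graphMap x - h.graphMap x'‖ ≤ 1 / 2 * ‖P x - P x'‖ := by
  refine (h.graphMap_sub_le_proj x x').trans (mul_le_mul_of_nonneg_right ?_ (norm_nonneg _))
  have := h.gap
  have := div_nonneg h.α_nonneg h.l₁_pos.le
  have := mul_nonneg h.α_nonneg h.eps_nonneg
  linarith

theorem graphMap_proj (h : GapMap Λ A P R α β q ε l₁ l₂) (x : X) :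
    h.graphMap (P x) = h.graphMap x := by
  have := h.graphMap_sub_le_proj' (P x) x
  rw [h.proj, sub_self, norm_zero, mul_zero] at this
  exact sub_eq_zero.1 (norm_le_zero_iff.1 this)

theorem lpSeq_zero (h : GapMap Λ A P R α β q ε l₁ l₂) (n : ℕ) : h.lpSeq 0 n = 0 := by
  have := h.lpSeq_norm_le 0 n
  simpa using this

theorem graphMap_zero (h : GapMap Λ A P R α β q ε l₁ l₂) : h.graphMap 0 = 0 := by
  simp [graphMap, h.lpSeq_zero]

theorem graphMap_norm_le (h : GapMap Λ A P R α β q ε l₁ l₂) (x : X) :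
    ‖h.graphMap x‖ ≤ 1 / 4 * ‖x‖ := by
  simpa [h.graphMap_zero] using h.graphMap_sub_le x 0

theorem lpSeq_isBackwardOrbit (h : GapMap Λ A P R α β q ε l₁ l₂) {x : X}
    (hx : x - P x = h.graphMap x) : IsBackwardOrbit (fun x => Λ x + R x) x (h.lpSeq x) := by
  refine ⟨?_, ((h.lpMap_fixed_iff x _).1 (h.lpSeq_fixed x)).2⟩
  rw [graphMap] at hx
  exact (sub_left_injective hx).symm

theorem mem_graph_of_backwardOrbit (h : GapMap Λ A P R α β q ε l₁ l₂) {x : X} {y : ℕ → X}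
    (hy : IsBackwardOrbit (fun x => Λ x + R x) x y) (hb : ∃ K, ∀ n, ‖y n‖ ≤ K * l₂ ^ n) :
    x - P x = h.graphMap x := by
  have h1 : lpMap Λ A P R x y = y := (h.lpMap_fixed_iff x y).2 ⟨by rw [hy.1], hy.2⟩
  rw [graphMap, ← h.eq_lpSeq h1 hb, hy.1]

end GapMap
end GapMap

/-! ### Differentiability of the center manifold. -/

section GapMap

variable {X : Type*} [NormedAddCommGroup X] [NormedSpace ℝ X]

namespace GapMap

variable {Λ A P : X →L[ℝ] X} {R : X → X} {α β q ε l₁ l₂ : ℝ}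

theorem norm_fderiv_rem_le (h : GapMap Λ A P R α β q ε l₁ l₂) (x : X) : ‖fderiv ℝ R x‖ ≤ ε := by
  have h1 : LipschitzWith ⟨ε, h.eps_nonneg⟩ R := LipschitzWith.of_dist_le_mul fun x y => by
    rw [dist_eq_norm, dist_eq_norm]; exact h.rem_lip x y
  exact norm_fderiv_le_of_lipschitz ℝ h1

/-- The derivative of `stablePart`. -/
noncomputable def stablePartDeriv (Λ P : X →L[ℝ] X) (R : X → X) (y : X) : X →L[ℝ] X :=
  (Λ - P.comp Λ) + (ContinuousLinearMap.id ℝ X - P).comp (fderiv ℝ R y)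

theorem norm_stablePartDeriv_le (h : GapMap Λ A P R α β q ε l₁ l₂) (y : X) :
    ‖stablePartDeriv Λ P R y‖ ≤ β + q * ε :=
  (norm_add_le _ _).trans (add_le_add h.norm_stable ((ContinuousLinearMap.opNorm_comp_le _ _).trans
    (mul_le_mul h.norm_compl (h.norm_fderiv_rem_le y) (norm_nonneg _) h.q_nonneg)))

/-- The linearization of `lpMap` along `y`, acting on sequences of operators. -/
noncomputable def lpDeriv (Λ A P : X →L[ℝ] X) (R : X → X) (y : ℕ → X) (z : ℕ → X →L[ℝ] X) :
    ℕ → X →L[ℝ] X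
  | 0 => P + (stablePartDeriv Λ P R (y 1)).comp (z 1)
  | n + 1 => A.comp (z n - (fderiv ℝ R (y (n + 1))).comp (z (n + 1))) +
      (stablePartDeriv Λ P R (y (n + 2))).comp (z (n + 2))

theorem norm_inv_comp_le (h : GapMap Λ A P R α β q ε l₁ l₂) {Y : Type*} [NormedAddCommGroup Y]
    [NormedSpace ℝ Y] (x : X) (u v : Y →L[ℝ] X) :
    ‖A.comp (u - (fderiv ℝ R x).comp v)‖ ≤ α * ‖u‖ + α * ε * ‖v‖ := by
  have h1 : ‖(fderiv ℝ R x).comp v‖ ≤ ε * ‖v‖ := (ContinuousLinearMap.opNorm_comp_le _ _).trans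
    (mul_le_mul_of_nonneg_right (h.norm_fderiv_rem_le x) (norm_nonneg _))
  have hα := h.α_nonneg
  calc ‖A.comp (u - (fderiv ℝ R x).comp v)‖ ≤ ‖A‖ * ‖u - (fderiv ℝ R x).comp v‖ :=
        ContinuousLinearMap.opNorm_comp_le _ _
    _ ≤ α * (‖u‖ + ε * ‖v‖) := mul_le_mul h.norm_inv
        ((norm_sub_le _ _).trans (add_le_add le_rfl h1)) (norm_nonneg _) hα
    _ = _ := by ring

theorem norm_stablePartDeriv_comp_le (h : GapMap Λ A P R α β q ε l₁ l₂) (x : X)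
    (v : X →L[ℝ] X) : ‖(stablePartDeriv Λ P R x).comp v‖ ≤ (β + q * ε) * ‖v‖ :=
  (ContinuousLinearMap.opNorm_comp_le _ _).trans
    (mul_le_mul_of_nonneg_right (h.norm_stablePartDeriv_le x) (norm_nonneg _))

theorem lpDeriv_lipschitz (h : GapMap Λ A P R α β q ε l₁ l₂) (y : ℕ → X) :
    NbrLipschitz (lpDeriv Λ A P R y) α (α * ε) (β + q * ε) 0 where
  zero z z' := by
    simp only [lpDeriv, add_sub_add_left_eq_sub, zero_mul, zero_add, ← ContinuousLinearMap.comp_sub]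
    exact h.norm_stablePartDeriv_comp_le _ _
  succ z z' n := by
    have h1 : lpDeriv Λ A P R y z (n + 1) - lpDeriv Λ A P R y z' (n + 1) =
        A.comp ((z n - z' n) - (fderiv ℝ R (y (n + 1))).comp (z (n + 1) - z' (n + 1))) +
        (stablePartDeriv Λ P R (y (n + 2))).comp (z (n + 2) - z' (n + 2)) := by
      simp only [lpDeriv, ContinuousLinearMap.comp_sub]; abel
    rw [h1]
    exact (norm_add_le _ _).trans (add_le_add (h.norm_inv_comp_le _ _ _)
      (h.norm_stablePartDeriv_comp_le _ _))

/-- A uniform weighted bound for sequences that solve the linearized problem up to `r`. -/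
theorem linearized_le (h : GapMap Λ A P R α β q ε l₁ l₂) {Y : Type*} [NormedAddCommGroup Y]
    [NormedSpace ℝ Y] (y : ℕ → X)
    (δ r : ℕ → Y →L[ℝ] X) {η : ℝ} (hη : 0 ≤ η) (hr : ∀ n, ‖r n‖ ≤ η * l₂ ^ n)
    (hδ : ∃ K, 0 ≤ K ∧ ∀ n, ‖δ n‖ ≤ K * l₂ ^ n)
    (h0 : δ 0 = (stablePartDeriv Λ P R (y 1)).comp (δ 1) +
      (ContinuousLinearMap.id ℝ X - P).comp (r 1))
    (hs : ∀ n, δ (n + 1) = A.comp (δ n - (fderiv ℝ R (y (n + 1))).comp (δ (n + 1))) +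
        (stablePartDeriv Λ P R (y (n + 2))).comp (δ (n + 2)) +
        ((ContinuousLinearMap.id ℝ X - P).comp (r (n + 2)) - A.comp (r (n + 1)))) (n : ℕ) :
    ‖δ n‖ ≤ 2 * ((q * l₂ + α) * η) * l₂ ^ n := by
  have hl := h.l₂_pos
  have hα := h.α_nonneg
  have hq := h.q_nonneg
  have hS : ∀ (x : X) (v : Y →L[ℝ] X),
      ‖(stablePartDeriv Λ P R x).comp v‖ ≤ (β + q * ε) * ‖v‖ := fun x v =>
    (ContinuousLinearMap.opNorm_comp_le _ _).trans
    (mul_le_mul_of_nonneg_right (h.norm_stablePartDeriv_le x) (norm_nonneg _))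
  have hQ : ∀ n, ‖(ContinuousLinearMap.id ℝ X - P).comp (r (n + 1))‖ ≤ q * l₂ * η * l₂ ^ n := by
    intro n
    calc _ ≤ ‖(ContinuousLinearMap.id ℝ X - P)‖ * ‖r (n + 1)‖ :=
          ContinuousLinearMap.opNorm_comp_le _ _
      _ ≤ q * (η * l₂ ^ (n + 1)) := mul_le_mul h.norm_compl (hr _) (norm_nonneg _) hq
      _ = _ := by ring
  have hA : ∀ n, ‖A.comp (r n)‖ ≤ α * η * l₂ ^ n := by
    intro n
    calc _ ≤ ‖A‖ * ‖r n‖ := ContinuousLinearMap.opNorm_comp_le _ _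
      _ ≤ α * (η * l₂ ^ n) := mul_le_mul h.norm_inv (hr _) (norm_nonneg _) hα
      _ = _ := by ring
  refine (h.weights h.l₂_mem le_rfl (by norm_num)).le (d := fun n => ‖δ n‖) hδ (by positivity)
    ?_ (fun n => ?_) n
  · have h1 := hQ 0
    rw [pow_zero, mul_one, zero_add] at h1
    have h2 := hS (y 1) (δ 1)
    have h3 : 0 ≤ α * η := by positivity
    have h4 : ‖δ 0‖ ≤ _ := (congrArg norm h0).le.trans (norm_add_le _ _)
    simp only [zero_mul, zero_add]
    linarith
  · have h1 := hQ (n + 1)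
    have h2 := hS (y (n + 2)) (δ (n + 2))
    have h3 := hA (n + 1)
    have h5 := h.norm_inv_comp_le (y (n + 1)) (δ n) (δ (n + 1))
    have h4 : ‖δ (n + 1)‖ ≤ _ := (congrArg norm (hs n)).le.trans ((norm_add_le _ _).trans
      (add_le_add (norm_add_le _ _) (norm_sub_le _ _)))
    have h6 : (q * l₂ + α) * η * l₂ ^ (n + 1) = q * l₂ * η * l₂ ^ (n + 1) +
      α * η * l₂ ^ (n + 1) := by ring
    linarith

variable [CompleteSpace X]

theorem exists_lpDeriv_fixed (h : GapMap Λ A P R α β q ε l₁ l₂) (x : X) :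
    ∃ z, lpDeriv Λ A P R (h.lpSeq x) z = z ∧ ∀ n, ‖z n‖ ≤ 2 * ‖P‖ * l₁ ^ n := by
  refine (h.lpDeriv_lipschitz _).exists_fixed (h.weights h.l₁_mem le_rfl (by norm_num))
    (norm_nonneg _) fun n => ?_
  have hl := h.l₁_pos
  cases n with
  | zero => simp [lpDeriv]
  | succ n => simp [lpDeriv]; positivity

/-- The derivative of `x ↦ lpSeq x n`. -/
noncomputable def lpSeqDeriv (h : GapMap Λ A P R α β q ε l₁ l₂) (x : X) : ℕ → X →L[ℝ] X :=
  (h.exists_lpDeriv_fixed x).choose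

theorem lpSeqDeriv_fixed (h : GapMap Λ A P R α β q ε l₁ l₂) (x : X) :
    lpDeriv Λ A P R (h.lpSeq x) (h.lpSeqDeriv x) = h.lpSeqDeriv x :=
  (h.exists_lpDeriv_fixed x).choose_spec.1

theorem lpSeqDeriv_norm_le (h : GapMap Λ A P R α β q ε l₁ l₂) (x : X) (n : ℕ) :
    ‖h.lpSeqDeriv x n‖ ≤ 2 * ‖P‖ * l₁ ^ n := (h.exists_lpDeriv_fixed x).choose_spec.2 n

theorem lpSeq_lipschitz (h : GapMap Λ A P R α β q ε l₁ l₂) (x x' : X) (n : ℕ) :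
    ‖h.lpSeq x n - h.lpSeq x' n‖ ≤ 2 * ‖P‖ * l₁ ^ n * ‖x - x'‖ := by
  have hl := h.l₁_pos
  have h1 : ‖P x - P x'‖ ≤ ‖P‖ * ‖x - x'‖ := by rw [← map_sub]; exact P.le_opNorm _
  calc _ ≤ _ := h.lpSeq_sub_le x x' n
    _ ≤ 2 * (‖P‖ * ‖x - x'‖) * l₁ ^ n := by gcongr
    _ = _ := by ring

theorem continuous_lpSeq (h : GapMap Λ A P R α β q ε l₁ l₂) (n : ℕ) :
    Continuous fun x => h.lpSeq x n := by
  have hl := h.l₁_pos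
  have : LipschitzWith ⟨2 * ‖P‖ * l₁ ^ n, by positivity⟩ fun x => h.lpSeq x n :=
    LipschitzWith.of_dist_le_mul fun x y => by
      rw [dist_eq_norm, dist_eq_norm]; exact h.lpSeq_lipschitz x y n
  exact this.continuous

/-- The error `lpSeq (x + v) - lpSeq x - lpSeqDeriv x v` solves the linearized fixed point problem,
with the Taylor remainders of `R` along the orbit as forcing, so `linearized_le` bounds it by the
size of these remainders. -/
theorem hasFDerivAt_lpSeq (h : GapMap Λ A P R α β q ε l₁ l₂) (hR : Differentiable ℝ R) (x : X) :
    HasFDerivAt (fun x => h.lpSeq x 0) (h.lpSeqDeriv x 0) x := by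
  have hl1 := h.l₁_pos
  have hl2 := h.l₂_pos
  have hε := h.eps_nonneg
  rw [hasFDerivAt_iff_isLittleO_nhds_zero, Asymptotics.isLittleO_iff]
  intro c hc
  -- uniform smallness of the remainders
  let rem : X → ℕ → X := fun v n => R (h.lpSeq (x + v) n) - R (h.lpSeq x n) -
    fderiv ℝ R (h.lpSeq x n) (h.lpSeq (x + v) n - h.lpSeq x n)
  have hrem : ∀ v n, ‖rem v n‖ ≤ (4 * ε * ‖P‖ * l₁ ^ n) * ‖v‖ := by
    intro v n
    have h1 := h.rem_lip (h.lpSeq (x + v) n) (h.lpSeq x n)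
    have h2 := ContinuousLinearMap.le_of_opNorm_le _ (h.norm_fderiv_rem_le (h.lpSeq x n))
      (h.lpSeq (x + v) n - h.lpSeq x n)
    have h3 := h.lpSeq_lipschitz (x + v) x n
    rw [add_sub_cancel_left] at h3
    have h4 := mul_le_mul_of_nonneg_left h3 hε
    have := norm_sub_le (R (h.lpSeq (x + v) n) - R (h.lpSeq x n))
      (fderiv ℝ R (h.lpSeq x n) (h.lpSeq (x + v) n - h.lpSeq x n))
    linarith
  obtain ⟨η, hη, hηc⟩ : ∃ η : ℝ, 0 < η ∧ 2 * ((q * l₂ + α) * η) ≤ c := by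
    have h1 : 0 ≤ q * l₂ + α := add_nonneg (mul_nonneg h.q_nonneg hl2.le) h.α_nonneg
    refine ⟨c / (2 * (q * l₂ + α) + 1), by positivity, ?_⟩
    have h2 : 0 < 2 * (q * l₂ + α) + 1 := by positivity
    rw [← mul_assoc, ← mul_div_assoc, div_le_iff₀ h2]
    nlinarith
  -- For each n the remainder is o(‖v‖), but not uniformly in n. Its Lipschitz bound in the weight
  -- `l₁` supplies uniformity in the larger weight `l₂`.
  have hsmall : ∀ᶠ v in 𝓝 (0 : X), ∀ n, ‖rem v n‖ / ‖v‖ ≤ η * l₂ ^ n := by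
    refine eventually_forall_le_mul_pow (C := 4 * ε * ‖P‖) hl1 h.l₁_lt
      (Eventually.of_forall fun v n => ?_) (fun n η' hη' => ?_) hη
    · exact div_le_of_le_mul₀ (norm_nonneg _) (by positivity) (hrem v n)
    · have h1 : HasFDerivAt R (fderiv ℝ R (h.lpSeq x n)) (h.lpSeq x n) := (hR _).hasFDerivAt
      rw [hasFDerivAt_iff_isLittleO, Asymptotics.isLittleO_iff] at h1
      obtain ⟨η'', hη'', h4⟩ : ∃ η'' > 0, η'' * (2 * ‖P‖ * l₁ ^ n) ≤ η' := by
        refine ⟨η' / (2 * ‖P‖ * l₁ ^ n + 1), by positivity, ?_⟩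
        rw [div_mul_eq_mul_div, div_le_iff₀ (by positivity)]
        nlinarith
      have h2 : Tendsto (fun v => h.lpSeq (x + v) n) (𝓝 0) (𝓝 (h.lpSeq x n)) := by
        have := ((h.continuous_lpSeq n).comp (continuous_const.add continuous_id)).tendsto
          (0 : X) (f := fun v => h.lpSeq (x + v) n)
        simpa using this
      filter_upwards [h2.eventually (h1 hη'')] with v hv
      refine div_le_of_le_mul₀ (norm_nonneg _) hη'.le (hv.trans ?_)
      have h3 := h.lpSeq_lipschitz (x + v) x n
      rw [add_sub_cancel_left] at h3
      calc η'' * ‖h.lpSeq (x + v) n - h.lpSeq x n‖ ≤ η'' * (2 * ‖P‖ * l₁ ^ n * ‖v‖) := by gcongr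
        _ = η'' * (2 * ‖P‖ * l₁ ^ n) * ‖v‖ := by ring
        _ ≤ η' * ‖v‖ := by gcongr
  filter_upwards [hsmall] with v hv
  have hv' : ∀ n, ‖rem v n‖ ≤ η * ‖v‖ * l₂ ^ n := by
    intro n
    by_cases hv0 : ‖v‖ = 0
    · have := hrem v n
      rw [hv0, mul_zero] at this
      rw [hv0]; simpa using this
    · have := hv n
      rw [div_le_iff₀ (lt_of_le_of_ne (norm_nonneg v) (Ne.symm hv0))] at this
      linarith
  let δ : ℕ → X := fun n => h.lpSeq (x + v) n - h.lpSeq x n - h.lpSeqDeriv x n v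
  -- view vectors as operators from the line
  let ι : X → (ℝ →L[ℝ] X) := fun u => ContinuousLinearMap.toSpanSingleton ℝ u
  have hι : ∀ u, ‖ι u‖ = ‖u‖ := fun u => ContinuousLinearMap.norm_toSpanSingleton u
  have hιcomp : ∀ (L : X →L[ℝ] X) u, L.comp (ι u) = ι (L u) := fun L u => by
    ext; simp [ι]
  have hιsub : ∀ u w, ι u - ι w = ι (u - w) := fun u w => by ext; simp [ι]
  have hιadd : ∀ u w, ι u + ι w = ι (u + w) := fun u w => by ext; simp [ι]
  have key := h.linearized_le (h.lpSeq x) (fun n => ι (δ n)) (fun n => ι (rem v n))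
    (η := η * ‖v‖) (by positivity) (fun n => by rw [hι]; exact hv' n)
    ⟨2 * ‖P‖ * ‖v‖ + 2 * ‖P‖ * ‖v‖, by positivity, fun n => by
      rw [hι]
      have h3 := h.lpSeq_lipschitz (x + v) x n
      rw [add_sub_cancel_left] at h3
      have h4 := ContinuousLinearMap.le_of_opNorm_le _ (h.lpSeqDeriv_norm_le x n) v
      have h5 := norm_sub_le (h.lpSeq (x + v) n - h.lpSeq x n) (h.lpSeqDeriv x n v)
      have h6 : l₁ ^ n ≤ l₂ ^ n := pow_le_pow_left₀ hl1.le h.l₁_lt.le n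
      calc ‖δ n‖ ≤ (2 * ‖P‖ * ‖v‖ + 2 * ‖P‖ * ‖v‖) * l₁ ^ n := by simp only [δ]; linarith
        _ ≤ _ := by gcongr⟩ ?_ ?_ 0
  · rw [hι, pow_zero, mul_one] at key
    refine key.trans ?_
    calc 2 * ((q * l₂ + α) * (η * ‖v‖)) = 2 * ((q * l₂ + α) * η) * ‖v‖ := by ring
      _ ≤ c * ‖v‖ := by gcongr
  · simp only [hιcomp, hιadd]
    congr 1
    simp only [δ]
    have e1 : h.lpSeq (x + v) 0 = P (x + v) + stablePart Λ P R (h.lpSeq (x + v) 1) :=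
      (congrFun (h.lpSeq_fixed (x + v)) 0).symm
    have e2 : h.lpSeq x 0 = P x + stablePart Λ P R (h.lpSeq x 1) :=
      (congrFun (h.lpSeq_fixed x) 0).symm
    have e3 : h.lpSeqDeriv x 0 = P + (stablePartDeriv Λ P R (h.lpSeq x 1)).comp
      (h.lpSeqDeriv x 1) := (congrFun (h.lpSeqDeriv_fixed x) 0).symm
    rw [e1, e2, e3]
    simp only [stablePart, stablePartDeriv, rem, add_apply,
      sub_apply, ContinuousLinearMap.comp_apply,
      ContinuousLinearMap.id_apply, map_add, map_sub]
    abel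
  · intro n
    simp only [hιcomp, hιadd, hιsub]
    congr 1
    simp only [δ]
    have e1 : h.lpSeq (x + v) (n + 1) = A (h.lpSeq (x + v) n - R (h.lpSeq (x + v) (n + 1))) +
        stablePart Λ P R (h.lpSeq (x + v) (n + 2)) :=
      (congrFun (h.lpSeq_fixed (x + v)) (n + 1)).symm
    have e2 : h.lpSeq x (n + 1) = A (h.lpSeq x n - R (h.lpSeq x (n + 1))) +
        stablePart Λ P R (h.lpSeq x (n + 2)) :=
      (congrFun (h.lpSeq_fixed x) (n + 1)).symm
    have e3 : h.lpSeqDeriv x (n + 1) = A.comp (h.lpSeqDeriv x n -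
        (fderiv ℝ R (h.lpSeq x (n + 1))).comp (h.lpSeqDeriv x (n + 1))) +
        (stablePartDeriv Λ P R (h.lpSeq x (n + 2))).comp (h.lpSeqDeriv x (n + 2)) :=
      (congrFun (h.lpSeqDeriv_fixed x) (n + 1)).symm
    have e4 : h.lpSeq (x + v) (n + 1) - h.lpSeq x (n + 1) - h.lpSeqDeriv x (n + 1) v =
        (A (h.lpSeq (x + v) n - R (h.lpSeq (x + v) (n + 1))) +
        stablePart Λ P R (h.lpSeq (x + v) (n + 2))) - (A (h.lpSeq x n - R (h.lpSeq x (n + 1))) +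
        stablePart Λ P R (h.lpSeq x (n + 2))) - (A.comp (h.lpSeqDeriv x n -
        (fderiv ℝ R (h.lpSeq x (n + 1))).comp (h.lpSeqDeriv x (n + 1))) +
        (stablePartDeriv Λ P R (h.lpSeq x (n + 2))).comp (h.lpSeqDeriv x (n + 2))) v := by
      rw [← e1, ← e2, ← e3]
    refine e4.trans ?_
    simp only [stablePart, stablePartDeriv, rem, add_apply,
      sub_apply, ContinuousLinearMap.comp_apply,
      ContinuousLinearMap.id_apply, map_add, map_sub]
    abel

/-- The same mechanism one order higher: the difference of two derivatives solves the problem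
linearized along the orbit of `x'`, forced by the difference of the derivatives of `R` along the two
orbits. This forcing is bounded in the weight `l₁` and tends to zero entry by entry. -/
theorem continuous_lpSeqDeriv (h : GapMap Λ A P R α β q ε l₁ l₂) (hR : ContDiff ℝ 1 R) :
    Continuous fun x => h.lpSeqDeriv x 0 := by
  have hl1 := h.l₁_pos
  have hl2 := h.l₂_pos
  have hε := h.eps_nonneg
  have hl12 : ∀ n, l₁ ^ n ≤ l₂ ^ n := fun n => pow_le_pow_left₀ hl1.le h.l₁_lt.le n
  rw [continuous_iff_continuousAt]
  intro x
  rw [ContinuousAt, tendsto_iff_norm_sub_tendsto_zero, Metric.tendsto_nhds]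
  intro c hc
  let r : X → ℕ → X →L[ℝ] X := fun x' n =>
    (fderiv ℝ R (h.lpSeq x' n) - fderiv ℝ R (h.lpSeq x n)).comp (h.lpSeqDeriv x n)
  obtain ⟨η, hη, hηc⟩ : ∃ η : ℝ, 0 < η ∧ 2 * ((q * l₂ + α) * η) < c := by
    have h1 : 0 ≤ q * l₂ + α := add_nonneg (mul_nonneg h.q_nonneg hl2.le) h.α_nonneg
    refine ⟨c / (2 * (q * l₂ + α) + 1), by positivity, ?_⟩
    have h2 : 0 < 2 * (q * l₂ + α) + 1 := by positivity
    rw [← mul_assoc, ← mul_div_assoc, div_lt_iff₀ h2]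
    nlinarith
  have hsmall : ∀ᶠ x' in 𝓝 x, ∀ n, ‖r x' n‖ ≤ η * l₂ ^ n := by
    refine eventually_forall_le_mul_pow (C := (ε + ε) * (2 * ‖P‖)) hl1 h.l₁_lt
      (Eventually.of_forall fun x' n => ?_) (fun n η' hη' => ?_) hη
    · refine (ContinuousLinearMap.opNorm_comp_le _ _).trans ?_
      rw [mul_assoc]
      exact mul_le_mul ((norm_sub_le _ _).trans (add_le_add (h.norm_fderiv_rem_le _)
        (h.norm_fderiv_rem_le _))) (h.lpSeqDeriv_norm_le x n) (norm_nonneg _) (by positivity)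
    · have h1 : Continuous fun x' => r x' n :=
        ((((hR.continuous_fderiv (by norm_num)).comp (h.continuous_lpSeq n)).sub
          continuous_const).clm_comp continuous_const)
      have h2 : Tendsto (fun x' => ‖r x' n‖) (𝓝 x) (𝓝 0) := by
        have := h1.norm.tendsto x
        simpa [r] using this
      exact (h2.eventually (gt_mem_nhds hη')).mono fun _ hx => hx.le
  filter_upwards [hsmall] with x' hx'
  have key := h.linearized_le (h.lpSeq x') (fun n => h.lpSeqDeriv x' n - h.lpSeqDeriv x n) (r x')
    hη.le hx' ⟨2 * ‖P‖ + 2 * ‖P‖, by positivity, fun n => ?_⟩ ?_ ?_ 0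
  · rw [pow_zero, mul_one] at key
    rw [Real.dist_eq, sub_zero, abs_of_nonneg (norm_nonneg _)]
    exact key.trans_lt hηc
  · have h1 := h.lpSeqDeriv_norm_le x n
    have h2 := h.lpSeqDeriv_norm_le x' n
    calc _ ≤ _ := norm_sub_le _ _
      _ ≤ (2 * ‖P‖ + 2 * ‖P‖) * l₁ ^ n := by linarith
      _ ≤ _ := mul_le_mul_of_nonneg_left (hl12 n) (by positivity)
  · have e2 : h.lpSeqDeriv x' 0 = P + (stablePartDeriv Λ P R (h.lpSeq x' 1)).comp
      (h.lpSeqDeriv x' 1) := (congrFun (h.lpSeqDeriv_fixed x') 0).symm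
    have e3 : h.lpSeqDeriv x 0 = P + (stablePartDeriv Λ P R (h.lpSeq x 1)).comp
      (h.lpSeqDeriv x 1) := (congrFun (h.lpSeqDeriv_fixed x) 0).symm
    rw [e2, e3]
    ext u
    simp only [stablePartDeriv, r, add_apply,
      sub_apply, ContinuousLinearMap.comp_apply,
      ContinuousLinearMap.id_apply, map_sub]
    abel
  · intro n
    have e3 : ∀ x, h.lpSeqDeriv x (n + 1) = A.comp (h.lpSeqDeriv x n -
        (fderiv ℝ R (h.lpSeq x (n + 1))).comp (h.lpSeqDeriv x (n + 1))) +
        (stablePartDeriv Λ P R (h.lpSeq x (n + 2))).comp (h.lpSeqDeriv x (n + 2)) :=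
      fun x => (congrFun (h.lpSeqDeriv_fixed x) (n + 1)).symm
    have e4 : h.lpSeqDeriv x' (n + 1) - h.lpSeqDeriv x (n + 1) =
        (A.comp (h.lpSeqDeriv x' n -
        (fderiv ℝ R (h.lpSeq x' (n + 1))).comp (h.lpSeqDeriv x' (n + 1))) +
        (stablePartDeriv Λ P R (h.lpSeq x' (n + 2))).comp (h.lpSeqDeriv x' (n + 2))) -
        (A.comp (h.lpSeqDeriv x n -
        (fderiv ℝ R (h.lpSeq x (n + 1))).comp (h.lpSeqDeriv x (n + 1))) +
        (stablePartDeriv Λ P R (h.lpSeq x (n + 2))).comp (h.lpSeqDeriv x (n + 2))) := by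
      rw [← e3, ← e3]
    refine e4.trans ?_
    ext u
    simp only [stablePartDeriv, r, add_apply,
      sub_apply, ContinuousLinearMap.comp_apply,
      ContinuousLinearMap.id_apply, map_sub]
    abel

theorem hasFDerivAt_graphMap (h : GapMap Λ A P R α β q ε l₁ l₂) (hR : ContDiff ℝ 1 R) (x : X) :
    HasFDerivAt h.graphMap (h.lpSeqDeriv x 0 - P) x :=
  (h.hasFDerivAt_lpSeq (hR.differentiable (by norm_num)) x).sub P.hasFDerivAt

theorem contDiff_graphMap (h : GapMap Λ A P R α β q ε l₁ l₂) (hR : ContDiff ℝ 1 R) :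
    ContDiff ℝ 1 h.graphMap := by
  rw [contDiff_one_iff_fderiv]
  refine ⟨fun x => (h.hasFDerivAt_graphMap hR x).differentiableAt, ?_⟩
  have : fderiv ℝ h.graphMap = fun x => h.lpSeqDeriv x 0 - P :=
    funext fun x => (h.hasFDerivAt_graphMap hR x).fderiv
  rw [this]
  exact (h.continuous_lpSeqDeriv hR).sub continuous_const

/-- The orbit through 0 vanishes and `R` has zero derivative there, so the components `Q.comp (z n)`
in the kernel of `P` satisfy a linear recursion from n + 1 to n with a strong contraction. With
growth at most `l₁ ^ n` they must vanish, and the derivative of the end point reduces to `P`. -/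
theorem fderiv_graphMap_zero (h : GapMap Λ A P R α β q ε l₁ l₂) (hR : ContDiff ℝ 1 R)
    (hR0 : fderiv ℝ R 0 = 0) : fderiv ℝ h.graphMap 0 = 0 := by
  rw [(h.hasFDerivAt_graphMap hR 0).fderiv]
  have hl1 := h.l₁_pos
  let z := h.lpSeqDeriv 0
  let Q := ContinuousLinearMap.id ℝ X - P
  have hPs : ∀ y, P.comp (stablePartDeriv Λ P R y) = 0 := fun y => by
    ext u; simp [stablePartDeriv, h.proj]
  have hQs : ∀ n, Q.comp (z n) = (Λ - P.comp Λ).comp (Q.comp (z (n + 1))) := by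
    have h1 : ∀ w : X →L[ℝ] X, Q.comp ((stablePartDeriv Λ P R 0).comp w) =
        (Λ - P.comp Λ).comp (Q.comp w) := by
      intro w
      ext u
      simp [Q, stablePartDeriv, hR0, h.proj, h.comm]
    intro n
    rw [← h1]
    cases n with
    | zero =>
      have e3 : z 0 = P + (stablePartDeriv Λ P R (h.lpSeq 0 1)).comp (z 1) :=
        (congrFun (h.lpSeqDeriv_fixed 0) 0).symm
      rw [e3, h.lpSeq_zero]
      ext u; simp [Q, h.proj]
    | succ n =>
      have e3 : z (n + 1) = A.comp (z n -
        (fderiv ℝ R (h.lpSeq 0 (n + 1))).comp (z (n + 1))) +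
        (stablePartDeriv Λ P R (h.lpSeq 0 (n + 2))).comp (z (n + 2)) :=
        (congrFun (h.lpSeqDeriv_fixed 0) (n + 1)).symm
      rw [h.lpSeq_zero, h.lpSeq_zero, hR0] at e3
      nth_rewrite 1 [e3]
      ext u; simp [Q, h.proj_inv]
  have hle : ∀ n, ‖Q.comp (z n)‖ ≤ (β + q * ε) * ‖Q.comp (z (n + 1))‖ := fun n => by
    rw [hQs n]
    refine (ContinuousLinearMap.opNorm_comp_le _ _).trans
      (mul_le_mul_of_nonneg_right (h.norm_stable.trans ?_) (norm_nonneg _))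
    exact le_add_of_nonneg_right (mul_nonneg h.q_nonneg h.eps_nonneg)
  have h0 := (h.weights h.l₁_mem le_rfl (by norm_num)).le (d := fun n => ‖Q.comp (z n)‖) (K₀ := 0)
    ⟨‖Q‖ * (2 * ‖P‖), by positivity, fun n => ?_⟩ le_rfl
    (by simpa using hle 0) (fun n => ?_) 0
  · have h1 : Q.comp (z 0) = 0 := by simpa using h0
    have e3 : z 0 = P + (stablePartDeriv Λ P R (h.lpSeq 0 1)).comp (z 1) :=
      (congrFun (h.lpSeqDeriv_fixed 0) 0).symm
    have h2 : P.comp (z 0) = P := by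
      rw [e3, ContinuousLinearMap.comp_add, ← ContinuousLinearMap.comp_assoc, hPs]
      ext u; simp [h.proj]
    have h3 : Q.comp (z 0) = z 0 - P.comp (z 0) := by ext u; simp [Q]
    rw [h1, h2] at h3
    exact h3.symm
  · refine (ContinuousLinearMap.opNorm_comp_le _ _).trans ?_
    rw [mul_assoc]
    exact mul_le_mul_of_nonneg_left (h.lpSeqDeriv_norm_le 0 n) (norm_nonneg _)
  · have h1 := hle (n + 1)
    have h2 := mul_nonneg h.α_nonneg (norm_nonneg (Q.comp (z n)))
    have h3 := mul_nonneg (mul_nonneg h.α_nonneg h.eps_nonneg) (norm_nonneg (Q.comp (z (n + 1))))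
    rw [zero_mul]
    linarith

end GapMap
end GapMap

/-! ### Orbits on the manifold and tracking for maps. -/

section GapMap

variable {X : Type*} [NormedAddCommGroup X] [NormedSpace ℝ X]

namespace GapMap

variable {Λ A P : X →L[ℝ] X} {R : X → X} {α β q ε l₁ l₂ : ℝ} [CompleteSpace X]

theorem sub_le_proj_sub (h : GapMap Λ A P R α β q ε l₁ l₂) {x x' : X}
    (hx : x - P x = h.graphMap x) (hx' : x' - P x' = h.graphMap x') :
    ‖x - x'‖ ≤ 2 * ‖P x - P x'‖ := by
  have h1 : x - x' = (P x - P x') + (h.graphMap x - h.graphMap x') := by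
    rw [← hx, ← hx']; abel
  have h2 := h.graphMap_sub_le_proj' x x'
  have h3 := norm_nonneg (P x - P x')
  calc ‖x - x'‖ ≤ ‖P x - P x'‖ + ‖h.graphMap x - h.graphMap x'‖ := by
        rw [h1]; exact norm_add_le _ _
    _ ≤ _ := by linarith

/-- On the graph a difference is controlled by twice its central component, so the nonlinear
contribution is at most half of the left side and can be absorbed. The map `Λ' + R'` need not be the
one that defines the graph; the uniqueness of tracking uses this with a different time step. -/
theorem proj_sub_le (h : GapMap Λ A P R α β q ε l₁ l₂) {Λ' A' : X →L[ℝ] X} {R' : X → X}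
    {a ε' : ℝ} (hA : ‖A'‖ ≤ a) (hinv : ∀ x, A' (Λ' x) = P x) (hproj : ∀ x, A' (P x) = A' x)
    (haε : a * ε' ≤ 1 / 4) {x x' : X}
    (hx : x - P x = h.graphMap x) (hx' : x' - P x' = h.graphMap x')
    (hR : ‖R' x - R' x'‖ ≤ ε' * ‖x - x'‖) :
    ‖P x - P x'‖ ≤ 2 * a * ‖P (Λ' x + R' x) - P (Λ' x' + R' x')‖ := by
  have ha : 0 ≤ a := (norm_nonneg _).trans hA
  have h1 : P x - P x' = A' (P (Λ' x + R' x) - P (Λ' x' + R' x')) - A' (R' x - R' x') := by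
    rw [map_sub, hproj, hproj, ← hinv, ← hinv]; simp only [map_add, map_sub]; abel
  have h2 := ContinuousLinearMap.le_of_opNorm_le _ hA (P (Λ' x + R' x) - P (Λ' x' + R' x'))
  have h3 := ContinuousLinearMap.le_of_opNorm_le _ hA (R' x - R' x')
  have h4 := mul_le_mul_of_nonneg_left hR ha
  have h5 := h.sub_le_proj_sub hx hx'
  have h6 : a * ε' * ‖x - x'‖ ≤ 1 / 4 * ‖x - x'‖ := mul_le_mul_of_nonneg_right haε (norm_nonneg _)
  have h7 : ‖P x - P x'‖ ≤ _ := (congrArg norm h1).le.trans (norm_sub_le _ _)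
  linarith

theorem proj_sub_le_l₁ (h : GapMap Λ A P R α β q ε l₁ l₂) {x x' : X}
    (hx : x - P x = h.graphMap x) (hx' : x' - P x' = h.graphMap x') :
    ‖P x - P x'‖ ≤ l₁ * ‖P (Λ x + R x) - P (Λ x' + R x')‖ := by
  have h1 := h.gap
  have h2 := div_nonneg h.α_nonneg h.l₁_pos.le
  have h3 := mul_nonneg h.α_nonneg h.eps_nonneg
  have h4 := mul_nonneg h.c_nonneg h.l₂_pos.le
  refine (h.proj_sub_le h.norm_inv h.left_inv h.inv_proj (by linarith) hx hx'
    (h.rem_lip x x')).trans (mul_le_mul_of_nonneg_right ?_ (norm_nonneg _))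
  have h5 : α / l₁ ≤ 1 / 4 := by linarith
  rw [div_le_iff₀ h.l₁_pos] at h5
  have := h.l₁_pos
  linarith

theorem backwardOrbit_sub_le (h : GapMap Λ A P R α β q ε l₁ l₂) {x x' : X} {y y' : ℕ → X}
    (hy : IsBackwardOrbit (fun x => Λ x + R x) x y)
    (hy' : IsBackwardOrbit (fun x => Λ x + R x) x' y')
    (hW : ∀ n, y n - P (y n) = h.graphMap (y n)) (hW' : ∀ n, y' n - P (y' n) = h.graphMap (y' n))
    (n : ℕ) : ‖y n - y' n‖ ≤ 2 * q * l₁ ^ n * ‖x - x'‖ := by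
  have h1 : ‖P (y n) - P (y' n)‖ ≤ l₁ ^ n * ‖P x - P x'‖ := by
    induction n with
    | zero => rw [hy.1, hy'.1]; simp
    | succ n ih =>
      have h2 := h.proj_sub_le_l₁ (hW (n + 1)) (hW' (n + 1))
      have h3 := hy.2 n
      have h4 := hy'.2 n
      simp only at h3 h4
      rw [h3, h4] at h2
      refine h2.trans ((mul_le_mul_of_nonneg_left ih h.l₁_pos.le).trans (le_of_eq ?_))
      ring
  have h2 := h.sub_le_proj_sub (hW n) (hW' n)
  have h3 : ‖P x - P x'‖ ≤ q * ‖x - x'‖ := by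
    rw [← map_sub]; exact ContinuousLinearMap.le_of_opNorm_le _ h.norm_proj _
  have h4 := mul_le_mul_of_nonneg_left h3 (pow_pos h.l₁_pos n).le
  linarith

/-- The Lyapunov–Perron map for the difference between an orbit in the center manifold and a given
orbit `w`. -/
noncomputable def trackMap (h : GapMap Λ A P R α β q ε l₁ l₂) (w : ℕ → X) (d : ℕ → X) : ℕ → X
  | 0 => A (d 1 - (R (w 0 + d 0) - R (w 0))) + (h.graphMap (w 0 + d 0) - (w 0 - P (w 0)))
  | n + 1 => A (d (n + 2) - (R (w (n + 1) + d (n + 1)) - R (w (n + 1)))) +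
      (stablePart Λ P R (w n + d n) - stablePart Λ P R (w n))

theorem trackMap_lipschitz (h : GapMap Λ A P R α β q ε l₁ l₂) (w : ℕ → X) :
    NbrLipschitz (h.trackMap w) (β + q * ε) (α * ε) α (α * ε + 1 / 4) where
  zero d d' := by
    have h1 := h.inv_sub (d 1) (d' 1) (w 0 + d 0) (w 0 + d' 0)
    have h2 := h.graphMap_sub_le (w 0 + d 0) (w 0 + d' 0)
    rw [add_sub_add_left_eq_sub] at h1 h2
    have h3 : h.trackMap w d 0 - h.trackMap w d' 0 = (A (d 1 - R (w 0 + d 0)) -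
      A (d' 1 - R (w 0 + d' 0))) + (h.graphMap (w 0 + d 0) - h.graphMap (w 0 + d' 0)) := by
      simp only [trackMap, map_sub]; abel
    rw [h3]
    refine (norm_add_le _ _).trans ((add_le_add h1 h2).trans (le_of_eq ?_))
    ring
  succ d d' n := by
    have h1 := h.inv_sub (d (n + 2)) (d' (n + 2)) (w (n + 1) + d (n + 1)) (w (n + 1) + d' (n + 1))
    have h2 := h.stablePart_sub (w n + d n) (w n + d' n)
    rw [add_sub_add_left_eq_sub] at h1 h2
    have h3 : h.trackMap w d (n + 1) - h.trackMap w d' (n + 1) =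
      (A (d (n + 2) - R (w (n + 1) + d (n + 1))) -
      A (d' (n + 2) - R (w (n + 1) + d' (n + 1)))) +
      (stablePart Λ P R (w n + d n) - stablePart Λ P R (w n + d' n)) := by
      simp only [trackMap, map_sub]; abel
    rw [h3]
    refine (norm_add_le _ _).trans ((add_le_add h1 h2).trans (le_of_eq ?_))
    ring

/-- The unknown is the difference `d` to the given orbit, sought in the weight `l₂⁻¹`. Its central
part is determined from the future, its stable part is propagated from the initial time, and the
stable initial value is chosen so that `w 0 + d 0` lies on the graph. At `d = 0` the map vanishes
except for the defect of `w 0` from the graph, which gives the constant `1 / 4 + q`. -/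
theorem exists_tracking (h : GapMap Λ A P R α β q ε l₁ l₂) {w : ℕ → X}
    (hw : ∀ n, w (n + 1) = Λ (w n) + R (w n)) :
    ∃ v : ℕ → X, (∀ n, v (n + 1) = Λ (v n) + R (v n)) ∧ v 0 - P (v 0) = h.graphMap (v 0) ∧
      ∀ n, ‖v n - w n‖ ≤ 2 * ((1 / 4 + q) * ‖w 0‖) * (l₂⁻¹) ^ n := by
  have hq := h.q_nonneg
  have hl := h.l₂_pos
  obtain ⟨d, hd, hdb⟩ := (h.trackMap_lipschitz w).exists_fixed h.weights_inv
    (K₀ := (1 / 4 + q) * ‖w 0‖) (by positivity) (fun n => by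
      cases n with
      | zero =>
        have h1 := h.graphMap_norm_le (w 0)
        have h2 := ContinuousLinearMap.le_of_opNorm_le _ h.norm_compl (w 0)
        simp only [sub_apply, ContinuousLinearMap.id_apply] at h2
        have h3 := norm_sub_le (h.graphMap (w 0)) (w 0 - P (w 0))
        simp [trackMap]
        linarith
      | succ n => simp [trackMap]; positivity)
  have hd0 : d 0 = A (d 1 - (R (w 0 + d 0) - R (w 0))) +
      (h.graphMap (w 0 + d 0) - (w 0 - P (w 0))) := (congrFun hd 0).symm
  have hds : ∀ n, d (n + 1) = A (d (n + 2) - (R (w (n + 1) + d (n + 1)) - R (w (n + 1)))) +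
      (stablePart Λ P R (w n + d n) - stablePart Λ P R (w n)) :=
    fun n => (congrFun hd (n + 1)).symm
  have hP : ∀ n, P (d n) = A (d (n + 1) - (R (w n + d n) - R (w n))) := by
    intro n
    cases n with
    | zero =>
      nth_rewrite 1 [hd0]
      rw [map_add, h.proj_inv, map_sub P (h.graphMap _), h.proj_graphMap, map_sub P, h.proj,
        sub_self, sub_zero, add_zero]
    | succ n =>
      nth_rewrite 1 [hds n]
      rw [map_add, h.proj_inv, map_sub P (stablePart _ _ _ _), h.proj_stablePart,
        h.proj_stablePart, sub_zero, add_zero]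
  have hPΛ : ∀ n, P (d (n + 1)) = P (Λ (d n)) + P (R (w n + d n) - R (w n)) := by
    intro n
    have := congrArg Λ (hP n)
    rw [h.right_inv, ← h.comm] at this
    rw [this, map_sub]; abel
  have hQ : ∀ n, d (n + 1) - P (d (n + 1)) =
      stablePart Λ P R (w n + d n) - stablePart Λ P R (w n) := fun n => by
    rw [hP (n + 1)]; nth_rewrite 1 [hds n]; abel
  refine ⟨fun n => w n + d n, fun n => ?_, ?_, fun n => by simpa using hdb n⟩
  · have h1 : d (n + 1) = P (d (n + 1)) + (d (n + 1) - P (d (n + 1))) := by abel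
    rw [hQ, hPΛ] at h1
    simp only
    rw [h1, hw]
    simp only [stablePart, map_add, map_sub]
    abel
  · have h1 : d 0 - P (d 0) = h.graphMap (w 0 + d 0) - (w 0 - P (w 0)) := by
      rw [hP 0]; nth_rewrite 1 [hd0]; abel
    simp only
    rw [map_add]
    have h2 : w 0 + d 0 - (P (w 0) + P (d 0)) = (w 0 - P (w 0)) + (d 0 - P (d 0)) := by abel
    rw [h2, h1]; abel

end GapMap
end GapMap

/-! ### Smooth superposition operators and a smooth inverse. -/

section Nemytskii

variable {α X Y : Type*} [TopologicalSpace α] [CompactSpace α] [NormedAddCommGroup X]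
  [NormedSpace ℝ X] [NormedAddCommGroup Y] [NormedSpace ℝ Y]

/-- Pointwise application of a continuous family of operators. -/
noncomputable def pointwiseApply : C(α, X →L[ℝ] Y) →L[ℝ] C(α, X) →L[ℝ] C(α, Y) :=
  LinearMap.mkContinuous₂ (LinearMap.mk₂ ℝ
    (fun (A : C(α, X →L[ℝ] Y)) (v : C(α, X)) =>
      (⟨fun s => A s (v s), A.continuous.clm_apply v.continuous⟩ : C(α, Y)))
    (fun A A' v => by ext; simp) (fun c A v => by ext; simp) (fun A v v' => by ext; simp)
    (fun c A v => by ext; simp)) 1 fun A v => by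
      rw [one_mul]
      refine (ContinuousMap.norm_le _ (by positivity)).2 fun s => ?_
      exact ((A s).le_opNorm (v s)).trans (mul_le_mul (A.norm_coe_le_norm s)
        (v.norm_coe_le_norm s) (norm_nonneg _) (norm_nonneg A))

theorem contDiff_one_postcomp {p : X → Y} (hp : ContDiff ℝ 1 p) :
    ContDiff ℝ 1 fun u : C(α, X) => (⟨p, hp.continuous⟩ : C(X, Y)).comp u := by
  have hp' : Continuous (fderiv ℝ p) := hp.continuous_fderiv (by norm_num)
  let D : C(α, X) → C(α, X →L[ℝ] Y) := fun u => (⟨fderiv ℝ p, hp'⟩ : C(X, X →L[ℝ] Y)).comp u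
  have hD : Continuous D := ContinuousMap.continuous_postcomp _
  rw [contDiff_one_iff_hasFDerivAt]
  refine ⟨fun u => pointwiseApply (D u), pointwiseApply.continuous.comp hD, fun u => ?_⟩
  rw [hasFDerivAt_iff_isLittleO_nhds_zero, Asymptotics.isLittleO_iff]
  intro c hc
  obtain ⟨δ, hδ, hδ'⟩ := (Metric.continuousAt_iff (f := D) (a := u)).1 hD.continuousAt c hc
  have hball : ∀ s : α, ∀ y ∈ Metric.ball (u s) δ, ‖fderiv ℝ p y - fderiv ℝ p (u s)‖ ≤ c := by
    intro s y hy
    -- Adding the constant `y - u s` to the path moves its value at `s` to `y`. Continuity of `D` at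
    -- the single path `u` then compares the derivatives of `p` at `y` and at `u s` with one `δ` for
    -- all `s`.
    have h1 : dist (u + ContinuousMap.const α (y - u s)) u < δ := by
      rw [dist_eq_norm, add_sub_cancel_left]
      refine lt_of_le_of_lt ((ContinuousMap.norm_le _ (norm_nonneg (y - u s))).2 fun _ => le_rfl) ?_
      rwa [← dist_eq_norm]
    have h2 := (hδ' h1).le
    have h3 := (ContinuousMap.dist_apply_le_dist s).trans h2
    rw [dist_eq_norm] at h3
    simpa [D] using h3
  filter_upwards [Metric.ball_mem_nhds (0 : C(α, X)) hδ] with v hv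
  rw [mem_ball_zero_iff] at hv
  refine (ContinuousMap.norm_le _ (by positivity)).2 fun s => ?_
  have h1 : ‖v s‖ ≤ ‖v‖ := v.norm_coe_le_norm s
  have h2 := (convex_ball (u s) δ).norm_image_sub_le_of_norm_fderiv_le' (𝕜 := ℝ) (f := p)
    (φ := fderiv ℝ p (u s)) (C := c) (x := u s) (y := u s + v s)
    (fun y _ => (hp.differentiable (by norm_num)) y) (hball s) (Metric.mem_ball_self hδ)
    (by rw [Metric.mem_ball, dist_eq_norm, add_sub_cancel_left]; exact h1.trans_lt hv)
  rw [add_sub_cancel_left] at h2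
  exact h2.trans (mul_le_mul_of_nonneg_left h1 hc.le)

/-- A `C¹` perturbation of the identity with Lipschitz constant `1 / 2` has a `C¹` inverse. -/
theorem exists_contDiff_inverse_id_sub {E : Type*} [NormedAddCommGroup E] [NormedSpace ℝ E]
    [CompleteSpace E] {K : E → E} (hK : LipschitzWith (1 / 2) K) (hK' : ContDiff ℝ 1 K) :
    ∃ g : E → E, ContDiff ℝ 1 g ∧ ∀ f, g f - K (g f) = f := by
  have hK2 : ∀ u v, ‖K u - K v‖ ≤ 1 / 2 * ‖u - v‖ := fun u v => by
    have := hK.dist_le_mul u v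
    rw [dist_eq_norm, dist_eq_norm] at this
    simpa using this
  have hex : ∀ f : E, ∃ u, u - K u = f := by
    intro f
    have hc : ContractingWith (1 / 2) fun u => f + K u :=
      ⟨by rw [← NNReal.coe_lt_coe]; norm_num, LipschitzWith.of_dist_le_mul fun u v => by
        rw [dist_eq_norm, dist_eq_norm, add_sub_add_left_eq_sub]; simpa using hK2 u v⟩
    refine ⟨hc.fixedPoint, ?_⟩
    have h1 : f + K hc.fixedPoint = hc.fixedPoint := hc.fixedPoint_isFixedPt
    nth_rewrite 1 [← h1]
    abel
  choose g hg using hex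
  have hlow : ∀ u v, ‖u - v‖ ≤ 2 * ‖(u - K u) - (v - K v)‖ := fun u v => by
    have h1 : u - v = ((u - K u) - (v - K v)) + (K u - K v) := by abel
    have h2 := norm_add_le ((u - K u) - (v - K v)) (K u - K v)
    rw [← h1] at h2
    have := hK2 u v
    linarith
  have hgc : Continuous g := by
    have : LipschitzWith 2 g := LipschitzWith.of_dist_le_mul fun f f' => by
      rw [dist_eq_norm, dist_eq_norm]
      have := hlow (g f) (g f')
      rw [hg, hg] at this
      simpa using this
    exact this.continuous
  -- The lower bound `hlow` makes the inverse Lipschitz. For a homeomorphism, smoothness of the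
  -- inverse only requires invertible derivatives, and these are given by a Neumann series.
  let e : E ≃ₜ E :=
    { toFun := fun u => u - K u
      invFun := g
      left_inv := fun u => by
        have := hlow (g (u - K u)) u
        rw [hg, sub_self, norm_zero, mul_zero] at this
        exact sub_eq_zero.1 (norm_le_zero_iff.1 this)
      right_inv := hg
      continuous_toFun := continuous_id.sub hK.continuous
      continuous_invFun := hgc }
  have hn : ∀ u, ‖fderiv ℝ K u‖ < 1 := fun u =>
    (norm_fderiv_le_of_lipschitz ℝ hK).trans_lt (by norm_num)
  refine ⟨g, ?_, hg⟩
  refine e.contDiff_symm (f₀' := fun u => ContinuousLinearEquiv.unitsEquiv ℝ E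
    (Units.oneSub (fderiv ℝ K u) (hn u))) (fun u => ?_) (contDiff_id.sub hK')
  exact (hasFDerivAt_id u).sub ((hK'.differentiable (by norm_num)) u).hasFDerivAt

end Nemytskii

/-! ### The Duhamel integral with an integrable singularity. -/

section Duhamel

variable {X : Type*} [NormedAddCommGroup X] [NormedSpace ℝ X]

/-- A strongly continuous semigroup `S` together with a family `B t = S t ∘ b` of bilinear maps,
where `b` is unbounded but smoothed by the semigroup: `‖B t‖ ≤ M t^(-3/4)`. -/
structure SmoothingPair (S : ℝ → X →L[ℝ] X) (B : ℝ → X →L[ℝ] X →L[ℝ] X) (M κ : ℝ) : Prop where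
  M_nonneg : 0 ≤ M
  κ_nonneg : 0 ≤ κ
  S_zero : ∀ x, S 0 x = x
  S_add : ∀ s t, 0 ≤ s → 0 ≤ t → ∀ x, S (s + t) x = S s (S t x)
  S_cont : ∀ x, ContinuousOn (fun t => S t x) (Ici 0)
  S_norm : ∀ t, 0 ≤ t → ‖S t‖ ≤ M * Real.exp (κ * t)
  S_B : ∀ s t, 0 ≤ s → 0 < t → ∀ x y, S s (B t x y) = B (s + t) x y
  B_norm : ∀ t ∈ Ioc (0 : ℝ) 1, ‖B t‖ ≤ M * t ^ (-(3 / 4 : ℝ))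

/-- The majorant of `‖B t‖`. -/
noncomputable def kerBound (M κ t : ℝ) : ℝ :=
  (M * M + M) * (t ^ (-(3 / 4 : ℝ)) * Real.exp ((κ + 1) * t))

/-- The Duhamel integral `∫₀^τ B (τ - s) (f s) (g s) ds`. -/
noncomputable def duhamel (B : ℝ → X →L[ℝ] X →L[ℝ] X) (f g : ℝ → X) (τ : ℝ) : X :=
  ∫ s in (0 : ℝ)..τ, B (τ - s) (f s) (g s)

theorem intervalIntegrable_kerBound (M κ a b : ℝ) :
    IntervalIntegrable (kerBound M κ) volume a b :=
  ((intervalIntegral.intervalIntegrable_rpow' (by norm_num)).mul_continuousOn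
    (by fun_prop)).const_mul _

theorem kerBound_nonneg {M : ℝ} (hM : 0 ≤ M) (κ : ℝ) {t : ℝ} (ht : 0 ≤ t) :
    0 ≤ kerBound M κ t := by
  unfold kerBound; positivity

theorem continuousAt_kerBound (M κ : ℝ) {t : ℝ} (ht : 0 < t) :
    ContinuousAt (kerBound M κ) t :=
  continuousAt_const.mul ((Real.continuousAt_rpow_const _ _ (Or.inl ht.ne')).mul (by fun_prop))

namespace SmoothingPair

variable {S : ℝ → X →L[ℝ] X} {B : ℝ → X →L[ℝ] X →L[ℝ] X} {M κ : ℝ}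

/-- Beyond time 1, the relation `B t = S (t - 1) ∘ B 1` gives a bound without singularity. The
inequality t^(3/4) ≤ e^t for t ≥ 1 brings it to the common form and explains the exponent `κ + 1`;
the two cases account for `M * M + M`. -/
theorem norm_B_le (h : SmoothingPair S B M κ) {t : ℝ} (ht : 0 < t) : ‖B t‖ ≤ kerBound M κ t := by
  have hM := h.M_nonneg
  have hκ := h.κ_nonneg
  unfold kerBound
  rcases le_or_gt t 1 with h1 | h1
  · have h2 : (1 : ℝ) ≤ Real.exp ((κ + 1) * t) := Real.one_le_exp (by positivity)
    have h3 : 0 ≤ t ^ (-(3 / 4 : ℝ)) := by positivity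
    calc ‖B t‖ ≤ M * t ^ (-(3 / 4 : ℝ)) := h.B_norm t ⟨ht, h1⟩
      _ ≤ (M * M + M) * (t ^ (-(3 / 4 : ℝ)) * 1) := by
        rw [mul_one]; exact mul_le_mul_of_nonneg_right (by nlinarith) h3
      _ ≤ _ := by gcongr
  · have h2 : ‖B t‖ ≤ M * Real.exp (κ * t) * M := by
      refine ContinuousLinearMap.opNorm_le_bound₂ _ (by positivity) fun x y => ?_
      have h3 := h.S_B (t - 1) 1 (by linarith) one_pos x y
      rw [sub_add_cancel] at h3
      rw [← h3]
      have h4 : ‖B 1‖ ≤ M := by simpa using h.B_norm 1 ⟨one_pos, le_rfl⟩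
      have h5 : ‖S (t - 1)‖ ≤ M * Real.exp (κ * t) :=
        (h.S_norm _ (by linarith)).trans (mul_le_mul_of_nonneg_left
          (Real.exp_le_exp.2 (mul_le_mul_of_nonneg_left (by linarith) hκ)) hM)
      calc ‖S (t - 1) (B 1 x y)‖ ≤ ‖S (t - 1)‖ * ‖B 1 x y‖ := (S (t - 1)).le_opNorm _
        _ ≤ (M * Real.exp (κ * t)) * (M * ‖x‖ * ‖y‖) := by
          refine mul_le_mul h5 (((B 1).le_opNorm₂ x y).trans ?_) (norm_nonneg _) (by positivity)
          gcongr
        _ = _ := by ring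
    have h3 : 1 ≤ t ^ (-(3 / 4 : ℝ)) * Real.exp t := by
      rw [Real.rpow_neg ht.le, ← div_eq_inv_mul, one_le_div (by positivity)]
      calc t ^ (3 / 4 : ℝ) ≤ t ^ (1 : ℝ) := Real.rpow_le_rpow_of_exponent_le h1.le (by norm_num)
        _ = t := Real.rpow_one t
        _ ≤ Real.exp t := by linarith [Real.add_one_le_exp t]
    calc ‖B t‖ ≤ M * Real.exp (κ * t) * M := h2
      _ = (M * M) * Real.exp (κ * t) * 1 := by ring
      _ ≤ (M * M + M) * Real.exp (κ * t) * (t ^ (-(3 / 4 : ℝ)) * Real.exp t) :=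
        mul_le_mul (mul_le_mul_of_nonneg_right (by linarith) (Real.exp_pos _).le) h3 zero_le_one
          (by positivity)
      _ = _ := by rw [add_mul κ, one_mul, Real.exp_add]; ring

theorem continuousAt_B (h : SmoothingPair S B M κ) (x y : X) {t : ℝ} (ht : 0 < t) :
    ContinuousAt (fun t => B t x y) t := by
  have h1 : ContinuousOn (fun s => S (s - t / 2) (B (t / 2) x y)) (Ici (t / 2)) :=
    (h.S_cont _).comp (by fun_prop) fun s hs => by
      simp only [mem_Ici] at hs ⊢; linarith
  have h2 : ContinuousOn (fun s => B s x y) (Ici (t / 2)) := h1.congr fun s hs => by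
    simp only [mem_Ici] at hs
    simp only
    rw [h.S_B _ _ (by linarith) (by linarith), sub_add_cancel]
  exact h2.continuousAt (Ici_mem_nhds (by linarith))

/-- The family `B` is only strongly continuous, and locally bounded for positive times. The moving
arguments are therefore first replaced by their limits at the price of the local bound. -/
theorem tendsto_B (h : SmoothingPair S B M κ) {ι : Type*} {F : Filter ι} {γ : ι → ℝ}
    {f g : ι → X} {t : ℝ} {x y : X} (ht : 0 < t) (hγ : Tendsto γ F (𝓝 t))
    (hf : Tendsto f F (𝓝 x)) (hg : Tendsto g F (𝓝 y)) :
    Tendsto (fun i => B (γ i) (f i) (g i)) F (𝓝 (B t x y)) := by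
  have h1 : Tendsto (fun i => B (γ i) x y) F (𝓝 (B t x y)) := (h.continuousAt_B x y ht).tendsto.comp hγ
  have h2 : ∀ᶠ i in F, ‖B (γ i)‖ ≤ kerBound M κ t + 1 := by
    have h3 := ((continuousAt_kerBound M κ ht).tendsto.comp hγ).eventually
      (gt_mem_nhds (lt_add_one (kerBound M κ t)))
    filter_upwards [h3, hγ.eventually (lt_mem_nhds ht)] with i hi hi'
    exact (h.norm_B_le hi').trans hi.le
  have h3 : Tendsto (fun i => B (γ i) (f i) (g i) - B (γ i) x y) F (𝓝 0) := by
    have h4 : Tendsto (fun i => (kerBound M κ t + 1) * ‖f i - x‖ * ‖g i‖ +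
        (kerBound M κ t + 1) * ‖x‖ * ‖g i - y‖) F (𝓝 ((kerBound M κ t + 1) * 0 * ‖y‖ +
        (kerBound M κ t + 1) * ‖x‖ * 0)) :=
      (((tendsto_iff_norm_sub_tendsto_zero.1 hf).const_mul _).mul hg.norm).add
        ((tendsto_iff_norm_sub_tendsto_zero.1 hg).const_mul _)
    rw [mul_zero, zero_mul, mul_zero, add_zero] at h4
    refine squeeze_zero_norm' ?_ h4
    filter_upwards [h2] with i hi
    have h5 : B (γ i) (f i) (g i) - B (γ i) x y = B (γ i) (f i - x) (g i) + B (γ i) x (g i - y) := by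
      simp only [map_sub, sub_apply]; abel
    rw [h5]
    refine (norm_add_le _ _).trans (add_le_add (((B (γ i)).le_opNorm₂ _ _).trans ?_)
      (((B (γ i)).le_opNorm₂ _ _).trans ?_)) <;> gcongr
  simpa using h3.add h1

theorem continuousOn_B (h : SmoothingPair S B M κ) {s : Set ℝ} {γ : ℝ → ℝ} {f g : ℝ → X}
    (hγ : ContinuousOn γ s) (hpos : ∀ x ∈ s, 0 < γ x) (hf : ContinuousOn f s)
    (hg : ContinuousOn g s) : ContinuousOn (fun x => B (γ x) (f x) (g x)) s := fun x hx =>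
  h.tendsto_B (hpos x hx) (hγ x hx) (hf x hx) (hg x hx)

theorem intervalIntegrable_kerBound_sub (M κ τ a b : ℝ) :
    IntervalIntegrable (fun s => kerBound M κ (τ - s)) volume a b := by
  have := (intervalIntegrable_kerBound M κ (τ - a) (τ - b)).comp_sub_left τ
  simpa using this

theorem intervalIntegrable_B (h : SmoothingPair S B M κ) {τ : ℝ} (hτ : 0 ≤ τ) {f g : ℝ → X}
    (hf : ContinuousOn f (Icc 0 τ)) (hg : ContinuousOn g (Icc 0 τ)) :
    IntervalIntegrable (fun s => B (τ - s) (f s) (g s)) volume 0 τ := by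
  obtain ⟨Cf, hCf⟩ := isCompact_Icc.exists_bound_of_continuousOn hf
  obtain ⟨Cg, hCg⟩ := isCompact_Icc.exists_bound_of_continuousOn hg
  have hCf0 : 0 ≤ Cf := (norm_nonneg _).trans (hCf 0 ⟨le_rfl, hτ⟩)
  have h1 : IntervalIntegrable (fun s => kerBound M κ (τ - s) * Cf * Cg) volume 0 τ :=
    ((intervalIntegrable_kerBound_sub M κ τ 0 τ).mul_const _).mul_const _
  rw [intervalIntegrable_iff_integrableOn_Ioo_of_le hτ] at h1 ⊢
  refine Integrable.mono' h1 ((h.continuousOn_B (by fun_prop) (fun x hx => sub_pos.2 hx.2)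
    (hf.mono Ioo_subset_Icc_self) (hg.mono Ioo_subset_Icc_self)).aestronglyMeasurable
    measurableSet_Ioo) ?_
  filter_upwards [self_mem_ae_restrict measurableSet_Ioo] with s hs
  have hs' := Ioo_subset_Icc_self hs
  have hk := h.norm_B_le (sub_pos.2 hs.2)
  have hk0 := kerBound_nonneg h.M_nonneg κ (sub_pos.2 hs.2).le
  exact ((B (τ - s)).le_opNorm₂ _ _).trans (mul_le_mul (mul_le_mul hk (hCf s hs') (norm_nonneg _)
    hk0) (hCg s hs') (norm_nonneg _) (by positivity))

/-- The basic estimate for differences of Duhamel integrals. -/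
theorem norm_duhamel_sub_le (h : SmoothingPair S B M κ) {τ : ℝ} (hτ : 0 ≤ τ) {f g f' g' : ℝ → X}
    {φ : ℝ → ℝ}
    (hf : ContinuousOn f (Icc 0 τ)) (hg : ContinuousOn g (Icc 0 τ))
    (hf' : ContinuousOn f' (Icc 0 τ)) (hg' : ContinuousOn g' (Icc 0 τ))
    (hφ : ContinuousOn φ (Icc 0 τ)) (hφ0 : ∀ s ∈ Icc 0 τ, 0 ≤ φ s)
    (hle : ∀ s ∈ Icc 0 τ, ∀ b : X →L[ℝ] X →L[ℝ] X,
      ‖b (f s) (g s) - b (f' s) (g' s)‖ ≤ ‖b‖ * φ s) :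
    ‖duhamel B f g τ - duhamel B f' g' τ‖ ≤ ∫ s in (0 : ℝ)..τ, kerBound M κ (τ - s) * φ s := by
  unfold duhamel
  rw [← intervalIntegral.integral_sub (h.intervalIntegrable_B hτ hf hg)
    (h.intervalIntegrable_B hτ hf' hg')]
  have hint : IntervalIntegrable (fun s => kerBound M κ (τ - s) * φ s) volume 0 τ :=
    (intervalIntegrable_kerBound_sub M κ τ 0 τ).mul_continuousOn (by rwa [uIcc_of_le hτ])
  rw [intervalIntegral.integral_of_le hτ, intervalIntegral.integral_of_le hτ,
    integral_Ioc_eq_integral_Ioo, integral_Ioc_eq_integral_Ioo]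
  refine norm_integral_le_of_norm_le
    ((intervalIntegrable_iff_integrableOn_Ioo_of_le hτ).1 hint) ?_
  filter_upwards [self_mem_ae_restrict measurableSet_Ioo] with s hs
  have hs' := Ioo_subset_Icc_self hs
  have h3 := hle s hs' (B (τ - s))
  exact h3.trans (mul_le_mul_of_nonneg_right (h.norm_B_le (sub_pos.2 hs.2)) (hφ0 s hs'))

/-- After the substitution σ = τ - s the singular kernel no longer depends on τ, and a fixed
integrable majorant is available. The integrand is extended by zero to negative σ so that both end
points 0 and τ₀ are interior to the interval of integration that is considered. -/
theorem continuousOn_duhamel [CompleteSpace X] (h : SmoothingPair S B M κ) {f g : ℝ → X}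
    (hf : Continuous f)
    (hg : Continuous g) {Cf Cg : ℝ} (hCf : ∀ s, ‖f s‖ ≤ Cf) (hCg : ∀ s, ‖g s‖ ≤ Cg) :
    ContinuousOn (duhamel B f g) (Ici 0) := by
  intro τ₀ hτ₀
  simp only [mem_Ici] at hτ₀
  have hCf0 : 0 ≤ Cf := (norm_nonneg _).trans (hCf 0)
  let F : ℝ → ℝ → X := fun τ => (Ioi (0 : ℝ)).indicator fun σ => B σ (f (τ - σ)) (g (τ - σ))
  have hFc : ∀ τ, ContinuousOn (fun σ => B σ (f (τ - σ)) (g (τ - σ))) (Ioi 0) := fun τ =>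
    h.continuousOn_B continuousOn_id (fun x hx => hx) (by fun_prop) (by fun_prop)
  have key : ContinuousAt (fun p : ℝ × ℝ => ∫ σ in (0 : ℝ)..p.2, F p.1 σ) (τ₀, τ₀) := by
    refine intervalIntegral.continuousAt_parametric_primitive_of_dominated (a := -1) (b := τ₀ + 1)
      (fun σ => kerBound M κ |σ| * Cf * Cg)
      (fun τ => ?_) (Eventually.of_forall fun τ => Eventually.of_forall fun σ => ?_) ?_
      (Eventually.of_forall fun σ => ?_) ⟨by norm_num, by linarith⟩
      ⟨by linarith, by linarith⟩ ?_
    · exact ((aestronglyMeasurable_indicator_iff measurableSet_Ioi).2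
        ((hFc τ).aestronglyMeasurable measurableSet_Ioi)).restrict
    · by_cases hσ : σ ∈ Ioi (0 : ℝ)
      · simp only [F, indicator_of_mem hσ]
        have hk := h.norm_B_le hσ
        rw [abs_of_pos hσ]
        have hk0 := kerBound_nonneg h.M_nonneg κ (le_of_lt hσ)
        exact ((B σ).le_opNorm₂ _ _).trans (mul_le_mul (mul_le_mul hk (hCf _) (norm_nonneg _)
          hk0) (hCg _) (norm_nonneg _) (by positivity))
      · simp only [F, indicator_of_notMem hσ, norm_zero]
        have := kerBound_nonneg h.M_nonneg κ (abs_nonneg σ)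
        have := (norm_nonneg _).trans (hCg 0)
        positivity
    · refine IntervalIntegrable.mul_const (IntervalIntegrable.mul_const ?_ _) _
      have h1 : IntervalIntegrable (fun σ => kerBound M κ |σ|) volume 0 (τ₀ + 1) :=
        (intervalIntegrable_kerBound M κ 0 (τ₀ + 1)).congr (fun σ hσ => by
          rw [uIoc_of_le (by linarith)] at hσ
          simp only [abs_of_pos hσ.1])
      have h2 : IntervalIntegrable (fun σ => kerBound M κ |σ|) volume (-1) 0 := by
        have h3 : IntervalIntegrable (fun σ => kerBound M κ |σ|) volume 0 1 :=
          (intervalIntegrable_kerBound M κ 0 1).congr (fun σ hσ => by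
            rw [uIoc_of_le (by linarith)] at hσ
            simp only [abs_of_pos hσ.1])
        have h4 := h3.comp_sub_left 0
        simp only [zero_sub, abs_neg, neg_zero] at h4
        exact h4.symm
      exact h2.trans h1
    · by_cases hσ : σ ∈ Ioi (0 : ℝ)
      · simp only [F, indicator_of_mem hσ]
        exact h.tendsto_B hσ tendsto_const_nhds
          ((hf.comp (continuous_id.sub continuous_const)).tendsto _)
          ((hg.comp (continuous_id.sub continuous_const)).tendsto _)
      · simp only [F, indicator_of_notMem hσ]
        exact continuousAt_const
    · exact measure_singleton _
  have h2 : ContinuousAt (fun τ => ∫ σ in (0 : ℝ)..τ, F τ σ) τ₀ :=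
    ContinuousAt.comp (f := fun τ : ℝ => (τ, τ)) key (by fun_prop)
  have h3 : ∀ τ ∈ Ici (0 : ℝ), duhamel B f g τ = ∫ σ in (0 : ℝ)..τ, F τ σ := by
    intro τ hτ
    have h4 := intervalIntegral.integral_comp_sub_left (a := 0) (b := τ)
      (fun σ => B σ (f (τ - σ)) (g (τ - σ))) τ
    simp only [sub_sub_cancel, sub_self, sub_zero] at h4
    rw [duhamel, h4]
    refine intervalIntegral.integral_congr_ae (Eventually.of_forall fun σ hσ => ?_)
    rw [uIoc_of_le hτ] at hσ
    simp only [F]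
    rw [indicator_of_mem (show σ ∈ Ioi (0 : ℝ) from hσ.1)]
  exact h2.continuousWithinAt.congr h3 (h3 τ₀ hτ₀)

end SmoothingPair
end Duhamel

/-! ### A Gronwall inequality with singular kernel. -/

section Gronwall

/-- Conjugation with the weight e^(lτ) multiplies the kernel by e^(-lσ), and the integral of the
product tends to zero as l grows, by dominated convergence. -/
theorem exists_exp_weight {M : ℝ} (hM : 0 ≤ M) (κ : ℝ) {T η : ℝ} (hT : 0 ≤ T) (hη : 0 < η) :
    ∃ l : ℝ, 0 ≤ l ∧ ∀ τ ∈ Icc 0 T, ∀ D : ℝ, 0 ≤ D → ∀ φ : ℝ → ℝ, ContinuousOn φ (Icc 0 τ) →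
      (∀ s ∈ Icc 0 τ, φ s ≤ D * Real.exp (l * s)) →
      ∫ s in (0 : ℝ)..τ, kerBound M κ (τ - s) * φ s ≤ η * D * Real.exp (l * τ) := by
  have hlim : Tendsto (fun l : ℝ => ∫ σ in (0 : ℝ)..T, kerBound M κ σ * Real.exp (-(l * σ))) atTop
      (𝓝 (∫ _ in (0 : ℝ)..T, (0 : ℝ))) := by
    refine intervalIntegral.tendsto_integral_filter_of_dominated_convergence (kerBound M κ)
      (Eventually.of_forall fun l => ?_) ?_ (intervalIntegrable_kerBound M κ 0 T) ?_
    · exact ((intervalIntegrable_kerBound M κ 0 T).def'.aestronglyMeasurable).mul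
        (by fun_prop : Continuous fun σ : ℝ => Real.exp (-(l * σ))).aestronglyMeasurable
    · filter_upwards [eventually_ge_atTop 0] with l hl
      refine Eventually.of_forall fun σ hσ => ?_
      rw [uIoc_of_le hT] at hσ
      have h1 := kerBound_nonneg hM κ hσ.1.le
      rw [Real.norm_eq_abs, abs_of_nonneg (by positivity)]
      refine mul_le_of_le_one_right h1 (Real.exp_le_one_iff.2 ?_)
      have := mul_nonneg hl hσ.1.le
      linarith
    · refine Eventually.of_forall fun σ hσ => ?_
      rw [uIoc_of_le hT] at hσ
      have h1 : Tendsto (fun l : ℝ => Real.exp (-(l * σ))) atTop (𝓝 0) :=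
        Real.tendsto_exp_neg_atTop_nhds_zero.comp (tendsto_id.atTop_mul_const hσ.1)
      simpa using h1.const_mul (kerBound M κ σ)
  rw [intervalIntegral.integral_zero] at hlim
  obtain ⟨l, hl0, hl⟩ := ((eventually_ge_atTop 0).and (hlim.eventually (gt_mem_nhds hη))).exists
  refine ⟨l, hl0, fun τ hτ D hD φ hφ hle => ?_⟩
  have hker : IntervalIntegrable (fun σ => kerBound M κ σ * Real.exp (-(l * σ))) volume 0 T :=
    (intervalIntegrable_kerBound M κ 0 T).mul_continuousOn (by fun_prop)
  have h1 : ∫ s in (0 : ℝ)..τ, kerBound M κ (τ - s) * φ s ≤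
      ∫ s in (0 : ℝ)..τ, kerBound M κ (τ - s) * (D * Real.exp (l * s)) := by
    refine intervalIntegral.integral_mono_on hτ.1 ?_ ?_ fun s hs => ?_
    · exact (SmoothingPair.intervalIntegrable_kerBound_sub M κ τ 0 τ).mul_continuousOn
        (by rwa [uIcc_of_le hτ.1])
    · exact (SmoothingPair.intervalIntegrable_kerBound_sub M κ τ 0 τ).mul_continuousOn
        (by fun_prop)
    · exact mul_le_mul_of_nonneg_left (hle s hs) (kerBound_nonneg hM κ (sub_nonneg.2 hs.2))
  have h2 : ∫ s in (0 : ℝ)..τ, kerBound M κ (τ - s) * (D * Real.exp (l * s)) =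
      D * Real.exp (l * τ) * ∫ σ in (0 : ℝ)..τ, kerBound M κ σ * Real.exp (-(l * σ)) := by
    have h4 := intervalIntegral.integral_comp_sub_left (a := 0) (b := τ)
      (fun σ => kerBound M κ σ * Real.exp (-(l * σ))) τ
    simp only [sub_self, sub_zero] at h4
    rw [← h4, ← intervalIntegral.integral_const_mul]
    refine intervalIntegral.integral_congr fun s _ => ?_
    have : Real.exp (l * s) = Real.exp (l * τ) * Real.exp (-(l * (τ - s))) := by
      rw [← Real.exp_add]; congr 1; ring
    rw [this]; ring
  have h3 : ∫ σ in (0 : ℝ)..τ, kerBound M κ σ * Real.exp (-(l * σ)) ≤ η := by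
    refine le_trans ?_ hl.le
    refine intervalIntegral.integral_mono_interval le_rfl hτ.1 hτ.2 ?_ hker
    filter_upwards [self_mem_ae_restrict measurableSet_Ioc] with σ hσ
    have := kerBound_nonneg hM κ hσ.1.le
    simp only [Pi.zero_apply]
    positivity
  calc _ ≤ _ := h1
    _ = _ := h2
    _ ≤ D * Real.exp (l * τ) * η := mul_le_mul_of_nonneg_left h3 (by positivity)
    _ = _ := by ring

/-- The inequality is evaluated where d(s) e^(-ls) is maximal; with `l` chosen for the factor
1/(2(L+1)) the integral term is at most half of the left side. The constant does not depend on the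
shorter time `T'`, on `d` or on `A`. -/
theorem exists_gronwall {M : ℝ} (hM : 0 ≤ M) (κ : ℝ) {T L : ℝ} (hT : 0 ≤ T) (hL : 0 ≤ L) :
    ∃ C : ℝ, 0 ≤ C ∧ ∀ T' ∈ Icc 0 T, ∀ d : ℝ → ℝ, ∀ A : ℝ, 0 ≤ A → ContinuousOn d (Icc 0 T') →
      (∀ s ∈ Icc 0 T', 0 ≤ d s) →
      (∀ τ ∈ Icc 0 T', d τ ≤ A + L * ∫ s in (0 : ℝ)..τ, kerBound M κ (τ - s) * d s) →
      ∀ τ ∈ Icc 0 T', d τ ≤ C * A := by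
  obtain ⟨l, hl, hw⟩ := exists_exp_weight hM κ (η := 1 / (2 * (L + 1))) hT (by positivity)
  refine ⟨2 * Real.exp (l * T), by positivity, fun T' hT' d A hA hd hd0 h τ hτ => ?_⟩
  obtain ⟨σ, hσ, hmax⟩ := isCompact_Icc.exists_isMaxOn ⟨0, le_rfl, hT'.1⟩
    (hd.mul (by fun_prop : ContinuousOn (fun s => Real.exp (-(l * s))) (Icc 0 T')))
  set D := d σ * Real.exp (-(l * σ)) with hD
  have hD0 : 0 ≤ D := mul_nonneg (hd0 σ hσ) (Real.exp_pos _).le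
  have hle : ∀ s ∈ Icc 0 T', d s ≤ D * Real.exp (l * s) := by
    intro s hs
    have h1 : d s * Real.exp (-(l * s)) ≤ D := hmax hs
    calc d s = d s * Real.exp (-(l * s)) * Real.exp (l * s) := by
          rw [mul_assoc, ← Real.exp_add]; simp
      _ ≤ _ := mul_le_mul_of_nonneg_right h1 (Real.exp_pos _).le
  have h1 := hw σ ⟨hσ.1, hσ.2.trans hT'.2⟩ D hD0 d (hd.mono (Icc_subset_Icc_right hσ.2))
    fun s hs => hle s ⟨hs.1, hs.2.trans hσ.2⟩
  have h2 := h σ hσ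
  have h3 : L * (1 / (2 * (L + 1)) * D * Real.exp (l * σ)) ≤ 1 / 2 * (D * Real.exp (l * σ)) := by
    have : L * (1 / (2 * (L + 1))) ≤ 1 / 2 := by
      rw [mul_one_div, div_le_div_iff₀ (by positivity) (by norm_num)]; linarith
    calc _ = L * (1 / (2 * (L + 1))) * (D * Real.exp (l * σ)) := by ring
      _ ≤ _ := mul_le_mul_of_nonneg_right this (by positivity)
  have h4 := mul_le_mul_of_nonneg_left h1 hL
  have h5 : d σ = D * Real.exp (l * σ) := by
    rw [hD, mul_assoc, ← Real.exp_add]; simp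
  have h6 : D * Real.exp (l * σ) ≤ 2 * A := by linarith
  have h7 : D ≤ 2 * A := by
    refine le_trans ?_ h6
    exact le_mul_of_one_le_right hD0 (Real.one_le_exp (mul_nonneg hl hσ.1))
  calc d τ ≤ D * Real.exp (l * τ) := hle τ hτ
    _ ≤ 2 * A * Real.exp (l * T) := mul_le_mul h7 (Real.exp_le_exp.2
      (mul_le_mul_of_nonneg_left (hτ.2.trans hT'.2) hl)) (Real.exp_pos _).le (by positivity)
    _ = _ := by ring

end Gronwall


/-! ### Uniqueness, Lipschitz dependence and restarting of solutions. -/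

section Solutions

variable {X : Type*} [NormedAddCommGroup X] [NormedSpace ℝ X]

/-- `w` solves `w(τ) = S(τ) w(0) + ∫₀^τ B(τ - s) (p (w s)) (w s) ds` on `[0, T]`. -/
def SolOn (S : ℝ → X →L[ℝ] X) (B : ℝ → X →L[ℝ] X →L[ℝ] X) (p : X → X) (T : ℝ) (w : ℝ → X) : Prop :=
  ContinuousOn w (Icc 0 T) ∧
    ∀ τ ∈ Icc 0 T, w τ = S τ (w 0) + duhamel B (fun s => p (w s)) w τ

/-- The quadratic nonlinearity `b (p x) x` is Lipschitz on `D`, uniformly in `‖b‖ ≤ 1`. -/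
def BilLipOn (p : X → X) (D : Set X) (L : ℝ) : Prop :=
  ∀ x ∈ D, ∀ y ∈ D, ∀ b : X →L[ℝ] X →L[ℝ] X, ‖b (p x) x - b (p y) y‖ ≤ ‖b‖ * (L * ‖x - y‖)

variable {S : ℝ → X →L[ℝ] X} {B : ℝ → X →L[ℝ] X →L[ℝ] X} {M κ : ℝ} {p : X → X}

theorem SolOn.mono {T T' : ℝ} {w : ℝ → X} (hw : SolOn S B p T w) (h : T' ≤ T) :
    SolOn S B p T' w :=
  ⟨hw.1.mono (Icc_subset_Icc_right h), fun τ hτ => hw.2 τ ⟨hτ.1, hτ.2.trans h⟩⟩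

theorem duhamel_congr {f g f' g' : ℝ → X} {τ : ℝ} (hτ : 0 ≤ τ) (hf : EqOn f f' (Icc 0 τ))
    (hg : EqOn g g' (Icc 0 τ)) : duhamel B f g τ = duhamel B f' g' τ := by
  refine intervalIntegral.integral_congr fun s hs => ?_
  rw [uIcc_of_le hτ] at hs
  simp only [hf hs, hg hs]

theorem SolOn.congr {T : ℝ} {w w' : ℝ → X} {p' : X → X} (hw : SolOn S B p T w)
    (h : EqOn w' w (Icc 0 T)) (hp : ∀ τ ∈ Icc 0 T, p' (w τ) = p (w τ)) : SolOn S B p' T w' := by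
  refine ⟨hw.1.congr h, fun τ hτ => ?_⟩
  have h0 : (0 : ℝ) ∈ Icc 0 T := ⟨le_rfl, hτ.1.trans hτ.2⟩
  rw [h hτ, h h0, hw.2 τ hτ]
  congr 1
  refine duhamel_congr hτ.1 (fun s hs => ?_) (fun s hs => (h ⟨hs.1, hs.2.trans hτ.2⟩).symm)
  simp only [h ⟨hs.1, hs.2.trans hτ.2⟩, hp s ⟨hs.1, hs.2.trans hτ.2⟩]

namespace SmoothingPair

/-- The order of the quantifiers matters: `C` depends on `T` and on the upper bound `L₀`, but not on
the nonlinearity. The deviation from the linear flow then has the Lipschitz constant `L * C`, which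
is small together with `L`; the truncation radius may thus be chosen after the time step. -/
theorem SolOn_sub_le (h : SmoothingPair S B M κ) {T L₀ : ℝ} (hT : 0 ≤ T) (hL₀ : 0 ≤ L₀) :
    ∃ C : ℝ, 0 ≤ C ∧ ∀ (p : X → X) (D : Set X) (L : ℝ), Continuous p → 0 ≤ L → L ≤ L₀ →
      BilLipOn p D L → ∀ T' ∈ Icc 0 T, ∀ w w' : ℝ → X, SolOn S B p T' w → SolOn S B p T' w' →
      (∀ s ∈ Icc 0 T', w s ∈ D) → (∀ s ∈ Icc 0 T', w' s ∈ D) → ∀ τ ∈ Icc 0 T',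
        ‖w τ - w' τ‖ ≤ C * ‖w 0 - w' 0‖ ∧
        ‖(w τ - S τ (w 0)) - (w' τ - S τ (w' 0))‖ ≤ L * C * ‖w 0 - w' 0‖ := by
  obtain ⟨C, hC, hG⟩ := exists_gronwall h.M_nonneg κ hT hL₀
  have hM := h.M_nonneg
  have hκ := h.κ_nonneg
  set N := M * Real.exp (κ * T) with hN
  have hN0 : 0 ≤ N := by positivity
  set J := ∫ s in (0 : ℝ)..T, kerBound M κ s with hJ
  have hJ0 : 0 ≤ J := intervalIntegral.integral_nonneg hT fun s hs => kerBound_nonneg hM κ hs.1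
  refine ⟨C * N + J * (C * N), by positivity, ?_⟩
  intro p D L hp hL hLL hD T' hT' w w' hw hw' hwD hwD'
  have h0 : (0 : ℝ) ∈ Icc 0 T' := ⟨le_rfl, hT'.1⟩
  have hd : ContinuousOn (fun s => ‖w s - w' s‖) (Icc 0 T') := (hw.1.sub hw'.1).norm
  have hS : ∀ τ ∈ Icc 0 T', ‖S τ (w 0) - S τ (w' 0)‖ ≤ N * ‖w 0 - w' 0‖ := by
    intro τ hτ
    rw [← map_sub]
    refine ContinuousLinearMap.le_of_opNorm_le _ ((h.S_norm τ hτ.1).trans ?_) _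
    exact mul_le_mul_of_nonneg_left (Real.exp_le_exp.2
      (mul_le_mul_of_nonneg_left (hτ.2.trans hT'.2) hκ)) hM
  have hdiff : ∀ τ ∈ Icc 0 T', ‖(w τ - S τ (w 0)) - (w' τ - S τ (w' 0))‖ ≤
      L * ∫ s in (0 : ℝ)..τ, kerBound M κ (τ - s) * ‖w s - w' s‖ := by
    intro τ hτ
    have hsub : Icc 0 τ ⊆ Icc 0 T' := Icc_subset_Icc_right hτ.2
    rw [hw.2 τ hτ, hw'.2 τ hτ, add_sub_cancel_left, add_sub_cancel_left,
      ← intervalIntegral.integral_const_mul]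
    refine (h.norm_duhamel_sub_le (φ := fun s => L * ‖w s - w' s‖) hτ.1
      (hp.comp_continuousOn (hw.1.mono hsub))
      (hw.1.mono hsub) (hp.comp_continuousOn (hw'.1.mono hsub)) (hw'.1.mono hsub)
      (continuousOn_const.mul (hd.mono hsub)) (fun s _ => by positivity)
      fun s hs b => hD _ (hwD s (hsub hs)) _ (hwD' s (hsub hs)) b).trans (le_of_eq ?_)
    exact intervalIntegral.integral_congr fun s _ => by ring
  have hint0 : ∀ τ ∈ Icc 0 T', 0 ≤ ∫ s in (0 : ℝ)..τ, kerBound M κ (τ - s) * ‖w s - w' s‖ :=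
    fun τ hτ => intervalIntegral.integral_nonneg hτ.1 fun s hs =>
      mul_nonneg (kerBound_nonneg hM κ (sub_nonneg.2 hs.2)) (norm_nonneg _)
  have key := hG T' hT' _ (N * ‖w 0 - w' 0‖) (by positivity) hd (fun _ _ => norm_nonneg _)
    fun τ hτ => by
      have h1 := hdiff τ hτ
      have h2 := mul_le_mul_of_nonneg_right hLL (hint0 τ hτ)
      have h3 := hS τ hτ
      have h4 : w τ - w' τ = (S τ (w 0) - S τ (w' 0)) +
        ((w τ - S τ (w 0)) - (w' τ - S τ (w' 0))) := by abel
      have h5 := norm_add_le (S τ (w 0) - S τ (w' 0)) ((w τ - S τ (w 0)) - (w' τ - S τ (w' 0)))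
      rw [← h4] at h5
      linarith
  intro τ hτ
  have h0' := norm_nonneg (w 0 - w' 0)
  refine ⟨(key τ hτ).trans ?_, (hdiff τ hτ).trans ?_⟩
  · have : 0 ≤ J * (C * N) * ‖w 0 - w' 0‖ := by positivity
    linarith
  · rw [mul_assoc]
    refine mul_le_mul_of_nonneg_left ?_ hL
    have hk1 : IntervalIntegrable (fun s => kerBound M κ (τ - s)) volume 0 τ :=
      intervalIntegrable_kerBound_sub M κ τ 0 τ
    calc ∫ s in (0 : ℝ)..τ, kerBound M κ (τ - s) * ‖w s - w' s‖
        ≤ ∫ s in (0 : ℝ)..τ, kerBound M κ (τ - s) * (C * (N * ‖w 0 - w' 0‖)) := by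
          refine intervalIntegral.integral_mono_on hτ.1 ?_ (hk1.mul_const _) fun s hs => ?_
          · exact hk1.mul_continuousOn (by
              rw [uIcc_of_le hτ.1]; exact hd.mono (Icc_subset_Icc_right hτ.2))
          · exact mul_le_mul_of_nonneg_left (key s ⟨hs.1, hs.2.trans hτ.2⟩)
              (kerBound_nonneg hM κ (sub_nonneg.2 hs.2))
      _ = (∫ s in (0 : ℝ)..τ, kerBound M κ s) * (C * (N * ‖w 0 - w' 0‖)) := by
          rw [intervalIntegral.integral_mul_const]
          congr 1
          simp
      _ ≤ J * (C * (N * ‖w 0 - w' 0‖)) := by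
          refine mul_le_mul_of_nonneg_right ?_ (by positivity)
          refine intervalIntegral.integral_mono_interval le_rfl hτ.1 (hτ.2.trans hT'.2) ?_
            (intervalIntegrable_kerBound M κ 0 T)
          filter_upwards [self_mem_ae_restrict measurableSet_Ioc] with σ hσ
          exact kerBound_nonneg hM κ hσ.1.le
      _ ≤ _ := by
          have : 0 ≤ C * N * ‖w 0 - w' 0‖ := by positivity
          linarith

theorem SolOn_eqOn (h : SmoothingPair S B M κ) (hp : Continuous p) {D : Set X} {L T : ℝ}
    (hL : 0 ≤ L) (hD : BilLipOn p D L) {w w' : ℝ → X} (hw : SolOn S B p T w)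
    (hw' : SolOn S B p T w') (hwD : ∀ s ∈ Icc 0 T, w s ∈ D) (hwD' : ∀ s ∈ Icc 0 T, w' s ∈ D)
    (h0 : w 0 = w' 0) : EqOn w w' (Icc 0 T) := by
  intro τ hτ
  have hT : 0 ≤ T := hτ.1.trans hτ.2
  obtain ⟨C, -, hC⟩ := h.SolOn_sub_le hT hL
  have := (hC p D L hp hL le_rfl hD T ⟨hT, le_rfl⟩ w w' hw hw' hwD hwD' τ hτ).1
  rw [h0, sub_self, norm_zero, mul_zero] at this
  exact sub_eq_zero.1 (norm_le_zero_iff.1 this)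

/-- By the relations of `S` with itself and with `B`, applying `S τ` to the solution at time a
produces the part of the later Duhamel integral over [0, a]. The point s = a has to be discarded,
since `S_B` is available for positive times only. -/
theorem SolOn_shift [CompleteSpace X] (h : SmoothingPair S B M κ) (hp : Continuous p) {T a : ℝ}
    {w : ℝ → X}
    (hw : SolOn S B p T w) (ha : 0 ≤ a) : SolOn S B p (T - a) fun τ => w (a + τ) := by
  refine ⟨hw.1.comp (by fun_prop) fun s hs => ⟨by linarith [hs.1], by linarith [hs.2]⟩,
    fun τ hτ => ?_⟩
  have hcw : ∀ t ∈ Icc 0 T, IntervalIntegrable (fun s => B (t - s) (p (w s)) (w s)) volume 0 t :=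
    fun t ht => h.intervalIntegrable_B ht.1
      (hp.comp_continuousOn (hw.1.mono (Icc_subset_Icc_right ht.2)))
      (hw.1.mono (Icc_subset_Icc_right ht.2))
  have hτ0 := hτ.1
  have haT : a ∈ Icc 0 T := ⟨ha, by linarith [hτ.2]⟩
  have haτ : a + τ ∈ Icc 0 T := ⟨by linarith, by linarith [hτ.2]⟩
  simp only [add_zero]
  rw [hw.2 _ haτ, hw.2 a haT, map_add, ← h.S_add τ a hτ0 ha, add_comm τ a, add_assoc]
  congr 1
  have h1 : S τ (duhamel B (fun s => p (w s)) w a) =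
      ∫ s in (0 : ℝ)..a, B (a + τ - s) (p (w s)) (w s) := by
    unfold duhamel
    rw [← (S τ).intervalIntegral_comp_comm (hcw a haT)]
    refine intervalIntegral.integral_congr_ae ?_
    have : ∀ᵐ s : ℝ ∂volume, s ≠ a := by
      rw [ae_iff]; simp
    filter_upwards [this] with s hs hs'
    rw [uIoc_of_le ha] at hs'
    have : 0 < a - s := sub_pos.2 (lt_of_le_of_ne hs'.2 hs)
    rw [h.S_B τ (a - s) hτ0 this]
    congr 3; ring
  have h2 : duhamel B (fun s => p (w (a + s))) (fun s => w (a + s)) τ =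
      ∫ s in a..a + τ, B (a + τ - s) (p (w s)) (w s) := by
    unfold duhamel
    have := intervalIntegral.integral_comp_add_left (a := 0) (b := τ)
      (fun s => B (a + τ - s) (p (w s)) (w s)) a
    rw [add_zero] at this
    rw [← this]
    refine intervalIntegral.integral_congr fun s _ => ?_
    simp only [add_sub_add_left_eq_sub]
  rw [h1, h2]
  unfold duhamel
  have h3 := hcw _ haτ
  refine (intervalIntegral.integral_add_adjacent_intervals (h3.mono_set ?_) (h3.mono_set ?_)).symm
  · rw [uIcc_of_le ha, uIcc_of_le haτ.1]; exact Icc_subset_Icc_right (by linarith)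
  · rw [uIcc_of_le (by linarith), uIcc_of_le haτ.1]; exact Icc_subset_Icc_left ha

end SmoothingPair
end Solutions

/-! ### Global solutions and smooth time maps. -/

section Existence

variable {X : Type*} [NormedAddCommGroup X]

/-- Constant extension of a path on `[0, T]` to the line. -/
noncomputable def extPath {T : ℝ} (hT : 0 ≤ T) (u : C(Icc (0 : ℝ) T, X)) (s : ℝ) : X := u (projIcc 0 T hT s)

theorem continuous_extPath {T : ℝ} (hT : 0 ≤ T) (u : C(Icc (0 : ℝ) T, X)) :
    Continuous (extPath hT u) := u.continuous.comp continuous_projIcc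

theorem norm_extPath_le {T : ℝ} (hT : 0 ≤ T) (u : C(Icc (0 : ℝ) T, X)) (s : ℝ) :
    ‖extPath hT u s‖ ≤ ‖u‖ := u.norm_coe_le_norm _

theorem extPath_of_mem {T : ℝ} (hT : 0 ≤ T) (u : C(Icc (0 : ℝ) T, X)) {s : ℝ} (hs : s ∈ Icc 0 T) :
    extPath hT u s = u ⟨s, hs⟩ := by rw [extPath, projIcc_of_mem hT hs]

variable [NormedSpace ℝ X] {S : ℝ → X →L[ℝ] X} {B : ℝ → X →L[ℝ] X →L[ℝ] X} {M κ : ℝ} {p : X → X}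

namespace SmoothingPair

/-- The path `τ ↦ S τ x`. -/
noncomputable def semigroupPath (h : SmoothingPair S B M κ) (T : ℝ) :
    X →L[ℝ] C(Icc (0 : ℝ) T, X) :=
  LinearMap.mkContinuous
    { toFun := fun x => (⟨fun τ => S τ x, ((h.S_cont x).mono fun _ hx => hx.1).domRestrict⟩ :
        C(Icc (0 : ℝ) T, X))
      map_add' := fun x y => by ext τ; exact map_add (S τ) x y
      map_smul' := fun c x => by ext τ; exact map_smul (S τ) c x } (M * Real.exp (κ * T)) fun x => by
      have hM := h.M_nonneg
      refine (ContinuousMap.norm_le _ (by positivity)).2 fun τ => ?_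
      exact ContinuousLinearMap.le_of_opNorm_le _ ((h.S_norm τ τ.2.1).trans
        (mul_le_mul_of_nonneg_left (Real.exp_le_exp.2
        (mul_le_mul_of_nonneg_left τ.2.2 h.κ_nonneg)) hM)) _

variable [CompleteSpace X]

/-- The Duhamel integral as a bounded bilinear map on paths. -/
noncomputable def duhamelPath (h : SmoothingPair S B M κ) {T : ℝ} (hT : 0 ≤ T) :
    C(Icc (0 : ℝ) T, X) →L[ℝ] C(Icc (0 : ℝ) T, X) →L[ℝ] C(Icc (0 : ℝ) T, X) :=
  have hi : ∀ (u v : C(Icc (0 : ℝ) T, X)) (τ : Icc (0 : ℝ) T), IntervalIntegrable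
      (fun s => B (τ - s) (extPath hT u s) (extPath hT v s)) volume 0 τ := fun u v τ =>
    h.intervalIntegrable_B τ.2.1 (continuous_extPath hT u).continuousOn
      (continuous_extPath hT v).continuousOn
  LinearMap.mkContinuous₂ (LinearMap.mk₂ ℝ (fun (u v : C(Icc (0 : ℝ) T, X)) =>
      (⟨fun τ => duhamel B (extPath hT u) (extPath hT v) τ,
        ((h.continuousOn_duhamel (continuous_extPath hT u) (continuous_extPath hT v)
          (norm_extPath_le hT u) (norm_extPath_le hT v)).mono
          (fun _ hx => hx.1)).domRestrict⟩ : C(Icc (0 : ℝ) T, X)))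
    (fun u u' v => by
      ext τ
      simp only [ContinuousMap.coe_mk, ContinuousMap.add_apply, duhamel]
      rw [← intervalIntegral.integral_add (hi u v τ) (hi u' v τ)]
      simp [extPath])
    (fun c u v => by
      ext τ
      simp only [ContinuousMap.coe_mk, ContinuousMap.smul_apply, duhamel]
      rw [← intervalIntegral.integral_smul]
      simp [extPath])
    (fun u v v' => by
      ext τ
      simp only [ContinuousMap.coe_mk, ContinuousMap.add_apply, duhamel]
      rw [← intervalIntegral.integral_add (hi u v τ) (hi u v' τ)]
      simp [extPath])
    (fun c u v => by
      ext τ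
      simp only [ContinuousMap.coe_mk, ContinuousMap.smul_apply, duhamel]
      rw [← intervalIntegral.integral_smul]
      simp [extPath]))
    (∫ s in (0 : ℝ)..T, kerBound M κ s) fun u v => by
      have hM := h.M_nonneg
      have hJ : 0 ≤ ∫ s in (0 : ℝ)..T, kerBound M κ s :=
        intervalIntegral.integral_nonneg hT fun s hs => kerBound_nonneg hM κ hs.1
      refine (ContinuousMap.norm_le _ (by positivity)).2 fun τ => ?_
      have h1 := h.norm_duhamel_sub_le (φ := fun _ => ‖u‖ * ‖v‖) τ.2.1
        (continuous_extPath hT u).continuousOn (continuous_extPath hT v).continuousOn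
        (f' := fun _ => 0) (g' := fun _ => 0) continuousOn_const continuousOn_const
        continuousOn_const (fun _ _ => by positivity) (fun s _ b => by
          rw [map_zero, sub_zero, ← mul_assoc]
          refine (b.le_opNorm₂ _ _).trans ?_
          gcongr
          · exact norm_extPath_le hT u s
          · exact norm_extPath_le hT v s)
      have h2 : duhamel B (fun _ => (0 : X)) (fun _ => (0 : X)) (τ : ℝ) = 0 := by simp [duhamel]
      rw [h2, sub_zero, intervalIntegral.integral_mul_const] at h1
      refine h1.trans ?_
      rw [mul_assoc]
      refine mul_le_mul_of_nonneg_right ?_ (by positivity)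
      have h3 : ∫ s in (0 : ℝ)..τ, kerBound M κ (τ - s) = ∫ s in (0 : ℝ)..τ, kerBound M κ s := by
        simp
      rw [h3]
      refine intervalIntegral.integral_mono_interval le_rfl τ.2.1 τ.2.2 ?_
            (intervalIntegrable_kerBound M κ 0 T)
      filter_upwards [self_mem_ae_restrict measurableSet_Ioc] with σ hσ
      exact kerBound_nonneg hM κ hσ.1.le

theorem duhamelPath_apply (h : SmoothingPair S B M κ) {T : ℝ} (hT : 0 ≤ T)
    (u v : C(Icc (0 : ℝ) T, X)) (τ : Icc (0 : ℝ) T) :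
    h.duhamelPath hT u v τ = duhamel B (extPath hT u) (extPath hT v) τ := rfl

/-- The contraction works on all of [0, T] at once in an exponentially weighted norm. The weight is
built into the unknown, e^(-lτ) w(τ), so that the fixed point is found in the usual space of
continuous paths. -/
theorem exists_solOn (h : SmoothingPair S B M κ) (hp : Continuous p) {L : ℝ}
    (hL : 0 ≤ L) (hpL : BilLipOn p univ L) {T : ℝ} (hT : 0 ≤ T) (x : X) :
    ∃ w, SolOn S B p T w ∧ w 0 = x := by
  obtain ⟨l, hl, hw⟩ := exists_exp_weight h.M_nonneg κ (T := T) (η := 1 / (2 * (L + 1))) hT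
    (by positivity)
  let E := C(Icc (0 : ℝ) T, X)
  let m : ℝ → C(Icc (0 : ℝ) T, ℝ) := fun a => ⟨fun τ => Real.exp (a * τ), by fun_prop⟩
  let p' : C(X, X) := ⟨p, hp⟩
  let Ψ : E → E := fun u => m (-l) • (h.semigroupPath T x +
    h.duhamelPath hT (p'.comp (m l • u)) (m l • u))
  have hm : ∀ (a : ℝ) (u : E) (τ : Icc (0 : ℝ) T), (m a • u) τ = Real.exp (a * τ) • u τ :=
    fun a u τ => rfl
  have hmm : ∀ u : E, m l • m (-l) • u = u := fun u => by
    ext τ; rw [hm, hm, smul_smul, ← Real.exp_add]; simp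
  have hc : ContractingWith (1 / 2) Ψ := by
    refine ⟨by rw [← NNReal.coe_lt_coe]; norm_num, LipschitzWith.of_dist_le_mul fun u v => ?_⟩
    rw [dist_eq_norm, dist_eq_norm]
    refine (ContinuousMap.norm_le _ (by positivity)).2 fun τ => ?_
    have h1 : (Ψ u - Ψ v) τ = Real.exp (-l * τ) •
      (h.duhamelPath hT (p'.comp (m l • u)) (m l • u) τ -
        h.duhamelPath hT (p'.comp (m l • v)) (m l • v) τ) := by
      rw [ContinuousMap.sub_apply, hm, hm, ← smul_sub]
      congr 1
      exact add_sub_add_left_eq_sub _ _ (h.semigroupPath T x τ)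
    have hcont : ContinuousOn (fun s => L * ‖extPath hT (m l • u) s - extPath hT (m l • v) s‖)
        (Icc 0 (τ : ℝ)) :=
      (continuous_const.mul ((continuous_extPath hT _).sub
        (continuous_extPath hT _)).norm).continuousOn
    have h2 := h.norm_duhamel_sub_le
      (φ := fun s => L * ‖extPath hT (m l • u) s - extPath hT (m l • v) s‖) τ.2.1
        (continuous_extPath hT (p'.comp (m l • u))).continuousOn
        (continuous_extPath hT (m l • u)).continuousOn
        (continuous_extPath hT (p'.comp (m l • v))).continuousOn
        (continuous_extPath hT (m l • v)).continuousOn hcont (fun _ _ => by positivity)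
        (fun s _ b => hpL _ (mem_univ _) _ (mem_univ _) b)
    have h3 := hw τ τ.2 (L * ‖u - v‖) (by positivity) _ hcont fun s hs => by
      have hs' : s ∈ Icc 0 T := ⟨hs.1, hs.2.trans τ.2.2⟩
      rw [extPath_of_mem hT _ hs', extPath_of_mem hT _ hs', hm, hm, ← smul_sub, norm_smul,
        Real.norm_eq_abs, Real.abs_exp, mul_assoc L, mul_comm (Real.exp _)]
      exact mul_le_mul_of_nonneg_left (mul_le_mul_of_nonneg_right
        ((u - v).norm_coe_le_norm ⟨s, hs'⟩) (Real.exp_pos _).le) hL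
    rw [h1, norm_smul, Real.norm_eq_abs, Real.abs_exp, duhamelPath_apply, duhamelPath_apply]
    have h4 := mul_le_mul_of_nonneg_left (h2.trans h3) (Real.exp_pos (-l * τ)).le
    refine h4.trans ?_
    have h5 : L * (1 / (2 * (L + 1))) ≤ 1 / 2 := by
      rw [mul_one_div, div_le_div_iff₀ (by positivity) (by norm_num)]; linarith
    have h6 : Real.exp (-l * τ) * Real.exp (l * τ) = 1 := by rw [← Real.exp_add]; simp
    calc _ = (L * (1 / (2 * (L + 1)))) * ‖u - v‖ * (Real.exp (-l * τ) * Real.exp (l * τ)) := by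
          ring
      _ ≤ _ := by
          rw [h6, mul_one]
          have := mul_le_mul_of_nonneg_right h5 (norm_nonneg (u - v))
          simpa using this
  set u := hc.fixedPoint with hu
  have hfix : Ψ u = u := hc.fixedPoint_isFixedPt
  let w := extPath hT (m l • u)
  have hweq : m l • u = h.semigroupPath T x +
      h.duhamelPath hT (p'.comp (m l • u)) (m l • u) := by
    nth_rewrite 1 [← hfix]
    exact hmm _
  have hw0 : ∀ τ, ∀ hτ : τ ∈ Icc 0 T, w τ = S τ x + duhamel B (fun s => p (w s)) w τ := by
    intro τ hτ
    change extPath hT (m l • u) τ = _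
    rw [extPath_of_mem hT _ hτ, hweq]
    rfl
  have hw00 : w 0 = x := by
    rw [hw0 0 ⟨le_rfl, hT⟩, h.S_zero]; simp [duhamel]
  exact ⟨w, ⟨(continuous_extPath hT _).continuousOn, fun τ hτ => by rw [hw00]; exact hw0 τ hτ⟩, hw00⟩

theorem exists_global_sol (h : SmoothingPair S B M κ) (hp : Continuous p) {L : ℝ}
    (hL : 0 ≤ L) (hpL : BilLipOn p univ L) (x : X) :
    ∃ w, (∀ T, 0 ≤ T → SolOn S B p T w) ∧ w 0 = x := by
  have hex := fun n : ℕ => h.exists_solOn hp hL hpL (T := (n : ℝ)) n.cast_nonneg x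
  choose W hW hW0 using hex
  have heq : ∀ n k : ℕ, n ≤ k → EqOn (W k) (W n) (Icc 0 n) := fun n k hnk =>
    h.SolOn_eqOn hp hL hpL ((hW k).mono (by exact_mod_cast hnk)) (hW n) (fun _ _ => mem_univ _)
      (fun _ _ => mem_univ _) (by rw [hW0, hW0])
  let w : ℝ → X := fun τ => W ⌈τ⌉₊ τ
  have hw : ∀ n : ℕ, EqOn w (W n) (Icc 0 n) := fun n τ hτ =>
    (heq ⌈τ⌉₊ n (Nat.ceil_le.2 hτ.2) ⟨hτ.1, Nat.le_ceil τ⟩).symm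
  refine ⟨w, fun T hT => ?_, by simp [w, hW0]⟩
  exact ((hW ⌈T⌉₊).congr (hw ⌈T⌉₊) fun _ _ => rfl).mono (Nat.le_ceil T)

/-- The path solves u - K(u) = S(·)x, where K is C¹ on the space of paths by
`contDiff_one_postcomp`. If K has Lipschitz constant 1/2, then u is a C¹ function of the right-hand
side, hence of x; this is the reason for the smallness condition on `L`. -/
theorem exists_contDiff_timeMap (h : SmoothingPair S B M κ) (hp : ContDiff ℝ 1 p) {L : ℝ}
    (hL : 0 ≤ L) (hpL : BilLipOn p univ L) {T : ℝ} (hT : 0 ≤ T)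
    (hLT : L * ∫ s in (0 : ℝ)..T, kerBound M κ s ≤ 1 / 2) :
    ∃ F : X → X, ContDiff ℝ 1 F ∧ ∀ w, SolOn S B p T w → w T = F (w 0) := by
  let p' : C(X, X) := ⟨p, hp.continuous⟩
  let K : C(Icc (0 : ℝ) T, X) → C(Icc (0 : ℝ) T, X) := fun u => h.duhamelPath hT (p'.comp u) u
  have hK : ContDiff ℝ 1 K :=
    ((h.duhamelPath hT).contDiff.comp (contDiff_one_postcomp hp)).clm_apply contDiff_id
  have hKL : LipschitzWith (1 / 2) K := by
    refine LipschitzWith.of_dist_le_mul fun u v => ?_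
    rw [dist_eq_norm, dist_eq_norm]
    refine (ContinuousMap.norm_le _ (by positivity)).2 fun τ => ?_
    have h2 := h.norm_duhamel_sub_le (φ := fun s => L * ‖u - v‖) τ.2.1
        (continuous_extPath hT (p'.comp u)).continuousOn
        (continuous_extPath hT u).continuousOn
        (continuous_extPath hT (p'.comp v)).continuousOn
        (continuous_extPath hT v).continuousOn continuousOn_const (fun _ _ => by positivity)
        (fun s _ b => (hpL _ (mem_univ _) _ (mem_univ _) b).trans
          (mul_le_mul_of_nonneg_left (mul_le_mul_of_nonneg_left
            ((u - v).norm_coe_le_norm _) hL) (norm_nonneg b)))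
    refine h2.trans ?_
    rw [intervalIntegral.integral_mul_const]
    have h3 : ∫ s in (0 : ℝ)..τ, kerBound M κ (τ - s) ≤ ∫ s in (0 : ℝ)..T, kerBound M κ s := by
      have : ∫ s in (0 : ℝ)..τ, kerBound M κ (τ - s) = ∫ s in (0 : ℝ)..τ, kerBound M κ s := by
        simp
      rw [this]
      refine intervalIntegral.integral_mono_interval le_rfl τ.2.1 τ.2.2 ?_
            (intervalIntegrable_kerBound M κ 0 T)
      filter_upwards [self_mem_ae_restrict measurableSet_Ioc] with σ hσ
      exact kerBound_nonneg h.M_nonneg κ hσ.1.le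
    calc _ ≤ (∫ s in (0 : ℝ)..T, kerBound M κ s) * (L * ‖u - v‖) :=
          mul_le_mul_of_nonneg_right h3 (by positivity)
      _ = (L * ∫ s in (0 : ℝ)..T, kerBound M κ s) * ‖u - v‖ := by ring
      _ ≤ 1 / 2 * ‖u - v‖ := mul_le_mul_of_nonneg_right hLT (norm_nonneg _)
      _ = _ := by simp
  obtain ⟨g, hg, hgK⟩ := exists_contDiff_inverse_id_sub hKL hK
  refine ⟨fun x => ContinuousMap.evalCLM ℝ (⟨T, hT, le_rfl⟩ : Icc (0 : ℝ) T)
    (g (h.semigroupPath T x)),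
    (ContinuousLinearMap.contDiff _).comp (hg.comp (h.semigroupPath T).contDiff), fun w hw => ?_⟩
  let w' := extPath hT (g (h.semigroupPath T (w 0)))
  have hw'0 : ∀ τ ∈ Icc 0 T, w' τ = S τ (w 0) + duhamel B (fun s => p (w' s)) w' τ := by
    intro τ hτ
    have h1 := DFunLike.congr_fun (hgK (h.semigroupPath T (w 0))) (⟨τ, hτ⟩ : Icc (0 : ℝ) T)
    rw [ContinuousMap.sub_apply, sub_eq_iff_eq_add] at h1
    change extPath hT _ τ = _
    rw [extPath_of_mem hT _ hτ, h1]
    rfl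
  have hw'00 : w' 0 = w 0 := by
    rw [hw'0 0 ⟨le_rfl, hT⟩, h.S_zero]; simp [duhamel]
  have hw' : SolOn S B p T w' :=
    ⟨(continuous_extPath hT _).continuousOn, fun τ hτ => by rw [hw'00]; exact hw'0 τ hτ⟩
  have h1 := h.SolOn_eqOn hp.continuous hL hpL hw hw' (fun _ _ => mem_univ _)
    (fun _ _ => mem_univ _) hw'00.symm ⟨hT, le_rfl⟩
  rw [h1]
  exact extPath_of_mem hT _ ⟨hT, le_rfl⟩

end SmoothingPair
end Existence

/-! ### Exponential growth rates of backward orbits. -/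

section Rates

variable {X : Type*} [NormedAddCommGroup X]

theorem backwardRate_le {w : ℝ → X} {C μ : ℝ}
    (hw : ∀ τ ≤ 0, ‖w τ‖ ≤ C * Real.exp (μ * |τ|)) : backwardRate w ≤ ((μ : ℝ) : EReal) := by
  set C' := max C 1 with hC'
  have hC1 : 0 < C' := lt_of_lt_of_le one_pos (le_max_right _ _)
  have hlim : Tendsto (fun τ : ℝ => ((1 / |τ| * Real.log C' + μ : ℝ) : EReal)) atBot
      (𝓝 ((μ : ℝ) : EReal)) := by
    refine (continuous_coe_real_ereal.tendsto μ).comp ?_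
    have h1 : Tendsto (fun τ : ℝ => 1 / |τ|) atBot (𝓝 0) := by
      simp only [one_div]
      exact tendsto_inv_atTop_zero.comp tendsto_abs_atBot_atTop
    simpa using (h1.mul_const (Real.log C')).add_const μ
  rw [← hlim.limsup_eq]
  refine limsup_le_limsup ?_
  filter_upwards [eventually_lt_atBot 0] with τ hτ
  have hτ' : 0 < |τ| := abs_pos.2 hτ.ne
  have h1 : ‖w τ‖ₑ ≤ ENNReal.ofReal (C' * Real.exp (μ * |τ|)) := by
    rw [← ofReal_norm]
    exact ENNReal.ofReal_le_ofReal ((hw τ hτ.le).trans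
      (mul_le_mul_of_nonneg_right (le_max_left _ _) (Real.exp_pos _).le))
  have h2 : ENNReal.log ‖w τ‖ₑ ≤ ((Real.log C' + μ * |τ| : ℝ) : EReal) := by
    refine (ENNReal.log_monotone h1).trans (le_of_eq ?_)
    rw [ENNReal.log_ofReal_of_pos (by positivity), Real.log_mul hC1.ne' (Real.exp_pos _).ne',
      Real.log_exp]
  calc ((1 / |τ| : ℝ) : EReal) * ENNReal.log ‖w τ‖ₑ
      ≤ ((1 / |τ| : ℝ) : EReal) * ((Real.log C' + μ * |τ| : ℝ) : EReal) :=
        mul_le_mul_of_nonneg_left h2 (by exact_mod_cast (by positivity : (0 : ℝ) ≤ 1 / |τ|))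
    _ = _ := by
        rw [← EReal.coe_mul]
        congr 1
        field_simp

/-- A limsup at most μ yields an exponential bound only for larger exponents. For this reason the
gap of the time map has to extend strictly beyond `μ₂`. -/
theorem eventually_norm_le_of_backwardRate_le {w : ℝ → X} {μ μ' : ℝ} (hμ : μ < μ')
    (hw : backwardRate w ≤ ((μ : ℝ) : EReal)) :
    ∀ᶠ τ in atBot, ‖w τ‖ ≤ Real.exp (μ' * |τ|) := by
  have h1 : backwardRate w < ((μ' : ℝ) : EReal) := hw.trans_lt (by exact_mod_cast hμ)
  filter_upwards [eventually_lt_of_limsup_lt h1, eventually_lt_atBot 0] with τ hτ hτ0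
  have hτ' : 0 < |τ| := abs_pos.2 hτ0.ne
  rcases eq_or_ne (w τ) 0 with h0 | h0
  · rw [h0, norm_zero]; positivity
  · have hpos : 0 < ‖w τ‖ := norm_pos_iff.2 h0
    rw [← ofReal_norm, ENNReal.log_ofReal_of_pos hpos, ← EReal.coe_mul,
      EReal.coe_lt_coe_iff, one_div, inv_mul_lt_iff₀ hτ'] at hτ
    rw [← Real.log_le_iff_le_exp hpos]
    linarith

end Rates

/-! ### From the time-t₀ map to the semiflow. -/

section GapFlow

variable {X : Type*} [NormedAddCommGroup X] [NormedSpace ℝ X]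

/-- A semiflow whose time-`t₀` map is a small perturbation of a linear map with a spectral gap. -/
structure GapFlow (Φ : ℝ → X → X) (Λ A P : X →L[ℝ] X) (α β q ε t₀ μ₁ μ₂ : ℝ) : Prop where
  zero : ∀ x, Φ 0 x = x
  add : ∀ s t, 0 ≤ s → 0 ≤ t → ∀ x, Φ (s + t) x = Φ s (Φ t x)
  cont : ∀ x, ContinuousOn (fun t => Φ t x) (Ici 0)
  lip : ∀ T, 0 ≤ T → ∃ C, 0 ≤ C ∧ ∀ t ∈ Icc 0 T, ∀ x y, ‖Φ t x - Φ t y‖ ≤ C * ‖x - y‖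
  map_zero : ∀ t, 0 ≤ t → Φ t 0 = 0
  t₀_pos : 0 < t₀
  μ₁_pos : 0 < μ₁
  gap : ∃ μ₂', μ₂ < μ₂' ∧ GapMap Λ A P (fun x => Φ t₀ x - Λ x) α β q ε (Real.exp (μ₁ * t₀))
    (Real.exp (μ₂' * t₀))
  contDiff : ContDiff ℝ 1 (Φ t₀)
  fderiv_zero : fderiv ℝ (fun x => Φ t₀ x - Λ x) 0 = 0

namespace GapFlow

variable {Φ : ℝ → X → X} {Λ A P : X →L[ℝ] X} {α β q ε t₀ μ₁ μ₂ : ℝ}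

theorem iterate (h : GapFlow Φ Λ A P α β q ε t₀ μ₁ μ₂) {y : ℕ → X}
    (hy : ∀ n, Φ t₀ (y (n + 1)) = y n) (n j : ℕ) : Φ (j * t₀) (y (n + j)) = y n := by
  induction j with
  | zero => simp [h.zero]
  | succ j ih =>
    have h1 := h.t₀_pos
    have h2 : ((j + 1 : ℕ) : ℝ) * t₀ = j * t₀ + t₀ := by push_cast; ring
    rw [h2, h.add _ _ (by positivity) h1.le, ← add_assoc, hy, ih]

/-- The upper rate of the gap of the time-`t₀` map. -/
noncomputable def rate (h : GapFlow Φ Λ A P α β q ε t₀ μ₁ μ₂) : ℝ := h.gap.choose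

theorem lt_rate (h : GapFlow Φ Λ A P α β q ε t₀ μ₁ μ₂) : μ₂ < h.rate := h.gap.choose_spec.1

theorem gapMap (h : GapFlow Φ Λ A P α β q ε t₀ μ₁ μ₂) :
    GapMap Λ A P (fun x => Φ t₀ x - Λ x) α β q ε (Real.exp (μ₁ * t₀)) (Real.exp (h.rate * t₀)) :=
  h.gap.choose_spec.2

theorem exists_nat (h : GapFlow Φ Λ A P α β q ε t₀ μ₁ μ₂) (τ : ℝ) : ∃ n : ℕ, -τ ≤ n * t₀ :=
  ⟨⌈-τ / t₀⌉₊, (div_le_iff₀ h.t₀_pos).1 (Nat.le_ceil _)⟩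

theorem negSemiOrbit_succ (h : GapFlow Φ Λ A P α β q ε t₀ μ₁ μ₂) {w : ℝ → X}
    (hw : IsNegSemiOrbit Φ w) {σ : ℝ} (hσ : σ ≤ 0) (n : ℕ) :
    Φ t₀ (w (σ - (n + 1 : ℕ) * t₀)) = w (σ - n * t₀) := by
  have ht := h.t₀_pos
  have h1 : σ - n * t₀ = σ - (n + 1 : ℕ) * t₀ + t₀ := by push_cast; ring
  have h2 : 0 ≤ n * t₀ := by positivity
  rw [h1, hw _ _ ht.le (by rw [← h1]; linarith)]

variable [CompleteSpace X]

/-- The center manifold. -/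
def manifold (h : GapFlow Φ Λ A P α β q ε t₀ μ₁ μ₂) : Set X := {x | x - P x = h.gapMap.graphMap x}

theorem mem_manifold_of_orbit (h : GapFlow Φ Λ A P α β q ε t₀ μ₁ μ₂) {x : X} {y : ℕ → X}
    (h0 : y 0 = x) (hy : ∀ n, Φ t₀ (y (n + 1)) = y n)
    (hb : ∃ K, ∀ n, ‖y n‖ ≤ K * Real.exp (h.rate * t₀) ^ n) : x ∈ h.manifold :=
  h.gapMap.mem_graph_of_backwardOrbit (y := y) ⟨h0, fun n => by simp [hy]⟩ hb

/-- The backward orbit through a point of the center manifold. -/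
noncomputable def seq (h : GapFlow Φ Λ A P α β q ε t₀ μ₁ μ₂) (x : X) : ℕ → X := h.gapMap.lpSeq x

theorem seq_zero (h : GapFlow Φ Λ A P α β q ε t₀ μ₁ μ₂) {x : X} (hx : x ∈ h.manifold) :
    h.seq x 0 = x := (h.gapMap.lpSeq_isBackwardOrbit hx).1

theorem seq_succ (h : GapFlow Φ Λ A P α β q ε t₀ μ₁ μ₂) (x : X) (n : ℕ) :
    Φ t₀ (h.seq x (n + 1)) = h.seq x n := by
  have := ((h.gapMap.lpMap_fixed_iff x _).1 (h.gapMap.lpSeq_fixed x)).2 n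
  rw [add_sub_cancel] at this
  exact this

theorem seq_unique (h : GapFlow Φ Λ A P α β q ε t₀ μ₁ μ₂) {x : X} {y : ℕ → X}
    (h0 : y 0 = x) (hy : ∀ n, Φ t₀ (y (n + 1)) = y n)
    (hb : ∃ K, ∀ n, ‖y n‖ ≤ K * Real.exp (h.rate * t₀) ^ n) : y = h.seq x :=
  h.gapMap.eq_lpSeq ((h.gapMap.lpMap_fixed_iff x y).2 ⟨by rw [h0], fun n => by simp [hy]⟩) hb

/-- The orbit, defined for all times, through a point of the center manifold. -/
noncomputable def orb (h : GapFlow Φ Λ A P α β q ε t₀ μ₁ μ₂) (x : X) (τ : ℝ) : X :=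
  Φ (τ + ⌈-τ / t₀⌉₊ * t₀) (h.seq x ⌈-τ / t₀⌉₊)

/-- Going back further than necessary along the discrete orbit and then flowing forward gives the
same point, so any sufficiently large number of backward steps may be used. This freedom underlies
the group law. -/
theorem orb_eq (h : GapFlow Φ Λ A P α β q ε t₀ μ₁ μ₂) (x : X) {τ : ℝ} {n : ℕ}
    (hn : -τ ≤ n * t₀) : h.orb x τ = Φ (τ + n * t₀) (h.seq x n) := by
  have ht := h.t₀_pos
  have h1 : ⌈-τ / t₀⌉₊ ≤ n := Nat.ceil_le.2 ((div_le_iff₀ ht).2 hn)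
  have h2 : -τ ≤ ⌈-τ / t₀⌉₊ * t₀ := (div_le_iff₀ ht).1 (Nat.le_ceil _)
  obtain ⟨j, hj⟩ := Nat.exists_eq_add_of_le h1
  rw [orb, hj, ← h.iterate (h.seq_succ x) ⌈-τ / t₀⌉₊ j, ← h.add _ _ (by linarith) (by positivity)]
  congr 1
  push_cast; ring

theorem orb_of_nonneg (h : GapFlow Φ Λ A P α β q ε t₀ μ₁ μ₂) {x : X} (hx : x ∈ h.manifold)
    {τ : ℝ} (hτ : 0 ≤ τ) : h.orb x τ = Φ τ x := by
  rw [h.orb_eq x (n := 0) (by simpa using hτ), h.seq_zero hx]; simp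

theorem orb_zero (h : GapFlow Φ Λ A P α β q ε t₀ μ₁ μ₂) {x : X} (hx : x ∈ h.manifold) :
    h.orb x 0 = x := by rw [h.orb_of_nonneg hx le_rfl, h.zero]

theorem orb_add (h : GapFlow Φ Λ A P α β q ε t₀ μ₁ μ₂) (x : X) (τ : ℝ) {s : ℝ} (hs : 0 ≤ s) :
    h.orb x (τ + s) = Φ s (h.orb x τ) := by
  obtain ⟨n, hn⟩ := h.exists_nat τ
  rw [h.orb_eq x hn, h.orb_eq x (n := n) (by linarith), ← h.add _ _ hs (by linarith)]
  congr 1; ring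

/-- The points at times τ - n t₀ form a backward orbit of the time-t₀ map. By the Lipschitz bound on
bounded times it grows at most like `l₁ ^ n` up to a constant, so its end point lies on the
manifold, and uniqueness identifies it with `seq`. The manifold of the discrete map is thus
invariant at all real times. -/
theorem orb_shift (h : GapFlow Φ Λ A P α β q ε t₀ μ₁ μ₂) (x : X) (τ : ℝ) :
    h.orb x τ ∈ h.manifold ∧ (fun n : ℕ => h.orb x (τ - n * t₀)) = h.seq (h.orb x τ) := by
  obtain ⟨N, hN⟩ := h.exists_nat τ
  have ht := h.t₀_pos
  have h1 : ∀ n : ℕ, Φ t₀ (h.orb x (τ - (n + 1 : ℕ) * t₀)) = h.orb x (τ - n * t₀) := fun n => by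
    rw [← h.orb_add _ _ ht.le]; congr 1; push_cast; ring
  obtain ⟨C, hC0, hC⟩ := h.lip (τ + N * t₀) (by linarith)
  have hl := h.gapMap.l₁_pos
  have hb : ∃ K, ∀ n : ℕ, ‖h.orb x (τ - n * t₀)‖ ≤ K * Real.exp (h.rate * t₀) ^ n := by
    refine ⟨C * (2 * ‖P x‖ * Real.exp (μ₁ * t₀) ^ N), fun n => ?_⟩
    rw [h.orb_eq x (n := N + n) (by push_cast; linarith)]
    have h2 : τ - n * t₀ + (N + n : ℕ) * t₀ = τ + N * t₀ := by push_cast; ring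
    rw [h2]
    have h3 := hC (τ + N * t₀) ⟨by linarith, le_rfl⟩ (h.seq x (N + n)) 0
    rw [h.map_zero _ (by linarith), sub_zero, sub_zero] at h3
    refine h3.trans ?_
    have h4 : ‖h.seq x (N + n)‖ ≤ _ := h.gapMap.lpSeq_norm_le x (N + n)
    have h5 : Real.exp (μ₁ * t₀) ^ n ≤ Real.exp (h.rate * t₀) ^ n :=
      pow_le_pow_left₀ hl.le h.gapMap.l₁_lt.le n
    calc C * ‖h.seq x (N + n)‖ ≤ C * (2 * ‖P x‖ * Real.exp (μ₁ * t₀) ^ (N + n)) := by gcongr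
      _ = C * (2 * ‖P x‖ * Real.exp (μ₁ * t₀) ^ N) * Real.exp (μ₁ * t₀) ^ n := by
        rw [pow_add]; ring
      _ ≤ _ := by gcongr
  exact ⟨h.mem_manifold_of_orbit (y := fun n : ℕ => h.orb x (τ - n * t₀)) (by simp) h1 hb,
    h.seq_unique (by simp) h1 hb⟩

theorem orb_orb (h : GapFlow Φ Λ A P α β q ε t₀ μ₁ μ₂) (x : X) (s t : ℝ) :
    h.orb (h.orb x t) s = h.orb x (s + t) := by
  obtain ⟨n, hn⟩ := h.exists_nat s
  rw [h.orb_eq _ hn, ← (h.orb_shift x t).2, ← h.orb_add _ _ (by linarith)]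
  congr 1; ring

theorem orb_lipschitz (h : GapFlow Φ Λ A P α β q ε t₀ μ₁ μ₂) (T : ℝ) :
    ∃ K, 0 ≤ K ∧ ∀ τ ∈ Icc (-T) T, ∀ x x', ‖h.orb x τ - h.orb x' τ‖ ≤ K * ‖x - x'‖ := by
  obtain ⟨N, hN⟩ := h.exists_nat (-T)
  rw [neg_neg] at hN
  have ht := h.t₀_pos
  have hl := h.gapMap.l₁_pos
  obtain ⟨C, hC0, hC⟩ := h.lip (|T| + N * t₀) (by positivity)
  refine ⟨C * (2 * ‖P‖ * Real.exp (μ₁ * t₀) ^ N), by positivity, fun τ hτ x x' => ?_⟩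
  rw [h.orb_eq x (n := N) (by linarith [hτ.1]), h.orb_eq x' (n := N) (by linarith [hτ.1])]
  refine (hC _ ⟨by linarith [hτ.1], by linarith [hτ.2, le_abs_self T]⟩ _ _).trans ?_
  rw [mul_assoc]
  exact mul_le_mul_of_nonneg_left (h.gapMap.lpSeq_lipschitz x x' N) hC0

theorem continuous_orb_time (h : GapFlow Φ Λ A P α β q ε t₀ μ₁ μ₂) (x : X) :
    Continuous fun τ => h.orb x τ := by
  rw [continuous_iff_continuousAt]
  intro τ
  obtain ⟨N, hN⟩ := h.exists_nat (τ - 1)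
  have h1 : ContinuousOn (fun σ => Φ (σ + N * t₀) (h.seq x N)) (Ici (τ - 1)) :=
    (h.cont _).comp (by fun_prop) fun σ hσ => by
      simp only [mem_Ici] at hσ ⊢; linarith
  have h2 : ContinuousOn (fun σ => h.orb x σ) (Ici (τ - 1)) := h1.congr fun σ hσ =>
    h.orb_eq x (by simp only [mem_Ici] at hσ; linarith)
  exact h2.continuousAt (Ici_mem_nhds (by linarith))

theorem continuous_orb (h : GapFlow Φ Λ A P α β q ε t₀ μ₁ μ₂) :
    Continuous fun p : ℝ × X => h.orb p.2 p.1 := by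
  rw [continuous_iff_continuousAt]
  rintro ⟨τ, x⟩
  obtain ⟨K, hK0, hK⟩ := h.orb_lipschitz (|τ| + 1)
  rw [ContinuousAt, tendsto_iff_norm_sub_tendsto_zero]
  have h1 : Tendsto (fun p : ℝ × X => K * ‖p.2 - x‖ + ‖h.orb x p.1 - h.orb x τ‖) (𝓝 (τ, x))
      (𝓝 (K * 0 + 0)) := by
    refine (Tendsto.const_mul K ?_).add ?_
    · have : Continuous fun p : ℝ × X => ‖p.2 - x‖ := by fun_prop
      simpa using this.tendsto (τ, x)
    · have : Continuous fun p : ℝ × X => ‖h.orb x p.1 - h.orb x τ‖ :=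
        (((h.continuous_orb_time x).comp continuous_fst).sub continuous_const).norm
      simpa using this.tendsto (τ, x)
  rw [mul_zero, add_zero] at h1
  refine squeeze_zero' (Eventually.of_forall fun _ => norm_nonneg _) ?_ h1
  have h2 : ∀ᶠ p : ℝ × X in 𝓝 (τ, x), p.1 ∈ Icc (-(|τ| + 1)) (|τ| + 1) :=
    (continuous_fst.tendsto (τ, x)).eventually (Icc_mem_nhds
      (by dsimp only; linarith [neg_abs_le τ]) (by dsimp only; linarith [le_abs_self τ]))
  filter_upwards [h2] with p hp
  have h3 := hK p.1 hp p.2 x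
  have h4 := norm_add_le (h.orb p.2 p.1 - h.orb x p.1) (h.orb x p.1 - h.orb x τ)
  rw [sub_add_sub_cancel] at h4
  linarith

theorem flow (h : GapFlow Φ Λ A P α β q ε t₀ μ₁ μ₂) :
    ∃ Ψ : ℝ → h.manifold → h.manifold,
    Continuous (fun p : ℝ × h.manifold => Ψ p.1 p.2) ∧ (∀ w, Ψ 0 w = w) ∧
      (∀ s t w, Ψ (s + t) w = Ψ s (Ψ t w)) ∧ (∀ τ, ∃ K : ℝ≥0, LipschitzWith K (Ψ τ)) ∧
        ∀ τ, 0 ≤ τ → ∀ w : h.manifold, (Ψ τ w : X) = Φ τ w := by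
  refine ⟨fun τ w => ⟨h.orb w τ, (h.orb_shift w τ).1⟩, ?_, fun w => Subtype.ext (h.orb_zero w.2),
    fun s t w => Subtype.ext (h.orb_orb w s t).symm, fun τ => ?_,
    fun τ hτ w => h.orb_of_nonneg w.2 hτ⟩
  · exact (h.continuous_orb.comp (continuous_fst.prodMk
      (continuous_subtype_val.comp continuous_snd))).subtype_mk _
  · obtain ⟨K, hK0, hK⟩ := h.orb_lipschitz |τ|
    refine ⟨⟨K, hK0⟩, LipschitzWith.of_dist_le_mul fun x y => ?_⟩
    rw [Subtype.dist_eq, Subtype.dist_eq, dist_eq_norm, dist_eq_norm]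
    exact hK τ ⟨neg_abs_le τ, le_abs_self τ⟩ _ _

theorem image_eq (h : GapFlow Φ Λ A P α β q ε t₀ μ₁ μ₂) {τ : ℝ} (hτ : 0 ≤ τ) :
    Φ τ '' h.manifold = h.manifold := by
  ext x
  constructor
  · rintro ⟨y, hy, rfl⟩
    rw [← h.orb_of_nonneg hy hτ]; exact (h.orb_shift y τ).1
  · intro hx
    refine ⟨h.orb x (-τ), (h.orb_shift x _).1, ?_⟩
    rw [← h.orb_add _ _ hτ, neg_add_cancel, h.orb_zero hx]

theorem negSemiOrbit_sub_le (h : GapFlow Φ Λ A P α β q ε t₀ μ₁ μ₂) {w w' : ℝ → X}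
    (hw : IsNegSemiOrbit Φ w) (hw' : IsNegSemiOrbit Φ w') (hW : ∀ τ ≤ 0, w τ ∈ h.manifold)
    (hW' : ∀ τ ≤ 0, w' τ ∈ h.manifold) (n : ℕ) :
    ‖w (-(n * t₀)) - w' (-(n * t₀))‖ ≤ 2 * q * Real.exp (μ₁ * t₀) ^ n * ‖w 0 - w' 0‖ := by
  have ht := h.t₀_pos
  have hn : ∀ n : ℕ, (0 : ℝ) - n * t₀ ≤ 0 := fun n => by
    have : 0 ≤ (n : ℝ) * t₀ := by positivity
    linarith
  have := h.gapMap.backwardOrbit_sub_le (x := w 0) (x' := w' 0) (y := fun n => w (0 - n * t₀))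
    (y' := fun n => w' (0 - n * t₀)) ⟨by simp, fun n => by
      simpa using h.negSemiOrbit_succ hw le_rfl n⟩ ⟨by simp, fun n => by
      simpa using h.negSemiOrbit_succ hw' le_rfl n⟩ (fun n => hW _ (hn n)) (fun n => hW' _ (hn n)) n
  simpa using this

theorem negSemiOrbit (h : GapFlow Φ Λ A P α β q ε t₀ μ₁ μ₂) {w₀ : X} (hw₀ : w₀ ∈ h.manifold) :
    (∃ w : ℝ → X, IsNegSemiOrbit Φ w ∧ (∀ τ ≤ 0, w τ ∈ h.manifold) ∧ w 0 = w₀) ∧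
      ∀ w w' : ℝ → X, IsNegSemiOrbit Φ w → IsNegSemiOrbit Φ w' →
        (∀ τ ≤ 0, w τ ∈ h.manifold) → (∀ τ ≤ 0, w' τ ∈ h.manifold) → w 0 = w₀ → w' 0 = w₀ →
          EqOn w w' (Iic 0) := by
  refine ⟨⟨h.orb w₀, fun τ s hs _ => h.orb_add w₀ τ hs, fun τ _ => (h.orb_shift w₀ τ).1,
    h.orb_zero hw₀⟩, fun w w' hw hw' hW hW' h0 h0' τ hτ => ?_⟩
  obtain ⟨n, hn⟩ := h.exists_nat τ
  have h1 := h.negSemiOrbit_sub_le hw hw' hW hW' n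
  rw [h0, h0', sub_self, norm_zero, mul_zero] at h1
  have h2 := sub_eq_zero.1 (norm_le_zero_iff.1 h1)
  have h3 : τ = -(n * t₀) + (τ + n * t₀) := by ring
  simp only [mem_Iic] at hτ
  rw [h3, hw _ _ (by linarith) (by linarith), hw' _ _ (by linarith) (by linarith), h2]

theorem zero_mem (h : GapFlow Φ Λ A P α β q ε t₀ μ₁ μ₂) : (0 : X) ∈ h.manifold := by
  simp [manifold, h.gapMap.graphMap_zero]

/-- At multiples of t₀ the growth is read off from the comparison with the zero orbit. The times in
between cost the Lipschitz constant on [0, t₀] and one factor e^(μ₁t₀) from rounding, neither of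
which affects the rate. -/
theorem rate_le (h : GapFlow Φ Λ A P α β q ε t₀ μ₁ μ₂) {w : ℝ → X}
    (hw : IsNegSemiOrbit Φ w) (hW : ∀ τ ≤ 0, w τ ∈ h.manifold) :
    backwardRate w ≤ ((μ₁ : ℝ) : EReal) := by
  have ht := h.t₀_pos
  have hμ := h.μ₁_pos
  obtain ⟨C, hC0, hC⟩ := h.lip t₀ ht.le
  have hq := h.gapMap.q_nonneg
  refine backwardRate_le (C := C * (2 * q * ‖w 0‖) * Real.exp (μ₁ * t₀)) fun τ hτ => ?_
  obtain ⟨n, hn1, hn2⟩ : ∃ n : ℕ, -τ ≤ n * t₀ ∧ n * t₀ ≤ -τ + t₀ := by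
    refine ⟨⌈-τ / t₀⌉₊, (div_le_iff₀ ht).1 (Nat.le_ceil _), ?_⟩
    have h1 := (Nat.ceil_lt_add_one (div_nonneg (neg_nonneg.2 hτ) ht.le)).le
    have h2 := mul_le_mul_of_nonneg_right h1 ht.le
    rw [add_mul, div_mul_cancel₀ _ ht.ne', one_mul] at h2
    exact h2
  have h1 := h.negSemiOrbit_sub_le (w' := fun _ => 0) hw
    (fun τ s hs _ => (h.map_zero s hs).symm) hW (fun _ _ => h.zero_mem) n
  simp only [sub_zero] at h1
  have h2 := hC (τ + n * t₀) ⟨by linarith, by linarith⟩ (w (-(n * t₀))) 0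
  rw [h.map_zero _ (by linarith), sub_zero, sub_zero,
    ← hw _ _ (by linarith) (by linarith)] at h2
  have h3 : -(n * t₀) + (τ + n * t₀) = τ := by ring
  rw [h3] at h2
  have h4 : Real.exp (μ₁ * t₀) ^ n ≤ Real.exp (μ₁ * t₀) * Real.exp (μ₁ * |τ|) := by
    rw [← Real.exp_nat_mul, ← Real.exp_add, Real.exp_le_exp, abs_of_nonpos hτ]
    nlinarith
  calc ‖w τ‖ ≤ C * (2 * q * Real.exp (μ₁ * t₀) ^ n * ‖w 0‖) :=
        h2.trans (mul_le_mul_of_nonneg_left h1 hC0)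
    _ ≤ C * (2 * q * (Real.exp (μ₁ * t₀) * Real.exp (μ₁ * |τ|)) * ‖w 0‖) := by gcongr
    _ = _ := by ring

theorem mem_of_rate_le (h : GapFlow Φ Λ A P α β q ε t₀ μ₁ μ₂) {w : ℝ → X}
    (hw : IsNegSemiOrbit Φ w) (hr : backwardRate w ≤ ((μ₂ : ℝ) : EReal)) {σ : ℝ} (hσ : σ ≤ 0) :
    w σ ∈ h.manifold := by
  have ht := h.t₀_pos
  refine h.mem_manifold_of_orbit (y := fun n => w (σ - n * t₀)) (by simp)
    (h.negSemiOrbit_succ hw hσ) ?_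
  have hl := h.gapMap.l₂_pos
  have h1 : Tendsto (fun n : ℕ => σ - n * t₀) atTop atBot :=
    tendsto_atBot_add_const_left _ σ (tendsto_neg_atTop_atBot.comp
      (tendsto_natCast_atTop_atTop.atTop_mul_const ht))
  obtain ⟨N, hN⟩ := eventually_atTop.1
    (h1.eventually (eventually_norm_le_of_backwardRate_le h.lt_rate hr))
  -- The growth bound holds only from the index N on; the sum covers the finitely many earlier
  -- entries.
  refine ⟨Real.exp (h.rate * |σ|) +
    ∑ i ∈ Finset.range N, ‖w (σ - i * t₀)‖ / Real.exp (h.rate * t₀) ^ i, fun n => ?_⟩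
  by_cases hn : N ≤ n
  · have h2 := hN n hn
    have h3 : 0 ≤ (n : ℝ) * t₀ := by positivity
    have h4 : Real.exp (h.rate * |σ - n * t₀|) =
        Real.exp (h.rate * |σ|) * Real.exp (h.rate * t₀) ^ n := by
      rw [← Real.exp_nat_mul, ← Real.exp_add, abs_of_nonpos hσ, abs_of_nonpos (by linarith)]
      congr 1; ring
    rw [h4] at h2
    refine h2.trans (mul_le_mul_of_nonneg_right ?_ (by positivity))
    exact le_add_of_nonneg_right (Finset.sum_nonneg fun i _ => by positivity)
  · have h2 := Finset.single_le_sum (f := fun i : ℕ =>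
      ‖w (σ - i * t₀)‖ / Real.exp (h.rate * t₀) ^ i) (s := Finset.range N)
      (fun i _ => by positivity) (Finset.mem_range.2 (not_le.1 hn))
    rw [← div_le_iff₀ (by positivity)]
    exact h2.trans (le_add_of_nonneg_left (Real.exp_pos _).le)

end GapFlow
end GapFlow

/-! ### Truncated nonlinearities and the gap of their flows. -/

section Cutoff

variable {X : Type*} [NormedAddCommGroup X] [NormedSpace ℝ X]

/-- Quantitative form of the properties of a cut-off function. -/
structure CutoffBounds (χ : X → ℝ) (m K : ℝ) : Prop where
  contDiff : ContDiff ℝ 1 χ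
  m_nonneg : 0 ≤ m
  K_nonneg : 0 ≤ K
  bound : ∀ x, |χ x| ≤ m
  lip : ∀ x y, |χ x - χ y| ≤ K * ‖x - y‖
  eq_one : ∀ x, ‖x‖ ≤ 1 → χ x = 1
  eq_zero : ∀ x, 2 ≤ ‖x‖ → χ x = 0

/-- The truncated identity `x ↦ χ(x / r) x`. -/
noncomputable def cutId (χ : X → ℝ) (r : ℝ) (x : X) : X := χ (r⁻¹ • x) • x

/-- Here the nonlinearity is purely quadratic, so its Lipschitz constant is proportional to the
radius. It serves for uniqueness without truncation and for the tangency of the remainder at the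
origin. -/
theorem bilLipOn_of_eq_id {p : X → X} {ρ : ℝ} (hp : ∀ x, ‖x‖ ≤ ρ → p x = x) :
    BilLipOn p {x | ‖x‖ ≤ ρ} (2 * ρ) := by
  intro x hx y hy b
  simp only [mem_ofPred_eq] at hx hy
  rw [hp x hx, hp y hy]
  have h1 : b x x - b y y = b (x - y) x + b y (x - y) := by
    simp only [map_sub, sub_apply]; abel
  rw [h1]
  have h2 := b.le_opNorm₂ (x - y) x
  have h3 := b.le_opNorm₂ y (x - y)
  have h4 := mul_le_mul_of_nonneg_left hx (mul_nonneg (norm_nonneg b) (norm_nonneg (x - y)))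
  have h5 := mul_le_mul_of_nonneg_left hy (mul_nonneg (norm_nonneg b) (norm_nonneg (x - y)))
  have := norm_add_le (b (x - y) x) (b y (x - y))
  linarith

namespace CutoffBounds

variable {χ : X → ℝ} {m K : ℝ}

theorem cutId_of_le (h : CutoffBounds χ m K) {r : ℝ} (hr : 0 < r) {x : X} (hx : ‖x‖ ≤ r) :
    cutId χ r x = x := by
  rw [cutId, h.eq_one, one_smul]
  rw [norm_smul, norm_inv, Real.norm_eq_abs, abs_of_pos hr, inv_mul_le_iff₀ hr, mul_one]
  exact hx

theorem cutId_of_ge (h : CutoffBounds χ m K) {r : ℝ} (hr : 0 < r) {x : X} (hx : 2 * r ≤ ‖x‖) :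
    cutId χ r x = 0 := by
  rw [cutId, h.eq_zero, zero_smul]
  rw [norm_smul, norm_inv, Real.norm_eq_abs, abs_of_pos hr, le_inv_mul_iff₀ hr]
  linarith

theorem norm_cutId_le (h : CutoffBounds χ m K) {r : ℝ} (hr : 0 < r) (x : X) :
    ‖cutId χ r x‖ ≤ m * (2 * r) := by
  have := h.m_nonneg
  rcases le_total ‖x‖ (2 * r) with hx | hx
  · rw [cutId, norm_smul]
    exact mul_le_mul (h.bound _) hx (norm_nonneg _) h.m_nonneg
  · rw [h.cutId_of_ge hr hx, norm_zero]; positivity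

theorem contDiff_cutId (h : CutoffBounds χ m K) (r : ℝ) : ContDiff ℝ 1 (cutId χ r) :=
  (h.contDiff.comp (contDiff_const.smul contDiff_id)).smul contDiff_id

/-- The slope of χ(x/r) is K/r, but it acts on vectors of size at most 2r, so differentiating the
cut-off costs nothing as r → 0. By symmetry the point at which this slope is used may be taken
inside the ball of radius 2r; if both points are outside, both terms vanish. -/
theorem bilLipOn_cutId (h : CutoffBounds χ m K) {r : ℝ} (hr : 0 < r) :
    BilLipOn (cutId χ r) univ (4 * (m + K) * r) := by
  have hm := h.m_nonneg
  have hK := h.K_nonneg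
  have key : ∀ x y, ‖x‖ ≤ 2 * r → ∀ b : X →L[ℝ] X →L[ℝ] X,
      ‖b (cutId χ r x) x - b (cutId χ r y) y‖ ≤ ‖b‖ * (4 * (m + K) * r * ‖x - y‖) := by
    intro x y hx b
    have h1 : b (cutId χ r x) x - b (cutId χ r y) y =
        b (cutId χ r x - cutId χ r y) x + b (cutId χ r y) (x - y) := by
      simp only [map_sub, sub_apply]; abel
    have h2 : cutId χ r x - cutId χ r y = χ (r⁻¹ • y) • (x - y) +
        (χ (r⁻¹ • x) - χ (r⁻¹ • y)) • x := by
      simp only [cutId, smul_sub, sub_smul]; abel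
    have h3 : ‖cutId χ r x - cutId χ r y‖ ≤ (m + 2 * K) * ‖x - y‖ := by
      rw [h2]
      refine (norm_add_le _ _).trans ?_
      rw [norm_smul, norm_smul, Real.norm_eq_abs, Real.norm_eq_abs]
      have h4 := h.lip (r⁻¹ • x) (r⁻¹ • y)
      rw [← smul_sub, norm_smul, norm_inv, Real.norm_eq_abs, abs_of_pos hr] at h4
      have h5 : |χ (r⁻¹ • x) - χ (r⁻¹ • y)| * ‖x‖ ≤ K * (r⁻¹ * ‖x - y‖) * (2 * r) :=
        mul_le_mul h4 hx (norm_nonneg _) (by positivity)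
      have h6 : K * (r⁻¹ * ‖x - y‖) * (2 * r) = 2 * K * ‖x - y‖ := by field_simp
      have h7 := mul_le_mul_of_nonneg_right (h.bound (r⁻¹ • y)) (norm_nonneg (x - y))
      linarith
    rw [h1]
    refine (norm_add_le _ _).trans ?_
    calc _ ≤ ‖b‖ * ((m + 2 * K) * ‖x - y‖) * (2 * r) + ‖b‖ * (m * (2 * r)) * ‖x - y‖ := by
          refine add_le_add ((b.le_opNorm₂ _ _).trans ?_) ((b.le_opNorm₂ _ _).trans ?_)
          · gcongr
          · gcongr
            exact h.norm_cutId_le hr y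
      _ = _ := by ring
  intro x _ y _ b
  rcases le_total ‖x‖ (2 * r) with hx | hx
  · exact key x y hx b
  rcases le_total ‖y‖ (2 * r) with hy | hy
  · rw [norm_sub_rev, norm_sub_rev x y]
    exact key y x hy b
  · rw [h.cutId_of_ge hr hx, h.cutId_of_ge hr hy]
    simp only [map_zero, zero_apply, sub_self, norm_zero]
    positivity

end CutoffBounds

/-- `Φ` is the semiflow of mild solutions for the nonlinearity `p`. -/
def IsFlow (S : ℝ → X →L[ℝ] X) (B : ℝ → X →L[ℝ] X →L[ℝ] X) (p : X → X) (Φ : ℝ → X → X) : Prop :=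
  ∀ x, (∀ T, 0 ≤ T → SolOn S B p T fun τ => Φ τ x) ∧ Φ 0 x = x

/-- The spectral splitting of the semigroup `S`, and a conserved quantity `P₀`. -/
structure SpectralSplit (S : ℝ → X →L[ℝ] X) (B : ℝ → X →L[ℝ] X →L[ℝ] X) (P : X →L[ℝ] X)
    (A : ℝ → X →L[ℝ] X) (P₀ : X →L[ℝ] X) (C γ ν δ : ℝ) : Prop where
  C_nonneg : 0 ≤ C
  δ_pos : 0 < δ
  proj : ∀ x, P (P x) = P x
  comm : ∀ t, 0 ≤ t → ∀ x, P (S t x) = S t (P x)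
  left_inv : ∀ t, 0 ≤ t → ∀ x, A t (S t x) = P x
  right_inv : ∀ t, 0 ≤ t → ∀ x, S t (A t x) = P x
  inv_proj : ∀ t, 0 ≤ t → ∀ x, A t (P x) = A t x
  norm_inv : ∀ t, 0 ≤ t → ‖A t‖ ≤ C * Real.exp (γ * t)
  norm_stable : ∀ t, 0 ≤ t → ‖S t - P.comp (S t)‖ ≤ C * Real.exp (-ν * t)
  P₀_S : ∀ t, 0 ≤ t → ∀ x, P₀ (S t x) = P₀ x
  P₀_B : ∀ t, 0 < t → ∀ x y, P₀ (B t x y) = 0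
  norm_P₀ : ∀ t, 0 ≤ t → ‖S t - P₀.comp (S t)‖ ≤ C * Real.exp (-δ * t)

theorem fderiv_eq_zero_of_quadratic {R : X → X} (h0 : R 0 = 0) {c : ℝ}
    (hR : ∀ᶠ x in 𝓝 (0 : X), ‖R x‖ ≤ c * ‖x‖ * ‖x‖) : fderiv ℝ R 0 = 0 := by
  have hfd : HasFDerivAt R (0 : X →L[ℝ] X) 0 := by
    rw [hasFDerivAt_iff_isLittleO_nhds_zero, Asymptotics.isLittleO_iff]
    intro η hη
    have h1 : Tendsto (fun x : X => c * ‖x‖) (𝓝 0) (𝓝 (c * ‖(0 : X)‖)) :=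
      (continuous_const.mul continuous_norm).tendsto 0
    rw [norm_zero, mul_zero] at h1
    filter_upwards [hR, h1.eventually (gt_mem_nhds hη)] with x hx hx'
    rw [zero_add, h0, sub_zero, zero_apply, sub_zero]
    exact hx.trans (mul_le_mul_of_nonneg_right hx'.le (norm_nonneg _))
  exact hfd.fderiv

/-- A semiflow which contracts modulo a conserved linear quantity is uniformly bounded. -/
theorem norm_le_of_conserved {Φ : ℝ → X → X} {P₀ T : X →L[ℝ] X} {t₀ C₀ : ℝ}
    (hΦ0 : ∀ x, Φ 0 x = x)
    (hadd : ∀ s t, 0 ≤ s → 0 ≤ t → ∀ x, Φ (s + t) x = Φ s (Φ t x)) (ht₀ : 0 < t₀) (hC₀ : 0 ≤ C₀)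
    (hbd : ∀ t ∈ Icc 0 t₀, ∀ x, ‖Φ t x‖ ≤ C₀ * ‖x‖) (hP₀ : ∀ y, P₀ (Φ t₀ y) = P₀ y)
    (hPS : ∀ y, P₀ (T y) = P₀ y) (hdec : ‖T - P₀.comp T‖ ≤ 1 / 4)
    (hR : ∀ y, ‖Φ t₀ y - T y‖ ≤ 1 / 4 * ‖y‖) (x : X) (τ : ℝ) (hτ : 0 ≤ τ) :
    ‖Φ τ x‖ ≤ C₀ * (1 + 2 * ‖P₀‖) * ‖x‖ := by
  have hiter : ∀ n : ℕ, P₀ (Φ (n * t₀) x) = P₀ x ∧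
      ‖Φ (n * t₀) x‖ ≤ (1 + 2 * ‖P₀‖) * ‖x‖ := by
    intro n
    induction n with
    | zero =>
      simp only [CharP.cast_eq_zero, zero_mul, hΦ0, true_and]
      have : 0 ≤ ‖P₀‖ * ‖x‖ := by positivity
      linarith
    | succ n ih =>
      have h1 : ((n + 1 : ℕ) : ℝ) * t₀ = t₀ + n * t₀ := by push_cast; ring
      rw [h1, hadd _ _ ht₀.le (by positivity)]
      set y := Φ (n * t₀) x with hy
      refine ⟨by rw [hP₀, ih.1], ?_⟩
      -- The first summand stays the same at every step because it is conserved; the other two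
      -- together are at most half of ‖y‖. The factor `1 + 2 * ‖P₀‖` reproduces itself under this
      -- recursion.
      have h2 : Φ t₀ y = P₀ y + (T - P₀.comp (T)) y + (Φ t₀ y - T y) := by
        simp only [sub_apply, ContinuousLinearMap.comp_apply, hPS]; abel
      have h3 : ‖(T - P₀.comp (T)) y‖ ≤ 1 / 4 * ‖y‖ := by
        exact ContinuousLinearMap.le_of_opNorm_le _ hdec y
      have h4 := hR y
      have h6 := P₀.le_opNorm x
      have h7 : ‖Φ t₀ y‖ ≤ ‖P₀ y‖ + ‖(T - P₀.comp (T)) y‖ + ‖Φ t₀ y - T y‖ := by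
        conv_lhs => rw [h2]
        exact norm_add₃_le
      rw [ih.1] at h7
      have := norm_nonneg x
      linarith [ih.2]
  have h1 : ⌊τ / t₀⌋₊ * t₀ ≤ τ := (le_div_iff₀ ht₀).1 (Nat.floor_le (by positivity))
  have h2 : τ < (⌊τ / t₀⌋₊ + 1) * t₀ := (div_lt_iff₀ ht₀).1 (Nat.lt_floor_add_one _)
  have h3 : τ = (τ - ⌊τ / t₀⌋₊ * t₀) + ⌊τ / t₀⌋₊ * t₀ := by ring
  rw [h3, hadd _ _ (by linarith) (by positivity)]
  have h4 := hbd (τ - ⌊τ / t₀⌋₊ * t₀) ⟨by linarith, by linarith⟩ (Φ (⌊τ / t₀⌋₊ * t₀) x)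
  refine h4.trans ?_
  rw [mul_assoc]
  exact mul_le_mul_of_nonneg_left (hiter _).2 hC₀

variable {S : ℝ → X →L[ℝ] X} {B : ℝ → X →L[ℝ] X →L[ℝ] X} {P P₀ : X →L[ℝ] X}
  {A : ℝ → X →L[ℝ] X} {M κ C γ ν δ μ₁ μ₂ : ℝ}

theorem IsFlow.map_zero {p : X → X} {Φ : ℝ → X → X} (h : SmoothingPair S B M κ) (hp : Continuous p)
    {L : ℝ} (hL : 0 ≤ L) (hpL : BilLipOn p univ L) (hΦ : IsFlow S B p Φ) {t : ℝ} (ht : 0 ≤ t) :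
    Φ t 0 = 0 := by
  have h1 : SolOn S B p t fun _ => (0 : X) := ⟨continuousOn_const, fun τ _ => by simp [duhamel]⟩
  exact h.SolOn_eqOn hp hL hpL ((hΦ 0).1 t ht) h1 (fun _ _ => mem_univ _)
    (fun _ _ => mem_univ _) (hΦ 0).2 ⟨ht, le_rfl⟩

variable [CompleteSpace X]

theorem IsFlow.add {p : X → X} {Φ : ℝ → X → X} (h : SmoothingPair S B M κ) (hp : Continuous p)
    {L : ℝ} (hL : 0 ≤ L) (hpL : BilLipOn p univ L) (hΦ : IsFlow S B p Φ) {s t : ℝ} (hs : 0 ≤ s)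
    (ht : 0 ≤ t) (x : X) : Φ (s + t) x = Φ s (Φ t x) := by
  have h1 := h.SolOn_shift hp ((hΦ x).1 (t + s) (by positivity)) ht
  rw [add_sub_cancel_left] at h1
  have h2 := h.SolOn_eqOn hp hL hpL h1 ((hΦ (Φ t x)).1 s hs) (fun _ _ => mem_univ _)
    (fun _ _ => mem_univ _) (by simp [(hΦ (Φ t x)).2]) ⟨hs, le_rfl⟩
  simp only at h2
  rw [add_comm, h2]

/-- The linear flow preserves `P₀`, and `P₀` annihilates the kernel `B`, hence the whole Duhamel
term once `P₀` is taken under the integral. -/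
theorem IsFlow.proj_eq {p : X → X} {Φ : ℝ → X → X} (h : SmoothingPair S B M κ)
    (hp : Continuous p) (hS : ∀ t, 0 ≤ t → ∀ x, P₀ (S t x) = P₀ x)
    (hB : ∀ t, 0 < t → ∀ x y, P₀ (B t x y) = 0) (hΦ : IsFlow S B p Φ) {t : ℝ} (ht : 0 ≤ t)
    (y : X) : P₀ (Φ t y) = P₀ y := by
  have h1 := ((hΦ y).1 t ht).2 t ⟨ht, le_rfl⟩
  simp only [(hΦ y).2] at h1
  have hc := ((hΦ y).1 t ht).1
  rw [h1, map_add, hS t ht]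
  have h2 := P₀.intervalIntegral_comp_comm (h.intervalIntegrable_B ht
    (f := fun s => p (Φ s y)) (hp.comp_continuousOn hc) hc)
  have h3 : P₀ (duhamel B (fun s => p (Φ s y)) (fun s => Φ s y) t) = 0 := by
    refine h2.symm.trans ?_
    rw [intervalIntegral.integral_congr_ae (g := fun _ => (0 : X)) ?_]
    · simp
    · have : ∀ᵐ s : ℝ ∂volume, s ≠ t := by
        rw [ae_iff]; simp
      filter_upwards [this] with s hs' hs''
      rw [uIoc_of_le ht] at hs''
      exact hB _ (sub_pos.2 (lt_of_le_of_ne hs''.2 hs')) _ _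
  rw [h3, add_zero]

/-- The time step is fixed by the linear part alone: it must be so long that the exponential gap
beats the constant `C`. Only then is the radius chosen, so that the nonlinear remainder of this
particular time map is small against the gap. -/
theorem exists_gapFlow (h : SmoothingPair S B M κ) (hs : SpectralSplit S B P A P₀ C γ ν δ)
    (hμ₁ : 0 < μ₁) (hγ : γ < μ₁) (hμ : μ₁ < μ₂) (hν : μ₂ < ν) {χ : X → ℝ} {m K : ℝ}
    (hχ : CutoffBounds χ m K) :
    ∃ rbar t₀ N : ℝ, 0 < rbar ∧ 0 < t₀ ∧ 0 ≤ N ∧ ∀ r, 0 < r → r < rbar → ∀ Φ : ℝ → X → X,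
      IsFlow S B (cutId χ r) Φ →
      (∃ α β q ε, GapFlow Φ (S t₀) (A t₀) P α β q ε t₀ μ₁ μ₂) ∧
      ∀ x τ, 0 ≤ τ → ‖Φ τ x‖ ≤ N * ‖x‖ := by
  have hC := hs.C_nonneg
  -- Room is needed on both sides: above `μ₂` for the limsup characterization, below `ν` for the
  -- linear decay to win.
  obtain ⟨μ₂', hμ₂, hμ₂'⟩ := exists_between hν
  set q := ‖P‖ + ‖ContinuousLinearMap.id ℝ X - P‖ with hq
  have hq0 : 0 ≤ q := by positivity
  have hdecay : ∀ c : ℝ, 0 < c → ∀ η : ℝ, 0 < η → ∀ᶠ t : ℝ in atTop, C * Real.exp (-(c * t)) ≤ η := by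
    intro c hc η hη
    have h1 : Tendsto (fun t : ℝ => C * Real.exp (-(c * t))) atTop (𝓝 (C * 0)) :=
      (Real.tendsto_exp_neg_atTop_nhds_zero.comp (tendsto_id.const_mul_atTop hc)).const_mul C
    rw [mul_zero] at h1
    exact (h1.eventually (gt_mem_nhds hη)).mono fun _ hx => hx.le
  -- The conditions are, in this order, those for the inverse on the center space, for the decay on
  -- the stable space, for the same decay against the norms of the projections, and for the
  -- contraction modulo the conserved quantity. Each 1/16 is one of the summands that have to fit
  -- into the 1/4 of `gap` or the 1/8 of `gap_proj`.
  obtain ⟨t₀, ht₀, hd1, hd2, hd3, hd4⟩ := ((eventually_gt_atTop 0).and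
    ((hdecay (μ₁ - γ) (by linarith) (1 / 16) (by norm_num)).and
    ((hdecay (ν - μ₂') (by linarith) (1 / 16) (by norm_num)).and
    ((hdecay (ν - μ₂') (by linarith) (1 / (16 * (q + 1))) (by positivity)).and
    (hdecay δ hs.δ_pos (1 / 4) (by norm_num)))))).exists
  set α := C * Real.exp (γ * t₀) with hα
  set β := C * Real.exp (-ν * t₀) with hβ
  set l₁ := Real.exp (μ₁ * t₀) with hl₁
  set l₂ := Real.exp (μ₂' * t₀) with hl₂
  have hα0 : 0 ≤ α := by positivity
  have hβ0 : 0 ≤ β := by positivity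
  have hl₁0 : 0 < l₁ := Real.exp_pos _
  have hl₂0 : 0 < l₂ := Real.exp_pos _
  have e1 : α / l₁ ≤ 1 / 16 := by
    rw [hα, hl₁, mul_div_assoc, ← Real.exp_sub]
    refine le_trans (le_of_eq ?_) hd1
    congr 2; ring
  have e2' : β * l₂ = C * Real.exp (-((ν - μ₂') * t₀)) := by
    rw [hβ, hl₂, mul_assoc, ← Real.exp_add]; congr 2; ring
  have e2 : β * l₂ ≤ 1 / 16 := e2'.le.trans hd2
  have e3 : β * l₂ * q ≤ 1 / 16 := by
    have h1 : β * l₂ ≤ 1 / (16 * (q + 1)) := e2'.le.trans hd3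
    have h2 := mul_le_mul_of_nonneg_right h1 hq0
    refine h2.trans ?_
    rw [div_mul_eq_mul_div, div_le_div_iff₀ (by positivity) (by norm_num)]
    linarith
  obtain ⟨C₀, hC₀, hsub⟩ := h.SolOn_sub_le ht₀.le zero_le_one (L₀ := 1)
  set J := ∫ s in (0 : ℝ)..t₀, kerBound M κ s with hJ
  have hJ0 : 0 ≤ J := intervalIntegral.integral_nonneg ht₀.le fun s hs =>
    kerBound_nonneg h.M_nonneg κ hs.1
  have hm := hχ.m_nonneg
  have hK := hχ.K_nonneg
  -- smallness of the nonlinearity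
  obtain ⟨ε₀, hε₀, f1, f2, f3, f4⟩ : ∃ ε₀ : ℝ, 0 < ε₀ ∧ α * ε₀ ≤ 1 / 16 ∧ q * ε₀ * l₂ ≤ 1 / 16 ∧
      q * ε₀ * l₂ * q ≤ 1 / 16 ∧ ε₀ ≤ 1 / 4 := by
    have hε : ∀ c : ℝ, ∀ᶠ e in 𝓝[>] (0 : ℝ), c * e ≤ 1 / 16 := by
      intro c
      have h1 : Tendsto (fun e : ℝ => c * e) (𝓝[>] 0) (𝓝 (c * 0)) :=
        (tendsto_nhdsWithin_of_tendsto_nhds tendsto_id).const_mul c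
      rw [mul_zero] at h1
      exact (h1.eventually (gt_mem_nhds (by norm_num))).mono fun _ hx => hx.le
    have hpos : ∀ᶠ e in 𝓝[>] (0 : ℝ), 0 < e := self_mem_nhdsWithin
    obtain ⟨e, he, g1, g2, g3, g4⟩ := (hpos.and ((hε α).and ((hε (q * l₂)).and
      ((hε (q * l₂ * q)).and (hε 1))))).exists
    exact ⟨e, he, g1, by linarith, by linarith, by linarith⟩
  set Lc := 4 * (m + K) with hLc
  have hLc0 : 0 ≤ Lc := by positivity
  -- The three bounds ensure that the Lipschitz constant of the nonlinearity is at most `L₀ = 1`,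
  -- that the remainder is at most `ε₀`, and that the integral equation on [0, t₀] is a perturbation
  -- of the identity by a Lipschitz constant of at most 1/2.
  refine ⟨min (1 / (Lc + 1)) (min (ε₀ / (Lc * C₀ + 1)) (1 / (2 * (Lc * J + 1)))), t₀,
    C₀ * (1 + 2 * ‖P₀‖), by positivity, ht₀, by positivity, fun r hr hrbar Φ hΦ => ?_⟩
  have r1 : Lc * r ≤ 1 := by
    have h1 : r * (Lc + 1) < 1 := (lt_div_iff₀ (by positivity)).1 (lt_min_iff.1 hrbar).1
    nlinarith
  have r2 : Lc * r * C₀ ≤ ε₀ := by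
    have h1 : r * (Lc * C₀ + 1) < ε₀ :=
      (lt_div_iff₀ (by positivity)).1 (lt_min_iff.1 (lt_min_iff.1 hrbar).2).1
    nlinarith
  have r3 : Lc * r * J ≤ 1 / 2 := by
    have h1 : r * (2 * (Lc * J + 1)) < 1 :=
      (lt_div_iff₀ (by positivity)).1 (lt_min_iff.1 (lt_min_iff.1 hrbar).2).2
    nlinarith
  have hLr : 0 ≤ Lc * r := by positivity
  have hbl : BilLipOn (cutId χ r) univ (Lc * r) := hχ.bilLipOn_cutId hr
  have hpc : Continuous (cutId χ r) := (hχ.contDiff_cutId r).continuous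
  have hadd := fun s t hs ht x => hΦ.add h hpc hLr hbl (s := s) (t := t) hs ht x
  have hzero := fun t ht => hΦ.map_zero h hpc hLr hbl (t := t) ht
  have hlip : ∀ t ∈ Icc 0 t₀, ∀ x y, ‖Φ t x - Φ t y‖ ≤ C₀ * ‖x - y‖ ∧
      ‖(Φ t x - S t x) - (Φ t y - S t y)‖ ≤ Lc * r * C₀ * ‖x - y‖ := by
    intro t ht x y
    have := hsub _ univ _ hpc hLr r1 hbl t₀ ⟨ht₀.le, le_rfl⟩ _ _ ((hΦ x).1 t₀ ht₀.le)
      ((hΦ y).1 t₀ ht₀.le) (fun _ _ => mem_univ _) (fun _ _ => mem_univ _) t ht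
    simpa only [(hΦ x).2, (hΦ y).2] using this
  have hR : ∀ x y, ‖(Φ t₀ x - S t₀ x) - (Φ t₀ y - S t₀ y)‖ ≤ ε₀ * ‖x - y‖ := fun x y =>
    (hlip t₀ ⟨ht₀.le, le_rfl⟩ x y).2.trans (mul_le_mul_of_nonneg_right r2 (norm_nonneg _))
  have hR0 : Φ t₀ 0 - S t₀ 0 = 0 := by rw [hzero t₀ ht₀.le]; simp
  refine ⟨⟨α, β, q, ε₀, (fun x => (hΦ x).2), hadd, fun x => ?_, fun T hT => ?_, hzero, ht₀, hμ₁,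
    ⟨μ₂', hμ₂, ?_⟩, ?_, ?_⟩, ?_⟩
  · intro t ht
    have h1 := ((hΦ x).1 (t + 1) (by simp only [mem_Ici] at ht; linarith)).1 t
      ⟨ht, by linarith⟩
    refine h1.mono_of_mem_nhdsWithin ?_
    have h2 : Iio (t + 1) ∈ 𝓝 t := Iio_mem_nhds (by linarith)
    filter_upwards [self_mem_nhdsWithin, mem_nhdsWithin_of_mem_nhds h2] with s hs hs'
    exact ⟨hs, le_of_lt hs'⟩
  · obtain ⟨C₁, hC₁, hsub₁⟩ := h.SolOn_sub_le hT hLr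
    refine ⟨C₁, hC₁, fun t ht x y => ?_⟩
    have := (hsub₁ _ univ _ hpc hLr le_rfl hbl T ⟨hT, le_rfl⟩ _ _ ((hΦ x).1 T hT)
      ((hΦ y).1 T hT) (fun _ _ => mem_univ _) (fun _ _ => mem_univ _) t ht).1
    simpa only [(hΦ x).2, (hΦ y).2] using this
  · exact
    { proj := hs.proj
      comm := hs.comm t₀ ht₀.le
      left_inv := hs.left_inv t₀ ht₀.le
      right_inv := hs.right_inv t₀ ht₀.le
      inv_proj := hs.inv_proj t₀ ht₀.le
      norm_inv := hs.norm_inv t₀ ht₀.le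
      norm_stable := hs.norm_stable t₀ ht₀.le
      norm_compl := le_add_of_nonneg_left (norm_nonneg _)
      norm_proj := le_add_of_nonneg_right (norm_nonneg _)
      rem_zero := hR0
      rem_lip := hR
      eps_nonneg := hε₀.le
      l₁_pos := hl₁0
      l₁_lt := Real.exp_lt_exp.2 (mul_lt_mul_of_pos_right (hμ.trans hμ₂) ht₀)
      gap := by rw [add_mul]; linarith
      gap_proj := by rw [add_mul, add_mul]; linarith }
  · obtain ⟨F, hF, hFw⟩ := h.exists_contDiff_timeMap (hχ.contDiff_cutId r) hLr hbl ht₀.le r3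
    have : Φ t₀ = F := funext fun x => by
      have := hFw _ ((hΦ x).1 t₀ ht₀.le)
      simpa only [(hΦ x).2] using this
    rwa [this]
  -- For small `x` the trajectory stays where nothing is truncated, within `C₀ * ‖x‖` of the origin.
  -- There the nonlinearity has a Lipschitz constant of order ‖x‖, so the remainder is quadratic.
  · have hquad : ∀ᶠ x in 𝓝 (0 : X), ‖Φ t₀ x - S t₀ x‖ ≤ 2 * C₀ * C₀ * ‖x‖ * ‖x‖ := by
      have h1 : Tendsto (fun x : X => C₀ * ‖x‖) (𝓝 0) (𝓝 (C₀ * ‖(0 : X)‖)) :=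
        (continuous_const.mul continuous_norm).tendsto 0
      have h1' : Tendsto (fun x : X => 2 * (C₀ * ‖x‖)) (𝓝 0) (𝓝 (2 * (C₀ * ‖(0 : X)‖))) :=
        h1.const_mul 2
      rw [norm_zero, mul_zero] at h1
      rw [norm_zero, mul_zero, mul_zero] at h1'
      filter_upwards [h1.eventually (gt_mem_nhds hr), h1'.eventually (gt_mem_nhds one_pos)]
        with x hx hx'
      have h2 : BilLipOn (cutId χ r) {y | ‖y‖ ≤ C₀ * ‖x‖} (2 * (C₀ * ‖x‖)) :=
        bilLipOn_of_eq_id fun y hy => hχ.cutId_of_le hr (hy.trans hx.le)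
      have h3 := (hsub _ _ _ hpc (by positivity) hx'.le h2 t₀ ⟨ht₀.le, le_rfl⟩ _ _
        ((hΦ x).1 t₀ ht₀.le) ((hΦ 0).1 t₀ ht₀.le) (fun s hs => by
          have := (hlip s hs x 0).1
          rw [hzero s hs.1, sub_zero, sub_zero] at this
          exact this) (fun s hs => by
          simp only [mem_ofPred_eq]
          rw [hzero s hs.1, norm_zero]; positivity) t₀ ⟨ht₀.le, le_rfl⟩).2
      simp only [(hΦ x).2, (hΦ 0).2] at h3
      rw [hR0, sub_zero, sub_zero] at h3
      linarith
    exact fderiv_eq_zero_of_quadratic hR0 hquad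
  · exact norm_le_of_conserved (fun x => (hΦ x).2) hadd ht₀ hC₀
      (fun t ht x => by
        have h4 := (hlip t ht x 0).1
        rwa [hzero t ht.1, sub_zero, sub_zero] at h4)
      (hΦ.proj_eq h hpc hs.P₀_S hs.P₀_B ht₀.le) (fun y => hs.P₀_S t₀ ht₀.le y)
      ((hs.norm_P₀ t₀ ht₀.le).trans (by rw [neg_mul]; exact hd4))
      (fun y => by
        have h4 := hR y 0
        rw [hR0, sub_zero, sub_zero] at h4
        exact h4.trans (mul_le_mul_of_nonneg_right f4 (norm_nonneg y)))

end Cutoff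

/-! ### Local consequences for the equation without truncation. -/

section Abstract

variable {X : Type*} [NormedAddCommGroup X] [NormedSpace ℝ X]

/-- `w` is a global solution. -/
def GlobalSol (S : ℝ → X →L[ℝ] X) (B : ℝ → X →L[ℝ] X →L[ℝ] X) (p : X → X) (w : ℝ → X) : Prop :=
  ∀ T, 0 ≤ T → SolOn S B p T w

/-- There is one and only one global solution starting at `x`. -/
def UniqueGlobalSol (S : ℝ → X →L[ℝ] X) (B : ℝ → X →L[ℝ] X →L[ℝ] X) (p : X → X) (x : X) : Prop :=
  (∃ w, GlobalSol S B p w ∧ w 0 = x) ∧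
    ∀ w w', GlobalSol S B p w → GlobalSol S B p w' → w 0 = x → w' 0 = x → EqOn w w' (Ici 0)

/-- `Φ` consists of global solutions, wherever these exist. -/
def IsPartialFlow (S : ℝ → X →L[ℝ] X) (B : ℝ → X →L[ℝ] X →L[ℝ] X) (p : X → X)
    (Φ : ℝ → X → X) : Prop :=
  ∀ x, (∃ w, GlobalSol S B p w ∧ w 0 = x) → GlobalSol S B p (fun τ => Φ τ x) ∧ Φ 0 x = x

variable {S : ℝ → X →L[ℝ] X} {B : ℝ → X →L[ℝ] X →L[ℝ] X} {P P₀ : X →L[ℝ] X}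
  {A : ℝ → X →L[ℝ] X} {M κ C γ ν δ μ₁ μ₂ : ℝ}

theorem SmoothingPair.uniqueGlobalSol [CompleteSpace X] (h : SmoothingPair S B M κ) {p : X → X}
    (hp : Continuous p) {L : ℝ} (hL : 0 ≤ L) (hpL : BilLipOn p univ L) (x : X) :
    UniqueGlobalSol S B p x :=
  ⟨h.exists_global_sol hp hL hpL x, fun w w' hw hw' h0 h0' τ hτ =>
    h.SolOn_eqOn hp hL hpL (hw τ hτ) (hw' τ hτ) (fun _ _ => mem_univ _) (fun _ _ => mem_univ _)
      (by rw [h0, h0']) ⟨hτ, le_rfl⟩⟩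

/-- Without truncation the nonlinearity is only locally Lipschitz, but two given continuous
solutions on a compact interval share a common ball. -/
theorem SmoothingPair.SolOn_id_eqOn (h : SmoothingPair S B M κ) {T : ℝ} {w w' : ℝ → X}
    (hw : SolOn S B (fun x => x) T w) (hw' : SolOn S B (fun x => x) T w') (h0 : w 0 = w' 0) :
    EqOn w w' (Icc 0 T) := by
  obtain ⟨c, hc⟩ := isCompact_Icc.exists_bound_of_continuousOn hw.1
  obtain ⟨c', hc'⟩ := isCompact_Icc.exists_bound_of_continuousOn hw'.1
  refine h.SolOn_eqOn continuous_id (D := {x | ‖x‖ ≤ max 0 (max c c')})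
    (L := 2 * max 0 (max c c')) (by positivity) (bilLipOn_of_eq_id fun _ _ => rfl) hw hw'
    (fun s hs => ?_) (fun s hs => ?_) h0
  · exact (hc s hs).trans ((le_max_left _ _).trans (le_max_right _ _))
  · exact (hc' s hs).trans ((le_max_right _ _).trans (le_max_right _ _))

/-- The semiflow without truncation and the truncated one agree as long as the trajectory of the
latter stays in the ball where nothing is truncated. -/
structure LocalAgreement (Φ Φ₁ : ℝ → X → X) (N r₀ : ℝ) : Prop where
  pos : 0 < r₀
  bound : ∀ x, ‖x‖ < r₀ → ∀ τ, 0 ≤ τ → ‖Φ₁ τ x‖ ≤ N * ‖x‖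
  eq_of_left : ∀ x, ‖x‖ < r₀ → ∀ T, 0 ≤ T → (∀ τ ∈ Icc 0 T, ‖Φ τ x‖ ≤ r₀) → Φ₁ T x = Φ T x
  eq_of_right : ∀ x, ‖x‖ < r₀ → ∀ T, 0 ≤ T → (∀ τ ∈ Icc 0 T, ‖Φ₁ τ x‖ ≤ r₀) → Φ₁ T x = Φ T x

variable [CompleteSpace X]

/-- A second truncation, at the larger radius `r * (N + 1)`, produces the solutions of the equation
itself: data below `r` lead to trajectories below `N * r`, where that truncation is inactive. This
works because `N` does not depend on the radius. -/
theorem exists_localAgreement (h : SmoothingPair S B M κ)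
    (hs : SpectralSplit S B P A P₀ C γ ν δ)
    (hμ₁ : 0 < μ₁) (hγ : γ < μ₁) (hμ : μ₁ < μ₂) (hν : μ₂ < ν) {χ : X → ℝ} {m K : ℝ}
    (hχ : CutoffBounds χ m K) :
    ∃ rbar t₀ N : ℝ, 0 < rbar ∧ 0 < t₀ ∧ 0 ≤ N ∧ ∀ r, 0 < r → r < rbar → ∀ Φ Φ₁ : ℝ → X → X,
      IsFlow S B (cutId χ r) Φ → IsPartialFlow S B (fun x => x) Φ₁ →
      (∃ α β q ε, GapFlow Φ (S t₀) (A t₀) P α β q ε t₀ μ₁ μ₂) ∧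
      LocalAgreement Φ Φ₁ N r ∧ ∀ x, ‖x‖ < r → UniqueGlobalSol S B (fun x => x) x := by
  obtain ⟨rbar, t₀, N, hr, ht₀, hN, hmain⟩ := exists_gapFlow h hs hμ₁ hγ hμ hν hχ
  refine ⟨rbar / (N + 1), t₀, N, by positivity, ht₀, hN, fun r hr0 hrr Φ Φ₁ hΦ hΦ₁ => ?_⟩
  have hrr' : r * (N + 1) < rbar := (lt_div_iff₀ (by positivity)).1 hrr
  have hm := hχ.m_nonneg
  have hK := hχ.K_nonneg
  set r' := r * (N + 1) with hr'
  have hr'0 : 0 < r' := by positivity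
  have hglob := h.exists_global_sol (hχ.contDiff_cutId r').continuous (by positivity)
    (hχ.bilLipOn_cutId hr'0)
  choose Φ' hΦ' hΦ'0 using hglob
  have hflow' : IsFlow S B (cutId χ r') (fun τ x => Φ' x τ) := fun x => ⟨hΦ' x, hΦ'0 x⟩
  have hbd := (hmain r' hr'0 hrr' _ hflow').2
  have hex : ∀ x, ‖x‖ < r → GlobalSol S B (fun x => x) (Φ' x) := fun x hx T hT =>
    (hΦ' x T hT).congr (fun _ _ => rfl) fun τ hτ => (hχ.cutId_of_le hr'0 (by
      refine (hbd x τ hτ.1).trans ?_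
      have := mul_le_mul_of_nonneg_left hx.le hN
      rw [hr']; nlinarith)).symm
  have hex₁ : ∀ x, ‖x‖ < r → GlobalSol S B (fun x => x) (fun τ => Φ₁ τ x) ∧ Φ₁ 0 x = x :=
    fun x hx => hΦ₁ x ⟨Φ' x, hex x hx, hΦ'0 x⟩
  have heq : ∀ x, ‖x‖ < r → ∀ τ, 0 ≤ τ → Φ₁ τ x = Φ' x τ := fun x hx τ hτ =>
    h.SolOn_id_eqOn ((hex₁ x hx).1 τ hτ) (hex x hx τ hτ) (by rw [(hex₁ x hx).2, hΦ'0])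
      ⟨hτ, le_rfl⟩
  have hrb : r < rbar := lt_of_le_of_lt (by rw [hr']; nlinarith) hrr'
  refine ⟨(hmain r hr0 hrb Φ hΦ).1, ⟨hr0, fun x hx τ hτ => ?_, fun x hx T hT hb => ?_,
    fun x hx T hT hb => ?_⟩, fun x hx => ⟨⟨Φ' x, hex x hx, hΦ'0 x⟩, ?_⟩⟩
  · rw [heq x hx τ hτ]; exact hbd x τ hτ
  · have h1 : SolOn S B (fun x => x) T fun τ => Φ τ x := ((hΦ x).1 T hT).congr (fun _ _ => rfl)
      fun τ hτ => (hχ.cutId_of_le hr0 (hb τ hτ)).symm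
    exact h.SolOn_id_eqOn ((hex₁ x hx).1 T hT) h1 (by rw [(hex₁ x hx).2, (hΦ x).2]) ⟨hT, le_rfl⟩
  · have h1 : SolOn S B (cutId χ r) T fun τ => Φ₁ τ x := ((hex₁ x hx).1 T hT).congr
      (fun _ _ => rfl) fun τ hτ => hχ.cutId_of_le hr0 (hb τ hτ)
    exact h.SolOn_eqOn (hχ.contDiff_cutId r).continuous (by positivity) (hχ.bilLipOn_cutId hr0)
      h1 ((hΦ x).1 T hT) (fun _ _ => mem_univ _) (fun _ _ => mem_univ _)
      (by rw [(hex₁ x hx).2, (hΦ x).2]) ⟨hT, le_rfl⟩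
  · exact fun w w' hw hw' h0 h0' τ hτ =>
      h.SolOn_id_eqOn (hw τ hτ) (hw' τ hτ) (by rw [h0, h0']) ⟨hτ, le_rfl⟩

section Local

variable {Φ Φ₁ : ℝ → X → X} {Λ A₀ : X →L[ℝ] X} {α β q ε t₀ N r₀ : ℝ}

/-- The manifold carries two-sided orbits of the truncated flow. They stay in the open ball for
short times, and there both semiflows coincide. -/
theorem GapFlow.isLocallyInvariant (h : GapFlow Φ Λ A₀ P α β q ε t₀ μ₁ μ₂)
    (hl : LocalAgreement Φ Φ₁ N r₀) :
    IsLocallyInvariant Φ₁ r₀ (h.manifold ∩ {w | ‖w‖ < r₀}) := by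
  have hpos := hl.pos
  constructor
  · intro w₀ hw₀ T _ hT τ hτ
    refine ⟨?_, hT τ hτ⟩
    rw [hl.eq_of_right w₀ hw₀.2 τ hτ.1 fun s hs => (hT s ⟨hs.1, hs.2.trans hτ.2⟩).le,
      ← h.orb_of_nonneg hw₀.1 hτ.1]
    exact (h.orb_shift w₀ τ).1
  · intro w₀ hw₀
    have h1 : ∀ᶠ τ in 𝓝 (0 : ℝ), ‖h.orb w₀ τ‖ < r₀ := by
      refine (h.continuous_orb_time w₀).norm.continuousAt.eventually (gt_mem_nhds ?_)
      simp only [h.orb_zero hw₀.1]; exact hw₀.2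
    obtain ⟨η, hη, hball⟩ := Metric.eventually_nhds_iff.1 h1
    have hball' : ∀ τ ∈ Ioo (-η) η, ‖h.orb w₀ τ‖ < r₀ := fun τ hτ => hball (by
      rw [Real.dist_eq, sub_zero, abs_lt]; exact hτ)
    refine ⟨η, hη, h.orb w₀, h.orb_zero hw₀.1, fun τ hτ => ⟨(h.orb_shift w₀ τ).1, hball' τ hτ⟩,
      fun τ s hs hτ hτs => ?_⟩
    rw [h.orb_add _ _ hs, hl.eq_of_left _ (hball' τ hτ) s hs fun u hu => ?_]
    rw [← h.orb_add _ _ hu.1]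
    exact (hball' _ ⟨by linarith [hτ.1, hu.1], by linarith [hτs.2, hu.2]⟩).le

/-- In the ball the orbit is also one of the truncated flow, and a bounded orbit has backward rate
at most 0, which does not exceed `μ₂`. -/
theorem GapFlow.mem_of_negSemiOrbit_local (h : GapFlow Φ Λ A₀ P α β q ε t₀ μ₁ μ₂) (hμ : 0 ≤ μ₂)
    (hl : LocalAgreement Φ Φ₁ N r₀) {w : ℝ → X} (hw : IsNegSemiOrbit Φ₁ w)
    (hr : ∀ τ ≤ 0, ‖w τ‖ < r₀) {τ : ℝ} (hτ : τ ≤ 0) : w τ ∈ h.manifold ∩ {w | ‖w‖ < r₀} := by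
  have h1 : IsNegSemiOrbit Φ w := fun τ s hs hτs => by
    rw [hw τ s hs hτs]
    refine hl.eq_of_right _ (hr τ (by linarith)) s hs fun u hu => ?_
    rw [← hw τ u hu.1 (by linarith [hu.2])]
    exact (hr _ (by linarith [hu.2])).le
  refine ⟨h.mem_of_rate_le h1 ?_ hτ, hr τ hτ⟩
  refine (backwardRate_le (C := r₀) (μ := 0) fun τ hτ => ?_).trans (by exact_mod_cast hμ)
  simpa using (hr τ hτ).le

/-- The center manifold is determined by the growth of negative semi-orbits. -/
theorem GapFlow.eq_manifold (h : GapFlow Φ Λ A₀ P α β q ε t₀ μ₁ μ₂) (hμ : μ₁ ≤ μ₂) {W : Set X}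
    (hex : ∀ w₀ ∈ W, ∃ w : ℝ → X, IsNegSemiOrbit Φ w ∧ (∀ τ ≤ 0, w τ ∈ W) ∧ w 0 = w₀)
    (hle : ∀ w : ℝ → X, IsNegSemiOrbit Φ w → (∀ τ ≤ 0, w τ ∈ W) →
      backwardRate w ≤ ((μ₁ : ℝ) : EReal))
    (hmem : ∀ w : ℝ → X, IsNegSemiOrbit Φ w → backwardRate w ≤ ((μ₂ : ℝ) : EReal) →
      ∀ τ ≤ 0, w τ ∈ W) : W = h.manifold := by
  have hμ' : ((μ₁ : ℝ) : EReal) ≤ ((μ₂ : ℝ) : EReal) := by exact_mod_cast hμ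
  ext x
  constructor
  · intro hx
    obtain ⟨w, hw, hwW, rfl⟩ := hex x hx
    exact h.mem_of_rate_le hw ((hle w hw hwW).trans hμ') le_rfl
  · intro hx
    obtain ⟨w, hw, hwW, rfl⟩ := (h.negSemiOrbit hx).1
    exact hmem w hw ((h.rate_le hw hwW).trans hμ') 0 le_rfl

/-- Discrete tracking is transferred to all times by the Lipschitz bound on [0, t₀]; the factor
e^(rate·t₀) makes up for rounding the time down to a multiple of t₀. -/
theorem GapFlow.exists_tracking (h : GapFlow Φ Λ A₀ P α β q ε t₀ μ₁ μ₂) :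
    ∃ G, 0 ≤ G ∧ ∀ x, ∃ x₀ ∈ h.manifold, ∀ τ, 0 ≤ τ →
      ‖Φ τ x - Φ τ x₀‖ ≤ G * ‖x‖ * Real.exp (-h.rate * τ) := by
  have ht := h.t₀_pos
  have hq := h.gapMap.q_nonneg
  obtain ⟨c, hc0, hc⟩ := h.lip t₀ ht.le
  refine ⟨c * (2 * (1 / 4 + q)) * Real.exp (h.rate * t₀), by positivity, fun x => ?_⟩
  have hstep : ∀ x, ∀ n : ℕ, Φ ((n + 1 : ℕ) * t₀) x = Φ t₀ (Φ (n * t₀) x) := fun x n => by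
    rw [← h.add _ _ ht.le (by positivity)]; congr 1; push_cast; ring
  obtain ⟨v, hv, hv0, hvb⟩ := h.gapMap.exists_tracking (w := fun n => Φ (n * t₀) x) fun n => by
    rw [hstep]; simp
  have hvn : ∀ n : ℕ, v n = Φ (n * t₀) (v 0) := by
    intro n
    induction n with
    | zero => simp [h.zero]
    | succ n ih => rw [hstep, ← ih, hv]; simp
  refine ⟨v 0, hv0, fun τ hτ => ?_⟩
  set n := ⌊τ / t₀⌋₊ with hn
  have h1 : n * t₀ ≤ τ := (le_div_iff₀ ht).1 (Nat.floor_le (by positivity))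
  have h2 : τ < (n + 1) * t₀ := (div_lt_iff₀ ht).1 (Nat.lt_floor_add_one _)
  have h3 : τ = (τ - n * t₀) + n * t₀ := by ring
  have h4 := hvb n
  rw [norm_sub_rev, hvn] at h4
  simp only [CharP.cast_eq_zero, zero_mul, h.zero] at h4
  have h5 : ‖Φ τ x - Φ τ (v 0)‖ ≤ c * ‖Φ (n * t₀) x - Φ (n * t₀) (v 0)‖ := by
    conv_lhs => rw [h3]
    rw [h.add _ _ (by linarith) (by positivity), h.add _ _ (by linarith) (by positivity)]
    exact hc _ ⟨by linarith, by linarith⟩ _ _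
  have hrate : 0 ≤ h.rate := by
    have := h.gapMap.l₁_lt
    rw [Real.exp_lt_exp] at this
    have h6 := mul_pos h.μ₁_pos ht
    exact (pos_of_mul_pos_left (h6.trans this) ht.le).le
  have h7 : (Real.exp (h.rate * t₀))⁻¹ ^ n ≤ Real.exp (h.rate * t₀) * Real.exp (-h.rate * τ) := by
    rw [← Real.exp_neg, ← Real.exp_nat_mul, ← Real.exp_add, Real.exp_le_exp]
    nlinarith
  have h8 := mul_le_mul_of_nonneg_left h7 (show 0 ≤ 2 * ((1 / 4 + q) * ‖x‖) by positivity)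
  refine h5.trans ((mul_le_mul_of_nonneg_left (h4.trans h8) hc0).trans (le_of_eq ?_))
  ring

end Local

/-- Two trajectories on the center manifold which stay in a small ball and approach each other
faster than `e^(-γτ)` coincide. -/
theorem exists_unique_radius (h : SmoothingPair S B M κ)
    (hs : SpectralSplit S B P A P₀ C γ ν δ) {χ : X → ℝ} {m K : ℝ} (hχ : CutoffBounds χ m K)
    {r₀ : ℝ} (hr₀ : 0 < r₀) {Φ : ℝ → X → X} (hΦ : IsFlow S B (cutId χ r₀) Φ)
    {Λ A₀ : X →L[ℝ] X} {α β q ε t₀ : ℝ} (hG : GapFlow Φ Λ A₀ P α β q ε t₀ μ₁ μ₂) {μ : ℝ}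
    (hμ : γ < μ) :
    ∃ ρ, 0 < ρ ∧ ∀ D, ∀ x ∈ hG.manifold, ∀ y ∈ hG.manifold, (∀ τ, 0 ≤ τ → ‖Φ τ x‖ ≤ ρ) →
      (∀ τ, 0 ≤ τ → ‖Φ τ y‖ ≤ ρ) → (∀ τ, 0 ≤ τ → ‖Φ τ x - Φ τ y‖ ≤ D * Real.exp (-μ * τ)) →
      x = y := by
  have hC := hs.C_nonneg
  -- This time step depends on the difference μ - γ and is unrelated to `t₀`. It is long enough that
  -- the factor 2C e^(γt), by which a central difference can shrink at most in one step, is beaten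
  -- by the assumed decay e^(-μt).
  obtain ⟨t, ht, hdt⟩ : ∃ t : ℝ, 0 < t ∧ 2 * C * Real.exp (-((μ - γ) * t)) ≤ 1 / 2 := by
    have h1 : Tendsto (fun t : ℝ => 2 * C * Real.exp (-((μ - γ) * t))) atTop (𝓝 (2 * C * 0)) :=
      (Real.tendsto_exp_neg_atTop_nhds_zero.comp
        (tendsto_id.const_mul_atTop (sub_pos.2 hμ))).const_mul _
    rw [mul_zero] at h1
    obtain ⟨t, ht⟩ := ((eventually_gt_atTop 0).and
      (h1.eventually (gt_mem_nhds (by norm_num : (0 : ℝ) < 1 / 2)))).exists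
    exact ⟨t, ht.1, ht.2.le⟩
  obtain ⟨C₁, hC₁, hsub⟩ := h.SolOn_sub_le ht.le zero_le_one (L₀ := 1)
  set a := C * Real.exp (γ * t) with ha
  have ha0 : 0 ≤ a := by positivity
  -- In the ball of radius ρ nothing is truncated; the Lipschitz constant 2ρ is at most 1, as `hsub`
  -- requires, and the nonlinear term satisfies the smallness condition of `proj_sub_le` over the
  -- time `t`.
  refine ⟨min r₀ (min (1 / 2) (1 / (8 * (a * C₁ + 1)))), by positivity,
    fun D x hx y hy hxb hyb hxy => ?_⟩
  set ρ := min r₀ (min (1 / 2) (1 / (8 * (a * C₁ + 1)))) with hρ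
  have hρ0 : 0 < ρ := by positivity
  have hρ1 : ρ ≤ r₀ := min_le_left _ _
  have hρ2 : ρ ≤ 1 / 2 := (min_le_right _ _).trans (min_le_left _ _)
  have hρ3 : a * (2 * ρ * C₁) ≤ 1 / 4 := by
    have h1 : ρ * (8 * (a * C₁ + 1)) ≤ 1 :=
      (le_div_iff₀ (by positivity)).1 ((min_le_right _ _).trans (min_le_right _ _))
    nlinarith
  have hbl : BilLipOn (cutId χ r₀) {z | ‖z‖ ≤ ρ} (2 * ρ) :=
    bilLipOn_of_eq_id fun z hz => hχ.cutId_of_le hr₀ (hz.trans hρ1)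
  have hmem : ∀ {x}, x ∈ hG.manifold → ∀ τ, 0 ≤ τ → Φ τ x ∈ hG.manifold := fun {x} hx τ hτ => by
    rw [← hG.orb_of_nonneg hx hτ]; exact (hG.orb_shift x τ).1
  have hstep : ∀ τ, 0 ≤ τ → ‖P (Φ τ x) - P (Φ τ y)‖ ≤
      2 * a * ‖P (Φ (t + τ) x) - P (Φ (t + τ) y)‖ := by
    intro τ hτ
    have hR := (hsub _ _ _ (hχ.contDiff_cutId r₀).continuous (by positivity) (by linarith) hbl t
      ⟨ht.le, le_rfl⟩ _ _ ((hΦ (Φ τ x)).1 t ht.le) ((hΦ (Φ τ y)).1 t ht.le)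
      (fun s hs => by rw [mem_ofPred_eq, ← hG.add _ _ hs.1 hτ]; exact hxb _ (by linarith [hs.1]))
      (fun s hs => by rw [mem_ofPred_eq, ← hG.add _ _ hs.1 hτ]; exact hyb _ (by linarith [hs.1]))
      t ⟨ht.le, le_rfl⟩).2
    simp only [hG.zero] at hR
    have := hG.gapMap.proj_sub_le (R' := fun z => Φ t z - S t z) (hs.norm_inv t ht.le)
      (hs.left_inv t ht.le) (hs.inv_proj t ht.le) hρ3 (hmem hx τ hτ) (hmem hy τ hτ) hR
    rw [hG.add _ _ ht.le hτ, hG.add _ _ ht.le hτ]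
    simpa using this
  have hiter : ∀ n : ℕ, ‖P x - P y‖ ≤ (2 * a) ^ n * ‖P (Φ (n * t) x) - P (Φ (n * t) y)‖ := by
    intro n
    induction n with
    | zero => simp [hG.zero]
    | succ n ih =>
      refine ih.trans ?_
      rw [pow_succ, mul_assoc]
      refine mul_le_mul_of_nonneg_left ?_ (by positivity)
      have h1 : ((n + 1 : ℕ) : ℝ) * t = t + n * t := by push_cast; ring
      rw [h1]
      exact hstep _ (by positivity)
  have hdec : ∀ n : ℕ, ‖P x - P y‖ ≤ ‖P‖ * D * (1 / 2) ^ n := by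
    intro n
    have h1 := hxy (n * t) (by positivity)
    have h2 := P.le_opNorm (Φ (n * t) x - Φ (n * t) y)
    rw [map_sub] at h2
    have h3 : (2 * a) ^ n * Real.exp (-μ * (n * t)) ≤ (1 / 2) ^ n := by
      have : Real.exp (-μ * (n * t)) = Real.exp (-μ * t) ^ n := by
        rw [← Real.exp_nat_mul]; congr 1; ring
      rw [this, ← mul_pow]
      refine pow_le_pow_left₀ (by positivity) ?_ n
      refine le_trans (le_of_eq ?_) hdt
      rw [ha, mul_assoc, mul_assoc, ← Real.exp_add, ← mul_assoc]
      congr 2; ring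
    have hD : 0 ≤ D := by
      have := (norm_nonneg _).trans (hxy 0 le_rfl)
      simpa using this
    calc ‖P x - P y‖ ≤ (2 * a) ^ n * (‖P‖ * (D * Real.exp (-μ * (n * t)))) :=
          (hiter n).trans (mul_le_mul_of_nonneg_left (h2.trans
            (mul_le_mul_of_nonneg_left h1 (norm_nonneg _))) (by positivity))
      _ = ‖P‖ * D * ((2 * a) ^ n * Real.exp (-μ * (n * t))) := by ring
      _ ≤ _ := mul_le_mul_of_nonneg_left h3 (by positivity)
  have h0 : ‖P x - P y‖ ≤ 0 := by
    refine ge_of_tendsto' (x := atTop) (f := fun n : ℕ => ‖P‖ * D * (1 / 2) ^ n) ?_ hdec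
    simpa using (tendsto_pow_atTop_nhds_zero_of_lt_one (by norm_num : (0 : ℝ) ≤ 1 / 2)
      (by norm_num)).const_mul (‖P‖ * D)
  have h1 := hG.gapMap.sub_le_proj_sub hx hy
  exact sub_eq_zero.1 (norm_le_zero_iff.1 (by linarith))

/-- The constant of the estimate is itself proportional to `r₂`. Any trajectory that tracks a small
one with this constant is therefore small, so that every competitor stays in the ball in which
`exists_unique_radius` applies. -/
theorem exists_tracking_local (h : SmoothingPair S B M κ)
    (hs : SpectralSplit S B P A P₀ C γ ν δ) (hγ : 0 ≤ γ) {χ : X → ℝ} {m K : ℝ}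
    (hχ : CutoffBounds χ m K)
    {r₀ N : ℝ} (hN : 0 ≤ N) {Φ Φ₁ : ℝ → X → X} (hΦ : IsFlow S B (cutId χ r₀) Φ)
    (hl : LocalAgreement Φ Φ₁ N r₀)
    {Λ A₀ : X →L[ℝ] X} {α β q ε t₀ : ℝ} (hG : GapFlow Φ Λ A₀ P α β q ε t₀ μ₁ μ₂) {μ : ℝ}
    (hμ : μ < μ₂) :
    ∃ r₂ C : ℝ, 0 < r₂ ∧ 0 < C ∧ r₂ < r₀ ∧ ∀ w₁ : X, ‖w₁‖ ≤ r₂ →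
      (∃ w₀, TracksIn Φ₁ (hG.manifold ∩ {w | ‖w‖ < r₀}) μ C w₁ w₀) ∧
      (γ < μ → ∃! w₀, TracksIn Φ₁ (hG.manifold ∩ {w | ‖w‖ < r₀}) μ C w₁ w₀) := by
  have hr₀ := hl.pos
  obtain ⟨G, hG0, htr⟩ := hG.exists_tracking
  obtain ⟨ρ, hρ, huniq⟩ : ∃ ρ, 0 < ρ ∧ (γ < μ → ∀ D, ∀ x ∈ hG.manifold, ∀ y ∈ hG.manifold,
      (∀ τ, 0 ≤ τ → ‖Φ τ x‖ ≤ ρ) → (∀ τ, 0 ≤ τ → ‖Φ τ y‖ ≤ ρ) →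
      (∀ τ, 0 ≤ τ → ‖Φ τ x - Φ τ y‖ ≤ D * Real.exp (-μ * τ)) → x = y) := by
    by_cases hγμ : γ < μ
    · obtain ⟨ρ, hρ, hu⟩ := exists_unique_radius h hs hχ hr₀ hΦ hG hγμ
      exact ⟨ρ, hρ, fun _ => hu⟩
    · exact ⟨1, one_pos, fun hc => absurd hc hγμ⟩
  -- `N * r₂` bounds the given trajectory and `(G + 1) * r₂` its distance to a tracking one. Their
  -- sum stays below the uniqueness radius and below `r₀`; the extra 1 keeps the tracking constant
  -- positive.
  set r₂ := min ρ (r₀ / 2) / (N + G + 1) with hr₂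
  have hr₂0 : 0 < r₂ := by positivity
  have hsum : (N + G + 1) * r₂ = min ρ (r₀ / 2) := by rw [hr₂]; field_simp
  have hs1 : (N + G + 1) * r₂ ≤ ρ := hsum.le.trans (min_le_left _ _)
  have hs2 : (N + G + 1) * r₂ < r₀ := by
    have := hsum.le.trans (min_le_right _ _); linarith
  have hNr : 0 ≤ N * r₂ := by positivity
  have hGr : 0 ≤ G * r₂ := by positivity
  have hr₂r : r₂ < r₀ := by linarith
  have hmem : ∀ {x}, x ∈ hG.manifold → ∀ τ, 0 ≤ τ → Φ τ x ∈ hG.manifold := fun {x} hx τ hτ => by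
    rw [← hG.orb_of_nonneg hx hτ]; exact (hG.orb_shift x τ).1
  refine ⟨r₂, (G + 1) * r₂, hr₂0, by positivity, hr₂r, fun w₁ hw₁ => ?_⟩
  have hbd : ∀ τ, 0 ≤ τ → ‖Φ₁ τ w₁‖ ≤ N * r₂ := fun τ hτ =>
    (hl.bound w₁ (by linarith) τ hτ).trans (mul_le_mul_of_nonneg_left hw₁ hN)
  have heq₁ : ∀ τ, 0 ≤ τ → Φ₁ τ w₁ = Φ τ w₁ := fun τ hτ =>
    hl.eq_of_right w₁ (by linarith) τ hτ fun s hs => by linarith [hbd s hs.1]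
  have hexists : ∃ w₀, TracksIn Φ₁ (hG.manifold ∩ {w | ‖w‖ < r₀}) μ ((G + 1) * r₂) w₁ w₀ := by
    obtain ⟨x₀, hx₀, hx₀b⟩ := htr w₁
    have hdist : ∀ τ, 0 ≤ τ → ‖Φ τ w₁ - Φ τ x₀‖ ≤ G * r₂ * Real.exp (-hG.rate * τ) :=
      fun τ hτ => (hx₀b τ hτ).trans (mul_le_mul_of_nonneg_right
        (mul_le_mul_of_nonneg_left hw₁ hG0) (Real.exp_pos _).le)
    have hrate : 0 ≤ hG.rate := by
      have := hG.gapMap.l₁_lt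
      rw [Real.exp_lt_exp] at this
      exact (pos_of_mul_pos_left ((mul_pos hG.μ₁_pos hG.t₀_pos).trans this) hG.t₀_pos.le).le
    have hsmall : ∀ τ, 0 ≤ τ → ‖Φ τ x₀‖ < r₀ := fun τ hτ => by
      have h1 := hdist τ hτ
      have h2 : Real.exp (-hG.rate * τ) ≤ 1 := Real.exp_le_one_iff.2 (by nlinarith)
      have h3 := mul_le_mul_of_nonneg_left h2 hGr
      have h4 := norm_le_norm_add_norm_sub' (Φ τ x₀) (Φ τ w₁)
      rw [norm_sub_rev] at h4
      have h5 := hbd τ hτ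
      rw [heq₁ τ hτ] at h5
      linarith
    have hx₀r : ‖x₀‖ < r₀ := by have := hsmall 0 le_rfl; rwa [hG.zero] at this
    have heq₀ : ∀ τ, 0 ≤ τ → Φ₁ τ x₀ = Φ τ x₀ := fun τ hτ =>
      hl.eq_of_left x₀ hx₀r τ hτ fun s hs => (hsmall s hs.1).le
    refine ⟨x₀, ⟨hx₀, hx₀r⟩, fun τ hτ => ?_, fun τ hτ => ?_⟩
    · rw [heq₀ τ hτ]; exact ⟨hmem hx₀ τ hτ, hsmall τ hτ⟩
    · rw [heq₀ τ hτ, heq₁ τ hτ]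
      refine (hdist τ hτ).trans ?_
      have h1 : Real.exp (-hG.rate * τ) ≤ Real.exp (-μ * τ) := Real.exp_le_exp.2
        (mul_le_mul_of_nonneg_right (by linarith [hG.lt_rate]) hτ)
      exact mul_le_mul (by linarith) h1 (Real.exp_pos _).le (by positivity)
  refine ⟨hexists, fun hγμ => ?_⟩
  obtain ⟨w₀, hw₀⟩ := hexists
  have key : ∀ {w}, TracksIn Φ₁ (hG.manifold ∩ {w | ‖w‖ < r₀}) μ ((G + 1) * r₂) w₁ w →
      ∀ τ, 0 ≤ τ → ‖Φ τ w‖ ≤ ρ ∧ ‖Φ τ w₁ - Φ τ w‖ ≤ (G + 1) * r₂ * Real.exp (-μ * τ) := by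
    intro w hw τ hτ
    have h1 : Φ₁ τ w = Φ τ w := hl.eq_of_right w hw.1.2 τ hτ fun s hs => (hw.2.1 s hs.1).2.le
    have h2 := hw.2.2 τ hτ
    rw [h1, heq₁ τ hτ] at h2
    refine ⟨?_, h2⟩
    have h3 : Real.exp (-μ * τ) ≤ 1 := Real.exp_le_one_iff.2 (by nlinarith)
    have h4 := mul_le_mul_of_nonneg_left h3 (show 0 ≤ (G + 1) * r₂ by positivity)
    have h5 := norm_le_norm_add_norm_sub' (Φ τ w) (Φ τ w₁)
    rw [norm_sub_rev] at h5
    have h6 := hbd τ hτ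
    rw [heq₁ τ hτ] at h6
    linarith
  refine ⟨w₀, hw₀, fun y hy => ?_⟩
  refine huniq hγμ (2 * ((G + 1) * r₂)) y hy.1.1 w₀ hw₀.1.1 (fun τ hτ => (key hy τ hτ).1)
    (fun τ hτ => (key hw₀ τ hτ).1) fun τ hτ => ?_
  have h1 := (key hy τ hτ).2
  have h2 := (key hw₀ τ hτ).2
  have h3 : Φ τ y - Φ τ w₀ = (Φ τ w₁ - Φ τ w₀) - (Φ τ w₁ - Φ τ y) := by abel
  rw [h3]
  have := norm_sub_le (Φ τ w₁ - Φ τ w₀) (Φ τ w₁ - Φ τ y)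
  linarith

end Abstract

/-! ### Cauchy–Schwarz for lower Lebesgue integrals. -/

section CauchySchwarz

variable {α : Type*} [MeasurableSpace α] {μ : Measure α}

theorem lintegral_mul_sq_le {f g : α → ℝ≥0∞} (hf : AEMeasurable f μ) (hg : AEMeasurable g μ) :
    (∫⁻ x, f x * g x ∂μ) ^ 2 ≤ (∫⁻ x, f x ^ 2 ∂μ) * ∫⁻ x, g x ^ 2 ∂μ := by
  have h := ENNReal.lintegral_mul_le_Lp_mul_Lq μ Real.HolderConjugate.two_two hf hg
  have h2 : ∀ a : ℝ≥0∞, (a ^ (1 / (2 : ℝ))) ^ 2 = a := fun a => by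
    rw [← ENNReal.rpow_natCast, ← ENNReal.rpow_mul]; norm_num
  calc _ ≤ _ := pow_le_pow_left₀ zero_le h 2
    _ = _ := by
      rw [mul_pow, h2, h2]
      simp only [ENNReal.rpow_ofNat]

theorem lintegral_mul_sq_le_weight {k h : α → ℝ≥0∞} (hk : AEMeasurable k μ)
    (hh : AEMeasurable h μ) :
    (∫⁻ x, k x * h x ∂μ) ^ 2 ≤ (∫⁻ x, k x ∂μ) * ∫⁻ x, k x * h x ^ 2 ∂μ := by
  have h2 : ∀ a : ℝ≥0∞, a ^ (1 / (2 : ℝ)) * a ^ (1 / (2 : ℝ)) = a := fun a => by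
    rw [← ENNReal.rpow_add_of_nonneg _ _ (by norm_num) (by norm_num)]; norm_num
  have h1 := lintegral_mul_sq_le (hk.pow_const (1 / (2 : ℝ)))
    ((hk.pow_const (1 / (2 : ℝ))).mul hh)
  simp only [Pi.mul_apply, mul_pow, ← mul_assoc, h2] at h1
  simpa only [sq (_ ^ (1 / (2 : ℝ))), h2] using h1

end CauchySchwarz

/-! ### The weights and the space L²(m). -/

section Weight

/-- The weight `(1 + |ξ|²)^m`. -/
noncomputable def wt (m : ℝ) (ξ : Plane) : ℝ≥0∞ := ENNReal.ofReal ((1 + ‖ξ‖ ^ 2) ^ m)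

theorem wt_base_pos (ξ : Plane) : 0 < 1 + ‖ξ‖ ^ 2 := by positivity

theorem continuous_wt_real (m : ℝ) : Continuous fun ξ : Plane => (1 + ‖ξ‖ ^ 2) ^ m :=
  (by fun_prop : Continuous fun ξ : Plane => 1 + ‖ξ‖ ^ 2).rpow_const
    fun ξ => Or.inl (wt_base_pos ξ).ne'

theorem measurable_wt (m : ℝ) : Measurable (wt m) :=
  (continuous_wt_real m).measurable.ennreal_ofReal

theorem wt_ne_zero (m : ℝ) (ξ : Plane) : wt m ξ ≠ 0 :=
  (ENNReal.ofReal_pos.2 (Real.rpow_pos_of_pos (wt_base_pos ξ) m)).ne'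

theorem wt_ne_top (m : ℝ) (ξ : Plane) : wt m ξ ≠ ⊤ := ENNReal.ofReal_ne_top

theorem wt_inv (m : ℝ) (ξ : Plane) : (wt m ξ)⁻¹ = wt (-m) ξ := by
  rw [wt, wt, ← ENNReal.ofReal_inv_of_pos (Real.rpow_pos_of_pos (wt_base_pos ξ) m),
    Real.rpow_neg (wt_base_pos ξ).le]

theorem one_le_wt {m : ℝ} (hm : 0 ≤ m) (ξ : Plane) : 1 ≤ wt m ξ := by
  rw [wt, ← ENNReal.ofReal_one]
  refine ENNReal.ofReal_le_ofReal (Real.one_le_rpow ?_ hm)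
  have := sq_nonneg ‖ξ‖
  linarith

theorem wt_add_le {m : ℝ} (hm : 0 ≤ m) (x y : Plane) :
    wt m (x + y) ≤ ENNReal.ofReal (2 ^ m) * (wt m x * wt m y) := by
  have hx := wt_base_pos x
  have hy := wt_base_pos y
  rw [wt, wt, wt, ← ENNReal.ofReal_mul (by positivity), ← ENNReal.ofReal_mul (by positivity),
    ← Real.mul_rpow hx.le hy.le, ← Real.mul_rpow (by norm_num) (by positivity)]
  refine ENNReal.ofReal_le_ofReal (Real.rpow_le_rpow (by positivity) ?_ hm)
  have h1 := norm_add_le x y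
  have h2 := pow_le_pow_left₀ (norm_nonneg _) h1 2
  nlinarith [sq_nonneg (‖x‖ - ‖y‖), mul_nonneg (sq_nonneg ‖x‖) (sq_nonneg ‖y‖)]

theorem wt_mono {m : ℝ} (hm : 0 ≤ m) {x y : Plane} (h : ‖x‖ ≤ ‖y‖) : wt m x ≤ wt m y :=
  ENNReal.ofReal_le_ofReal (Real.rpow_le_rpow (by positivity) (by gcongr) hm)

/-- The plane has dimension 2, so (1+|ξ|²)^(-m) is integrable for m > 1. This puts L²(m) into L¹ and
is the only condition on m before the spectral projections appear. -/
theorem lintegral_wt_neg_lt_top {m : ℝ} (hm : 1 < m) : ∫⁻ ξ, wt (-m) ξ < ⊤ := by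
  have h := integrable_rpow_neg_one_add_norm_sq (E := Plane) (μ := volume) (r := 2 * m)
    (by simp; linarith)
  have h2 := h.lintegral_lt_top
  have h3 : -(2 * m) / 2 = -m := by ring
  rw [h3] at h2
  exact h2

/-! ### The space `L²(m)` -/

variable {m : ℝ}

theorem ae_weight_iff {p : Plane → Prop} :
    (∀ᵐ ξ ∂(weightMeasure m), p ξ) ↔ ∀ᵐ ξ, p ξ := by
  rw [weightMeasure]
  refine (ae_withDensity_iff (measurable_wt m)).trans ?_
  refine eventually_congr (Eventually.of_forall fun ξ => ?_)
  have := wt_ne_zero m ξ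
  simp only [ne_eq, this, not_false_eq_true, forall_const]

theorem lintegral_weight (g : Plane → ℝ≥0∞) :
    ∫⁻ ξ, g ξ ∂(weightMeasure m) = ∫⁻ ξ, wt m ξ * g ξ :=
  lintegral_withDensity_eq_lintegral_mul_non_measurable _ (measurable_wt m)
    (Eventually.of_forall fun ξ => (wt_ne_top m ξ).lt_top) g

theorem aestronglyMeasurable_weight_iff {g : Plane → ℝ} :
    AEStronglyMeasurable g (weightMeasure m) ↔ AEStronglyMeasurable g volume :=
  ⟨fun h => ⟨h.mk g, h.stronglyMeasurable_mk, ae_weight_iff.1 h.ae_eq_mk⟩,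
    fun h => ⟨h.mk g, h.stronglyMeasurable_mk, ae_weight_iff.2 h.ae_eq_mk⟩⟩

theorem aestronglyMeasurable_coe (f : L2m m) : AEStronglyMeasurable f volume :=
  aestronglyMeasurable_weight_iff.1 (Lp.aestronglyMeasurable f)

theorem eLpNorm_sq (g : Plane → ℝ) :
    eLpNorm g 2 (weightMeasure m) ^ 2 = ∫⁻ ξ, wt m ξ * ‖g ξ‖ₑ ^ 2 := by
  rw [eLpNorm_eq_lintegral_rpow_enorm_toReal two_ne_zero ENNReal.ofNat_ne_top, lintegral_weight,
    ← ENNReal.rpow_natCast, ← ENNReal.rpow_mul]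
  simp

theorem enorm_sq (f : L2m m) : ‖f‖ₑ ^ 2 = ∫⁻ ξ, wt m ξ * ‖f ξ‖ₑ ^ 2 := by
  rw [Lp.enorm_def, eLpNorm_sq]

theorem memLp_of_lintegral {g : Plane → ℝ} (hg : AEStronglyMeasurable g volume) {c : ℝ≥0∞}
    (hc : c ≠ ⊤) (h : ∫⁻ ξ, wt m ξ * ‖g ξ‖ₑ ^ 2 ≤ c) : MemLp g 2 (weightMeasure m) := by
  refine ⟨aestronglyMeasurable_weight_iff.2 hg, ?_⟩
  have h1 : eLpNorm g 2 (weightMeasure m) ^ 2 < ⊤ := by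
    rw [eLpNorm_sq]; exact h.trans_lt hc.lt_top
  exact (ENNReal.pow_lt_top_iff.1 h1).resolve_right two_ne_zero

theorem coeFn_toLp {g : Plane → ℝ} (hg : MemLp g 2 (weightMeasure m)) :
    hg.toLp g =ᵐ[volume] g := ae_weight_iff.1 hg.coeFn_toLp

theorem norm_le_of_lintegral {f : L2m m} {c : ℝ} (hc : 0 ≤ c)
    (h : ∫⁻ ξ, wt m ξ * ‖f ξ‖ₑ ^ 2 ≤ ENNReal.ofReal (c ^ 2)) : ‖f‖ ≤ c := by
  rw [← enorm_sq, ← ofReal_norm, ← ENNReal.ofReal_pow (norm_nonneg _),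
    ENNReal.ofReal_le_ofReal_iff (by positivity)] at h
  exact (pow_le_pow_iff_left₀ (norm_nonneg f) hc two_ne_zero).1 h

theorem ext_ae {f g : L2m m} (h : f =ᵐ[volume] g) : f = g := Lp.ext (ae_weight_iff.2 h)

theorem coeFn_add_ae (f g : L2m m) : ⇑(f + g) =ᵐ[volume] fun ξ => f ξ + g ξ :=
  ae_weight_iff.1 (Lp.coeFn_add f g)

theorem coeFn_sub_ae (f g : L2m m) : ⇑(f - g) =ᵐ[volume] fun ξ => f ξ - g ξ :=
  ae_weight_iff.1 (Lp.coeFn_sub f g)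

theorem coeFn_smul_ae (c : ℝ) (f : L2m m) : ⇑(c • f) =ᵐ[volume] fun ξ => c * f ξ :=
  ae_weight_iff.1 (Lp.coeFn_smul c f)

/-- The weights with exponents m and -m multiply to 1, so L²(-m) is the dual of L²(m) under the
unweighted pairing. -/
theorem lintegral_mul_sq_le_wt {g h : Plane → ℝ≥0∞} (hg : AEMeasurable g) (hh : AEMeasurable h) :
    (∫⁻ ξ, g ξ * h ξ) ^ 2 ≤ (∫⁻ ξ, wt (-m) ξ * g ξ ^ 2) * ∫⁻ ξ, wt m ξ * h ξ ^ 2 := by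
  have h2 : ∀ a : ℝ≥0∞, (a ^ (1 / (2 : ℝ))) ^ 2 = a := fun a => by
    rw [← ENNReal.rpow_natCast, ← ENNReal.rpow_mul]; norm_num
  have hw := (measurable_wt m).aemeasurable (μ := volume)
  have h1 := lintegral_mul_sq_le ((hw.inv.pow_const (1 / (2 : ℝ))).mul hg)
    ((hw.pow_const (1 / (2 : ℝ))).mul hh)
  simp only [Pi.mul_apply, mul_pow, h2, Pi.inv_apply, wt_inv] at h1
  refine le_trans (le_of_eq ?_) h1
  congr 2
  ext ξ
  have h3 : wt (-m) ξ ^ (1 / (2 : ℝ)) * wt m ξ ^ (1 / (2 : ℝ)) = 1 := by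
    rw [← ENNReal.mul_rpow_of_nonneg _ _ (by norm_num), ← wt_inv,
      ENNReal.inv_mul_cancel (wt_ne_zero m ξ) (wt_ne_top m ξ), ENNReal.one_rpow]
  calc g ξ * h ξ = (wt (-m) ξ ^ (1 / (2 : ℝ)) * wt m ξ ^ (1 / (2 : ℝ))) *
        (g ξ * h ξ) := by rw [h3, one_mul]
    _ = _ := by ring

/-- Pairing with a function whose dual weighted norm is finite. -/
theorem lintegral_mul_coe_sq_le {g : Plane → ℝ} (hg : AEStronglyMeasurable g volume)
    (f : L2m m) :
    (∫⁻ ξ, ‖g ξ‖ₑ * ‖f ξ‖ₑ) ^ 2 ≤ (∫⁻ ξ, wt (-m) ξ * ‖g ξ‖ₑ ^ 2) * ‖f‖ₑ ^ 2 := by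
  rw [enorm_sq]
  exact lintegral_mul_sq_le_wt hg.enorm (aestronglyMeasurable_coe f).enorm

theorem integrable_mul_coe {g : Plane → ℝ} (hg : AEStronglyMeasurable g volume)
    (h : ∫⁻ ξ, wt (-m) ξ * ‖g ξ‖ₑ ^ 2 < ⊤) (f : L2m m) : Integrable fun ξ => g ξ * f ξ := by
  refine ⟨hg.mul (aestronglyMeasurable_coe f), ?_⟩
  have h1 := lintegral_mul_coe_sq_le hg f
  rw [hasFiniteIntegral_iff_enorm]
  simp only [enorm_mul]
  have h2 : (∫⁻ ξ, ‖g ξ‖ₑ * ‖f ξ‖ₑ) ^ 2 < ⊤ :=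
    h1.trans_lt (ENNReal.mul_lt_top h (ENNReal.pow_lt_top enorm_lt_top))
  exact (ENNReal.pow_lt_top_iff.1 h2).resolve_right two_ne_zero

/-- The continuous linear functional `f ↦ ∫ g f`. -/
theorem exists_pairing {g : Plane → ℝ} (hg : AEStronglyMeasurable g volume)
    (h : ∫⁻ ξ, wt (-m) ξ * ‖g ξ‖ₑ ^ 2 < ⊤) :
    ∃ ℓ : L2m m →L[ℝ] ℝ, ∀ f, ℓ f = ∫ ξ, g ξ * f ξ := by
  have hint := fun f : L2m m => integrable_mul_coe hg h f
  refine ⟨LinearMap.mkContinuous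
    { toFun := fun f => ∫ ξ, g ξ * f ξ
      map_add' := fun f f' => ?_
      map_smul' := fun c f => ?_ } (Real.sqrt (∫⁻ ξ, wt (-m) ξ * ‖g ξ‖ₑ ^ 2).toReal)
      fun f => ?_, fun f => rfl⟩
  · rw [← integral_add (hint f) (hint f')]
    refine integral_congr_ae ((coeFn_add_ae f f').mono fun ξ hξ => ?_)
    simp only [hξ, mul_add]
  · rw [RingHom.id_apply, smul_eq_mul, ← integral_const_mul]
    refine integral_congr_ae ((coeFn_smul_ae c f).mono fun ξ hξ => ?_)
    simp only [hξ]; ring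
  · simp only [LinearMap.coe_mk, AddHom.coe_mk]
    refine (pow_le_pow_iff_left₀ (norm_nonneg _) (by positivity) two_ne_zero).1 ?_
    rw [mul_pow, Real.sq_sqrt ENNReal.toReal_nonneg]
    have h1 : ‖∫ ξ, g ξ * f ξ‖ₑ ≤ ∫⁻ ξ, ‖g ξ‖ₑ * ‖f ξ‖ₑ := by
      simpa only [enorm_mul] using enorm_integral_le_lintegral_enorm (fun ξ => g ξ * f ξ)
    have h2 := (pow_le_pow_left₀ zero_le h1 2).trans (lintegral_mul_coe_sq_le hg f)
    have h3 := ENNReal.toReal_mono (ENNReal.mul_lt_top h (ENNReal.pow_lt_top enorm_lt_top)).ne h2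
    simpa [ENNReal.toReal_mul, ENNReal.toReal_pow] using h3

theorem integrable_coe (hm : 1 < m) (f : L2m m) : Integrable f := by
  simpa using integrable_mul_coe (g := fun _ => 1) aestronglyMeasurable_const
    (by simpa using lintegral_wt_neg_lt_top hm) f

end Weight

/-! ### Gaussian kernels and weights. -/

section Gaussian

/-- The Gaussian `(4πc)⁻¹ exp(-|x|²/(4c))` on the plane. -/
noncomputable def gk (c : ℝ) (x : Plane) : ℝ :=
  1 / (4 * Real.pi * c) * Real.exp (-‖x‖ ^ 2 / (4 * c))

theorem gk_nonneg {c : ℝ} (hc : 0 < c) (x : Plane) : 0 ≤ gk c x := by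
  have := Real.pi_pos
  unfold gk; positivity

theorem continuous_gk (c : ℝ) : Continuous (gk c) := by unfold gk; fun_prop

theorem gk_le {c : ℝ} (hc : 0 < c) (x : Plane) : gk c x ≤ 1 / (4 * Real.pi * c) := by
  have := Real.pi_pos
  unfold gk
  refine mul_le_of_le_one_right (by positivity) (Real.exp_le_one_iff.2 ?_)
  rw [neg_div]
  have : 0 ≤ ‖x‖ ^ 2 / (4 * c) := by positivity
  linarith

/-- Half of the exponent is set aside, at the cost of doubling the width, to absorb polynomial
factors. -/
theorem gk_eq {c : ℝ} (hc : 0 < c) (x : Plane) :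
    gk c x = 2 * gk (2 * c) x * Real.exp (-‖x‖ ^ 2 / (8 * c)) := by
  unfold gk
  have h1 : Real.exp (-‖x‖ ^ 2 / (4 * c)) =
      Real.exp (-‖x‖ ^ 2 / (4 * (2 * c))) * Real.exp (-‖x‖ ^ 2 / (8 * c)) := by
    rw [← Real.exp_add]; congr 1; field_simp; ring
  rw [h1]
  have := Real.pi_pos
  field_simp

theorem integral_gk {c : ℝ} (hc : 0 < c) : ∫ x, gk c x = 1 := by
  have hπ := Real.pi_pos
  have h1 := GaussianFourier.integral_rexp_neg_mul_sq_norm (V := Plane) (b := 1 / (4 * c))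
    (by positivity)
  unfold gk
  rw [integral_const_mul]
  have h2 : ∀ x : Plane, -‖x‖ ^ 2 / (4 * c) = -(1 / (4 * c)) * ‖x‖ ^ 2 := fun x => by ring
  simp only [h2, h1]
  simp
  field_simp

theorem integrable_gk {c : ℝ} (hc : 0 < c) : Integrable (gk c) := by
  by_contra h
  have := integral_gk hc
  rw [integral_undef h] at this
  exact zero_ne_one this

theorem measurable_ofReal_gk (c : ℝ) : Measurable fun x => ENNReal.ofReal (gk c x) :=
  (continuous_gk c).measurable.ennreal_ofReal

theorem lintegral_gk {c : ℝ} (hc : 0 < c) : ∫⁻ x, ENNReal.ofReal (gk c x) = 1 := by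
  rw [← ofReal_integral_eq_lintegral_ofReal (integrable_gk hc)
    (Eventually.of_forall (gk_nonneg hc)), integral_gk hc, ENNReal.ofReal_one]

theorem lintegral_gk_sub {c : ℝ} (hc : 0 < c) (x : Plane) :
    ∫⁻ z, ENNReal.ofReal (gk c (x - z)) = 1 := by
  rw [lintegral_sub_left_eq_self (fun z => ENNReal.ofReal (gk c z)) x, lintegral_gk hc]

theorem exists_one_add_rpow_le {m b : ℝ} (hm : 0 ≤ m) (hb : 0 < b) :
    ∃ C : ℝ, 0 ≤ C ∧ ∀ r : ℝ, 0 ≤ r → (1 + r) ^ m ≤ C * Real.exp (b * r) := by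
  set e := min 1 (b / (m + 1)) with he
  have he0 : 0 < e := by positivity
  have he1 : e ≤ 1 := min_le_left _ _
  have hem : e * m ≤ b := by
    have h1 : e * (m + 1) ≤ b := (le_div_iff₀ (by positivity)).1 (min_le_right _ _)
    nlinarith
  refine ⟨(e⁻¹) ^ m, by positivity, fun r hr => ?_⟩
  have h1 : 1 + r ≤ e⁻¹ * Real.exp (e * r) := by
    rw [le_inv_mul_iff₀ he0]
    have := Real.add_one_le_exp (e * r)
    nlinarith
  calc (1 + r) ^ m ≤ (e⁻¹ * Real.exp (e * r)) ^ m := Real.rpow_le_rpow (by positivity) h1 hm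
    _ = (e⁻¹) ^ m * Real.exp (e * r * m) := by
      rw [Real.mul_rpow (by positivity) (by positivity), ← Real.exp_mul]
    _ ≤ _ := by
      refine mul_le_mul_of_nonneg_left (Real.exp_le_exp.2 ?_) (by positivity)
      nlinarith [mul_le_mul_of_nonneg_right hem hr]

theorem exists_wt_mul_gk_le {m : ℝ} (hm : 0 ≤ m) : ∃ C : ℝ≥0, ∀ c : ℝ, 0 < c → c ≤ 2 →
    ∀ x, wt m x * ENNReal.ofReal (gk c x) ≤ C * ENNReal.ofReal (gk (2 * c) x) := by
  obtain ⟨C, hC, hb⟩ := exists_one_add_rpow_le hm (show (0 : ℝ) < 1 / 16 by norm_num)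
  refine ⟨(2 * C).toNNReal, fun c hc hc2 x => ?_⟩
  have h2 := gk_nonneg (show 0 < 2 * c by positivity) x
  rw [wt, ← ENNReal.ofReal_mul (by positivity)]
  change _ ≤ ENNReal.ofReal (2 * C) * _
  rw [← ENNReal.ofReal_mul (by positivity)]
  refine ENNReal.ofReal_le_ofReal ?_
  rw [gk_eq hc]
  have h3 := hb (‖x‖ ^ 2) (by positivity)
  have h4 : Real.exp (1 / 16 * ‖x‖ ^ 2) * Real.exp (-‖x‖ ^ 2 / (8 * c)) ≤ 1 := by
    rw [← Real.exp_add, Real.exp_le_one_iff]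
    have : 1 / 16 * ‖x‖ ^ 2 ≤ ‖x‖ ^ 2 / (8 * c) := by
      rw [le_div_iff₀ (by positivity)]
      nlinarith [sq_nonneg ‖x‖]
    rw [neg_div]; linarith
  calc (1 + ‖x‖ ^ 2) ^ m * (2 * gk (2 * c) x * Real.exp (-‖x‖ ^ 2 / (8 * c)))
      ≤ C * Real.exp (1 / 16 * ‖x‖ ^ 2) * (2 * gk (2 * c) x * Real.exp (-‖x‖ ^ 2 / (8 * c))) := by
        gcongr
    _ = 2 * C * gk (2 * c) x * (Real.exp (1 / 16 * ‖x‖ ^ 2) * Real.exp (-‖x‖ ^ 2 / (8 * c))) := by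
        ring
    _ ≤ 2 * C * gk (2 * c) x * 1 := by gcongr
    _ = _ := by ring

/-- The weight is submultiplicative under translation up to a constant, and a Gaussian of bounded
width has bounded moments. The range c ≤ 2 covers the widths `aTime t` and `2 * aTime t` that occur
later. -/
theorem exists_lintegral_wt_gk_le {m : ℝ} (hm : 0 ≤ m) : ∃ C : ℝ≥0, ∀ c : ℝ, 0 < c → c ≤ 2 →
    ∀ x, ∫⁻ ξ, wt m ξ * ENNReal.ofReal (gk c (ξ - x)) ≤ C * wt m x := by
  obtain ⟨C, hC⟩ := exists_wt_mul_gk_le hm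
  refine ⟨(2 ^ m : ℝ).toNNReal * C, fun c hc hc2 x => ?_⟩
  rw [← lintegral_add_right_eq_self _ x]
  calc ∫⁻ ξ, wt m (ξ + x) * ENNReal.ofReal (gk c (ξ + x - x))
      ≤ ∫⁻ ξ, ENNReal.ofReal (2 ^ m) * wt m x * (C * ENNReal.ofReal (gk (2 * c) ξ)) := by
        refine lintegral_mono fun ξ => ?_
        rw [add_sub_cancel_right]
        calc _ ≤ ENNReal.ofReal (2 ^ m) * (wt m ξ * wt m x) * ENNReal.ofReal (gk c ξ) := by
              gcongr; exact wt_add_le hm ξ x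
          _ = ENNReal.ofReal (2 ^ m) * wt m x * (wt m ξ * ENNReal.ofReal (gk c ξ)) := by ring
          _ ≤ _ := mul_le_mul_right (hC c hc hc2 ξ) _
    _ = _ := by
        rw [lintegral_const_mul _ (by exact (measurable_ofReal_gk _).const_mul _),
          lintegral_const_mul _ (measurable_ofReal_gk _), lintegral_gk (by positivity), mul_one,
          ENNReal.coe_mul]
        change ENNReal.ofReal (2 ^ m) * wt m x * C = ENNReal.ofReal (2 ^ m) * C * wt m x
        ring

theorem norm_mul_gk_le {c : ℝ} (hc : 0 < c) (x : Plane) :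
    ‖x‖ * gk c x ≤ 4 * Real.sqrt c * gk (2 * c) x := by
  rw [gk_eq hc]
  have h2 := gk_nonneg (show 0 < 2 * c by positivity) x
  have hs : 0 < Real.sqrt c := Real.sqrt_pos.2 hc
  have hsq := Real.sq_sqrt hc.le
  have h1 : ‖x‖ * Real.exp (-‖x‖ ^ 2 / (8 * c)) ≤ 2 * Real.sqrt c := by
    rw [neg_div, Real.exp_neg, ← div_eq_mul_inv, div_le_iff₀ (Real.exp_pos _)]
    have h3 := Real.add_one_le_exp (‖x‖ ^ 2 / (8 * c))
    have h4 : ‖x‖ ≤ 2 * Real.sqrt c * (‖x‖ ^ 2 / (8 * c) + 1) := by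
      have h5 : 2 * Real.sqrt c * (‖x‖ ^ 2 / (8 * c) + 1) =
          (‖x‖ ^ 2 + 8 * Real.sqrt c ^ 2) / (4 * Real.sqrt c) := by
        rw [show c = Real.sqrt c ^ 2 from hsq.symm, Real.sqrt_sq hs.le]; field_simp; ring
      rw [h5, le_div_iff₀ (by positivity)]
      nlinarith [sq_nonneg (‖x‖ - 2 * Real.sqrt c)]
    exact h4.trans (mul_le_mul_of_nonneg_left h3 (by positivity))
  calc ‖x‖ * (2 * gk (2 * c) x * Real.exp (-‖x‖ ^ 2 / (8 * c)))
      = 2 * gk (2 * c) x * (‖x‖ * Real.exp (-‖x‖ ^ 2 / (8 * c))) := by ring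
    _ ≤ 2 * gk (2 * c) x * (2 * Real.sqrt c) := by gcongr
    _ = _ := by ring

theorem lintegral_comp_smul {g : Plane → ℝ≥0∞} (hg : Measurable g) {s : ℝ} (hs : 0 < s) :
    ∫⁻ y, g (s • y) = ENNReal.ofReal (s ^ 2)⁻¹ * ∫⁻ y, g y := by
  have h1 := Measure.map_addHaar_smul (volume : Measure Plane) hs.ne'
  have h2 : ∫⁻ y, g y ∂(Measure.map (s • ·) (volume : Measure Plane)) = ∫⁻ y, g (s • y) :=
    lintegral_map hg (measurable_const_smul s)
  rw [← h2, h1, lintegral_smul_measure]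
  simp only [finrank_euclideanSpace, Fintype.card_fin, smul_eq_mul]
  rw [abs_of_pos (by positivity)]

end Gaussian

/-! ### The singular kernel 1/|z|. -/

section Riesz

/-- The kernel `1 / |z|`. -/
noncomputable def rz (z : Plane) : ℝ≥0∞ := ENNReal.ofReal ‖z‖⁻¹

theorem measurable_rz : Measurable rz := measurable_norm.inv.ennreal_ofReal

theorem rz_neg (z : Plane) : rz (-z) = rz z := by rw [rz, rz, norm_neg]

theorem rz_smul {s : ℝ} (hs : 0 < s) (z : Plane) : rz (s • z) = ENNReal.ofReal s⁻¹ * rz z := by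
  rw [rz, rz, ← ENNReal.ofReal_mul (by positivity), norm_smul, Real.norm_eq_abs, abs_of_pos hs,
    mul_inv]

theorem lintegral_rz_ball_lt_top : ∫⁻ z in Metric.closedBall 0 1, rz z < ⊤ := by
  have h1 : LocallyIntegrable (fun z : Plane => ‖z‖⁻¹) volume :=
    locallyIntegrable_of_norm_le_rpow (C := 1) (α := 1) (by simp) (by simp)
      (Eventually.of_forall fun z => by
        rw [norm_inv, norm_norm, one_mul, Real.rpow_neg_one])
      measurable_norm.inv.aestronglyMeasurable
  exact (h1.integrableOn_isCompact (isCompact_closedBall 0 1)).lintegral_lt_top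

/-- The kernel is split at distance R into a rescaled local part and a constant; with the local part
supported in a ball, its integral is explicit by scaling. -/
theorem rz_le {R : ℝ} (hR : 0 < R) (z : Plane) :
    rz z ≤ ENNReal.ofReal R⁻¹ * (Metric.closedBall 0 1).indicator rz (R⁻¹ • z) +
      ENNReal.ofReal R⁻¹ := by
  by_cases hz : ‖z‖ ≤ R
  · refine le_add_right (le_of_eq ?_)
    rw [indicator_of_mem, rz_smul (by positivity), ← mul_assoc, ← ENNReal.ofReal_mul (by positivity),
      inv_inv, inv_mul_cancel₀ hR.ne', ENNReal.ofReal_one, one_mul]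
    rw [mem_closedBall_zero_iff, norm_smul, norm_inv, Real.norm_eq_abs, abs_of_pos hR,
      inv_mul_le_iff₀ hR, mul_one]
    exact hz
  · refine le_add_left (ENNReal.ofReal_le_ofReal ?_)
    exact inv_anti₀ hR (not_le.1 hz).le

theorem lintegral_indicator_rz (R : ℝ) (hR : 0 < R) (η : Plane) :
    ∫⁻ z, (Metric.closedBall 0 1).indicator rz (R⁻¹ • (z - η)) =
      ENNReal.ofReal (R ^ 2) * ∫⁻ z in Metric.closedBall 0 1, rz z := by
  rw [lintegral_sub_right_eq_self (fun z => (Metric.closedBall 0 1).indicator rz (R⁻¹ • z)) η,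
    lintegral_comp_smul (measurable_rz.indicator Metric.isClosed_closedBall.measurableSet)
      (inv_pos.2 hR), lintegral_indicator Metric.isClosed_closedBall.measurableSet]
  congr 2
  rw [inv_pow, inv_inv]

/-- Splitting at the width R = √c balances the two parts: the Gaussian is at most 1/c on the ball,
whose singular mass is of order R, and has total mass 1 outside. -/
theorem exists_lintegral_gk_rz_le : ∃ C : ℝ≥0, ∀ c : ℝ, 0 < c → ∀ x η : Plane,
    ∫⁻ z, ENNReal.ofReal (gk c (x - z)) * rz (z - η) ≤ C * ENNReal.ofReal (Real.sqrt c)⁻¹ := by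
  lift (∫⁻ z in Metric.closedBall 0 1, rz z) to ℝ≥0 using lintegral_rz_ball_lt_top.ne with K hK
  refine ⟨K + 1, fun c hc x η => ?_⟩
  set R := Real.sqrt c with hR
  have hR0 : 0 < R := Real.sqrt_pos.2 hc
  have hRc : R ^ 2 = c := Real.sq_sqrt hc.le
  have hm1 : Measurable fun z : Plane => (Metric.closedBall 0 1).indicator rz (R⁻¹ • (z - η)) :=
    (measurable_rz.indicator Metric.isClosed_closedBall.measurableSet).comp
      (by fun_prop : Measurable fun z : Plane => R⁻¹ • (z - η))
  have hm2 : Measurable fun z : Plane => ENNReal.ofReal (gk c (x - z)) :=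
    (measurable_ofReal_gk c).comp (by fun_prop : Measurable fun z : Plane => x - z)
  calc ∫⁻ z, ENNReal.ofReal (gk c (x - z)) * rz (z - η)
      ≤ ∫⁻ z, (ENNReal.ofReal c⁻¹ * (ENNReal.ofReal R⁻¹ *
          (Metric.closedBall 0 1).indicator rz (R⁻¹ • (z - η))) +
          ENNReal.ofReal R⁻¹ * ENNReal.ofReal (gk c (x - z))) := by
        refine lintegral_mono fun z => ?_
        calc _ ≤ ENNReal.ofReal (gk c (x - z)) * (ENNReal.ofReal R⁻¹ *
              (Metric.closedBall 0 1).indicator rz (R⁻¹ • (z - η)) + ENNReal.ofReal R⁻¹) := by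
              gcongr; exact rz_le hR0 _
          _ ≤ _ := by
              rw [mul_add, mul_comm _ (ENNReal.ofReal R⁻¹)]
              gcongr
              refine (gk_le hc _).trans ?_
              have := Real.pi_gt_three
              rw [one_div]
              exact inv_anti₀ hc (by nlinarith)
    _ = ENNReal.ofReal c⁻¹ * (ENNReal.ofReal R⁻¹ * (ENNReal.ofReal (R ^ 2) * K)) +
          ENNReal.ofReal R⁻¹ := by
        rw [lintegral_add_right _ (hm2.const_mul _), lintegral_const_mul _ (hm1.const_mul _),
          lintegral_const_mul _ hm1, lintegral_const_mul _ hm2, lintegral_indicator_rz R hR0,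
          lintegral_gk_sub hc, mul_one, hK]
    _ = _ := by
        rw [← mul_assoc, ← mul_assoc, ← ENNReal.ofReal_mul (by positivity),
          ← ENNReal.ofReal_mul (by positivity), hRc]
        have : c⁻¹ * R⁻¹ * c = R⁻¹ := by field_simp
        rw [this, ENNReal.coe_add, ENNReal.coe_one]; ring

theorem exists_lintegral_wt_neg_rz_le {m : ℝ} (hm : 1 < m) : ∃ C : ℝ≥0, ∀ y : Plane,
    ∫⁻ η, rz (y - η) * wt (-m) η ≤ C := by
  lift (∫⁻ z in Metric.closedBall 0 1, rz z) to ℝ≥0 using lintegral_rz_ball_lt_top.ne with K hK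
  have h1 := (lintegral_wt_neg_lt_top hm).ne
  lift (∫⁻ ξ, wt (-m) ξ) to ℝ≥0 using h1 with J hJ
  refine ⟨K + J, fun y => ?_⟩
  have hm1 : Measurable fun z : Plane => (Metric.closedBall 0 1).indicator rz (z - y) :=
    (measurable_rz.indicator Metric.isClosed_closedBall.measurableSet).comp
      (by fun_prop : Measurable fun z : Plane => z - y)
  calc ∫⁻ η, rz (y - η) * wt (-m) η
      ≤ ∫⁻ η, ((Metric.closedBall 0 1).indicator rz (η - y) + wt (-m) η) := by
        refine lintegral_mono fun η => ?_
        have h2 := rz_le one_pos (η - y)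
        rw [inv_one, ENNReal.ofReal_one, one_mul, one_smul] at h2
        have h3 : wt (-m) η ≤ 1 := by
          rw [← wt_inv, ENNReal.inv_le_one]; exact one_le_wt (by linarith) η
        rw [← rz_neg, neg_sub]
        calc _ ≤ ((Metric.closedBall 0 1).indicator rz (η - y) + 1) * wt (-m) η := by gcongr
          _ ≤ _ := by
            rw [add_mul, one_mul]
            gcongr
            exact mul_le_of_le_one_right zero_le h3
    _ = _ := by
        rw [lintegral_add_right _ (measurable_wt _), ← hJ,
          lintegral_sub_right_eq_self (fun z => (Metric.closedBall 0 1).indicator rz z) y,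
          lintegral_indicator Metric.isClosed_closedBall.measurableSet, ← hK, ENNReal.coe_add]

end Riesz

/-! ### A weighted Schur test. -/

section Schur

/-- Cauchy–Schwarz with respect to the measure K(ξ, y) dy uses the row bound, Tonelli then uses the
weighted column bound. Keeping `V` general allows column weights that gain decay for remote y. -/
theorem lintegral_kernel_sq_le {w V h : Plane → ℝ≥0∞} {K : Plane → Plane → ℝ≥0∞} {C₁ : ℝ≥0∞}
    (hK : Measurable (Function.uncurry K)) (hw : Measurable w) (hh : AEMeasurable h)
    (h1 : ∀ ξ, ∫⁻ y, K ξ y ≤ C₁) (h2 : ∀ y, ∫⁻ ξ, w ξ * K ξ y ≤ V y) :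
    ∫⁻ ξ, w ξ * (∫⁻ y, K ξ y * h y) ^ 2 ≤ C₁ * ∫⁻ y, V y * h y ^ 2 := by
  have hKξ : ∀ ξ, Measurable (K ξ) := fun ξ => hK.of_uncurry_left
  have hm : AEMeasurable (fun p : Plane × Plane => w p.1 * (K p.1 p.2 * h p.2 ^ 2))
      (volume.prod volume) :=
    (hw.comp measurable_fst).aemeasurable.mul (hK.aemeasurable.mul
      ((hh.comp_quasiMeasurePreserving Measure.quasiMeasurePreserving_snd).pow_const 2))
  calc ∫⁻ ξ, w ξ * (∫⁻ y, K ξ y * h y) ^ 2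
      ≤ ∫⁻ ξ, C₁ * ∫⁻ y, w ξ * (K ξ y * h y ^ 2) := by
        refine lintegral_mono fun ξ => ?_
        have h3 := lintegral_mul_sq_le_weight (hKξ ξ).aemeasurable hh
        have h4 : ∫⁻ y, w ξ * (K ξ y * h y ^ 2) = w ξ * ∫⁻ y, K ξ y * h y ^ 2 :=
          lintegral_const_mul'' _ ((hKξ ξ).aemeasurable.mul (hh.pow_const 2))
        rw [h4]
        calc _ ≤ w ξ * (C₁ * ∫⁻ y, K ξ y * h y ^ 2) := by
              gcongr
              exact h3.trans (by gcongr; exact h1 ξ)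
          _ = _ := by ring
    _ = C₁ * ∫⁻ ξ, ∫⁻ y, w ξ * (K ξ y * h y ^ 2) :=
        lintegral_const_mul'' _ hm.lintegral_prod_right'
    _ = C₁ * ∫⁻ y, ∫⁻ ξ, w ξ * (K ξ y * h y ^ 2) := by
        rw [lintegral_lintegral_swap hm]
    _ ≤ _ := by
        gcongr with y
        simp only [← mul_assoc]
        have : Measurable fun ξ => w ξ * K ξ y := hw.mul hK.of_uncurry_right
        rw [lintegral_mul_const _ this]
        gcongr
        exact h2 y

end Schur

/-! ### Explicit kernels of the semigroup and of its gradient. -/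

section HeatKernel

theorem aTime_pos {t : ℝ} (ht : 0 < t) : 0 < aTime t := by
  rw [aTime, sub_pos, Real.exp_lt_one_iff]; linarith

theorem aTime_le_one (t : ℝ) : aTime t ≤ 1 := by
  rw [aTime]; linarith [Real.exp_pos (-t)]

theorem exp_half_sq (t : ℝ) : Real.exp (-t / 2) ^ 2 = Real.exp (-t) := by
  rw [← Real.exp_nat_mul]; congr 1; push_cast; ring

theorem aTime_add (s t : ℝ) : aTime (s + t) = aTime s + Real.exp (-s / 2) ^ 2 * aTime t := by
  rw [exp_half_sq, aTime, aTime, aTime, neg_add, Real.exp_add]; ring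

/-- The kernel of `e^(t𝓛)`. -/
noncomputable def heatK (t : ℝ) (ξ y : Plane) : ℝ := gk (aTime t) (ξ - Real.exp (-t / 2) • y)

/-- The gradient of the kernel of `e^(t𝓛)` in the second variable. -/
noncomputable def gradK (t : ℝ) (ξ y : Plane) : Plane :=
  (Real.exp (-t / 2) / (2 * aTime t) * heatK t ξ y) • (ξ - Real.exp (-t / 2) • y)

theorem heatK_nonneg {t : ℝ} (ht : 0 < t) (ξ y : Plane) : 0 ≤ heatK t ξ y :=
  gk_nonneg (aTime_pos ht) _

theorem continuous_heatK (t : ℝ) : Continuous (Function.uncurry (heatK t)) :=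
  (continuous_gk _).comp (by fun_prop : Continuous fun p : Plane × Plane =>
    p.1 - Real.exp (-t / 2) • p.2)

theorem continuous_gradK (t : ℝ) : Continuous (Function.uncurry (gradK t)) :=
  (continuous_const.mul (continuous_heatK t)).smul (by fun_prop : Continuous fun p : Plane × Plane =>
    p.1 - Real.exp (-t / 2) • p.2)

theorem norm_heatK_le {t : ℝ} (ht : 0 < t) (ξ y : Plane) :
    ‖heatK t ξ y‖ ≤ 1 / (4 * Real.pi * aTime t) := by
  rw [Real.norm_eq_abs, abs_of_nonneg (heatK_nonneg ht ξ y)]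
  exact gk_le (aTime_pos ht) _

theorem norm_gradK_le {t : ℝ} (ht : 0 < t) (ξ y : Plane) :
    ‖gradK t ξ y‖ ≤ 2 * Real.exp (-t / 2) * (Real.sqrt (aTime t))⁻¹ *
      gk (2 * aTime t) (ξ - Real.exp (-t / 2) • y) := by
  have ha := aTime_pos ht
  have hs : 0 < Real.sqrt (aTime t) := Real.sqrt_pos.2 ha
  rw [gradK, norm_smul, norm_mul, Real.norm_eq_abs, Real.norm_eq_abs,
    abs_of_nonneg (heatK_nonneg ht ξ y), abs_of_nonneg (by positivity)]
  have h1 := norm_mul_gk_le ha (ξ - Real.exp (-t / 2) • y)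
  calc Real.exp (-t / 2) / (2 * aTime t) * heatK t ξ y * ‖ξ - Real.exp (-t / 2) • y‖
      = Real.exp (-t / 2) / (2 * aTime t) *
          (‖ξ - Real.exp (-t / 2) • y‖ * gk (aTime t) (ξ - Real.exp (-t / 2) • y)) := by
        rw [heatK]; ring
    _ ≤ Real.exp (-t / 2) / (2 * aTime t) * (4 * Real.sqrt (aTime t) *
          gk (2 * aTime t) (ξ - Real.exp (-t / 2) • y)) := by gcongr
    _ = _ := by
        have : aTime t = Real.sqrt (aTime t) * Real.sqrt (aTime t) :=
          (Real.mul_self_sqrt ha.le).symm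
        rw [show Real.exp (-t / 2) / (2 * aTime t) = Real.exp (-t / 2) /
          (2 * (Real.sqrt (aTime t) * Real.sqrt (aTime t))) by rw [← this]]
        field_simp
        ring

theorem norm_gradK_le_const {t : ℝ} (ht : 0 < t) (ξ y : Plane) :
    ‖gradK t ξ y‖ ≤ 2 * Real.exp (-t / 2) * (Real.sqrt (aTime t))⁻¹ *
      (1 / (4 * Real.pi * (2 * aTime t))) := by
  have ha := aTime_pos ht
  exact (norm_gradK_le ht ξ y).trans
    (mul_le_mul_of_nonneg_left (gk_le (by positivity) _) (by positivity))

/-- The substitution y = e^(t/2) η moves the dilation from the argument of f into the kernel; its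
Jacobian e^(-t) cancels the prefactor e^t of the semigroup. -/
theorem integral_rescale (t : ℝ) (g : Plane → Plane → ℝ) :
    ∫ η, g η (Real.exp (t / 2) • η) = Real.exp (-t) * ∫ y, g (Real.exp (-t / 2) • y) y := by
  have h := Measure.integral_comp_smul (volume : Measure Plane)
    (fun y => g (Real.exp (-t / 2) • y) y) (Real.exp (t / 2))
  have h1 : ∀ η : Plane, Real.exp (-t / 2) • Real.exp (t / 2) • η = η := fun η => by
    rw [smul_smul, ← Real.exp_add]; simp [neg_div]
  simp only [h1] at h
  rw [h]
  simp only [finrank_euclideanSpace, Fintype.card_fin, smul_eq_mul]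
  rw [abs_of_pos (by positivity), ← Real.exp_nat_mul, ← Real.exp_neg]
  congr 2
  push_cast; ring

theorem linSemigroup_eq (t : ℝ) (f : Plane → ℝ) (ξ : Plane) :
    linSemigroup t f ξ = ∫ y, heatK t ξ y * f y := by
  rw [linSemigroup, integral_rescale t fun η y =>
    Real.exp (-‖ξ - η‖ ^ 2 / (4 * aTime t)) * f y, ← mul_assoc, ← integral_const_mul]
  refine integral_congr_ae (Eventually.of_forall fun y => ?_)
  simp only [heatK, gk]
  rw [Real.exp_neg]
  field_simp

theorem divLinSemigroup_eq (t : ℝ) (F : Plane → Plane) (ξ : Plane) :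
    -(Real.exp (-t / 2) * divLinSemigroup t F ξ) = ∫ y, inner ℝ (gradK t ξ y) (F y) := by
  rw [divLinSemigroup, integral_rescale t fun η y =>
    Real.exp (-‖ξ - η‖ ^ 2 / (4 * aTime t)) * (-(inner ℝ (ξ - η) (F y)) / (2 * aTime t)),
    ← mul_assoc, ← mul_assoc, ← integral_const_mul, ← integral_neg]
  refine integral_congr_ae (Eventually.of_forall fun y => ?_)
  simp only [gradK, heatK, gk, real_inner_smul_left]
  have h : Real.exp t * Real.exp (-t) = 1 := by rw [← Real.exp_add]; simp
  linear_combination (Real.exp (-t / 2) * (4 * Real.pi * aTime t)⁻¹ *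
    Real.exp (-‖ξ - Real.exp (-t / 2) • y‖ ^ 2 / (4 * aTime t)) *
    (inner ℝ (ξ - Real.exp (-t / 2) • y) (F y)) * (2 * aTime t)⁻¹) * h

/-- Completion of the square in η: a product of two Gaussians is a Gaussian in the end points times
a normalized Gaussian in the intermediate point. With `aTime_add` this is the semigroup law for the
kernels. -/
theorem gk_mul_gk {a b s r : ℝ} (ha : 0 < a) (hb : 0 < b) (ξ η y : Plane) :
    gk a (ξ - s • η) * gk b (η - r • y) =
      gk (a + s ^ 2 * b) (ξ - (s * r) • y) * gk (a * b / (a + s ^ 2 * b))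
        (η - (a + s ^ 2 * b)⁻¹ • ((s * b) • ξ + (r * a) • y)) := by
  have hA : 0 < a + s ^ 2 * b := by positivity
  have hπ := Real.pi_pos
  have key : ∀ x h z : ℝ, (x - s * h) ^ 2 / (4 * a) + (h - r * z) ^ 2 / (4 * b) =
      (x - s * r * z) ^ 2 / (4 * (a + s ^ 2 * b)) +
      (h - (a + s ^ 2 * b)⁻¹ * (s * b * x + r * a * z)) ^ 2 / (4 * (a * b / (a + s ^ 2 * b))) := by
    intro x h z
    field_simp
    ring
  have h1 : -‖ξ - s • η‖ ^ 2 / (4 * a) + -‖η - r • y‖ ^ 2 / (4 * b) =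
      -‖ξ - (s * r) • y‖ ^ 2 / (4 * (a + s ^ 2 * b)) +
      -‖η - (a + s ^ 2 * b)⁻¹ • ((s * b) • ξ + (r * a) • y)‖ ^ 2 /
        (4 * (a * b / (a + s ^ 2 * b))) := by
    simp only [EuclideanSpace.norm_sq_eq, Fin.sum_univ_two, PiLp.sub_apply, PiLp.smul_apply,
      PiLp.add_apply, smul_eq_mul, Real.norm_eq_abs, sq_abs]
    have k0 := key (ξ 0) (η 0) (y 0)
    have k1 := key (ξ 1) (η 1) (y 1)
    simp only [neg_add, add_div, neg_div] at *
    linarith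
  unfold gk
  have hpre : 1 / (4 * Real.pi * a) * (1 / (4 * Real.pi * b)) =
      1 / (4 * Real.pi * (a + s ^ 2 * b)) *
        (1 / (4 * Real.pi * (a * b / (a + s ^ 2 * b)))) := by field_simp
  rw [mul_mul_mul_comm, ← Real.exp_add, h1, Real.exp_add, hpre]
  ring

theorem integral_gk_smul_self (c : ℝ) : ∫ x, gk c x • x = (0 : Plane) := by
  have h := integral_neg_eq_self (fun x : Plane => gk c x • x) volume
  have h1 : ∀ x : Plane, gk c (-x) • (-x) = -(gk c x • x) := fun x => by simp [gk]
  simp only [h1, integral_neg] at h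
  have h2 : (2 : ℝ) • ∫ x : Plane, gk c x • x = 0 := by
    rw [two_smul]; nth_rewrite 1 [← h]; exact neg_add_cancel _
  exact (smul_eq_zero.1 h2).resolve_left two_ne_zero

theorem integrable_gk_smul_self {c : ℝ} (hc : 0 < c) : Integrable fun x : Plane => gk c x • x := by
  refine Integrable.mono' ((integrable_gk (show 0 < 2 * c by positivity)).const_mul
    (4 * Real.sqrt c)) ((continuous_gk c).smul continuous_id).aestronglyMeasurable
    (Eventually.of_forall fun x => ?_)
  rw [norm_smul, Real.norm_eq_abs, abs_of_nonneg (gk_nonneg hc x), mul_comm]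
  exact norm_mul_gk_le hc x

theorem integral_gk_smul_sub {c : ℝ} (hc : 0 < c) (z x₀ : Plane) :
    Integrable (fun x : Plane => gk c (x - z) • (x - x₀)) ∧
      ∫ x, gk c (x - z) • (x - x₀) = z - x₀ := by
  have h1 := (integrable_gk_smul_self hc).comp_sub_right z
  have h2 := ((integrable_gk hc).comp_sub_right z).smul_const (z - x₀)
  have h3 : (fun x : Plane => gk c (x - z) • (x - x₀)) =
      fun x => gk c (x - z) • (x - z) + gk c (x - z) • (z - x₀) := by
    ext1 x; rw [← smul_add, sub_add_sub_cancel]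
  rw [h3]
  refine ⟨h1.add h2, ?_⟩
  rw [integral_add h1 h2, integral_sub_right_eq_self (fun x => gk c x • x) z,
    integral_gk_smul_self, integral_smul_const, integral_sub_right_eq_self (gk c) z,
    integral_gk hc, one_smul, zero_add]

theorem integral_heatK_mul_heatK {s t : ℝ} (hs : 0 < s) (ht : 0 < t) (ξ y : Plane) :
    ∫ η, heatK s ξ η * heatK t η y = heatK (s + t) ξ y := by
  have ha := aTime_pos hs
  have hb := aTime_pos ht
  simp only [heatK, gk_mul_gk ha hb]
  rw [integral_const_mul, integral_sub_right_eq_self (gk _), integral_gk (by positivity), mul_one,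
    ← aTime_add, ← Real.exp_add]
  congr 4; ring

/-- By `gk_mul_gk` the integral is the mean of the affine function η - r y under a Gaussian, hence
its value at the center, and that is a multiple of ξ - p r y. -/
theorem integral_heatK_smul_gradK {s t : ℝ} (hs : 0 < s) (ht : 0 < t) (ξ y : Plane) :
    ∫ η, heatK s ξ η • gradK t η y = gradK (s + t) ξ y := by
  have ha := aTime_pos hs
  have hb := aTime_pos ht
  set p := Real.exp (-s / 2) with hp
  set r := Real.exp (-t / 2) with hr
  have hA : 0 < aTime s + p ^ 2 * aTime t := by positivity
  have hpr : Real.exp (-(s + t) / 2) = p * r := by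
    rw [hp, hr, ← Real.exp_add]; congr 1; ring
  have h1 : ∀ η, heatK s ξ η • gradK t η y =
      (r / (2 * aTime t) * gk (aTime s + p ^ 2 * aTime t) (ξ - (p * r) • y)) •
      (gk (aTime s * aTime t / (aTime s + p ^ 2 * aTime t)) (η - (aTime s + p ^ 2 * aTime t)⁻¹ •
        ((p * aTime t) • ξ + (r * aTime s) • y)) • (η - r • y)) := by
    intro η
    have h2 : heatK s ξ η * heatK t η y = _ := gk_mul_gk ha hb ξ η y
    rw [gradK, smul_smul, smul_smul]
    congr 1
    linear_combination (r / (2 * aTime t)) * h2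
  simp only [h1]
  rw [integral_smul, (integral_gk_smul_sub (by positivity) _ _).2, gradK, heatK, hpr, aTime_add,
    ← hp]
  have h3 : (aTime s + p ^ 2 * aTime t)⁻¹ • ((p * aTime t) • ξ + (r * aTime s) • y) - r • y =
      (p * aTime t / (aTime s + p ^ 2 * aTime t)) • (ξ - (p * r) • y) := by
    ext i
    simp only [PiLp.sub_apply, PiLp.smul_apply, PiLp.add_apply, smul_eq_mul]
    field_simp
    ring
  rw [h3, smul_smul]
  congr 1
  field_simp

/-- Composition of a kernel operator with an integrable kernel. -/
theorem integral_kernel_comp {E : Type*} [NormedAddCommGroup E] [InnerProductSpace ℝ E]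
    [CompleteSpace E] {k : Plane → ℝ} {K : Plane → Plane → E} {F : Plane → E} {C : ℝ}
    (hk : Integrable k) (hK : StronglyMeasurable (Function.uncurry K)) (hC : ∀ η y, ‖K η y‖ ≤ C)
    (hF : Integrable F) :
    ∫ η, k η * ∫ y, inner ℝ (K η y) (F y) = ∫ y, inner ℝ (∫ η, k η • K η y) (F y) := by
  have hint : Integrable (fun p : Plane × Plane => k p.1 * inner ℝ (K p.1 p.2) (F p.2))
      (volume.prod volume) := by
    refine Integrable.mono' (((hk.norm.mul_prod hF.norm)).const_mul C) ?_
      (Eventually.of_forall fun p => ?_)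
    · exact (hk.aestronglyMeasurable.comp_fst).mul
        (hK.aestronglyMeasurable.inner hF.aestronglyMeasurable.comp_snd)
    · rw [norm_mul]
      calc ‖k p.1‖ * ‖inner ℝ (K p.1 p.2) (F p.2)‖ ≤ ‖k p.1‖ * (C * ‖F p.2‖) := by
            gcongr
            exact (norm_inner_le_norm _ _).trans (by gcongr; exact hC _ _)
        _ = _ := by ring
  calc _ = ∫ η, ∫ y, k η * inner ℝ (K η y) (F y) := by simp only [integral_const_mul]
    _ = ∫ y, ∫ η, k η * inner ℝ (K η y) (F y) := integral_integral_swap hint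
    _ = _ := by
      refine integral_congr_ae (Eventually.of_forall fun y => ?_)
      have h1 : Integrable fun η => k η • K η y := by
        refine Integrable.mono' (hk.norm.mul_const C) (hk.aestronglyMeasurable.smul
          (hK.comp_measurable measurable_prodMk_right).aestronglyMeasurable)
          (Eventually.of_forall fun η => ?_)
        rw [norm_smul]
        exact mul_le_mul_of_nonneg_left (hC η y) (norm_nonneg _)
      simp only
      rw [real_inner_comm, ← integral_inner h1]
      refine integral_congr_ae (Eventually.of_forall fun η => ?_)
      simp only
      rw [real_inner_smul_right, real_inner_comm]

theorem integrable_heatK {t : ℝ} (ht : 0 < t) (ξ : Plane) : Integrable fun y => heatK t ξ y := by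
  have h1 := ((integrable_gk (aTime_pos ht)).comp_sub_left ξ).comp_smul
    (Real.exp_pos (-t / 2)).ne'
  exact h1

theorem lintegral_heatK {t : ℝ} {c : ℝ} (hc : 0 < c) (ξ : Plane) :
    ∫⁻ y, ENNReal.ofReal (gk c (ξ - Real.exp (-t / 2) • y)) = ENNReal.ofReal (Real.exp t) := by
  have hm : Measurable fun z : Plane => ENNReal.ofReal (gk c (ξ - z)) :=
    (measurable_ofReal_gk c).comp (by fun_prop : Measurable fun z : Plane => ξ - z)
  rw [lintegral_comp_smul hm (Real.exp_pos _), lintegral_gk_sub hc, mul_one, exp_half_sq,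
    ← Real.exp_neg, neg_neg]

end HeatKernel

/-! ### Bounded operators from pointwise formulas. -/

section Builders

variable {m : ℝ}

theorem enorm_toLp_sq {g : Plane → ℝ} (hg : MemLp g 2 (weightMeasure m)) :
    ‖hg.toLp g‖ₑ ^ 2 = ∫⁻ ξ, wt m ξ * ‖g ξ‖ₑ ^ 2 := by
  rw [Lp.enorm_toLp, eLpNorm_sq]

theorem exists_clm {T : L2m m → Plane → ℝ} {c : ℝ} (hc : 0 ≤ c)
    (hmeas : ∀ f, AEStronglyMeasurable (T f) volume)
    (hadd : ∀ f g, T (f + g) =ᵐ[volume] T f + T g)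
    (hsmul : ∀ (r : ℝ) f, T (r • f) =ᵐ[volume] r • T f)
    (hbound : ∀ f, ∫⁻ ξ, wt m ξ * ‖T f ξ‖ₑ ^ 2 ≤ ENNReal.ofReal (c ^ 2) * ‖f‖ₑ ^ 2) :
    ∃ L : L2m m →L[ℝ] L2m m, (∀ f, L f =ᵐ[volume] T f) ∧ ‖L‖ ≤ c := by
  have hLp : ∀ f, MemLp (T f) 2 (weightMeasure m) := fun f => memLp_of_lintegral (hmeas f)
    (ENNReal.mul_ne_top ENNReal.ofReal_ne_top (ENNReal.pow_ne_top enorm_ne_top)) (hbound f)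
  have hcoe : ∀ f, (hLp f).toLp (T f) =ᵐ[volume] T f := fun f => coeFn_toLp (hLp f)
  let L : L2m m →ₗ[ℝ] L2m m :=
    { toFun := fun f => (hLp f).toLp (T f)
      map_add' := fun f g => by
        refine ext_ae ?_
        filter_upwards [hcoe (f + g), hcoe f, hcoe g, hadd f g, coeFn_add_ae ((hLp f).toLp (T f))
          ((hLp g).toLp (T g))] with ξ h1 h2 h3 h4 h5
        rw [h1, h4, h5, h2, h3, Pi.add_apply]
      map_smul' := fun r f => by
        refine ext_ae ?_
        filter_upwards [hcoe (r • f), hcoe f, hsmul r f, coeFn_smul_ae r ((hLp f).toLp (T f))]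
          with ξ h1 h2 h3 h4
        rw [h1, h3, RingHom.id_apply, h4, h2, Pi.smul_apply, smul_eq_mul] }
  have hL : ∀ f, ‖L f‖ ≤ c * ‖f‖ := fun f => by
    refine (pow_le_pow_iff_left₀ (norm_nonneg _) (by positivity) two_ne_zero).1 ?_
    have h1 : ‖L f‖ₑ ^ 2 ≤ ENNReal.ofReal (c ^ 2) * ‖f‖ₑ ^ 2 :=
      (enorm_toLp_sq (hLp f)).le.trans (hbound f)
    rw [← ofReal_norm, ← ofReal_norm, ← ENNReal.ofReal_pow (norm_nonneg _),
      ← ENNReal.ofReal_pow (norm_nonneg _), ← ENNReal.ofReal_mul (by positivity),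
      ENNReal.ofReal_le_ofReal_iff (by positivity)] at h1
    rw [mul_pow]; exact h1
  exact ⟨L.mkContinuous c hL, fun f => hcoe f, L.mkContinuous_norm_le hc hL⟩

theorem exists_clm₂ {T : L2m m → L2m m → Plane → ℝ} {c : ℝ} (hc : 0 ≤ c)
    (hmeas : ∀ f g, AEStronglyMeasurable (T f g) volume)
    (hadd : ∀ f f' g, T (f + f') g =ᵐ[volume] T f g + T f' g)
    (hsmul : ∀ (r : ℝ) f g, T (r • f) g =ᵐ[volume] r • T f g)
    (hadd' : ∀ f g g', T f (g + g') =ᵐ[volume] T f g + T f g')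
    (hsmul' : ∀ (r : ℝ) f g, T f (r • g) =ᵐ[volume] r • T f g)
    (hbound : ∀ f g, ∫⁻ ξ, wt m ξ * ‖T f g ξ‖ₑ ^ 2 ≤
      ENNReal.ofReal (c ^ 2) * ‖f‖ₑ ^ 2 * ‖g‖ₑ ^ 2) :
    ∃ L : L2m m →L[ℝ] L2m m →L[ℝ] L2m m, (∀ f g, L f g =ᵐ[volume] T f g) ∧ ‖L‖ ≤ c := by
  have h1 : ∀ f, ∃ L : L2m m →L[ℝ] L2m m, (∀ g, L g =ᵐ[volume] T f g) ∧ ‖L‖ ≤ c * ‖f‖ := fun f =>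
    exists_clm (by positivity) (hmeas f) (hadd' f) (fun r g => hsmul' r f g) fun g => by
      rw [mul_pow, ENNReal.ofReal_mul (by positivity), ENNReal.ofReal_pow (norm_nonneg f),
        ofReal_norm]
      exact hbound f g
  choose L hL hLn using h1
  let L' : L2m m →ₗ[ℝ] L2m m →L[ℝ] L2m m :=
    { toFun := L
      map_add' := fun f f' => by
        ext1 g
        refine ext_ae ?_
        filter_upwards [hL (f + f') g, hL f g, hL f' g, hadd f f' g, coeFn_add_ae (L f g) (L f' g)]
          with ξ h1 h2 h3 h4 h5
        rw [h1, h4, add_apply, h5, h2, h3, Pi.add_apply]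
      map_smul' := fun r f => by
        ext1 g
        refine ext_ae ?_
        filter_upwards [hL (r • f) g, hL f g, hsmul r f g, coeFn_smul_ae r (L f g)]
          with ξ h1 h2 h3 h4
        rw [h1, h3, RingHom.id_apply, smul_apply, h4, h2, Pi.smul_apply,
          smul_eq_mul] }
  exact ⟨L'.mkContinuous c hLn, hL, L'.mkContinuous_norm_le hc hLn⟩

end Builders

/-! ### The semigroup on L²(m). -/

section Heat

variable {m : ℝ}

/-- The function `e^(t𝓛) f`. -/
noncomputable def heatOp (t : ℝ) (f : Plane → ℝ) (ξ : Plane) : ℝ := ∫ y, heatK t ξ y * f y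

theorem heatOp_aestronglyMeasurable (t : ℝ) {f : Plane → ℝ} (hf : AEStronglyMeasurable f volume) :
    AEStronglyMeasurable (heatOp t f) volume :=
  AEStronglyMeasurable.integral_prod_right' (f := fun p : Plane × Plane => heatK t p.1 p.2 * f p.2)
    ((continuous_heatK t).aestronglyMeasurable.mul hf.comp_snd)

theorem integrable_heatK_mul {t : ℝ} (ht : 0 < t) {f : Plane → ℝ} (hf : Integrable f) (ξ : Plane) :
    Integrable fun y => heatK t ξ y * f y :=
  hf.bdd_mul ((continuous_heatK t).comp (by fun_prop : Continuous fun y : Plane =>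
    (ξ, y))).aestronglyMeasurable (Eventually.of_forall (norm_heatK_le ht ξ))

theorem enorm_heatOp_le {t : ℝ} (ht : 0 < t) (f : Plane → ℝ) (ξ : Plane) :
    ‖heatOp t f ξ‖ₑ ≤ ∫⁻ y, ENNReal.ofReal (heatK t ξ y) * ‖f y‖ₑ := by
  refine (enorm_integral_le_lintegral_enorm _).trans (le_of_eq ?_)
  congr 1; ext y
  rw [enorm_mul, Real.enorm_of_nonneg (heatK_nonneg ht ξ y)]

theorem measurable_gk_kernel (c s : ℝ) :
    Measurable (Function.uncurry fun ξ y : Plane => ENNReal.ofReal (gk c (ξ - s • y))) :=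
  (measurable_ofReal_gk c).comp (by fun_prop : Measurable fun p : Plane × Plane => p.1 - s • p.2)

theorem lintegral_heatOp_le {t : ℝ} (ht : 0 < t) {f : Plane → ℝ}
    (hf : AEStronglyMeasurable f volume) {V : Plane → ℝ≥0∞} 
    (hV : ∀ y, ∫⁻ ξ, wt m ξ * ENNReal.ofReal (heatK t ξ y) ≤ V y) :
    ∫⁻ ξ, wt m ξ * ‖heatOp t f ξ‖ₑ ^ 2 ≤
      ENNReal.ofReal (Real.exp t) * ∫⁻ y, V y * ‖f y‖ₑ ^ 2 := by
  refine le_trans (lintegral_mono fun ξ => ?_) (lintegral_kernel_sq_le (h := fun y => ‖f y‖ₑ)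
    (measurable_gk_kernel (aTime t) (Real.exp (-t / 2))) (measurable_wt m) hf.enorm
    (fun ξ => (lintegral_heatK (aTime_pos ht) ξ).le) hV)
  gcongr
  exact enorm_heatOp_le ht f ξ

/-- The kernel has mass e^t in the variable y and weighted columns bounded by the weight, so Schur's
test gives the growth e^(t/2). This crude rate suffices for well-posedness; the decay is derived
from the spectral splitting. -/
theorem exists_heat_clm (hm : 1 < m) : ∃ C : ℝ, 0 ≤ C ∧ ∀ t : ℝ, 0 < t →
    ∃ L : L2m m →L[ℝ] L2m m, (∀ f, L f =ᵐ[volume] heatOp t f) ∧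
      ‖L‖ ≤ C * Real.exp (1 / 2 * t) := by
  obtain ⟨C, hC⟩ := exists_lintegral_wt_gk_le (show 0 ≤ m by linarith)
  refine ⟨Real.sqrt C, by positivity, fun t ht => ?_⟩
  refine exists_clm (by positivity)
    (fun f => heatOp_aestronglyMeasurable t (aestronglyMeasurable_coe f))
    (fun f g => Eventually.of_forall fun ξ => ?_) (fun r f => Eventually.of_forall fun ξ => ?_)
    fun f => ?_
  · rw [Pi.add_apply, heatOp, heatOp, heatOp, ← integral_add
      (integrable_heatK_mul ht (integrable_coe hm f) ξ)
      (integrable_heatK_mul ht (integrable_coe hm g) ξ)]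
    refine integral_congr_ae ((coeFn_add_ae f g).mono fun y hy => ?_)
    simp only [hy, mul_add]
  · rw [Pi.smul_apply, heatOp, heatOp, smul_eq_mul, ← integral_const_mul]
    refine integral_congr_ae ((coeFn_smul_ae r f).mono fun y hy => ?_)
    simp only [hy]; ring
  · have hV : ∀ y, ∫⁻ ξ, wt m ξ * ENNReal.ofReal (heatK t ξ y) ≤ C * wt m y := fun y => by
      refine (hC _ (aTime_pos ht) (by linarith [aTime_le_one t]) _).trans ?_
      gcongr
      refine wt_mono (by linarith) ?_
      rw [norm_smul, Real.norm_eq_abs, abs_of_pos (Real.exp_pos _)]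
      exact mul_le_of_le_one_left (norm_nonneg _) (Real.exp_le_one_iff.2 (by linarith))
    refine (lintegral_heatOp_le ht (aestronglyMeasurable_coe f) hV).trans (le_of_eq ?_)
    have h4 : ∫⁻ y, C * wt m y * ‖f y‖ₑ ^ 2 = C * ∫⁻ y, wt m y * ‖f y‖ₑ ^ 2 := by
      simp only [mul_assoc]
      exact lintegral_const_mul'' _ ((measurable_wt m).aemeasurable.mul
        ((aestronglyMeasurable_coe f).enorm.pow_const 2))
    rw [h4, enorm_sq, mul_pow,
      Real.sq_sqrt C.coe_nonneg, ← Real.exp_nat_mul, mul_comm (C : ℝ),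
      ENNReal.ofReal_mul (by positivity), ENNReal.ofReal_coe_nnreal, mul_assoc]
    congr 3
    push_cast; ring

end Heat

/-! ### The velocity field of a function in L²(m). -/

section BiotSavart

variable {m : ℝ}

theorem continuous_perp : Continuous perp := by
  unfold perp
  refine (PiLp.continuous_toLp 2 _).comp (continuous_pi fun i => ?_)
  fin_cases i
  · exact ((continuous_apply (1 : Fin 2)).comp (PiLp.continuous_ofLp 2 _)).neg
  · exact (continuous_apply (0 : Fin 2)).comp (PiLp.continuous_ofLp 2 _)

theorem norm_perp (x : Plane) : ‖perp x‖ = ‖x‖ := by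
  rw [EuclideanSpace.norm_eq, EuclideanSpace.norm_eq]
  simp [perp, Fin.sum_univ_two, add_comm]

/-- The integrand of the Biot-Savart law. -/
noncomputable def bsK (b : Plane → ℝ) (y η : Plane) : Plane :=
  (b η / ‖y - η‖ ^ 2) • perp (y - η)

theorem enorm_bsK (b : Plane → ℝ) (y η : Plane) : ‖bsK b y η‖ₑ = rz (y - η) * ‖b η‖ₑ := by
  rw [bsK, enorm_smul, ← ofReal_norm, ← ofReal_norm, ← ofReal_norm, norm_perp, rz,
    ← ENNReal.ofReal_mul (norm_nonneg _), ← ENNReal.ofReal_mul (by positivity), norm_div, norm_pow,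
    norm_norm]
  congr 1
  rcases eq_or_ne ‖y - η‖ 0 with h | h
  · simp [h]
  · field_simp

/-- The majorant `∫ |b(η)| / |y - η| dη` of the velocity field. -/
noncomputable def riesz (b : Plane → ℝ) (y : Plane) : ℝ≥0∞ := ∫⁻ η, rz (y - η) * ‖b η‖ₑ

theorem enorm_biotSavart_le (b : Plane → ℝ) (y : Plane) : ‖biotSavart b y‖ₑ ≤ riesz b y := by
  rw [biotSavart, enorm_smul]
  have h1 : ‖1 / (2 * Real.pi)‖ₑ ≤ 1 := by
    rw [← ofReal_norm, ENNReal.ofReal_le_one, Real.norm_eq_abs, abs_of_pos (by positivity),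
      div_le_one (by positivity)]
    linarith [Real.pi_gt_three]
  refine (mul_le_of_le_one_left zero_le h1).trans ?_
  refine (enorm_integral_le_lintegral_enorm _).trans (le_of_eq ?_)
  congr 1; ext η; exact enorm_bsK b y η

theorem bsK_aestronglyMeasurable (b : L2m m) :
    AEStronglyMeasurable (fun p : Plane × Plane => bsK b p.1 p.2) (volume.prod volume) := by
  have h1 : AEStronglyMeasurable (fun p : Plane × Plane => b p.2) (volume.prod volume) :=
    (aestronglyMeasurable_coe b).comp_snd
  have h2 : Measurable fun p : Plane × Plane => ‖p.1 - p.2‖ ^ 2 := by fun_prop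
  exact (h1.aemeasurable.div h2.aemeasurable).aestronglyMeasurable.smul
    (continuous_perp.comp (by fun_prop : Continuous fun p : Plane × Plane =>
      p.1 - p.2)).aestronglyMeasurable

theorem biotSavart_aestronglyMeasurable (b : L2m m) :
    AEStronglyMeasurable (biotSavart b) volume :=
  (bsK_aestronglyMeasurable b).integral_prod_right'.const_smul (1 / (2 * Real.pi))

theorem measurable_rz_sub : Measurable fun p : Plane × Plane => rz (p.1 - p.2) :=
  measurable_rz.comp (by fun_prop)

theorem riesz_aemeasurable (b : L2m m) : AEMeasurable (riesz b) :=
  AEMeasurable.lintegral_prod_right' (f := fun p : Plane × Plane => rz (p.1 - p.2) * ‖b p.2‖ₑ)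
    (measurable_rz_sub.aemeasurable.mul (aestronglyMeasurable_coe b).comp_snd.enorm)

/-- The weights of exponents -m and m are inserted as a factor 1. The kernel (1/|y-η|)(1+|η|²)^(-m)
has mass bounded uniformly in y, so Cauchy–Schwarz can be taken with respect to it. -/
theorem riesz_sq_le (hm : 1 < m) : ∃ C : ℝ≥0, ∀ (b : L2m m) (y : Plane),
    riesz b y ^ 2 ≤ C * ∫⁻ η, rz (y - η) * (wt m η * ‖b η‖ₑ ^ 2) := by
  obtain ⟨C, hC⟩ := exists_lintegral_wt_neg_rz_le hm
  refine ⟨C, fun b y => ?_⟩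
  have hr : Measurable fun η => rz (y - η) := measurable_rz.comp (by fun_prop)
  have h1 := lintegral_mul_sq_le_weight (μ := volume) (k := fun η => rz (y - η) * wt (-m) η)
    (h := fun η => wt m η * ‖b η‖ₑ) (hr.mul (measurable_wt _)).aemeasurable
    ((measurable_wt m).aemeasurable.mul (aestronglyMeasurable_coe b).enorm)
  have h2 : ∀ η, wt (-m) η * wt m η = 1 := fun η => by
    rw [← wt_inv, ENNReal.inv_mul_cancel (wt_ne_zero m η) (wt_ne_top m η)]
  have h3 : ∀ η, rz (y - η) * wt (-m) η * (wt m η * ‖b η‖ₑ) = rz (y - η) * ‖b η‖ₑ := fun η => by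
    calc _ = rz (y - η) * (wt (-m) η * wt m η) * ‖b η‖ₑ := by ring
      _ = _ := by rw [h2, mul_one]
  have h4 : ∀ η, rz (y - η) * wt (-m) η * (wt m η * ‖b η‖ₑ) ^ 2 =
      rz (y - η) * (wt m η * ‖b η‖ₑ ^ 2) := fun η => by
    calc _ = rz (y - η) * (wt (-m) η * wt m η) * (wt m η * ‖b η‖ₑ ^ 2) := by ring
      _ = _ := by rw [h2, mul_one]
  simp only [h3, h4] at h1
  exact h1.trans (by gcongr; exact hC y)

/-- Weighted bound for the velocity field. -/
theorem lintegral_mul_riesz_sq_le {C C' : ℝ≥0∞} {b : L2m m}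
    (hC : ∀ y, riesz b y ^ 2 ≤ C * ∫⁻ η, rz (y - η) * (wt m η * ‖b η‖ₑ ^ 2)) {g : Plane → ℝ≥0∞}
    (hg : Measurable g) (hgb : ∀ η, ∫⁻ y, g y * rz (y - η) ≤ C') :
    ∫⁻ y, g y * riesz b y ^ 2 ≤ C * C' * ‖b‖ₑ ^ 2 := by
  have hb : AEMeasurable fun η => wt m η * ‖b η‖ₑ ^ 2 :=
    (measurable_wt m).aemeasurable.mul ((aestronglyMeasurable_coe b).enorm.pow_const 2)
  have hm2 : AEMeasurable (fun p : Plane × Plane =>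
      g p.1 * (rz (p.1 - p.2) * (wt m p.2 * ‖b p.2‖ₑ ^ 2))) (volume.prod volume) :=
    (hg.comp measurable_fst).aemeasurable.mul (measurable_rz_sub.aemeasurable.mul
      (hb.comp_quasiMeasurePreserving Measure.quasiMeasurePreserving_snd))
  calc ∫⁻ y, g y * riesz b y ^ 2
      ≤ ∫⁻ y, C * ∫⁻ η, g y * (rz (y - η) * (wt m η * ‖b η‖ₑ ^ 2)) := by
        refine lintegral_mono fun y => ?_
        have hr : Measurable fun η => rz (y - η) := measurable_rz.comp (by fun_prop)
        have h4 : ∫⁻ η, g y * (rz (y - η) * (wt m η * ‖b η‖ₑ ^ 2)) =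
            g y * ∫⁻ η, rz (y - η) * (wt m η * ‖b η‖ₑ ^ 2) :=
          lintegral_const_mul'' _ (hr.aemeasurable.mul hb)
        rw [h4]
        calc _ ≤ g y * (C * ∫⁻ η, rz (y - η) * (wt m η * ‖b η‖ₑ ^ 2)) := by gcongr; exact hC y
          _ = _ := by ring
    _ = C * ∫⁻ η, ∫⁻ y, g y * (rz (y - η) * (wt m η * ‖b η‖ₑ ^ 2)) := by
        rw [lintegral_const_mul'' _ hm2.lintegral_prod_right', lintegral_lintegral_swap hm2]
    _ ≤ C * ∫⁻ η, C' * (wt m η * ‖b η‖ₑ ^ 2) := by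
        gcongr with η
        have hr : Measurable fun y => g y * rz (y - η) :=
          hg.mul (measurable_rz.comp (by fun_prop))
        simp only [← mul_assoc]
        simp only [mul_assoc _ (wt m η)]
        rw [lintegral_mul_const _ hr]
        gcongr
        exact hgb η
    _ = _ := by rw [lintegral_const_mul'' _ hb, ← enorm_sq, mul_assoc]

/-- The product of a vorticity and a velocity is integrable because the velocity lies in the dual
space L²(-m): by `riesz_sq_le` this reduces to one more integral of 1/|z| against the weight of
exponent -m. -/
theorem exists_flux_bound (hm : 1 < m) : ∃ C : ℝ≥0, ∀ a b : L2m m,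
    (∫⁻ y, ‖a y‖ₑ * riesz b y) ^ 2 ≤ C * ‖a‖ₑ ^ 2 * ‖b‖ₑ ^ 2 := by
  obtain ⟨C, hC⟩ := riesz_sq_le hm
  obtain ⟨C', hC'⟩ := exists_lintegral_wt_neg_rz_le hm
  refine ⟨C * C', fun a b => ?_⟩
  have h1 := lintegral_mul_sq_le_wt (m := m) (riesz_aemeasurable b)
    (aestronglyMeasurable_coe a).enorm
  rw [← enorm_sq] at h1
  have h2 : ∀ η, ∫⁻ y, wt (-m) y * rz (y - η) ≤ C' := fun η => by
    refine le_trans (le_of_eq ?_) (hC' η)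
    congr 1; ext y; rw [← rz_neg, neg_sub, mul_comm]
  have h3 := lintegral_mul_riesz_sq_le (hC b) (measurable_wt (-m)) h2
  simp only [mul_comm ‖_‖ₑ (riesz _ _)]
  refine h1.trans ?_
  calc _ ≤ C * C' * ‖b‖ₑ ^ 2 * ‖a‖ₑ ^ 2 := by gcongr
    _ = _ := by push_cast; ring

theorem riesz_ae_lt_top (hm : 1 < m) (b : L2m m) : ∀ᵐ y, riesz b y < ⊤ := by
  obtain ⟨C, hC⟩ := riesz_sq_le hm
  obtain ⟨C', hC'⟩ := exists_lintegral_wt_neg_rz_le hm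
  have h2 : ∀ η, ∫⁻ y, wt (-m) y * rz (y - η) ≤ C' := fun η => by
    refine le_trans (le_of_eq ?_) (hC' η)
    congr 1; ext y; rw [← rz_neg, neg_sub, mul_comm]
  have h3 := lintegral_mul_riesz_sq_le (hC b) (measurable_wt (-m)) h2
  have h4 : ∫⁻ y, wt (-m) y * riesz b y ^ 2 < ⊤ := h3.trans_lt
    (ENNReal.mul_lt_top (ENNReal.mul_lt_top ENNReal.coe_lt_top ENNReal.coe_lt_top)
      (ENNReal.pow_lt_top enorm_lt_top))
  refine (ae_lt_top' ((measurable_wt _).aemeasurable.mul ((riesz_aemeasurable b).pow_const 2))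
    h4.ne).mono fun y hy => ?_
  by_contra hc
  rw [not_lt, top_le_iff] at hc
  simp [hc, wt_ne_zero] at hy

theorem integrable_bsK {b : L2m m} {y : Plane} (h : riesz b y < ⊤) : Integrable (bsK b y) := by
  refine ⟨?_, ?_⟩
  · have h2 : Measurable fun η : Plane => ‖y - η‖ ^ 2 := by fun_prop
    exact ((aestronglyMeasurable_coe b).aemeasurable.div h2.aemeasurable).aestronglyMeasurable.smul
      (continuous_perp.comp (by fun_prop : Continuous fun η : Plane =>
        y - η)).aestronglyMeasurable
  · rw [hasFiniteIntegral_iff_enorm]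
    simp only [enorm_bsK]
    exact h

theorem biotSavart_add (hm : 1 < m) (b b' : L2m m) :
    biotSavart ⇑(b + b') =ᵐ[volume] biotSavart b + biotSavart b' := by
  filter_upwards [riesz_ae_lt_top hm b, riesz_ae_lt_top hm b'] with y hy hy'
  rw [Pi.add_apply, biotSavart, biotSavart, biotSavart, ← smul_add]
  congr 1
  refine Eq.trans ?_ (integral_add (integrable_bsK hy) (integrable_bsK hy'))
  refine integral_congr_ae ((coeFn_add_ae b b').mono fun η hη => ?_)
  simp only [hη, add_div, add_smul]

theorem biotSavart_smul (r : ℝ) (b : L2m m) : biotSavart ⇑(r • b) = r • biotSavart b := by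
  ext1 y
  rw [Pi.smul_apply, biotSavart, biotSavart, smul_comm r,
    ← integral_smul r (fun η => (b η / ‖y - η‖ ^ 2) • perp (y - η))]
  congr 1
  refine integral_congr_ae ((coeFn_smul_ae r b).mono fun η hη => ?_)
  simp only [hη, smul_smul]
  congr 1; ring

end BiotSavart

/-! ### The bilinear transport term. -/

section Transport

variable {m : ℝ}

/-- The vector field `a v`, where `v` is the velocity field of `b`. -/
noncomputable def fluxOf (a b : Plane → ℝ) (y : Plane) : Plane := a y • biotSavart b y

/-- The function `-e^(-t/2) ∇ · e^(t𝓛) (a v)`, where `v` is the velocity field of `b`. -/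
noncomputable def gradOp (t : ℝ) (a b : Plane → ℝ) (ξ : Plane) : ℝ :=
  ∫ y, inner ℝ (gradK t ξ y) (fluxOf a b y)

theorem enorm_fluxOf_le (a b : Plane → ℝ) (y : Plane) :
    ‖fluxOf a b y‖ₑ ≤ ‖a y‖ₑ * riesz b y := by
  rw [fluxOf, enorm_smul]; gcongr; exact enorm_biotSavart_le b y

theorem fluxOf_aestronglyMeasurable (a b : L2m m) : AEStronglyMeasurable (fluxOf a b) volume :=
  (aestronglyMeasurable_coe a).smul (biotSavart_aestronglyMeasurable b)

theorem exists_lintegral_fluxOf_le (hm : 1 < m) : ∃ C : ℝ≥0, ∀ a b : L2m m,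
    ∫⁻ y, ‖fluxOf a b y‖ₑ ≤ C * ‖a‖ₑ * ‖b‖ₑ := by
  obtain ⟨C, hC⟩ := exists_flux_bound hm
  refine ⟨NNReal.sqrt C, fun a b => ?_⟩
  have h1 : (∫⁻ y, ‖fluxOf a b y‖ₑ) ^ 2 ≤ (NNReal.sqrt C * ‖a‖ₑ * ‖b‖ₑ) ^ 2 := by
    rw [mul_pow, mul_pow, ← ENNReal.coe_pow, NNReal.sq_sqrt]
    exact (pow_le_pow_left₀ zero_le (lintegral_mono fun y => enorm_fluxOf_le a b y) 2).trans
      (hC a b)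
  exact (ENNReal.pow_le_pow_left_iff two_ne_zero).1 h1

theorem integrable_fluxOf (hm : 1 < m) (a b : L2m m) : Integrable (fluxOf a b) := by
  obtain ⟨C, hC⟩ := exists_lintegral_fluxOf_le hm
  refine ⟨fluxOf_aestronglyMeasurable a b, ?_⟩
  rw [hasFiniteIntegral_iff_enorm]
  exact (hC a b).trans_lt (ENNReal.mul_lt_top (ENNReal.mul_lt_top ENNReal.coe_lt_top
    enorm_lt_top) enorm_lt_top)

theorem fluxOf_add_left (a a' b : L2m m) :
    fluxOf ⇑(a + a') b =ᵐ[volume] fluxOf a b + fluxOf a' b := by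
  filter_upwards [coeFn_add_ae a a'] with y hy
  rw [Pi.add_apply, fluxOf, hy, add_smul, fluxOf, fluxOf]

theorem fluxOf_smul_left (r : ℝ) (a b : L2m m) :
    fluxOf ⇑(r • a) b =ᵐ[volume] r • fluxOf a b := by
  filter_upwards [coeFn_smul_ae r a] with y hy
  rw [Pi.smul_apply, fluxOf, hy, fluxOf, smul_smul]

theorem fluxOf_add_right (hm : 1 < m) (a b b' : L2m m) :
    fluxOf a ⇑(b + b') =ᵐ[volume] fluxOf a b + fluxOf a b' := by
  filter_upwards [biotSavart_add hm b b'] with y hy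
  rw [Pi.add_apply, fluxOf, hy, Pi.add_apply, smul_add, fluxOf, fluxOf]

theorem fluxOf_smul_right (r : ℝ) (a b : L2m m) :
    fluxOf a ⇑(r • b) =ᵐ[volume] r • fluxOf a b := by
  refine Eventually.of_forall fun y => ?_
  rw [Pi.smul_apply, fluxOf, biotSavart_smul, Pi.smul_apply, smul_comm, fluxOf]

theorem integrable_inner_gradK {t : ℝ} (ht : 0 < t) {F : Plane → Plane} (hF : Integrable F)
    (ξ : Plane) : Integrable fun y => inner ℝ (gradK t ξ y) (F y) := by
  have hc : Continuous fun y => gradK t ξ y := (continuous_gradK t).uncurry_left ξ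
  refine Integrable.mono' (hF.norm.const_mul (2 * Real.exp (-t / 2) * (Real.sqrt (aTime t))⁻¹ *
    (1 / (4 * Real.pi * (2 * aTime t))))) (hc.aestronglyMeasurable.inner hF.aestronglyMeasurable)
    (Eventually.of_forall fun y => ?_)
  exact (norm_inner_le_norm _ _).trans
    (mul_le_mul_of_nonneg_right (norm_gradK_le_const ht ξ y) (norm_nonneg _))

theorem gradOp_congr_add {t : ℝ} (ht : 0 < t) {F F₁ F₂ : Plane → Plane} (h1 : Integrable F₁)
    (h2 : Integrable F₂) (h : F =ᵐ[volume] F₁ + F₂) (ξ : Plane) :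
    ∫ y, inner ℝ (gradK t ξ y) (F y) =
      (∫ y, inner ℝ (gradK t ξ y) (F₁ y)) + ∫ y, inner ℝ (gradK t ξ y) (F₂ y) := by
  rw [← integral_add (integrable_inner_gradK ht h1 ξ) (integrable_inner_gradK ht h2 ξ)]
  refine integral_congr_ae (h.mono fun y hy => ?_)
  simp only [hy, Pi.add_apply, inner_add_right]

theorem gradOp_congr_smul (t : ℝ) {F F₁ : Plane → Plane} (r : ℝ) (h : F =ᵐ[volume] r • F₁)
    (ξ : Plane) :
    ∫ y, inner ℝ (gradK t ξ y) (F y) = r * ∫ y, inner ℝ (gradK t ξ y) (F₁ y) := by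
  rw [← integral_const_mul]
  refine integral_congr_ae (h.mono fun y hy => ?_)
  simp only [hy, Pi.smul_apply, real_inner_smul_right]

theorem gradOp_aestronglyMeasurable (t : ℝ) (a b : L2m m) :
    AEStronglyMeasurable (gradOp t a b) volume :=
  AEStronglyMeasurable.integral_prod_right'
    (f := fun p : Plane × Plane => inner ℝ (gradK t p.1 p.2) (fluxOf a b p.2))
    ((continuous_gradK t).aestronglyMeasurable.inner (fluxOf_aestronglyMeasurable a b).comp_snd)

theorem enorm_gradOp_le {t : ℝ} (ht : 0 < t) (a b : L2m m) (ξ : Plane) :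
    ‖gradOp t a b ξ‖ₑ ≤ ENNReal.ofReal (2 * Real.exp (-t / 2) * (Real.sqrt (aTime t))⁻¹) *
      ∫⁻ y, ENNReal.ofReal (gk (2 * aTime t) (ξ - Real.exp (-t / 2) • y)) *
        (‖a y‖ₑ * riesz b y) := by
  have hm1 : Measurable fun y => ENNReal.ofReal (gk (2 * aTime t) (ξ - Real.exp (-t / 2) • y)) :=
    (measurable_gk_kernel (2 * aTime t) (Real.exp (-t / 2))).of_uncurry_left
  refine le_trans ?_ (lintegral_const_mul'' _ (hm1.aemeasurable.mul
    ((aestronglyMeasurable_coe a).enorm.mul (riesz_aemeasurable b)))).le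
  refine (enorm_integral_le_lintegral_enorm _).trans (lintegral_mono fun y => ?_)
  have h1 : ‖inner ℝ (gradK t ξ y) (fluxOf a b y)‖ₑ ≤ ‖gradK t ξ y‖ₑ * ‖fluxOf a b y‖ₑ := by
    rw [← ofReal_norm, ← ofReal_norm, ← ofReal_norm, ← ENNReal.ofReal_mul (norm_nonneg _)]
    exact ENNReal.ofReal_le_ofReal (norm_inner_le_norm _ _)
  refine h1.trans ?_
  simp only [Pi.mul_apply]
  rw [← mul_assoc]
  refine mul_le_mul' ?_ (enorm_fluxOf_le a b y)
  rw [← ENNReal.ofReal_mul (by positivity), ← ofReal_norm]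
  exact ENNReal.ofReal_le_ofReal (norm_gradK_le ht ξ y)

/-- Homogeneity of 1/|z| reduces the dilated Gaussian to `exists_lintegral_gk_rz_le`: one factor s
comes from the kernel and s⁻² from the change of variables. -/
theorem exists_lintegral_gk_scaled_rz_le : ∃ C : ℝ≥0, ∀ c s : ℝ, 0 < c → 0 < s → ∀ ξ η : Plane,
    ∫⁻ y, ENNReal.ofReal (gk c (ξ - s • y)) * rz (y - η) ≤
      C * ENNReal.ofReal (s⁻¹ * (Real.sqrt c)⁻¹) := by
  obtain ⟨C, hC⟩ := exists_lintegral_gk_rz_le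
  refine ⟨C, fun c s hc hs ξ η => ?_⟩
  have h1 : ∀ y, ENNReal.ofReal (gk c (ξ - s • y)) * rz (y - η) =
      ENNReal.ofReal s * (ENNReal.ofReal (gk c (ξ - s • y)) * rz (s • y - s • η)) := fun y => by
    rw [← smul_sub, rz_smul hs, mul_left_comm, ← mul_assoc (ENNReal.ofReal s),
      ← ENNReal.ofReal_mul hs.le, mul_inv_cancel₀ hs.ne', ENNReal.ofReal_one, one_mul]
  have hm1 : Measurable fun z : Plane => ENNReal.ofReal (gk c (ξ - z)) * rz (z - s • η) :=
    ((measurable_ofReal_gk c).comp (by fun_prop : Measurable fun z : Plane => ξ - z)).mul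
      (measurable_rz.comp (by fun_prop))
  simp only [h1]
  have h2 : ∫⁻ y, ENNReal.ofReal s * (ENNReal.ofReal (gk c (ξ - s • y)) * rz (s • y - s • η)) =
      ENNReal.ofReal s * ∫⁻ y, ENNReal.ofReal (gk c (ξ - s • y)) * rz (s • y - s • η) :=
    lintegral_const_mul _ (hm1.comp (measurable_const_smul s))
  rw [h2, lintegral_comp_smul hm1 hs]
  calc _ ≤ ENNReal.ofReal s * (ENNReal.ofReal (s ^ 2)⁻¹ * (C * ENNReal.ofReal (Real.sqrt c)⁻¹)) := by
        gcongr; exact hC c hc ξ _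
    _ = C * (ENNReal.ofReal s * ENNReal.ofReal (s ^ 2)⁻¹ * ENNReal.ofReal (Real.sqrt c)⁻¹) := by ring
    _ = _ := by
        rw [← ENNReal.ofReal_mul hs.le, ← ENNReal.ofReal_mul (by positivity)]
        congr 3
        field_simp

theorem lintegral_mul_mul_sq_le {k g h : Plane → ℝ≥0∞} (hk : Measurable k) (hg : AEMeasurable g)
    (hh : AEMeasurable h) :
    (∫⁻ y, k y * (g y * h y)) ^ 2 ≤ (∫⁻ y, k y * g y ^ 2) * ∫⁻ y, k y * h y ^ 2 := by
  have h2 : ∀ a : ℝ≥0∞, a ^ (1 / (2 : ℝ)) * a ^ (1 / (2 : ℝ)) = a := fun a => by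
    rw [← ENNReal.rpow_add_of_nonneg _ _ (by norm_num) (by norm_num)]; norm_num
  have hk' := hk.aemeasurable (μ := (volume : Measure Plane)).pow_const (1 / (2 : ℝ))
  have h1 := lintegral_mul_sq_le (hk'.mul hg) (hk'.mul hh)
  simp only [Pi.mul_apply, mul_pow, sq (_ ^ (1 / (2 : ℝ))), h2] at h1
  refine le_trans (le_of_eq ?_) h1
  congr 2; ext y
  rw [mul_mul_mul_comm, h2]

/-- Cauchy–Schwarz with respect to the Gaussian separates the factors. The velocity part is bounded
uniformly in ξ by the singular-kernel estimate, so the whole weight falls on `a`. The gradient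
contributes 1/a(t) and the velocity a(t)^(-1/2) to the squared norm. -/
theorem lintegral_gradOp_le {C Cz Cw : ℝ≥0} (hm : 0 ≤ m)
    (hC : ∀ (b : L2m m) (y : Plane), riesz b y ^ 2 ≤ C * ∫⁻ η, rz (y - η) * (wt m η * ‖b η‖ₑ ^ 2))
    (hz : ∀ c s : ℝ, 0 < c → 0 < s → ∀ ξ η : Plane,
      ∫⁻ y, ENNReal.ofReal (gk c (ξ - s • y)) * rz (y - η) ≤
        Cz * ENNReal.ofReal (s⁻¹ * (Real.sqrt c)⁻¹))
    (hw : ∀ c : ℝ, 0 < c → c ≤ 2 →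
      ∀ x, ∫⁻ ξ, wt m ξ * ENNReal.ofReal (gk c (ξ - x)) ≤ Cw * wt m x)
    {t : ℝ} (ht : 0 < t) (a b : L2m m) :
    ∫⁻ ξ, wt m ξ * ‖gradOp t a b ξ‖ₑ ^ 2 ≤
      ENNReal.ofReal (4 * Real.exp (-t / 2) * (aTime t)⁻¹ * (Real.sqrt (2 * aTime t))⁻¹ *
        (C * Cz * Cw)) * ‖a‖ₑ ^ 2 * ‖b‖ₑ ^ 2 := by
  have hat := aTime_pos ht
  set s := Real.exp (-t / 2) with hs
  have hs0 : 0 < s := Real.exp_pos _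
  have hs1 : s ≤ 1 := Real.exp_le_one_iff.2 (by linarith)
  set E : ℝ≥0∞ := ENNReal.ofReal (s⁻¹ * (Real.sqrt (2 * aTime t))⁻¹) with hE
  set D := ENNReal.ofReal (2 * s * (Real.sqrt (aTime t))⁻¹) with hD
  set g : Plane → Plane → ℝ≥0∞ := fun ξ y => ENNReal.ofReal (gk (2 * aTime t) (ξ - s • y)) with hg
  have hgm : Measurable (Function.uncurry g) := measurable_gk_kernel _ _
  have hgy : ∀ ξ, Measurable (g ξ) := fun ξ => hgm.of_uncurry_left
  have ham := (aestronglyMeasurable_coe a).enorm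
  have h1 : ∀ ξ, ‖gradOp t a b ξ‖ₑ ^ 2 ≤
      D ^ 2 * (C * (Cz * E) * ‖b‖ₑ ^ 2) * ∫⁻ y, g ξ y * ‖a y‖ₑ ^ 2 := by
    intro ξ
    refine (pow_le_pow_left₀ zero_le (enorm_gradOp_le ht a b ξ) 2).trans ?_
    rw [mul_pow, mul_assoc (D ^ 2)]
    refine mul_le_mul_right ((lintegral_mul_mul_sq_le (hgy ξ) ham (riesz_aemeasurable b)).trans ?_)
      (D ^ 2)
    rw [mul_comm]
    refine mul_le_mul_left ?_ _
    exact lintegral_mul_riesz_sq_le (hC b) (hgy ξ) fun η =>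
      hz _ _ (by positivity) hs0 ξ η
  have hm2 : AEMeasurable (fun p : Plane × Plane => wt m p.1 * (g p.1 p.2 * ‖a p.2‖ₑ ^ 2))
      (volume.prod volume) :=
    ((measurable_wt m).comp measurable_fst).aemeasurable.mul (hgm.aemeasurable.mul
      ((ham.comp_quasiMeasurePreserving Measure.quasiMeasurePreserving_snd).pow_const 2))
  have h3 : ∀ ξ, wt m ξ * ∫⁻ y, g ξ y * ‖a y‖ₑ ^ 2 =
      ∫⁻ y, wt m ξ * (g ξ y * ‖a y‖ₑ ^ 2) := fun ξ =>
    (lintegral_const_mul'' _ ((hgy ξ).aemeasurable.mul (ham.pow_const 2))).symm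
  have hwa : AEMeasurable fun y => wt m y * ‖a y‖ₑ ^ 2 :=
    (measurable_wt m).aemeasurable.mul (ham.pow_const 2)
  calc ∫⁻ ξ, wt m ξ * ‖gradOp t a b ξ‖ₑ ^ 2
      ≤ ∫⁻ ξ, D ^ 2 * (C * (Cz * E) * ‖b‖ₑ ^ 2) *
          ∫⁻ y, wt m ξ * (g ξ y * ‖a y‖ₑ ^ 2) := by
        refine lintegral_mono fun ξ => ?_
        rw [← h3]
        calc _ ≤ wt m ξ * (D ^ 2 * (C * (Cz * E) * ‖b‖ₑ ^ 2) * ∫⁻ y, g ξ y * ‖a y‖ₑ ^ 2) := by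
              gcongr; exact h1 ξ
          _ = _ := by ring
    _ = D ^ 2 * (C * (Cz * E) * ‖b‖ₑ ^ 2) * ∫⁻ y, ∫⁻ ξ, wt m ξ * (g ξ y * ‖a y‖ₑ ^ 2) := by
        rw [lintegral_const_mul'' _ hm2.lintegral_prod_right', lintegral_lintegral_swap hm2]
    _ ≤ D ^ 2 * (C * (Cz * E) * ‖b‖ₑ ^ 2) * ∫⁻ y, Cw * (wt m y * ‖a y‖ₑ ^ 2) := by
        gcongr with y
        have h4 : Measurable fun ξ => wt m ξ * g ξ y := (measurable_wt m).mul hgm.of_uncurry_right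
        simp only [← mul_assoc]
        rw [lintegral_mul_const _ h4]
        gcongr
        refine (hw _ (by positivity) (by linarith [aTime_le_one t]) _).trans ?_
        gcongr
        refine wt_mono hm ?_
        rw [norm_smul, Real.norm_eq_abs, abs_of_pos hs0]
        exact mul_le_of_le_one_left (norm_nonneg _) hs1
    _ = D ^ 2 * E * (C * Cz * Cw) * ‖a‖ₑ ^ 2 * ‖b‖ₑ ^ 2 := by
        rw [lintegral_const_mul'' _ hwa, ← enorm_sq]; ring
    _ = _ := by
        have h5 : ((C : ℝ≥0∞) * Cz * Cw) = ENNReal.ofReal (C * Cz * Cw) := by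
          rw [← NNReal.coe_mul, ← NNReal.coe_mul, ENNReal.ofReal_coe_nnreal]; push_cast; rfl
        rw [h5, hD, hE, ← ENNReal.ofReal_pow (by positivity), ← ENNReal.ofReal_mul (by positivity),
          ← ENNReal.ofReal_mul (by positivity)]
        congr 4
        rw [mul_pow, inv_pow, Real.sq_sqrt hat.le]
        field_simp
        ring

theorem half_le_aTime {t : ℝ} (ht : t ∈ Ioc (0 : ℝ) 1) : t / 2 ≤ aTime t := by
  have h1 : Real.exp (-t) ≤ (1 + t)⁻¹ := by
    rw [Real.exp_neg]
    exact inv_anti₀ (by linarith [ht.1]) (by linarith [Real.add_one_le_exp t])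
  have h2 : (1 + t)⁻¹ ≤ 1 - t / 2 := by
    rw [inv_le_iff_one_le_mul₀ (by linarith [ht.1])]
    nlinarith [ht.1, ht.2]
  rw [aTime]; linarith

theorem exists_transport_clm (hm : 1 < m) : ∃ C : ℝ, 0 ≤ C ∧ ∀ t : ℝ, 0 < t →
    ∃ L : L2m m →L[ℝ] L2m m →L[ℝ] L2m m, (∀ a b, L a b =ᵐ[volume] gradOp t a b) ∧
      (t ≤ 1 → ‖L‖ ≤ C * t ^ (-(3 / 4 : ℝ))) := by
  obtain ⟨C, hC⟩ := riesz_sq_le hm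
  obtain ⟨Cz, hz⟩ := exists_lintegral_gk_scaled_rz_le
  obtain ⟨Cw, hw⟩ := exists_lintegral_wt_gk_le (show 0 ≤ m by linarith)
  refine ⟨Real.sqrt (8 * (C * Cz * Cw)), by positivity, fun t ht => ?_⟩
  have hat := aTime_pos ht
  -- The squared norm is of order a(t)^(-3/2), and a(t) ≥ t/2 for t ≤ 1; the root gives the exponent
  -- -3/4, which is integrable at 0.
  set c := Real.sqrt (4 * Real.exp (-t / 2) * (aTime t)⁻¹ * (Real.sqrt (2 * aTime t))⁻¹ *
        (C * Cz * Cw)) with hc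
  obtain ⟨L, hL, hLc⟩ := exists_clm₂ (T := fun a b : L2m m => gradOp t a b) (c := c) (by positivity)
    (fun a b => gradOp_aestronglyMeasurable t a b)
    (fun a a' b => Eventually.of_forall fun ξ => gradOp_congr_add ht (integrable_fluxOf hm a b)
      (integrable_fluxOf hm a' b) (fluxOf_add_left a a' b) ξ)
    (fun r a b => Eventually.of_forall fun ξ =>
      gradOp_congr_smul t r (fluxOf_smul_left r a b) ξ)
    (fun a b b' => Eventually.of_forall fun ξ => gradOp_congr_add ht (integrable_fluxOf hm a b)
      (integrable_fluxOf hm a b') (fluxOf_add_right hm a b b') ξ)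
    (fun r a b => Eventually.of_forall fun ξ =>
      gradOp_congr_smul t r (fluxOf_smul_right r a b) ξ)
    fun a b => by
      rw [hc, Real.sq_sqrt (by positivity)]
      exact lintegral_gradOp_le (by linarith) hC hz hw ht a b
  refine ⟨L, hL, fun ht1 => hLc.trans ?_⟩
  rw [hc, Real.sqrt_le_left (by positivity), mul_pow, Real.sq_sqrt (by positivity)]
  have h1 := half_le_aTime ⟨ht, ht1⟩
  have h2 : (aTime t)⁻¹ ≤ 2 * t⁻¹ := by
    rw [← div_eq_mul_inv, ← inv_div]; exact inv_anti₀ (by positivity) h1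
  have h3 : (Real.sqrt (2 * aTime t))⁻¹ ≤ (Real.sqrt t)⁻¹ :=
    inv_anti₀ (Real.sqrt_pos.2 ht) (Real.sqrt_le_sqrt (by linarith))
  have h4 : Real.exp (-t / 2) ≤ 1 := Real.exp_le_one_iff.2 (by linarith)
  have h5 : (t ^ (-(3 / 4 : ℝ))) ^ 2 = t⁻¹ * (Real.sqrt t)⁻¹ := by
    rw [Real.sqrt_eq_rpow, ← Real.rpow_neg ht.le, ← Real.rpow_neg_one, ← Real.rpow_add ht,
      ← Real.rpow_natCast, ← Real.rpow_mul ht.le]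
    norm_num
  have hCC : (0 : ℝ) ≤ C * Cz * Cw := by positivity
  rw [h5]
  calc 4 * Real.exp (-t / 2) * (aTime t)⁻¹ * (Real.sqrt (2 * aTime t))⁻¹ * (C * Cz * Cw)
      ≤ 4 * 1 * (2 * t⁻¹) * (Real.sqrt t)⁻¹ * (C * Cz * Cw) := by gcongr
    _ = _ := by ring

end Transport

/-! ### The operators on L²(m) and strong continuity. -/

section Operators

open Classical in
/-- The semigroup `e^(t𝓛)` on `L²(m)`. -/
noncomputable def heatS (m t : ℝ) : L2m m →L[ℝ] L2m m :=
  if h : 0 < t ∧ ∃ L : L2m m →L[ℝ] L2m m, ∀ f, L f =ᵐ[volume] heatOp t f then h.2.choose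
  else ContinuousLinearMap.id ℝ (L2m m)

open Classical in
/-- The bilinear maps `-e^(-t/2) ∇ · e^(t𝓛) (a v)`, `v` the velocity field of `b`, on `L²(m)`. -/
noncomputable def transB (m t : ℝ) : L2m m →L[ℝ] L2m m →L[ℝ] L2m m :=
  if h : 0 < t ∧ ∃ L : L2m m →L[ℝ] L2m m →L[ℝ] L2m m, ∀ a b, L a b =ᵐ[volume] gradOp t a b
  then h.2.choose else 0

variable {m : ℝ}

theorem heatS_of_nonpos {t : ℝ} (ht : t ≤ 0) : heatS m t = ContinuousLinearMap.id ℝ (L2m m) := by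
  rw [heatS, dif_neg]; exact fun h => absurd h.1 (not_lt.2 ht)

theorem heatS_coe (hm : 1 < m) {t : ℝ} (ht : 0 < t) (f : L2m m) :
    heatS m t f =ᵐ[volume] heatOp t f := by
  obtain ⟨C, -, hC⟩ := exists_heat_clm hm
  obtain ⟨L, hL, -⟩ := hC t ht
  have h : 0 < t ∧ ∃ L : L2m m →L[ℝ] L2m m, ∀ f, L f =ᵐ[volume] heatOp t f := ⟨ht, L, hL⟩
  rw [heatS, dif_pos h]
  exact h.2.choose_spec f

theorem exists_norm_heatS_le (hm : 1 < m) : ∃ C : ℝ, 1 ≤ C ∧ ∀ t, 0 ≤ t →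
    ‖heatS m t‖ ≤ C * Real.exp (1 / 2 * t) := by
  obtain ⟨C, hC0, hC⟩ := exists_heat_clm hm
  refine ⟨max C 1, le_max_right _ _, fun t ht => ?_⟩
  rcases ht.eq_or_lt with rfl | ht
  · rw [heatS_of_nonpos le_rfl, mul_zero, Real.exp_zero, mul_one]
    exact ContinuousLinearMap.norm_id_le.trans (le_max_right _ _)
  · obtain ⟨L, hL, hLC⟩ := hC t ht
    have : heatS m t = L := by
      ext1 f; exact ext_ae ((heatS_coe hm ht f).trans (hL f).symm)
    rw [this]
    exact hLC.trans (mul_le_mul_of_nonneg_right (le_max_left _ _) (Real.exp_pos _).le)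

theorem transB_coe (hm : 1 < m) {t : ℝ} (ht : 0 < t) (a b : L2m m) :
    transB m t a b =ᵐ[volume] gradOp t a b := by
  obtain ⟨C, -, hC⟩ := exists_transport_clm hm
  obtain ⟨L, hL, -⟩ := hC t ht
  have h : 0 < t ∧ ∃ L : L2m m →L[ℝ] L2m m →L[ℝ] L2m m, ∀ a b, L a b =ᵐ[volume] gradOp t a b :=
    ⟨ht, L, hL⟩
  rw [transB, dif_pos h]
  exact h.2.choose_spec a b

theorem exists_norm_transB_le (hm : 1 < m) : ∃ C : ℝ, 0 ≤ C ∧ ∀ t ∈ Ioc (0 : ℝ) 1,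
    ‖transB m t‖ ≤ C * t ^ (-(3 / 4 : ℝ)) := by
  obtain ⟨C, hC0, hC⟩ := exists_transport_clm hm
  refine ⟨C, hC0, fun t ht => ?_⟩
  obtain ⟨L, hL, hLC⟩ := hC t ht.1
  have : transB m t = L := by
    ext1 a; ext1 b; exact ext_ae ((transB_coe hm ht.1 a b).trans (hL a b).symm)
  rw [this]
  exact hLC ht.2

theorem heatOp_congr (t : ℝ) {f g : Plane → ℝ} (h : f =ᵐ[volume] g) : heatOp t f = heatOp t g := by
  ext1 ξ
  exact integral_congr_ae (h.mono fun y hy => by simp only [hy])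

theorem heatOp_heatOp {s t : ℝ} (hs : 0 < s) (ht : 0 < t) {f : Plane → ℝ} (hf : Integrable f)
    (ξ : Plane) : heatOp s (heatOp t f) ξ = heatOp (s + t) f ξ := by
  have h := integral_kernel_comp (E := ℝ) (K := heatK t) (integrable_heatK hs ξ)
    (continuous_heatK t).stronglyMeasurable (norm_heatK_le ht) hf
  simp only [smul_eq_mul, integral_heatK_mul_heatK hs ht] at h
  have h1 : ∀ a b : ℝ, inner ℝ a b = a * b := fun a b => by simp [mul_comm]
  simp only [h1] at h
  exact h

theorem heatOp_gradOp (hm : 1 < m) {s t : ℝ} (hs : 0 < s) (ht : 0 < t) (a b : L2m m) (ξ : Plane) :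
    heatOp s (gradOp t a b) ξ = gradOp (s + t) a b ξ := by
  have h := integral_kernel_comp (K := gradK t) (integrable_heatK hs ξ)
    (continuous_gradK t).stronglyMeasurable (norm_gradK_le_const ht) (integrable_fluxOf hm a b)
  simp only [integral_heatK_smul_gradK hs ht] at h
  exact h

theorem heatS_add (hm : 1 < m) {s t : ℝ} (hs : 0 ≤ s) (ht : 0 ≤ t) (f : L2m m) :
    heatS m (s + t) f = heatS m s (heatS m t f) := by
  rcases hs.eq_or_lt with rfl | hs
  · rw [zero_add, heatS_of_nonpos le_rfl]; rfl
  rcases ht.eq_or_lt with rfl | ht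
  · rw [add_zero, heatS_of_nonpos le_rfl]; rfl
  refine ext_ae ?_
  filter_upwards [heatS_coe hm (add_pos hs ht) f, heatS_coe hm hs (heatS m t f)] with ξ h1 h2
  rw [h1, h2, heatOp_congr s (heatS_coe hm ht f), heatOp_heatOp hs ht (integrable_coe hm f)]

theorem heatS_transB (hm : 1 < m) {s t : ℝ} (hs : 0 ≤ s) (ht : 0 < t) (a b : L2m m) :
    heatS m s (transB m t a b) = transB m (s + t) a b := by
  rcases hs.eq_or_lt with rfl | hs
  · rw [zero_add, heatS_of_nonpos le_rfl]; rfl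
  refine ext_ae ?_
  filter_upwards [transB_coe hm (add_pos hs ht) a b, heatS_coe hm hs (transB m t a b)] with ξ h1 h2
  rw [h1, h2, heatOp_congr s (transB_coe hm ht a b), heatOp_gradOp hm hs ht]

/-! ### Strong continuity -/

/-- Scaling to a Gaussian of fixed width moves all dependence on t into the argument of g, so that
convergence as t → 0 follows by dominated convergence for bounded continuous g. -/
theorem heatOp_eq_gk_one {t : ℝ} (ht : 0 < t) (g : Plane → ℝ) (ξ : Plane) :
    heatOp t g ξ = Real.exp t *
      ∫ z, gk 1 z * g (Real.exp (t / 2) • (ξ - Real.sqrt (aTime t) • z)) := by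
  have ha := aTime_pos ht
  have hs : 0 < Real.sqrt (aTime t) := Real.sqrt_pos.2 ha
  have hsq := Real.sq_sqrt ha.le
  have h1 := Measure.integral_comp_smul (volume : Measure Plane)
    (fun w => aTime t * gk (aTime t) w * g (Real.exp (t / 2) • (ξ - w))) (Real.sqrt (aTime t))
  have h2 : ∀ z : Plane, aTime t * gk (aTime t) (Real.sqrt (aTime t) • z) = gk 1 z := fun z => by
    rw [gk, gk, norm_smul, Real.norm_eq_abs, abs_of_pos hs, mul_pow, hsq]
    have : -(aTime t * ‖z‖ ^ 2) / (4 * aTime t) = -‖z‖ ^ 2 / (4 * 1) := by field_simp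
    rw [this]
    field_simp
  simp only [h2, finrank_euclideanSpace, Fintype.card_fin, smul_eq_mul, hsq, mul_assoc] at h1
  rw [h1, integral_const_mul, abs_of_pos (inv_pos.2 ha), inv_mul_cancel_left₀ ha.ne']
  have h3 := integral_sub_left_eq_self
    (fun w => gk (aTime t) w * g (Real.exp (t / 2) • (ξ - w))) volume ξ
  simp only [sub_sub_cancel] at h3
  rw [← h3, integral_rescale t fun η y => gk (aTime t) (ξ - η) * g y, ← mul_assoc, ← Real.exp_add,
    add_neg_cancel, Real.exp_zero, one_mul]
  rfl

theorem tendsto_aTime : Tendsto aTime (𝓝[>] 0) (𝓝 0) := by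
  have : Continuous aTime := by unfold aTime; fun_prop
  have h := this.tendsto 0
  simp only [aTime, neg_zero, Real.exp_zero, sub_self] at h
  exact h.mono_left nhdsWithin_le_nhds

theorem tendsto_heatOp {g : Plane → ℝ} (hg : Continuous g) {c : ℝ} (hc : ∀ x, ‖g x‖ ≤ c)
    (ξ : Plane) : Tendsto (fun t => heatOp t g ξ) (𝓝[>] 0) (𝓝 (g ξ)) := by
  have h1 : Tendsto (fun t => Real.exp t *
      ∫ z, gk 1 z * g (Real.exp (t / 2) • (ξ - Real.sqrt (aTime t) • z))) (𝓝[>] 0)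
      (𝓝 (1 * ∫ z, gk 1 z * g ξ)) := by
    refine Tendsto.mul ?_ ?_
    · have := (Real.continuous_exp.tendsto 0)
      rw [Real.exp_zero] at this
      exact this.mono_left nhdsWithin_le_nhds
    · refine tendsto_integral_filter_of_dominated_convergence (fun z => gk 1 z * c)
        (Eventually.of_forall fun t => ?_) (Eventually.of_forall fun t =>
          Eventually.of_forall fun z => ?_) ((integrable_gk one_pos).mul_const c)
        (Eventually.of_forall fun z => ?_)
      · exact ((continuous_gk 1).mul (hg.comp (by fun_prop))).aestronglyMeasurable
      · rw [norm_mul, Real.norm_of_nonneg (gk_nonneg one_pos z)]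
        exact mul_le_mul_of_nonneg_left (hc _) (gk_nonneg one_pos z)
      · refine Tendsto.const_mul _ ?_
        have h2 : Tendsto (fun t : ℝ => Real.exp (t / 2)) (𝓝[>] 0) (𝓝 1) := by
          have : Continuous fun t : ℝ => Real.exp (t / 2) := by fun_prop
          have h := this.tendsto 0
          simp only [zero_div, Real.exp_zero] at h
          exact h.mono_left nhdsWithin_le_nhds
        have h3 : Tendsto (fun t => Real.sqrt (aTime t)) (𝓝[>] 0) (𝓝 0) := by
          have := (Real.continuous_sqrt.tendsto 0).comp tendsto_aTime
          rwa [Real.sqrt_zero] at this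
        have h4 : Tendsto (fun t => Real.exp (t / 2) • (ξ - Real.sqrt (aTime t) • z)) (𝓝[>] 0)
            (𝓝 ((1 : ℝ) • (ξ - (0 : ℝ) • z))) :=
          h2.smul (tendsto_const_nhds.sub (h3.smul_const z))
        rw [zero_smul, sub_zero, one_smul] at h4
        exact (hg.tendsto ξ).comp h4
  rw [integral_mul_const, integral_gk one_pos, one_mul, one_mul] at h1
  refine h1.congr' ?_
  filter_upwards [self_mem_nhdsWithin] with t ht
  rw [heatOp_eq_gk_one ht]

theorem lintegral_wt_exp_lt_top (hm : 0 ≤ m) (K : ℝ) :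
    ∫⁻ ξ, wt m ξ * ENNReal.ofReal (K * Real.exp (-‖ξ‖ ^ 2 / 16)) ^ 2 < ⊤ := by
  obtain ⟨C, hC⟩ := exists_lintegral_wt_gk_le hm
  have h1 := hC 2 two_pos le_rfl 0
  simp only [sub_zero] at h1
  have h2 : ∀ ξ : Plane, wt m ξ * ENNReal.ofReal (K * Real.exp (-‖ξ‖ ^ 2 / 16)) ^ 2 ≤
      ENNReal.ofReal (8 * Real.pi * K ^ 2) * (wt m ξ * ENNReal.ofReal (gk 2 ξ)) := fun ξ => by
    rw [mul_left_comm, ← ENNReal.ofReal_mul (by positivity)]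
    gcongr
    have h3 : ENNReal.ofReal (K * Real.exp (-‖ξ‖ ^ 2 / 16)) ≤
        ENNReal.ofReal (|K| * Real.exp (-‖ξ‖ ^ 2 / 16)) :=
      ENNReal.ofReal_le_ofReal (mul_le_mul_of_nonneg_right (le_abs_self K) (Real.exp_pos _).le)
    refine (pow_le_pow_left₀ zero_le h3 2).trans ?_
    rw [← ENNReal.ofReal_pow (by positivity)]
    refine ENNReal.ofReal_le_ofReal (le_of_eq ?_)
    rw [mul_pow, sq_abs, gk, ← Real.exp_nat_mul]
    have h4 : ((2 : ℕ) : ℝ) * (-‖ξ‖ ^ 2 / 16) = -‖ξ‖ ^ 2 / (4 * 2) := by push_cast; ring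
    rw [h4]
    have := Real.pi_pos
    field_simp
    ring
  refine (lintegral_mono h2).trans_lt ?_
  refine (lintegral_const_mul _ ((measurable_wt m).mul (measurable_ofReal_gk 2))).trans_lt ?_
  exact ENNReal.mul_lt_top ENNReal.ofReal_lt_top
    (h1.trans_lt (ENNReal.mul_lt_top ENNReal.coe_lt_top (wt_ne_top m 0).lt_top))

/-- For y in the support, |ξ| is at most |ξ - e^(-t/2) y| + R, so part of the Gaussian exponent
turns into decay in ξ. For t ≤ 1 this is a majorant independent of t and square integrable against
every weight. -/
theorem norm_heatOp_le_of_support {t : ℝ} (ht : 0 < t) {g : Plane → ℝ} {c R : ℝ}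
    (hc : ∀ x, ‖g x‖ ≤ c) (hR : ∀ x, R < ‖x‖ → g x = 0) (ξ : Plane) :
    ‖heatOp t g ξ‖ ≤ 2 * c * Real.exp (R ^ 2 / 8) * Real.exp t * Real.exp (-‖ξ‖ ^ 2 / 16) := by
  have ha := aTime_pos ht
  have hc0 : 0 ≤ c := (norm_nonneg _).trans (hc 0)
  have hint : Integrable fun y => gk (2 * aTime t) (ξ - Real.exp (-t / 2) • y) := by
    have h1 := ((integrable_gk (show 0 < 2 * aTime t by positivity)).comp_sub_left ξ).comp_smul
      (Real.exp_pos (-t / 2)).ne'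
    exact h1
  have hI : ∫ y, gk (2 * aTime t) (ξ - Real.exp (-t / 2) • y) = Real.exp t := by
    rw [integral_eq_lintegral_of_nonneg_ae (Eventually.of_forall fun y =>
      gk_nonneg (by positivity) _) hint.aestronglyMeasurable, lintegral_heatK (by positivity),
      ENNReal.toReal_ofReal (Real.exp_pos _).le]
  have h2 : ∀ y, ‖heatK t ξ y * g y‖ ≤ 2 * c * Real.exp (R ^ 2 / 8) * Real.exp (-‖ξ‖ ^ 2 / 16) *
      gk (2 * aTime t) (ξ - Real.exp (-t / 2) • y) := by
    intro y
    have hg0 := gk_nonneg (show 0 < 2 * aTime t by positivity) (ξ - Real.exp (-t / 2) • y)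
    by_cases hy : R < ‖y‖
    · rw [hR y hy, mul_zero, norm_zero]; positivity
    · rw [norm_mul, Real.norm_of_nonneg (heatK_nonneg ht ξ y), heatK, gk_eq ha]
      set x := ξ - Real.exp (-t / 2) • y with hx
      have h3 : ‖ξ‖ ≤ ‖x‖ + R := by
        have h4 : ξ = x + Real.exp (-t / 2) • y := by rw [hx]; abel
        have h5 : ‖Real.exp (-t / 2) • y‖ ≤ R := by
          rw [norm_smul, Real.norm_eq_abs, abs_of_pos (Real.exp_pos _)]
          exact (mul_le_of_le_one_left (norm_nonneg _)
            (Real.exp_le_one_iff.2 (by linarith))).trans (not_lt.1 hy)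
        calc ‖ξ‖ = ‖x + Real.exp (-t / 2) • y‖ := by rw [← h4]
          _ ≤ _ := (norm_add_le _ _).trans (by linarith)
      have h6 : Real.exp (-‖x‖ ^ 2 / (8 * aTime t)) ≤
          Real.exp (R ^ 2 / 8) * Real.exp (-‖ξ‖ ^ 2 / 16) := by
        rw [← Real.exp_add, Real.exp_le_exp]
        have h7 : ‖x‖ ^ 2 / 8 ≤ ‖x‖ ^ 2 / (8 * aTime t) := by
          gcongr; linarith [aTime_le_one t]
        have h8 := pow_le_pow_left₀ (norm_nonneg ξ) h3 2
        rw [neg_div]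
        nlinarith [sq_nonneg (‖x‖ - R)]
      calc 2 * gk (2 * aTime t) x * Real.exp (-‖x‖ ^ 2 / (8 * aTime t)) * ‖g y‖
          ≤ 2 * gk (2 * aTime t) x * (Real.exp (R ^ 2 / 8) * Real.exp (-‖ξ‖ ^ 2 / 16)) * c := by
            gcongr; exact hc y
        _ = _ := by ring
  refine (norm_integral_le_of_norm_le (hint.const_mul _) (Eventually.of_forall h2)).trans
    (le_of_eq ?_)
  rw [integral_const_mul, hI]; ring

theorem tendsto_heatS_of_compactSupport (hm : 1 < m) {g : Plane → ℝ} (hg : Continuous g)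
    (hgc : HasCompactSupport g) (G : L2m m) (hG : G =ᵐ[volume] g) :
    Tendsto (fun t => heatS m t G) (𝓝[>] 0) (𝓝 G) := by
  obtain ⟨c, hc⟩ := hgc.exists_bound_of_continuous hg
  obtain ⟨R, hR⟩ := hgc.isCompact.isBounded.exists_norm_le
  have hgR : ∀ x, R < ‖x‖ → g x = 0 := fun x hx => by
    by_contra h
    exact absurd (hR x (subset_tsupport g h)) (not_le.2 hx)
  set K := 2 * c * Real.exp (R ^ 2 / 8) * Real.exp 1 + c * Real.exp (R ^ 2 / 16) with hK
  have hc0 : 0 ≤ c := (norm_nonneg _).trans (hc 0)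
  have hlim : Tendsto (fun t => ∫⁻ ξ, wt m ξ * ‖heatOp t g ξ - g ξ‖ₑ ^ 2) (𝓝[>] 0)
      (𝓝 (∫⁻ _ : Plane, 0)) := by
    refine tendsto_lintegral_filter_of_dominated_convergence'
      (fun ξ => wt m ξ * ENNReal.ofReal (K * Real.exp (-‖ξ‖ ^ 2 / 16)) ^ 2)
      (Eventually.of_forall fun t => ?_) ?_ (lintegral_wt_exp_lt_top (by linarith) K).ne
      (Eventually.of_forall fun ξ => ?_)
    · exact (measurable_wt m).aemeasurable.mul (((heatOp_aestronglyMeasurable t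
        hg.aestronglyMeasurable).sub hg.aestronglyMeasurable).enorm.pow_const 2)
    · have h1 : ∀ᶠ t in 𝓝[>] (0 : ℝ), t ≤ 1 :=
        mem_nhdsWithin_of_mem_nhds (Iic_mem_nhds one_pos)
      filter_upwards [self_mem_nhdsWithin, h1] with t ht ht1
      refine Eventually.of_forall fun ξ => ?_
      gcongr
      rw [← ofReal_norm]
      refine ENNReal.ofReal_le_ofReal ((norm_sub_le _ _).trans ?_)
      rw [hK, add_mul]
      refine add_le_add ((norm_heatOp_le_of_support ht hc hgR ξ).trans ?_) ?_
      · gcongr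
      · by_cases hx : R < ‖ξ‖
        · rw [hgR ξ hx, norm_zero]; positivity
        · have h2 : ‖ξ‖ ^ 2 ≤ R ^ 2 := pow_le_pow_left₀ (norm_nonneg _) (not_lt.1 hx) 2
          rw [mul_assoc, ← Real.exp_add]
          exact (hc ξ).trans (le_mul_of_one_le_right hc0 (Real.one_le_exp (by
            rw [neg_div]; linarith)))
    · have h1 := ((tendsto_heatOp hg hc ξ).sub_const (g ξ)).enorm
      rw [sub_self, enorm_zero] at h1
      have h2 := ENNReal.Tendsto.const_mul (a := wt m ξ) (((ENNReal.continuous_pow 2).tendsto _).comp h1) (Or.inr (wt_ne_top m ξ))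
      simpa using h2
  rw [lintegral_zero] at hlim
  rw [tendsto_iff_norm_sub_tendsto_zero]
  have h1 : Tendsto (fun t => ‖heatS m t G - G‖ₑ ^ 2) (𝓝[>] 0) (𝓝 0) := by
    refine hlim.congr' ?_
    filter_upwards [self_mem_nhdsWithin] with t ht
    rw [enorm_sq]
    refine lintegral_congr_ae ?_
    filter_upwards [coeFn_sub_ae (heatS m t G) G, heatS_coe hm ht G, hG] with ξ h1 h2 h3
    rw [h1, h2, h3, heatOp_congr t hG]
  have h2 := ((ENNReal.tendsto_toReal ENNReal.zero_ne_top).comp h1).sqrt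
  simp only [ENNReal.toReal_zero, Real.sqrt_zero] at h2
  refine h2.congr fun t => ?_
  simp only [Function.comp_apply, ENNReal.toReal_pow, toReal_enorm]
  exact Real.sqrt_sq (norm_nonneg _)

/-- Continuous functions of compact support are dense in L²(m), and the operators are uniformly
bounded for t ≤ 1; so the convergence for such functions carries over. -/
theorem tendsto_heatS_zero (hm : 1 < m) (f : L2m m) :
    Tendsto (fun t => heatS m t f) (𝓝[>] 0) (𝓝 f) := by
  obtain ⟨C, hC1, hC⟩ := exists_norm_heatS_le hm
  have : IsLocallyFiniteMeasure (weightMeasure m) :=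
    IsLocallyFiniteMeasure.withDensity_ofReal (continuous_wt_real m)
  set D := C * Real.exp (1 / 2) with hD
  have hD0 : 0 < D := by positivity
  rw [Metric.tendsto_nhds]
  intro ε hε
  obtain ⟨g, hgc, hg, hgc', hgL⟩ := (Lp.memLp f).exists_hasCompactSupport_eLpNorm_sub_le
    (ENNReal.ofNat_ne_top) (ε := ENNReal.ofReal (ε / (2 * (D + 2))))
    (by rw [ne_eq, ENNReal.ofReal_eq_zero, not_le]; positivity)
  set G := hgL.toLp g with hGdef
  have hfG : ‖f - G‖ ≤ ε / (2 * (D + 2)) := by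
    have h1 : ‖f - G‖ₑ ≤ ENNReal.ofReal (ε / (2 * (D + 2))) := by
      rw [Lp.enorm_def]
      refine le_trans (le_of_eq ?_) hg
      refine eLpNorm_congr_ae ?_
      filter_upwards [Lp.coeFn_sub f G, hgL.coeFn_toLp] with ξ h1 h2
      rw [h1, Pi.sub_apply, Pi.sub_apply, h2]
    rw [← ofReal_norm] at h1
    exact (ENNReal.ofReal_le_ofReal_iff (by positivity)).1 h1
  have hlim := tendsto_heatS_of_compactSupport hm hgc' hgc G (coeFn_toLp hgL)
  have h1 : ∀ᶠ t in 𝓝[>] (0 : ℝ), t ≤ 1 := mem_nhdsWithin_of_mem_nhds (Iic_mem_nhds one_pos)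
  filter_upwards [self_mem_nhdsWithin, h1, Metric.tendsto_nhds.1 hlim (ε / 2) (half_pos hε)]
    with t ht ht1 h2
  rw [dist_eq_norm] at h2 ⊢
  have h3 : heatS m t f - f = heatS m t (f - G) + (heatS m t G - G) - (f - G) := by
    rw [map_sub]; abel
  have h4 : ‖heatS m t (f - G)‖ ≤ D * ‖f - G‖ := by
    refine ContinuousLinearMap.le_of_opNorm_le _ ((hC t (le_of_lt ht)).trans ?_) _
    exact mul_le_mul_of_nonneg_left (Real.exp_le_exp.2 (by linarith)) (by linarith)
  have h5 : (D + 1) * ‖f - G‖ < ε / 2 := by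
    calc (D + 1) * ‖f - G‖ ≤ (D + 1) * (ε / (2 * (D + 2))) := by gcongr
      _ < (D + 2) * (ε / (2 * (D + 2))) := by
        apply mul_lt_mul_of_pos_right (by linarith) (by positivity)
      _ = ε / 2 := by field_simp
  rw [h3]
  calc _ ≤ ‖heatS m t (f - G)‖ + ‖heatS m t G - G‖ + ‖f - G‖ :=
        (norm_sub_le _ _).trans (by gcongr; exact norm_add_le _ _)
    _ < ε := by linarith

/-- The semigroup law reduces the difference at two times to the operator over their distance, with
the factor taken at the smaller time. This gives continuity from both sides out of the right limit
at 0. -/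
theorem continuousOn_heatS (hm : 1 < m) (f : L2m m) :
    ContinuousOn (fun t => heatS m t f) (Ici 0) := by
  obtain ⟨C, hC1, hC⟩ := exists_norm_heatS_le hm
  have key : ∀ s t, 0 ≤ s → s ≤ t → ‖heatS m t f - heatS m s f‖ ≤
      C * Real.exp (1 / 2 * s) * ‖heatS m (t - s) f - f‖ := fun s t hs hst => by
    have h1 : t = s + (t - s) := by ring
    have h2 : heatS m t f - heatS m s f = heatS m s (heatS m (t - s) f - f) := by
      rw [map_sub, ← heatS_add hm hs (by linarith), ← h1]
    rw [h2]
    exact ContinuousLinearMap.le_of_opNorm_le _ (hC s hs) _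
  have hlim : Tendsto (fun t => ‖heatS m t f - f‖) (𝓝[≥] 0) (𝓝 0) := by
    have h1 : ContinuousWithinAt (fun t => heatS m t f) (Ioi 0) 0 := by
      rw [ContinuousWithinAt]
      have h2 : heatS m 0 f = f := by rw [heatS_of_nonpos le_rfl]; rfl
      rw [h2]; exact tendsto_heatS_zero hm f
    have h3 := (continuousWithinAt_Ioi_iff_Ici.1 h1).tendsto
    have h2 : heatS m 0 f = f := by rw [heatS_of_nonpos le_rfl]; rfl
    rw [h2] at h3
    exact tendsto_iff_norm_sub_tendsto_zero.1 h3
  intro t₀ ht₀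
  rw [ContinuousWithinAt, tendsto_iff_norm_sub_tendsto_zero]
  have habs : Tendsto (fun t : ℝ => |t - t₀|) (𝓝[Ici 0] t₀) (𝓝[≥] 0) := by
    refine tendsto_nhdsWithin_iff.2 ⟨?_, Eventually.of_forall fun t => mem_Ici.2 (abs_nonneg _)⟩
    have : Continuous fun t : ℝ => |t - t₀| := by fun_prop
    have h := this.tendsto t₀
    simp only [sub_self, abs_zero] at h
    exact h.mono_left nhdsWithin_le_nhds
  have h4 := (hlim.comp habs).const_mul (C * Real.exp (1 / 2 * t₀))
  rw [mul_zero] at h4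
  refine squeeze_zero' (Eventually.of_forall fun t => norm_nonneg _) ?_ h4
  filter_upwards [self_mem_nhdsWithin] with t ht
  rcases le_total t₀ t with h | h
  · have := key t₀ t ht₀ h
    simpa only [Function.comp_apply, abs_of_nonneg (sub_nonneg.2 h)] using this
  · have h5 := key t t₀ ht h
    rw [norm_sub_rev]
    simp only [Function.comp_apply, abs_of_nonpos (sub_nonpos.2 h), neg_sub]
    refine h5.trans (mul_le_mul_of_nonneg_right ?_ (norm_nonneg _))
    exact mul_le_mul_of_nonneg_left (Real.exp_le_exp.2 (by linarith)) (by linarith)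

theorem exists_smoothingPair (hm : 1 < m) :
    ∃ M, SmoothingPair (heatS m) (transB m) M (1 / 2) := by
  obtain ⟨C, hC1, hC⟩ := exists_norm_heatS_le hm
  obtain ⟨C', hC'0, hC'⟩ := exists_norm_transB_le hm
  refine ⟨max C C', ⟨hC'0.trans (le_max_right _ _), by norm_num, fun x => ?_,
    fun s t hs ht x => heatS_add hm hs ht x, continuousOn_heatS hm, fun t ht => ?_,
    fun s t hs ht x y => heatS_transB hm hs ht x y, fun t ht => ?_⟩⟩
  · rw [heatS_of_nonpos le_rfl]; rfl
  · exact (hC t ht).trans (mul_le_mul_of_nonneg_right (le_max_left _ _) (Real.exp_pos _).le)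
  · exact (hC' t ht).trans (mul_le_mul_of_nonneg_right (le_max_right _ _)
      (Real.rpow_nonneg ht.1.le _))

end Operators

/-! ### Pointwise mild solutions and Bochner integral equations. -/

section Bridge

variable {m : ℝ}

/-- A bound for `‖gradK t ξ y‖`. -/
noncomputable def gradBound (t : ℝ) : ℝ :=
  2 * Real.exp (-t / 2) * (Real.sqrt (aTime t))⁻¹ * (1 / (4 * Real.pi * (2 * aTime t)))

theorem gradBound_nonneg {t : ℝ} (ht : 0 < t) : 0 ≤ gradBound t := by
  have := aTime_pos ht
  unfold gradBound; positivity

theorem continuousAt_gradBound {t : ℝ} (ht : 0 < t) : ContinuousAt gradBound t := by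
  have ha := aTime_pos ht
  have hs := (Real.sqrt_pos.2 ha).ne'
  have hc : Continuous aTime := by unfold aTime; fun_prop
  have h4 : 4 * Real.pi * (2 * aTime t) ≠ 0 := by positivity
  unfold gradBound
  fun_prop (disch := assumption)

theorem continuousAt_gradK {t : ℝ} (ht : 0 < t) (ξ y : Plane) :
    ContinuousAt (fun t => gradK t ξ y) t := by
  have ha := aTime_pos ht
  have hc : Continuous aTime := by unfold aTime; fun_prop
  have h1 : 4 * Real.pi * aTime t ≠ 0 := by positivity
  have h2 : 4 * aTime t ≠ 0 := by positivity
  have h3 : 2 * aTime t ≠ 0 := by positivity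
  unfold gradK heatK gk
  fun_prop (disch := assumption)

theorem norm_inner_gradK_le {t : ℝ} (ht : 0 < t) (ξ y z : Plane) :
    ‖inner ℝ (gradK t ξ y) z‖ ≤ gradBound t * ‖z‖ :=
  (norm_inner_le_norm _ _).trans
    (mul_le_mul_of_nonneg_right (norm_gradK_le_const ht ξ y) (norm_nonneg _))

theorem continuous_gradOp (hm : 1 < m) {t : ℝ} (ht : 0 < t) (a b : L2m m) :
    Continuous (gradOp t a b) := by
  have hF := integrable_fluxOf hm a b
  refine continuous_of_dominated (fun ξ => (integrable_inner_gradK ht hF ξ).1)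
    (fun ξ => Eventually.of_forall fun y => norm_inner_gradK_le ht ξ y _)
    (hF.norm.const_mul _) (Eventually.of_forall fun y => ?_)
  exact ((continuous_gradK t).uncurry_right y).inner continuous_const

theorem continuousAt_gradOp (hm : 1 < m) {t : ℝ} (ht : 0 < t) (a b : L2m m) (ξ : Plane) :
    ContinuousAt (fun t => gradOp t a b ξ) t := by
  have hF := integrable_fluxOf hm a b
  have hpos := lt_mem_nhds ht
  refine continuousAt_of_dominated (bound := fun y => (gradBound t + 1) * ‖fluxOf a b y‖)
    ?_ ?_ (hF.norm.const_mul _) (Eventually.of_forall fun y =>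
      (continuousAt_gradK ht ξ y).inner continuousAt_const)
  · filter_upwards [hpos] with t' ht'
    exact (integrable_inner_gradK ht' hF ξ).1
  · filter_upwards [hpos, (continuousAt_gradBound ht).eventually_le_const
      (lt_add_one (gradBound t))] with t' ht' h
    exact Eventually.of_forall fun y => (norm_inner_gradK_le ht' ξ y _).trans
      (mul_le_mul_of_nonneg_right h (norm_nonneg _))

theorem exists_norm_gradOp_le (hm : 1 < m) : ∃ C : ℝ≥0, ∀ t, 0 < t → ∀ (a b : L2m m) (ξ : Plane),
    ‖gradOp t a b ξ‖ ≤ gradBound t * (C * ‖a‖ * ‖b‖) := by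
  obtain ⟨C, hC⟩ := exists_lintegral_fluxOf_le hm
  refine ⟨C, fun t ht a b ξ => ?_⟩
  have hF := integrable_fluxOf hm a b
  have h1 : ∫ y, ‖fluxOf a b y‖ ≤ C * ‖a‖ * ‖b‖ := by
    rw [integral_norm_eq_lintegral_enorm hF.1]
    refine ENNReal.toReal_le_of_le_ofReal (by positivity) ((hC a b).trans_eq ?_)
    rw [ENNReal.ofReal_mul (by positivity), ENNReal.ofReal_mul (by positivity),
      ENNReal.ofReal_coe_nnreal, ofReal_norm, ofReal_norm]
  calc _ ≤ ∫ y, gradBound t * ‖fluxOf a b y‖ :=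
        norm_integral_le_of_norm_le (hF.norm.const_mul _)
          (Eventually.of_forall fun y => norm_inner_gradK_le ht ξ y _)
    _ ≤ _ := by
        rw [integral_const_mul]
        exact mul_le_mul_of_nonneg_left h1 (gradBound_nonneg ht)

theorem gradOp_sub (hm : 1 < m) {t : ℝ} (ht : 0 < t) (a a' b b' : L2m m) (ξ : Plane) :
    gradOp t a b ξ - gradOp t a' b' ξ =
      gradOp t ⇑(a - a') b ξ + gradOp t a' ⇑(b - b') ξ := by
  have h1 := fluxOf_add_left (a - a') a' b
  have h2 := fluxOf_add_right hm a' (b - b') b'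
  rw [sub_add_cancel] at h1 h2
  have h3 := gradOp_congr_add ht (integrable_fluxOf hm _ _) (integrable_fluxOf hm _ _) h1 ξ
  have h4 := gradOp_congr_add ht (integrable_fluxOf hm _ _) (integrable_fluxOf hm _ _) h2 ξ
  unfold gradOp
  linarith

theorem continuousOn_gradOp (hm : 1 < m) {f g : ℝ → L2m m} (hf : Continuous f) (hg : Continuous g)
    (τ : ℝ) (ξ : Plane) : ContinuousOn (fun s => gradOp (τ - s) (f s) (g s) ξ) (Iio τ) := by
  obtain ⟨C, hC⟩ := exists_norm_gradOp_le hm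
  intro s₀ hs₀
  have hpos : 0 < τ - s₀ := sub_pos.2 hs₀
  have hsub : ContinuousAt (fun s => τ - s) s₀ := by fun_prop
  refine ContinuousAt.continuousWithinAt ?_
  have h1 : Tendsto (fun s => gradOp (τ - s) (f s) (g s) ξ - gradOp (τ - s) (f s₀) (g s₀) ξ)
      (𝓝 s₀) (𝓝 0) := by
    have h2 : Tendsto (fun s => gradBound (τ - s) * (C * ‖f s - f s₀‖ * ‖g s‖) +
        gradBound (τ - s) * (C * ‖f s₀‖ * ‖g s - g s₀‖)) (𝓝 s₀)
        (𝓝 (gradBound (τ - s₀) * (C * ‖f s₀ - f s₀‖ * ‖g s₀‖) +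
          gradBound (τ - s₀) * (C * ‖f s₀‖ * ‖g s₀ - g s₀‖))) := by
      have hb : ContinuousAt (fun s => gradBound (τ - s)) s₀ :=
        ContinuousAt.comp (f := fun s => τ - s) (continuousAt_gradBound hpos) hsub
      exact ContinuousAt.tendsto (by fun_prop)
    simp only [sub_self, norm_zero, mul_zero, zero_mul, add_zero] at h2
    refine squeeze_zero_norm' ?_ h2
    filter_upwards [gt_mem_nhds (show s₀ < τ from hs₀)] with s hs
    rw [gradOp_sub hm (sub_pos.2 hs)]
    exact (norm_add_le _ _).trans (add_le_add (hC _ (sub_pos.2 hs) _ _ _)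
      (hC _ (sub_pos.2 hs) _ _ _))
  have h3 : Tendsto (fun s => gradOp (τ - s) (f s₀) (g s₀) ξ) (𝓝 s₀)
      (𝓝 (gradOp (τ - s₀) (f s₀) (g s₀) ξ)) :=
    (ContinuousAt.comp (f := fun s => τ - s) (continuousAt_gradOp hm hpos (f s₀) (g s₀) ξ) hsub)
  simpa [ContinuousAt] using h1.add h3

/-- Joint measurability comes from continuity in ξ for each time and measurability in time for each
ξ. Values of curves in L²(m) are only almost everywhere classes, so the smoothing in ξ by the
gradient kernel is essential here. -/
theorem stronglyMeasurable_gradOp (hm : 1 < m) {f g : ℝ → L2m m} (hf : Continuous f)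
    (hg : Continuous g) (τ : ℝ) : StronglyMeasurable fun p : ℝ × Plane =>
      (Iio τ).indicator (fun s => gradOp (τ - s) (f s) (g s) p.2) p.1 := by
  have h := stronglyMeasurable_uncurry_of_continuous_of_stronglyMeasurable (ι := Plane)
    (u := fun ξ s => (Iio τ).indicator (fun s => gradOp (τ - s) (f s) (g s) ξ) s)
    (fun s => ?_) (fun ξ => ?_)
  · exact h.comp_measurable measurable_swap
  · by_cases hs : s ∈ Iio τ
    · simp only [indicator_of_mem hs]
      exact continuous_gradOp hm (sub_pos.2 hs) _ _
    · simp only [indicator_of_notMem hs]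
      exact continuous_const
  · classical
    have h := (continuousOn_gradOp hm hf hg τ ξ).measurable_piecewise
      (continuousOn_const (c := (0 : ℝ))) measurableSet_Iio
    rw [show (fun _ : ℝ => (0 : ℝ)) = 0 from rfl, piecewise_eq_indicator] at h
    exact h.stronglyMeasurable

/-- The Bochner integral of a curve in `L²(m)` may be computed pointwise. -/
theorem integral_coe_ae (hm : 1 < m) {ρ : Measure ℝ} [SFinite ρ] {h : ℝ → L2m m}
    (hh : Integrable h ρ) {G : ℝ × Plane → ℝ} (hG : StronglyMeasurable G)
    (hGh : ∀ᵐ s ∂ρ, h s =ᵐ[volume] fun ξ => G (s, ξ)) :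
    ⇑(∫ s, h s ∂ρ) =ᵐ[volume] fun ξ => ∫ s, G (s, ξ) ∂ρ := by
  have hmeas : ∀ E : Set Plane, MeasurableSet E →
      AEStronglyMeasurable (E.indicator fun _ => (1 : ℝ)) volume := fun E hE =>
    (stronglyMeasurable_const.indicator hE).aestronglyMeasurable
  have hbd : ∀ E : Set Plane,
      ∫⁻ ξ, wt (-m) ξ * ‖E.indicator (fun _ => (1 : ℝ)) ξ‖ₑ ^ 2 < ⊤ := fun E => by
    refine (lintegral_mono fun ξ => ?_).trans_lt (lintegral_wt_neg_lt_top hm)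
    by_cases hξ : ξ ∈ E <;> simp [hξ]
  have hGint : Integrable G (ρ.prod volume) := by
    rw [integrable_prod_iff hG.aestronglyMeasurable]
    refine ⟨hGh.mono fun s hs => (integrable_coe hm (h s)).congr hs, ?_⟩
    set K := ∫⁻ ξ : Plane, wt (-m) ξ with hK
    have hKt : K < ⊤ := lintegral_wt_neg_lt_top hm
    refine (hh.norm.const_mul (Real.sqrt K.toReal)).mono'
      hG.norm.integral_prod_right'.aestronglyMeasurable (hGh.mono fun s hs => ?_)
    have h0 : ∫ ξ, ‖G (s, ξ)‖ = ∫ ξ, ‖h s ξ‖ := integral_congr_ae (hs.symm.fun_comp norm)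
    rw [Real.norm_of_nonneg (integral_nonneg fun ξ => norm_nonneg _), h0, integral_norm_eq_lintegral_enorm
        (aestronglyMeasurable_coe _)]
    refine ENNReal.toReal_le_of_le_ofReal (by positivity) ?_
    have h1 := lintegral_mul_coe_sq_le (g := fun _ => 1) aestronglyMeasurable_const (h s)
    rw [← (ENNReal.pow_right_strictMono two_ne_zero).le_iff_le,
      ENNReal.ofReal_mul (Real.sqrt_nonneg _), mul_pow, ofReal_norm,
      ← ENNReal.ofReal_pow (Real.sqrt_nonneg _), Real.sq_sqrt ENNReal.toReal_nonneg,
      ENNReal.ofReal_toReal hKt.ne]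
    simpa only [enorm_one, one_pow, mul_one, one_mul, ← hK] using h1
  -- Both sides are compared on measurable sets E. The integral over E is a bounded functional on
  -- L²(m) since m > 1, so it commutes with the Bochner integral; Fubini treats the other side.
  refine Integrable.ae_eq_of_forall_setIntegral_eq _ _ (integrable_coe hm _)
    hGint.integral_prod_right fun E hE _ => ?_
  obtain ⟨ℓ, hℓ⟩ := exists_pairing (hmeas E hE) (hbd E)
  have hℓ' : ∀ f : Plane → ℝ, ∫ ξ, E.indicator (fun _ => (1 : ℝ)) ξ * f ξ = ∫ ξ in E, f ξ :=
    fun f => by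
      rw [← integral_indicator hE]
      refine integral_congr_ae (Eventually.of_forall fun ξ => ?_)
      by_cases hξ : ξ ∈ E <;> simp [hξ]
  have hGE : Integrable (Function.uncurry fun s ξ => G (s, ξ)) (ρ.prod (volume.restrict E)) :=
    hGint.mono_measure (Measure.prod_mono le_rfl Measure.restrict_le_self)
  rw [← hℓ', ← hℓ, ← ℓ.integral_comp_comm hh, ← integral_integral_swap hGE]
  refine integral_congr_ae (hGh.mono fun s hs => ?_)
  simp only [hℓ, hℓ']
  exact integral_congr_ae (ae_restrict_of_ae hs)

theorem flux_ae_eq (c : L2m m → ℝ) (w : L2m m) :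
    flux c w =ᵐ[volume] fluxOf ⇑(c w • w) w := by
  filter_upwards [coeFn_smul_ae (c w) w] with ξ h
  rw [flux, fluxOf, h]

theorem duhamel_ae_eq (hm : 1 < m) {c : L2m m → ℝ} (hc : Continuous c) {w : ℝ → L2m m}
    (hw : ContinuousOn w (Ici 0)) {τ : ℝ} (hτ : 0 < τ) :
    ⇑(heatS m τ (w 0) + duhamel (transB m) (fun s => c (w s) • w s) w τ) =ᵐ[volume] fun ξ =>
      linSemigroup τ (w 0) ξ - ∫ s in (0 : ℝ)..τ,
        Real.exp (-(τ - s) / 2) * divLinSemigroup (τ - s) (flux c (w s)) ξ := by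
  obtain ⟨M, hM⟩ := exists_smoothingPair hm
  -- Only nonnegative times carry information. The extension by the initial value makes the curve
  -- continuous on the line, as the measurability lemma demands.
  have hw' : Continuous fun s => w (max 0 s) :=
    hw.comp_continuous (by fun_prop) fun s => mem_Ici.2 (le_max_left _ _)
  have hf' : Continuous fun s => c (w (max 0 s)) • w (max 0 s) := (hc.comp hw').smul hw'
  have hw0 := hw.mono (Icc_subset_Ici_self : Icc 0 τ ⊆ Ici 0)
  have hint := hM.intervalIntegrable_B hτ.le
    ((hc.comp_continuousOn hw0).smul hw0) hw0
  rw [intervalIntegrable_iff_integrableOn_Ioc_of_le hτ.le] at hint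
  have hlt : ∀ᵐ s ∂(volume.restrict (Ioc 0 τ)), s ∈ Ioo 0 τ := by
    rw [← restrict_Ioo_eq_restrict_Ioc]
    exact ae_restrict_mem measurableSet_Ioo
  have h1 := integral_coe_ae hm hint (stronglyMeasurable_gradOp hm hf' hw' τ) <| by
    filter_upwards [hlt] with s hs
    simp only [indicator_of_mem (mem_Iio.2 hs.2), max_eq_right hs.1.le]
    exact transB_coe hm (sub_pos.2 hs.2) _ _
  filter_upwards [h1, heatS_coe hm hτ (w 0), coeFn_add_ae (heatS m τ (w 0))
    (duhamel (transB m) (fun s => c (w s) • w s) w τ)] with ξ h1 h2 h3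
  rw [h3, h2, linSemigroup_eq, sub_eq_add_neg, duhamel, intervalIntegral.integral_of_le hτ.le,
    intervalIntegral.integral_of_le hτ.le, ← integral_neg]
  refine congrArg₂ _ rfl (h1.trans (integral_congr_ae ?_))
  filter_upwards [hlt] with s hs
  simp only [indicator_of_mem (mem_Iio.2 hs.2), max_eq_right hs.1.le]
  rw [divLinSemigroup_eq]
  exact integral_congr_ae ((flux_ae_eq c (w s)).symm.mono fun y hy => by simp only [hy])

/-- For positive times both equations say the same almost everywhere, by `duhamel_ae_eq`. At time 0
the abstract equation is trivial because `heatS m 0` is the identity and the integral vanishes. -/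
theorem isMildSolution_iff (hm : 1 < m) {c : L2m m → ℝ} (hc : Continuous c) {w : ℝ → L2m m} :
    IsMildSolution c w ↔ GlobalSol (heatS m) (transB m) (fun x => c x • x) w := by
  constructor
  · rintro ⟨hw, h⟩ T hT
    refine ⟨hw.mono Icc_subset_Ici_self, fun τ hτ => ?_⟩
    rcases hτ.1.eq_or_lt with rfl | hpos
    · rw [heatS_of_nonpos le_rfl, duhamel, intervalIntegral.integral_same, add_zero]; rfl
    · exact ext_ae (EventuallyEq.trans (h τ hpos) (duhamel_ae_eq hm hc hw hpos).symm)
  · intro h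
    have hw : ContinuousOn w (Ici 0) := fun x hx => by
      have h1 := (h (x + 1) (by linarith [mem_Ici.1 hx])).1 x ⟨hx, by linarith⟩
      refine h1.mono_of_mem_nhdsWithin ?_
      rw [← Ici_inter_Iic]
      exact inter_mem self_mem_nhdsWithin (mem_nhdsWithin_of_mem_nhds (Iic_mem_nhds (by linarith)))
    refine ⟨hw, fun τ hτ => ?_⟩
    rw [(h τ hτ.le).2 τ ⟨hτ.le, le_rfl⟩]
    exact duhamel_ae_eq hm hc hw hτ

theorem wellPosedAt_iff (hm : 1 < m) {c : L2m m → ℝ} (hc : Continuous c) {x : L2m m} :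
    WellPosedAt c x ↔ UniqueGlobalSol (heatS m) (transB m) (fun x => c x • x) x := by
  simp only [WellPosedAt, UniqueGlobalSol, isMildSolution_iff hm hc]

theorem isPartialFlow_semiflow (hm : 1 < m) {c : L2m m → ℝ} (hc : Continuous c) :
    IsPartialFlow (heatS m) (transB m) (fun x => c x • x) (semiflow c) := by
  intro x hx
  simp only [← isMildSolution_iff hm hc] at hx ⊢
  have h1 : (fun τ => semiflow c τ x) = hx.choose := by
    ext1 τ; rw [semiflow, dif_pos hx]
  rw [h1, show semiflow c 0 x = hx.choose 0 from congrFun h1 0]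
  exact hx.choose_spec

end Bridge

/-! ### One-dimensional Hermite polynomials and Gaussian means. -/

section OneDimensional

open Polynomial

/-- The Gaussian density on the line. -/
noncomputable def lineGauss (c x : ℝ) : ℝ :=
  (Real.sqrt (4 * Real.pi * c))⁻¹ * Real.exp (-x ^ 2 / (4 * c))

/-- The mean of a polynomial with respect to the Gaussian density centered at `z`. -/
noncomputable def gaussMean (c z : ℝ) (p : ℝ[X]) : ℝ := ∫ x, lineGauss c (x - z) * p.eval x

variable {c : ℝ}

theorem integrable_lineGauss_mul (hc : 0 < c) (z : ℝ) (p : ℝ[X]) :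
    Integrable fun x => lineGauss c (x - z) * p.eval x := by
  have key : ∀ p : ℝ[X], Integrable fun x => lineGauss c x * p.eval x := fun p => by
    induction p using Polynomial.induction_on' with
    | add p q hp hq =>
      refine (hp.add hq).congr (Eventually.of_forall fun x => ?_)
      simp only [Pi.add_apply, eval_add]; ring
    | monomial n a =>
      have h := integrable_rpow_mul_exp_neg_mul_sq (show 0 < 1 / (4 * c) by positivity)
        (show (-1 : ℝ) < n by have : (0 : ℝ) ≤ n := n.cast_nonneg; linarith)
      refine (h.const_mul ((Real.sqrt (4 * Real.pi * c))⁻¹ * a)).congr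
        (Eventually.of_forall fun x => ?_)
      simp only [lineGauss, eval_monomial, Real.rpow_natCast]
      rw [show -(1 / (4 * c)) * x ^ 2 = -x ^ 2 / (4 * c) by ring]
      ring
  have h := (key (p.comp (X + C z))).comp_sub_right z
  simpa using h

theorem gaussMean_add (hc : 0 < c) (z : ℝ) (p q : ℝ[X]) :
    gaussMean c z (p + q) = gaussMean c z p + gaussMean c z q := by
  unfold gaussMean
  rw [← integral_add (integrable_lineGauss_mul hc z p) (integrable_lineGauss_mul hc z q)]
  simp only [eval_add, mul_add]

theorem gaussMean_C_mul (c z a : ℝ) (p : ℝ[X]) :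
    gaussMean c z (C a * p) = a * gaussMean c z p := by
  unfold gaussMean
  rw [← integral_const_mul]
  simp only [eval_mul, eval_C, mul_left_comm]

theorem gaussMean_one (hc : 0 < c) (z : ℝ) : gaussMean c z 1 = 1 := by
  have hπ := Real.pi_pos
  simp only [gaussMean, eval_one, mul_one]
  rw [integral_sub_right_eq_self (lineGauss c) z]
  simp only [lineGauss, integral_const_mul]
  have h := integral_gaussian (1 / (4 * c))
  have h1 : ∀ x : ℝ, -(1 / (4 * c)) * x ^ 2 = -x ^ 2 / (4 * c) := fun x => by ring
  simp only [h1] at h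
  rw [h, show Real.pi / (1 / (4 * c)) = 4 * Real.pi * c by field_simp]
  exact inv_mul_cancel₀ (Real.sqrt_pos.2 (by positivity)).ne'

/-- Integration by parts against a Gaussian of variance 2c: the derivative of density times p
integrates to zero. All explicit integrals below follow algebraically from this identity. -/
theorem gaussMean_X_mul (hc : 0 < c) (z : ℝ) (p : ℝ[X]) :
    gaussMean c z (X * p) = z * gaussMean c z p + 2 * c * gaussMean c z (derivative p) := by
  set q : ℝ[X] := derivative p + C (-(1 / (2 * c))) * (X * p) + C (z / (2 * c)) * p with hq
  have h : ∫ x, lineGauss c (x - z) * q.eval x = 0 := by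
    refine integral_eq_zero_of_hasDerivAt_of_integrable
      (f := fun x => lineGauss c (x - z) * p.eval x) (fun x => ?_)
      (integrable_lineGauss_mul hc z q) (integrable_lineGauss_mul hc z p)
    have h1 : HasDerivAt (fun x => lineGauss c (x - z))
        (lineGauss c (x - z) * (-(x - z) / (2 * c))) x := by
      have h2 := ((((hasDerivAt_id x).sub_const z).pow 2).neg.div_const (4 * c)).exp.const_mul
        (Real.sqrt (4 * Real.pi * c))⁻¹
      simp only [id] at h2
      refine h2.congr_deriv ?_
      simp only [lineGauss, Pi.neg_apply, Pi.pow_apply]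
      push_cast
      field_simp
      ring
    refine (h1.mul (p.hasDerivAt x)).congr_deriv ?_
    simp only [hq, eval_add, eval_mul, eval_C, eval_X]
    field_simp
    ring
  change gaussMean c z q = 0 at h
  rw [hq, gaussMean_add hc, gaussMean_add hc, gaussMean_C_mul, gaussMean_C_mul] at h
  field_simp at h
  linarith

/-- The one-dimensional Hermite polynomials: `∂ⁿ e^(-x²/4) = hq n x · e^(-x²/4)`. -/
noncomputable def hq : ℕ → ℝ[X]
  | 0 => 1
  | n + 1 => derivative (hq n) - C (1 / 2) * (X * hq n)

theorem derivative_hq (n : ℕ) : derivative (hq (n + 1)) = C (-((n + 1 : ℝ) / 2)) * hq n := by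
  induction n with
  | zero => simp [hq]
  | succ n ih =>
    rw [hq, ih, derivative_sub, derivative_C_mul, derivative_C_mul, derivative_mul, derivative_X, ih,
      hq]
    push_cast
    simp only [C_neg, neg_mul, mul_sub, mul_add, one_mul]
    have e1 : (C ((n + 1 + 1 : ℝ) / 2) : ℝ[X]) = C ((n + 1 : ℝ) / 2) + C (1 / 2) := by
      rw [← C_add]; congr 1; ring
    rw [e1]
    ring

theorem X_mul_hq_zero : X * hq 0 = C (-2) * hq 1 := by
  simp only [hq, derivative_one, mul_one, zero_sub]
  rw [mul_neg, ← mul_assoc, ← C_mul]; norm_num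

theorem X_mul_hq_succ (n : ℕ) :
    X * hq (n + 1) = C (-(n + 1 : ℝ)) * hq n + C (-2) * hq (n + 2) := by
  rw [show hq (n + 2) = derivative (hq (n + 1)) - C (1 / 2) * (X * hq (n + 1)) from rfl,
    derivative_hq, mul_sub, ← mul_assoc, ← C_mul, ← mul_assoc (C (-2)) (C (1 / 2)), ← C_mul]
  have e1 : (C (-2 * -((n + 1 : ℝ) / 2)) : ℝ[X]) = -C (-(n + 1 : ℝ)) := by
    rw [← C_neg]; congr 1; ring
  have e2 : (C (-2 * (1 / 2)) : ℝ[X]) = -1 := by rw [← C_1, ← C_neg]; congr 1; norm_num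
  rw [e1, e2]
  ring

/-- Hermite polynomials are eigenfunctions of the dual semigroup, provided the width and the
dilation are tied by c = 1 - s². The induction carries two consecutive indices because the
derivative of a Hermite polynomial is a multiple of the previous one. -/
theorem gaussMean_hq (hc : 0 < c) {s : ℝ} (hcs : c = 1 - s ^ 2) (y : ℝ) (n : ℕ) :
    gaussMean c (s * y) (hq n) = s ^ n * (hq n).eval y := by
  have step : ∀ n, gaussMean c (s * y) (hq (n + 1)) =
      s ^ 2 * gaussMean c (s * y) (derivative (hq n)) -
        1 / 2 * (s * y * gaussMean c (s * y) (hq n)) := fun n => by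
    rw [hq, sub_eq_add_neg, ← neg_mul, ← C_neg, gaussMean_add hc, gaussMean_C_mul,
      gaussMean_X_mul hc]
    rw [show s ^ 2 = 1 - c by linarith]
    ring
  have key : ∀ n, gaussMean c (s * y) (hq n) = s ^ n * (hq n).eval y ∧
      gaussMean c (s * y) (hq (n + 1)) = s ^ (n + 1) * (hq (n + 1)).eval y := fun n => by
    induction n with
    | zero =>
      have h0 : gaussMean c (s * y) (hq 0) = 1 := gaussMean_one hc _
      have h1 : gaussMean c (s * y) (derivative (hq 0)) = 0 := by
        have := gaussMean_C_mul c (s * y) 0 0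
        simpa [hq] using this
      refine ⟨by rw [h0]; simp [hq], ?_⟩
      rw [step, h0, h1]
      simp [hq]
      ring
    | succ n ih =>
      refine ⟨ih.2, ?_⟩
      rw [step, derivative_hq, gaussMean_C_mul, ih.1, ih.2]
      rw [show hq (n + 2) = derivative (hq (n + 1)) - C (1 / 2) * (X * hq (n + 1)) from rfl,
        derivative_hq]
      simp only [eval_sub, eval_mul, eval_C, eval_X]
      ring
  exact (key n).1

/-- The weight times a Hermite polynomial is an n-th derivative of the weight, so n integrations by
parts move the derivatives to p. Orthogonality results, as lower degrees are differentiated away. -/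
theorem gaussMean_hq_mul (n : ℕ) (p : ℝ[X]) :
    gaussMean 1 0 (hq n * p) = (-1) ^ n * gaussMean 1 0 (derivative^[n] p) := by
  induction n generalizing p with
  | zero => simp [hq]
  | succ n ih =>
    have h1 : hq (n + 1) * p =
        derivative (hq n) * p + C (-(1 / 2)) * (X * (hq n * p)) := by
      rw [hq, C_neg]; ring
    have h2 := gaussMean_X_mul one_pos 0 (hq n * p)
    rw [derivative_mul, gaussMean_add one_pos] at h2
    rw [h1, gaussMean_add one_pos, gaussMean_C_mul, h2, Function.iterate_succ_apply]
    linear_combination (-1 : ℝ) * ih (derivative p)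

theorem iterate_derivative_hq (n : ℕ) :
    derivative^[n] (hq n) = C ((-1 / 2) ^ n * (n.factorial : ℝ)) := by
  induction n with
  | zero => simp [hq]
  | succ n ih =>
    rw [Function.iterate_succ_apply, derivative_hq, iterate_derivative_C_mul, ih, ← C_mul,
      Nat.factorial_succ]
    congr 1
    push_cast
    ring

theorem iterate_derivative_hq_of_lt {n i : ℕ} (h : i < n) : derivative^[n] (hq i) = 0 := by
  induction n generalizing i with
  | zero => exact absurd h (Nat.not_lt_zero i)
  | succ n ih =>
    rw [Function.iterate_succ_apply]
    rcases i with _ | i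
    · simp [hq]
    · rw [derivative_hq, iterate_derivative_C_mul, ih (Nat.lt_of_succ_lt_succ h), mul_zero]

theorem gaussMean_hq_mul_hq (n i : ℕ) :
    gaussMean 1 0 (hq n * hq i) = if n = i then (n.factorial : ℝ) / 2 ^ n else 0 := by
  have h0 : gaussMean 1 0 0 = 0 := by simp [gaussMean]
  rcases lt_trichotomy n i with h | rfl | h
  · rw [mul_comm, gaussMean_hq_mul, iterate_derivative_hq_of_lt h, h0, if_neg h.ne, mul_zero]
  · rw [gaussMean_hq_mul, iterate_derivative_hq, if_pos rfl, ← mul_one (C _), gaussMean_C_mul,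
      gaussMean_one one_pos, mul_one, ← mul_assoc, ← mul_pow]
    rw [show (-1 : ℝ) * (-1 / 2) = 1 / 2 by norm_num, div_pow, one_pow]
    ring
  · rw [gaussMean_hq_mul, iterate_derivative_hq_of_lt h, h0, if_neg h.ne', mul_zero]

theorem exists_hq_sq_le (n : ℕ) : ∃ K : ℝ, 0 ≤ K ∧
    ∀ x, (hq n).eval x ^ 2 ≤ K * (1 + x ^ 2) ^ n := by
  have key : ∀ n, (∃ K : ℝ, 0 ≤ K ∧ ∀ x, (hq n).eval x ^ 2 ≤ K * (1 + x ^ 2) ^ n) ∧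
      ∃ K : ℝ, 0 ≤ K ∧ ∀ x, (hq (n + 1)).eval x ^ 2 ≤ K * (1 + x ^ 2) ^ (n + 1) := fun n => by
    induction n with
    | zero =>
      refine ⟨⟨1, zero_le_one, fun x => by simp [hq]⟩, 1, zero_le_one, fun x => ?_⟩
      simp [hq]; nlinarith [sq_nonneg x]
    | succ n ih =>
      obtain ⟨⟨K₁, hK₁, h₁⟩, K₂, hK₂, h₂⟩ := ih
      refine ⟨⟨K₂, hK₂, h₂⟩, 2 * ((n + 1 : ℝ) / 2) ^ 2 * K₁ + K₂, by positivity, fun x => ?_⟩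
      rw [show hq (n + 2) = derivative (hq (n + 1)) - C (1 / 2) * (X * hq (n + 1)) from rfl,
        derivative_hq]
      simp only [eval_sub, eval_mul, eval_C, eval_X]
      have hb : (1 : ℝ) ≤ 1 + x ^ 2 := by nlinarith [sq_nonneg x]
      have h3 : (1 + x ^ 2) ^ n ≤ (1 + x ^ 2) ^ (n + 2) := pow_le_pow_right₀ hb (by omega)
      have h4 : x ^ 2 * (1 + x ^ 2) ^ (n + 1) ≤ (1 + x ^ 2) ^ (n + 2) := by
        rw [pow_succ _ (n + 1), mul_comm]
        exact mul_le_mul_of_nonneg_left (by linarith) (by positivity)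
      set u := (hq n).eval x
      set v := (hq (n + 1)).eval x
      calc (-((n + 1 : ℝ) / 2) * u - 1 / 2 * (x * v)) ^ 2
          ≤ 2 * ((n + 1 : ℝ) / 2) ^ 2 * u ^ 2 + x ^ 2 * v ^ 2 := by
            nlinarith [sq_nonneg (-((n + 1 : ℝ) / 2) * u + 1 / 2 * (x * v)), sq_nonneg (x * v)]
        _ ≤ 2 * ((n + 1 : ℝ) / 2) ^ 2 * (K₁ * (1 + x ^ 2) ^ n) +
            x ^ 2 * (K₂ * (1 + x ^ 2) ^ (n + 1)) :=
            add_le_add (mul_le_mul_of_nonneg_left (h₁ x) (by positivity))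
              (mul_le_mul_of_nonneg_left (h₂ x) (by positivity))
        _ = 2 * ((n + 1 : ℝ) / 2) ^ 2 * K₁ * (1 + x ^ 2) ^ n +
            K₂ * (x ^ 2 * (1 + x ^ 2) ^ (n + 1)) := by ring
        _ ≤ _ := by
            rw [add_mul]
            exact add_le_add (mul_le_mul_of_nonneg_left h3 (by positivity))
              (mul_le_mul_of_nonneg_left h4 hK₂)
  exact (key n).1

end OneDimensional

/-! ### Hermite functions on the plane as eigenfunctions. -/

section Planar

theorem pderiv_zero_mul {u v u' v' : ℝ → ℝ} (hu : ∀ x, HasDerivAt u (u' x) x)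
    (hv : ∀ x, HasDerivAt v (v' x) x) :
    pderiv 0 (fun ξ => u (ξ 0) * v (ξ 1)) = fun ξ => u' (ξ 0) * v (ξ 1) := by
  ext1 ξ
  have h0 := (hu (ξ 0)).comp_hasFDerivAt ξ (EuclideanSpace.proj (𝕜 := ℝ) (0 : Fin 2)).hasFDerivAt
  have h1 := (hv (ξ 1)).comp_hasFDerivAt ξ (EuclideanSpace.proj (𝕜 := ℝ) (1 : Fin 2)).hasFDerivAt
  have h := (h0.mul h1).fderiv
  change fderiv ℝ (fun ξ : Plane => u (ξ 0) * v (ξ 1)) ξ = _ at h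
  rw [pderiv, h]
  simp [mul_comm]

theorem pderiv_one_mul {u v u' v' : ℝ → ℝ} (hu : ∀ x, HasDerivAt u (u' x) x)
    (hv : ∀ x, HasDerivAt v (v' x) x) :
    pderiv 1 (fun ξ => u (ξ 0) * v (ξ 1)) = fun ξ => u (ξ 0) * v' (ξ 1) := by
  ext1 ξ
  have h0 := (hu (ξ 0)).comp_hasFDerivAt ξ (EuclideanSpace.proj (𝕜 := ℝ) (0 : Fin 2)).hasFDerivAt
  have h1 := (hv (ξ 1)).comp_hasFDerivAt ξ (EuclideanSpace.proj (𝕜 := ℝ) (1 : Fin 2)).hasFDerivAt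
  have h := (h0.mul h1).fderiv
  change fderiv ℝ (fun ξ : Plane => u (ξ 0) * v (ξ 1)) ξ = _ at h
  rw [pderiv, h]
  simp

theorem norm_sq_plane (ξ : Plane) : ‖ξ‖ ^ 2 = ξ 0 ^ 2 + ξ 1 ^ 2 := by
  rw [EuclideanSpace.norm_sq_eq]
  simp [Fin.sum_univ_two]

theorem hasDerivAt_exp_mul_hq (c : ℝ) (n : ℕ) (x : ℝ) :
    HasDerivAt (fun x => c * Real.exp (-x ^ 2 / 4) * (hq n).eval x)
      (c * Real.exp (-x ^ 2 / 4) * (hq (n + 1)).eval x) x := by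
  have h1 := ((((hasDerivAt_id x).pow 2).neg.div_const 4).exp.const_mul c).mul ((hq n).hasDerivAt x)
  refine h1.congr_deriv ?_
  simp only [hq, id, Pi.neg_apply, Pi.pow_apply, Polynomial.eval_sub, Polynomial.eval_mul,
    Polynomial.eval_C, Polynomial.eval_X]
  push_cast
  ring

/-- The product Hermite polynomials. -/
noncomputable def hermP (α : ℕ × ℕ) (ξ : Plane) : ℝ := (hq α.1).eval (ξ 0) * (hq α.2).eval (ξ 1)

theorem multiDeriv_exp (c : ℝ) (α : ℕ × ℕ) :
    multiDeriv α (fun ξ => c * Real.exp (-‖ξ‖ ^ 2 / 4)) =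
      fun ξ => c * Real.exp (-‖ξ‖ ^ 2 / 4) * hermP α ξ := by
  set u : ℝ → ℕ → ℝ → ℝ := fun c n x => c * Real.exp (-x ^ 2 / 4) * (hq n).eval x with hu
  have key : ∀ a b, (fun ξ : Plane => c * Real.exp (-‖ξ‖ ^ 2 / 4) * hermP (a, b) ξ) =
      fun ξ => u c a (ξ 0) * u 1 b (ξ 1) := fun a b => by
    ext1 ξ
    simp only [hu, norm_sq_plane, hermP, neg_add, add_div, Real.exp_add]
    ring
  have hd := fun c n => hasDerivAt_exp_mul_hq c n
  have h1 : ∀ b, (pderiv 1)^[b] (fun ξ => u c 0 (ξ 0) * u 1 0 (ξ 1)) =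
      fun ξ => u c 0 (ξ 0) * u 1 b (ξ 1) := fun b => by
    induction b with
    | zero => rfl
    | succ b ih => rw [Function.iterate_succ_apply', ih]; exact pderiv_one_mul (hd c 0) (hd 1 b)
  have h2 : ∀ b a, (pderiv 0)^[a] (fun ξ => u c 0 (ξ 0) * u 1 b (ξ 1)) =
      fun ξ => u c a (ξ 0) * u 1 b (ξ 1) := fun b a => by
    induction a with
    | zero => rfl
    | succ a ih => rw [Function.iterate_succ_apply', ih]; exact pderiv_zero_mul (hd c a) (hd 1 b)
  have h3 : (fun ξ : Plane => c * Real.exp (-‖ξ‖ ^ 2 / 4)) =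
      fun ξ => u c 0 (ξ 0) * u 1 0 (ξ 1) := by
    rw [← key 0 0]; simp [hermP, hq]
  rw [multiDeriv, h3, h1, h2, ← key]

theorem hermiteFun_eq (α : ℕ × ℕ) (ξ : Plane) : hermiteFun α ξ = gk 1 ξ * hermP α ξ := by
  simp only [hermiteFun, multiDeriv_exp, gk, mul_one]

theorem hermitePoly_eq (α : ℕ × ℕ) (ξ : Plane) : hermitePoly α ξ =
    2 ^ (α.1 + α.2) / ((α.1.factorial : ℝ) * (α.2.factorial : ℝ)) * hermP α ξ := by
  have h := multiDeriv_exp 1 α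
  simp only [one_mul] at h
  rw [hermitePoly, h, mul_assoc, ← mul_assoc (Real.exp _), ← Real.exp_add, neg_div, add_neg_cancel,
    Real.exp_zero, one_mul]

theorem integral_plane_mul (f g : ℝ → ℝ) :
    ∫ ξ : Plane, f (ξ 0) * g (ξ 1) = (∫ x, f x) * ∫ x, g x := by
  have h := (PiLp.volume_preserving_toLp (Fin 2)).integral_comp
    (MeasurableEquiv.toLp 2 (Fin 2 → ℝ)).measurableEmbedding
    (fun ξ : Plane => f (ξ 0) * g (ξ 1))
  rw [← h]
  have h2 := integral_fintype_prod_volume_eq_prod (𝕜 := ℝ) (fun i : Fin 2 => ![f, g] i)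
  simp only [Fin.prod_univ_two, Matrix.cons_val_zero, Matrix.cons_val_one] at h2
  exact h2

theorem gk_eq_lineGauss {c : ℝ} (hc : 0 < c) (x : Plane) :
    gk c x = lineGauss c (x 0) * lineGauss c (x 1) := by
  have hπ := Real.pi_pos
  have h : Real.sqrt (4 * Real.pi * c) ≠ 0 := (Real.sqrt_pos.2 (by positivity)).ne'
  have h2 := Real.sq_sqrt (show 0 ≤ 4 * Real.pi * c by positivity)
  simp only [gk, lineGauss, norm_sq_plane, neg_add, add_div, Real.exp_add]
  rw [← h2, Real.sqrt_sq (Real.sqrt_nonneg _)]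
  field_simp

theorem integral_gk_mul_eval {c : ℝ} (hc : 0 < c) (z : Plane) (p q : Polynomial ℝ) :
    ∫ ξ : Plane, gk c (ξ - z) * (p.eval (ξ 0) * q.eval (ξ 1)) =
      gaussMean c (z 0) p * gaussMean c (z 1) q := by
  rw [gaussMean, gaussMean, ← integral_plane_mul (fun x => lineGauss c (x - z 0) * p.eval x)
    fun x => lineGauss c (x - z 1) * q.eval x]
  refine integral_congr_ae (Eventually.of_forall fun ξ => ?_)
  simp only [gk_eq_lineGauss hc, PiLp.sub_apply]
  ring

theorem exp_half_pow (t : ℝ) (n : ℕ) : Real.exp (-t / 2) ^ n = Real.exp (-(n / 2 : ℝ) * t) := by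
  rw [← Real.exp_nat_mul]; congr 1; ring

theorem integral_heatK_mul_hermP {t : ℝ} (ht : 0 < t) (α : ℕ × ℕ) (y : Plane) :
    ∫ ξ, heatK t ξ y * hermP α ξ =
      Real.exp (-(((α.1 + α.2 : ℕ) : ℝ) / 2) * t) * hermP α y := by
  have ha := aTime_pos ht
  have hs : aTime t = 1 - Real.exp (-t / 2) ^ 2 := by rw [exp_half_sq, aTime]
  simp only [heatK, hermP]
  rw [integral_gk_mul_eval ha, PiLp.smul_apply, PiLp.smul_apply, smul_eq_mul, smul_eq_mul,
    gaussMean_hq ha hs, gaussMean_hq ha hs, ← exp_half_pow, pow_add]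
  ring

/-- Detailed balance: the semigroup is symmetric with respect to the inverse of its Gaussian
equilibrium. In the exponent this is the relation s² = 1 - a between the dilation and the width. -/
theorem heatK_mul_gk_one {t : ℝ} (ht : 0 < t) (ξ y : Plane) :
    heatK t ξ y * gk 1 y = heatK t y ξ * gk 1 ξ := by
  have ha := aTime_pos ht
  have hs : Real.exp (-t / 2) ^ 2 = 1 - aTime t := by rw [exp_half_sq, aTime]; ring
  have hπ := Real.pi_pos
  simp only [heatK, gk]
  have h : ∀ A B x y : ℝ, A * Real.exp x * (B * Real.exp y) = A * B * Real.exp (x + y) :=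
    fun A B x y => by rw [Real.exp_add]; ring
  rw [h, h]
  congr 2
  rw [norm_sub_sq_real, norm_sub_sq_real, norm_smul, norm_smul, mul_pow, mul_pow, Real.norm_eq_abs,
    sq_abs, hs, inner_smul_right, inner_smul_right, real_inner_comm]
  field_simp
  ring

/-- A Hermite function is the equilibrium times a Hermite polynomial, and detailed balance turns the
semigroup acting on it into the dual semigroup acting on the polynomial. -/
theorem heatOp_hermiteFun {t : ℝ} (ht : 0 < t) (α : ℕ × ℕ) (ξ : Plane) :
    heatOp t (hermiteFun α) ξ =
      Real.exp (-(((α.1 + α.2 : ℕ) : ℝ) / 2) * t) * hermiteFun α ξ := by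
  have h : ∀ y, heatK t ξ y * hermiteFun α y = gk 1 ξ * (heatK t y ξ * hermP α y) := fun y => by
    rw [hermiteFun_eq, ← mul_assoc, heatK_mul_gk_one ht]; ring
  simp only [heatOp, h, integral_const_mul]
  rw [integral_heatK_mul_hermP ht, hermiteFun_eq]
  ring

theorem integral_hermitePoly_mul_hermiteFun (α β : ℕ × ℕ) :
    ∫ ξ, hermitePoly α ξ * hermiteFun β ξ = if α = β then 1 else 0 := by
  have h : ∀ ξ, hermitePoly α ξ * hermiteFun β ξ =
      2 ^ (α.1 + α.2) / ((α.1.factorial : ℝ) * (α.2.factorial : ℝ)) *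
        (gk 1 (ξ - 0) * ((hq α.1 * hq β.1).eval (ξ 0) * (hq α.2 * hq β.2).eval (ξ 1))) := fun ξ => by
    rw [hermitePoly_eq, hermiteFun_eq, sub_zero, hermP, hermP, Polynomial.eval_mul,
      Polynomial.eval_mul]
    ring
  simp only [h, integral_const_mul]
  rw [integral_gk_mul_eval one_pos, PiLp.zero_apply, PiLp.zero_apply, gaussMean_hq_mul_hq,
    gaussMean_hq_mul_hq]
  by_cases h1 : α.1 = β.1 <;> by_cases h2 : α.2 = β.2
  · have h3 := Nat.factorial_ne_zero β.1
    have h4 := Nat.factorial_ne_zero β.2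
    rw [if_pos h1, if_pos h2, if_pos (Prod.ext h1 h2), h1, h2, pow_add]
    field_simp
  all_goals simp [h1, h2, Prod.ext_iff]

end Planar

/-! ### Hermite coefficients as functionals on L²(m). -/

section Spectral

variable {m : ℝ}

theorem wt_mul (a b : ℝ) (ξ : Plane) : wt a ξ * wt b ξ = wt (a + b) ξ := by
  rw [wt, wt, wt, ← ENNReal.ofReal_mul (Real.rpow_nonneg (wt_base_pos ξ).le _),
    ← Real.rpow_add (wt_base_pos ξ)]

theorem continuous_hermP (α : ℕ × ℕ) : Continuous (hermP α) := by
  unfold hermP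
  exact ((hq α.1).continuous.comp (by fun_prop)).mul ((hq α.2).continuous.comp (by fun_prop))

theorem continuous_hermiteFun (α : ℕ × ℕ) : Continuous (hermiteFun α) := by
  have h : hermiteFun α = fun ξ => gk 1 ξ * hermP α ξ := funext (hermiteFun_eq α)
  rw [h]
  exact (continuous_gk 1).mul (continuous_hermP α)

theorem exists_enorm_hermP_le (α : ℕ × ℕ) : ∃ K : ℝ≥0, ∀ ξ,
    ‖hermP α ξ‖ₑ ≤ K * wt (((α.1 + α.2 : ℕ) : ℝ) / 2) ξ := by
  obtain ⟨K₁, hK₁, h₁⟩ := exists_hq_sq_le α.1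
  obtain ⟨K₂, hK₂, h₂⟩ := exists_hq_sq_le α.2
  refine ⟨(Real.sqrt (K₁ * K₂)).toNNReal, fun ξ => ?_⟩
  have hb := wt_base_pos ξ
  have e0 : 1 + ξ 0 ^ 2 ≤ 1 + ‖ξ‖ ^ 2 := by rw [norm_sq_plane]; nlinarith [sq_nonneg (ξ 1)]
  have e1 : 1 + ξ 1 ^ 2 ≤ 1 + ‖ξ‖ ^ 2 := by rw [norm_sq_plane]; nlinarith [sq_nonneg (ξ 0)]
  have h : |hermP α ξ| ≤
      Real.sqrt (K₁ * K₂) * (1 + ‖ξ‖ ^ 2) ^ (((α.1 + α.2 : ℕ) : ℝ) / 2) := by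
    refine abs_le_of_sq_le_sq ?_ (by positivity)
    rw [hermP, mul_pow, mul_pow, Real.sq_sqrt (by positivity), ← Real.rpow_natCast,
      ← Real.rpow_natCast, ← Real.rpow_natCast, ← Real.rpow_mul hb.le]
    rw [show ((α.1 + α.2 : ℕ) : ℝ) / 2 * ((2 : ℕ) : ℝ) = ((α.1 + α.2 : ℕ) : ℝ) by push_cast; ring]
    simp only [Real.rpow_natCast]
    calc _ ≤ (K₁ * (1 + ξ 0 ^ 2) ^ α.1) * (K₂ * (1 + ξ 1 ^ 2) ^ α.2) :=
          mul_le_mul (h₁ _) (h₂ _) (sq_nonneg _) (by positivity)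
      _ ≤ (K₁ * (1 + ‖ξ‖ ^ 2) ^ α.1) * (K₂ * (1 + ‖ξ‖ ^ 2) ^ α.2) := by gcongr
      _ = _ := by rw [pow_add]; ring
  rw [← ofReal_norm, Real.norm_eq_abs]
  refine (ENNReal.ofReal_le_ofReal h).trans_eq ?_
  rw [ENNReal.ofReal_mul (Real.sqrt_nonneg _)]; rfl

/-- A polynomial of degree n is dual to L²(m) exactly in the range n + 1 < m used here: its square
grows like (1+|ξ|²)ⁿ, and the remaining weight of exponent -(m - n) has to be integrable in the
plane. -/
theorem lintegral_hermP_lt_top (α : ℕ × ℕ) (hα : ((α.1 + α.2 : ℕ) : ℝ) + 1 < m) :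
    ∫⁻ ξ, wt (-m) ξ * ‖hermP α ξ‖ₑ ^ 2 < ⊤ := by
  obtain ⟨K, hK⟩ := exists_enorm_hermP_le α
  have h : ∀ ξ, wt (-m) ξ * ‖hermP α ξ‖ₑ ^ 2 ≤
      (K : ℝ≥0∞) ^ 2 * wt (-(m - ((α.1 + α.2 : ℕ) : ℝ))) ξ := fun ξ => by
    calc _ ≤ wt (-m) ξ * (K * wt (((α.1 + α.2 : ℕ) : ℝ) / 2) ξ) ^ 2 :=
          mul_le_mul_right (pow_le_pow_left₀ zero_le (hK ξ) 2) _
      _ = (K : ℝ≥0∞) ^ 2 * (wt (-m) ξ * (wt (((α.1 + α.2 : ℕ) : ℝ) / 2) ξ *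
          wt (((α.1 + α.2 : ℕ) : ℝ) / 2) ξ)) := by ring
      _ = _ := by rw [wt_mul, wt_mul]; congr 2; ring
  refine (lintegral_mono h).trans_lt ?_
  rw [lintegral_const_mul _ (measurable_wt _)]
  exact ENNReal.mul_lt_top (by simp) (lintegral_wt_neg_lt_top (by linarith))

theorem integrable_hermP_mul (α : ℕ × ℕ) (hα : ((α.1 + α.2 : ℕ) : ℝ) + 1 < m) (f : L2m m) :
    Integrable fun ξ => hermP α ξ * f ξ :=
  integrable_mul_coe (continuous_hermP α).aestronglyMeasurable (lintegral_hermP_lt_top α hα) f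

theorem memLp_hermiteFun (hm : 0 ≤ m) (α : ℕ × ℕ) :
    MemLp (hermiteFun α) 2 (weightMeasure m) := by
  obtain ⟨K, hK⟩ := exists_enorm_hermP_le α
  obtain ⟨C, hC⟩ := exists_lintegral_wt_gk_le (m := m + ((α.1 + α.2 : ℕ) : ℝ)) (by positivity)
  refine memLp_of_lintegral (continuous_hermiteFun α).aestronglyMeasurable
    (c := (K : ℝ≥0∞) ^ 2 * (C * wt (m + ((α.1 + α.2 : ℕ) : ℝ)) 0))
    (ENNReal.mul_ne_top (by simp) (ENNReal.mul_ne_top ENNReal.coe_ne_top (wt_ne_top _ _))) ?_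
  refine le_trans ?_ (mul_le_mul_right (hC 1 one_pos one_le_two 0) _)
  refine le_trans (lintegral_mono fun ξ => ?_) (lintegral_const_mul _ ((measurable_wt _).mul
    ((measurable_ofReal_gk 1).comp (measurable_id.sub_const 0)))).le
  have h0 := gk_nonneg one_pos ξ
  have h1 : gk 1 ξ ≤ 1 := (gk_le one_pos ξ).trans (by
    rw [mul_one, div_le_one (by positivity)]; nlinarith [Real.pi_gt_three])
  have h2 : ENNReal.ofReal (gk 1 ξ) ^ 2 ≤ ENNReal.ofReal (gk 1 ξ) := by
    rw [← ENNReal.ofReal_pow h0]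
    exact ENNReal.ofReal_le_ofReal (by nlinarith)
  rw [hermiteFun_eq, enorm_mul, Real.enorm_of_nonneg h0]
  simp only [Pi.mul_apply, Function.comp_apply, id, sub_zero]
  calc _ ≤ wt m ξ * (ENNReal.ofReal (gk 1 ξ) * (K * wt (((α.1 + α.2 : ℕ) : ℝ) / 2) ξ)) ^ 2 :=
        mul_le_mul_right (pow_le_pow_left₀ zero_le (mul_le_mul_right (hK ξ) _) 2) _
    _ = (K : ℝ≥0∞) ^ 2 * (wt m ξ * (wt (((α.1 + α.2 : ℕ) : ℝ) / 2) ξ *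
        wt (((α.1 + α.2 : ℕ) : ℝ) / 2) ξ) * ENNReal.ofReal (gk 1 ξ) ^ 2) := by ring
    _ ≤ _ := by
      rw [wt_mul, wt_mul, add_halves]
      exact mul_le_mul_right (mul_le_mul_right h2 _) _

open Classical in
/-- The coefficient `∫ H_α f`. -/
noncomputable def coefL (m : ℝ) (α : ℕ × ℕ) : L2m m →L[ℝ] ℝ :=
  if h : ∃ ℓ : L2m m →L[ℝ] ℝ, ∀ f, ℓ f = ∫ ξ, hermitePoly α ξ * f ξ then h.choose else 0

open Classical in
/-- The Hermite function `φ_α` as an element of `L²(m)`. -/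
noncomputable def hermL (m : ℝ) (α : ℕ × ℕ) : L2m m :=
  if h : MemLp (hermiteFun α) 2 (weightMeasure m) then h.toLp (hermiteFun α) else 0

theorem hermL_coe (hm : 0 ≤ m) (α : ℕ × ℕ) : hermL m α =ᵐ[volume] hermiteFun α := by
  rw [hermL, dif_pos (memLp_hermiteFun hm α)]
  exact coeFn_toLp _

/-- The normalization of `H_α`. -/
noncomputable def hermC (α : ℕ × ℕ) : ℝ :=
  2 ^ (α.1 + α.2) / ((α.1.factorial : ℝ) * (α.2.factorial : ℝ))

theorem hermC_pos (α : ℕ × ℕ) : 0 < hermC α := by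
  have h1 : (0 : ℝ) < α.1.factorial := Nat.cast_pos.2 (Nat.factorial_pos _)
  have h2 : (0 : ℝ) < α.2.factorial := Nat.cast_pos.2 (Nat.factorial_pos _)
  unfold hermC; positivity

theorem integral_hermitePoly_mul (α : ℕ × ℕ) (f : Plane → ℝ) :
    ∫ ξ, hermitePoly α ξ * f ξ = hermC α * ∫ ξ, hermP α ξ * f ξ := by
  rw [← integral_const_mul]
  refine integral_congr_ae (Eventually.of_forall fun ξ => ?_)
  simp only [hermitePoly_eq, hermC]; ring

theorem coefL_apply (α : ℕ × ℕ) (hα : ((α.1 + α.2 : ℕ) : ℝ) + 1 < m) (f : L2m m) :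
    coefL m α f = ∫ ξ, hermitePoly α ξ * f ξ := by
  obtain ⟨ℓ, hℓ⟩ := exists_pairing (continuous_hermP α).aestronglyMeasurable
    (lintegral_hermP_lt_top α hα)
  have h : ∃ ℓ : L2m m →L[ℝ] ℝ, ∀ f, ℓ f = ∫ ξ, hermitePoly α ξ * f ξ :=
    ⟨hermC α • ℓ, fun f => by rw [integral_hermitePoly_mul, ← hℓ]; rfl⟩
  rw [coefL, dif_pos h]
  exact h.choose_spec f

theorem coefL_hermL (α β : ℕ × ℕ) (hα : ((α.1 + α.2 : ℕ) : ℝ) + 1 < m) :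
    coefL m α (hermL m β) = if α = β then 1 else 0 := by
  have hm : 0 ≤ m := by have := (α.1 + α.2).cast_nonneg (α := ℝ); linarith
  rw [coefL_apply α hα, ← integral_hermitePoly_mul_hermiteFun]
  exact integral_congr_ae ((hermL_coe hm β).mono fun ξ h => by simp only [h])

theorem heatS_hermL (hm : 1 < m) {t : ℝ} (ht : 0 ≤ t) (α : ℕ × ℕ) :
    heatS m t (hermL m α) = Real.exp (-(((α.1 + α.2 : ℕ) : ℝ) / 2) * t) • hermL m α := by
  rcases ht.eq_or_lt with rfl | ht
  · rw [heatS_of_nonpos le_rfl, mul_zero, Real.exp_zero, one_smul]; rfl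
  refine ext_ae ?_
  filter_upwards [heatS_coe hm ht (hermL m α), hermL_coe (by linarith : 0 ≤ m) α,
    coeFn_smul_ae (Real.exp (-(((α.1 + α.2 : ℕ) : ℝ) / 2) * t)) (hermL m α)] with ξ h1 h2 h3
  rw [h1, h3, h2, heatOp_congr t (hermL_coe (by linarith) α), heatOp_hermiteFun ht]

/-- Duality by Fubini. Absolute integrability holds because the kernel maps the polynomial bound to
itself, up to a constant, and f is integrable against (1+|y|²)^(n/2) when m - n > 1. -/
theorem integral_hermP_mul_heatOp {t : ℝ} (ht : 0 < t) (α : ℕ × ℕ)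
    (hα : ((α.1 + α.2 : ℕ) : ℝ) + 1 < m) (f : L2m m) :
    ∫ ξ, hermP α ξ * heatOp t f ξ =
      Real.exp (-(((α.1 + α.2 : ℕ) : ℝ) / 2) * t) * ∫ y, hermP α y * f y := by
  set n : ℝ := ((α.1 + α.2 : ℕ) : ℝ) with hn
  have hn0 : 0 ≤ n := Nat.cast_nonneg _
  obtain ⟨K, hK⟩ := exists_enorm_hermP_le α
  obtain ⟨C, hC⟩ := exists_lintegral_wt_gk_le (m := n / 2) (by positivity)
  have hs1 : ‖Real.exp (-t / 2)‖ ≤ 1 := by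
    rw [Real.norm_of_nonneg (Real.exp_pos _).le, Real.exp_le_one_iff]; linarith
  have hmeas : AEStronglyMeasurable (fun p : Plane × Plane =>
      hermP α p.1 * (heatK t p.1 p.2 * f p.2)) (volume.prod volume) :=
    ((continuous_hermP α).comp continuous_fst).aestronglyMeasurable.mul
      ((continuous_heatK t).aestronglyMeasurable.mul (aestronglyMeasurable_coe f).comp_snd)
  have hint : Integrable (fun p : Plane × Plane =>
      hermP α p.1 * (heatK t p.1 p.2 * f p.2)) (volume.prod volume) := by
    refine ⟨hmeas, ?_⟩
    rw [HasFiniteIntegral, lintegral_prod_symm _ hmeas.enorm]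
    have h1 : ∀ y, ∫⁻ ξ, ‖hermP α ξ * (heatK t ξ y * f y)‖ₑ ≤ K * C * (wt (n / 2) y * ‖f y‖ₑ) :=
      fun y => by
        calc _ ≤ ∫⁻ ξ, K * ‖f y‖ₑ * (wt (n / 2) ξ * ENNReal.ofReal (heatK t ξ y)) :=
              lintegral_mono fun ξ => by
                rw [enorm_mul, enorm_mul, Real.enorm_of_nonneg (heatK_nonneg ht ξ y)]
                calc _ ≤ K * wt (n / 2) ξ * (ENNReal.ofReal (heatK t ξ y) * ‖f y‖ₑ) :=
                      mul_le_mul_left (hK ξ) _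
                  _ = _ := by ring
          _ = K * ‖f y‖ₑ * ∫⁻ ξ, wt (n / 2) ξ * ENNReal.ofReal (heatK t ξ y) :=
              lintegral_const_mul _ ((measurable_wt _).mul
                (measurable_gk_kernel (aTime t) (Real.exp (-t / 2))).of_uncurry_right)
          _ ≤ K * ‖f y‖ₑ * (C * wt (n / 2) y) := by
              refine mul_le_mul_right ((hC _ (aTime_pos ht) ((aTime_le_one t).trans one_le_two)
                _).trans (mul_le_mul_right (wt_mono (by positivity) ?_) _)) _
              rw [norm_smul]
              exact mul_le_of_le_one_left (norm_nonneg y) hs1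
          _ = _ := by ring
    refine (lintegral_mono h1).trans_lt ?_
    have hwm : AEStronglyMeasurable (fun y : Plane => (1 + ‖y‖ ^ 2) ^ (n / 2)) volume :=
      (continuous_wt_real _).aestronglyMeasurable
    have h2 : ∀ y : Plane, ‖(1 + ‖y‖ ^ 2) ^ (n / 2)‖ₑ = wt (n / 2) y := fun y =>
      Real.enorm_of_nonneg (Real.rpow_nonneg (wt_base_pos y).le _)
    have h3 := (integrable_mul_coe (m := m) hwm (by
      refine (lintegral_mono fun ξ => ?_).trans_lt (lintegral_wt_neg_lt_top
        (show 1 < m - n by linarith))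
      rw [h2, sq, wt_mul, wt_mul]
      exact (congrArg (fun a => wt a ξ) (by ring)).le) f).2
    rw [HasFiniteIntegral] at h3
    simp only [enorm_mul, h2] at h3
    refine lt_of_eq_of_lt (lintegral_const_mul'' _ ((measurable_wt _).aemeasurable.mul
      (aestronglyMeasurable_coe f).enorm)) ?_
    exact ENNReal.mul_lt_top (ENNReal.mul_lt_top ENNReal.coe_lt_top ENNReal.coe_lt_top) h3
  calc _ = ∫ ξ, ∫ y, hermP α ξ * (heatK t ξ y * f y) := by
        refine integral_congr_ae (Eventually.of_forall fun ξ => ?_)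
        simp only [heatOp, integral_const_mul]
    _ = ∫ y, ∫ ξ, hermP α ξ * (heatK t ξ y * f y) := integral_integral_swap hint
    _ = _ := by
        rw [← integral_const_mul]
        refine integral_congr_ae (Eventually.of_forall fun y => ?_)
        have h : ∀ ξ, hermP α ξ * (heatK t ξ y * f y) = heatK t ξ y * hermP α ξ * f y :=
          fun ξ => by ring
        simp only [h, integral_mul_const]
        rw [integral_heatK_mul_hermP ht, mul_assoc]

theorem coefL_heatS {t : ℝ} (ht : 0 ≤ t) (α : ℕ × ℕ)
    (hα : ((α.1 + α.2 : ℕ) : ℝ) + 1 < m) (f : L2m m) :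
    coefL m α (heatS m t f) = Real.exp (-(((α.1 + α.2 : ℕ) : ℝ) / 2) * t) * coefL m α f := by
  rcases ht.eq_or_lt with rfl | ht
  · rw [heatS_of_nonpos le_rfl, mul_zero, Real.exp_zero, one_mul]; rfl
  have hm : 1 < m := by have := (α.1 + α.2).cast_nonneg (α := ℝ); linarith
  rw [coefL_apply α hα, coefL_apply α hα, integral_hermitePoly_mul, integral_hermitePoly_mul,
    mul_left_comm, ← integral_hermP_mul_heatOp ht α hα]
  congr 1
  exact integral_congr_ae ((heatS_coe hm ht f).mono fun ξ h => by simp only [h])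

/-- The conservation of mass. -/
theorem coefL_transB (hm : 1 < m) {t : ℝ} (ht : 0 < t) (a b : L2m m) :
    coefL m (0, 0) (transB m t a b) = 0 := by
  have hF := integrable_fluxOf hm a b
  have ha := aTime_pos ht
  set c := 2 * Real.exp (-t / 2) * (Real.sqrt (aTime t))⁻¹ with hc
  have hmeas : AEStronglyMeasurable (fun p : Plane × Plane =>
      inner ℝ (gradK t p.1 p.2) (fluxOf a b p.2)) (volume.prod volume) :=
    (continuous_gradK t).aestronglyMeasurable.inner (fluxOf_aestronglyMeasurable a b).comp_snd
  have hint : Integrable (fun p : Plane × Plane =>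
      inner ℝ (gradK t p.1 p.2) (fluxOf a b p.2)) (volume.prod volume) := by
    rw [integrable_prod_iff' hmeas]
    have h1 : ∀ y, Integrable fun ξ : Plane =>
        c * gk (2 * aTime t) (ξ - Real.exp (-t / 2) • y) * ‖fluxOf a b y‖ := fun y =>
      (((integrable_gk (by positivity : 0 < 2 * aTime t)).comp_sub_right _).const_mul c).mul_const _
    have h2 : ∀ y ξ, ‖inner ℝ (gradK t ξ y) (fluxOf a b y)‖ ≤
        c * gk (2 * aTime t) (ξ - Real.exp (-t / 2) • y) * ‖fluxOf a b y‖ := fun y ξ =>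
      (norm_inner_le_norm _ _).trans
        (mul_le_mul_of_nonneg_right (norm_gradK_le ht ξ y) (norm_nonneg _))
    have h3 : ∀ y, Continuous fun ξ => inner ℝ (gradK t ξ y) (fluxOf a b y) := fun y =>
      ((continuous_gradK t).uncurry_right y).inner continuous_const
    refine ⟨Eventually.of_forall fun y => (h1 y).mono' (h3 y).aestronglyMeasurable
      (Eventually.of_forall (h2 y)), ?_⟩
    refine (hF.norm.const_mul c).mono' hmeas.norm.prod_swap.integral_prod_right'
      (Eventually.of_forall fun y => ?_)
    rw [Real.norm_of_nonneg (integral_nonneg fun ξ => norm_nonneg _)]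
    calc _ ≤ ∫ ξ, c * gk (2 * aTime t) (ξ - Real.exp (-t / 2) • y) * ‖fluxOf a b y‖ :=
          integral_mono_of_nonneg (Eventually.of_forall fun ξ => norm_nonneg _) (h1 y)
            (Eventually.of_forall (h2 y))
      _ = _ := by
          rw [integral_mul_const, integral_const_mul, integral_sub_right_eq_self (gk _),
            integral_gk (by positivity), mul_one]
  rw [coefL_apply _ (by simpa using hm), integral_hermitePoly_mul]
  have h1 : ∫ ξ, hermP (0, 0) ξ * transB m t a b ξ = ∫ ξ, gradOp t a b ξ :=
    integral_congr_ae ((transB_coe hm ht a b).mono fun ξ h => by simp [h, hermP, hq])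
  rw [h1]
  unfold gradOp
  rw [integral_integral_swap hint]
  have h2 : ∀ y, ∫ ξ, inner ℝ (gradK t ξ y) (fluxOf a b y) = 0 := fun y => by
    have h3 := (integral_gk_smul_sub ha (Real.exp (-t / 2) • y) (Real.exp (-t / 2) • y))
    have h4 : ∀ ξ, inner ℝ (gradK t ξ y) (fluxOf a b y) = Real.exp (-t / 2) / (2 * aTime t) *
        inner ℝ (fluxOf a b y) (gk (aTime t) (ξ - Real.exp (-t / 2) • y) •
          (ξ - Real.exp (-t / 2) • y)) := fun ξ => by
      rw [gradK, heatK, mul_smul, real_inner_smul_left, real_inner_comm]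
    simp only [h4, integral_const_mul]
    rw [integral_inner h3.1, h3.2, sub_self, inner_zero_right, mul_zero]
  simp only [h2, integral_zero, mul_zero]

end Spectral

/-! ### The spectral projection and the polynomials annihilated by its kernel. -/

section Projection

open Finset.HasAntidiagonal

variable {m : ℝ} {k : ℕ}

/-- The operator with eigenvalues `c n`, `n ≤ k`, on the eigenspaces of `e^𝓛`, which vanishes
on the kernel of `P_k`. -/
noncomputable def specMul (m : ℝ) (k : ℕ) (c : ℕ → ℝ) : L2m m →L[ℝ] L2m m :=
  ∑ n ∈ Finset.range (k + 1), ∑ α ∈ antidiagonal n,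
    c n • (coefL m α).smulRight (hermL m α)

theorem specMul_apply (c : ℕ → ℝ) (f : L2m m) : specMul m k c f =
    ∑ n ∈ Finset.range (k + 1), ∑ α ∈ antidiagonal n, (c n * coefL m α f) • hermL m α := by
  simp only [specMul, sum_apply, smul_apply, ContinuousLinearMap.smulRight_apply, smul_smul]

theorem index_lt (hm : (k : ℝ) + 2 ≤ m) {n : ℕ} (hn : n ∈ Finset.range (k + 1)) {α : ℕ × ℕ}
    (hα : α ∈ antidiagonal n) : ((α.1 + α.2 : ℕ) : ℝ) + 1 < m := by
  rw [mem_antidiagonal.1 hα]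
  have : (n : ℝ) ≤ k := by exact_mod_cast Nat.lt_succ_iff.1 (Finset.mem_range.1 hn)
  linarith

theorem specMul_congr {c d : ℕ → ℝ} {f g : L2m m} (h : ∀ α : ℕ × ℕ, α.1 + α.2 ≤ k →
    c (α.1 + α.2) * coefL m α f = d (α.1 + α.2) * coefL m α g) :
    specMul m k c f = specMul m k d g := by
  rw [specMul_apply, specMul_apply]
  refine Finset.sum_congr rfl fun n hn => Finset.sum_congr rfl fun α hα => ?_
  have h1 := mem_antidiagonal.1 hα
  have h2 := h α (by rw [h1]; exact Nat.lt_succ_iff.1 (Finset.mem_range.1 hn))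
  rw [h1] at h2
  rw [h2]

theorem coefL_specMul (hm : (k : ℝ) + 2 ≤ m) (c : ℕ → ℝ) (f : L2m m) {β : ℕ × ℕ}
    (hβ : β.1 + β.2 ≤ k) : coefL m β (specMul m k c f) = c (β.1 + β.2) * coefL m β f := by
  have hβm : ((β.1 + β.2 : ℕ) : ℝ) + 1 < m := by
    have : ((β.1 + β.2 : ℕ) : ℝ) ≤ k := by exact_mod_cast hβ
    linarith
  rw [specMul_apply]
  simp only [map_sum, map_smul, coefL_hermL β _ hβm, smul_eq_mul]
  rw [Finset.sum_eq_single (β.1 + β.2), Finset.sum_eq_single β]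
  · rw [if_pos rfl, mul_one]
  · intro α _ hα; rw [if_neg hα.symm, mul_zero]
  · intro h; exact absurd (mem_antidiagonal.2 rfl) h
  · intro n _ hn
    refine Finset.sum_eq_zero fun α hα => ?_
    rw [if_neg, mul_zero]
    rintro rfl
    exact hn (mem_antidiagonal.1 hα).symm
  · intro h; exact absurd (Finset.mem_range.2 (Nat.lt_succ_of_le hβ)) h

/-- Such operators multiply like their symbols. Together with the action of the semigroup as
multiplication by e^(-nt/2), this makes the inverse of the semigroup on E_c and all its commutation
rules a matter of multiplying exponentials. -/
theorem specMul_specMul (hm : (k : ℝ) + 2 ≤ m) (c d : ℕ → ℝ) (f : L2m m) :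
    specMul m k c (specMul m k d f) = specMul m k (fun n => c n * d n) f :=
  specMul_congr fun α hα => by rw [coefL_specMul hm d f hα, mul_assoc]

theorem specMul_heatS (hm : (k : ℝ) + 2 ≤ m) (c : ℕ → ℝ) {t : ℝ} (ht : 0 ≤ t) (f : L2m m) :
    specMul m k c (heatS m t f) =
      specMul m k (fun n => c n * Real.exp (-((n : ℝ) / 2) * t)) f :=
  specMul_congr fun α hα => by
    have : ((α.1 + α.2 : ℕ) : ℝ) ≤ k := by exact_mod_cast hα
    rw [coefL_heatS ht α (by linarith), mul_assoc]

theorem heatS_specMul (hm : (k : ℝ) + 2 ≤ m) (c : ℕ → ℝ) {t : ℝ} (ht : 0 ≤ t) (f : L2m m) :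
    heatS m t (specMul m k c f) =
      specMul m k (fun n => c n * Real.exp (-((n : ℝ) / 2) * t)) f := by
  have hk : (0 : ℝ) ≤ k := Nat.cast_nonneg _
  rw [specMul_apply, specMul_apply]
  simp only [map_sum, map_smul, heatS_hermL (show 1 < m by linarith) ht, smul_smul]
  refine Finset.sum_congr rfl fun n _ => Finset.sum_congr rfl fun α hα => ?_
  rw [mem_antidiagonal.1 hα, mul_right_comm]

theorem exists_norm_specMul_le (m : ℝ) (k : ℕ) : ∃ D : ℝ, 0 ≤ D ∧ ∀ (c : ℕ → ℝ) (b : ℝ),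
    (∀ n ≤ k, |c n| ≤ b) → ‖specMul m k c‖ ≤ D * b := by
  refine ⟨∑ n ∈ Finset.range (k + 1), ∑ α ∈ antidiagonal n,
    ‖(coefL m α).smulRight (hermL m α)‖, by positivity, fun c b hb => ?_⟩
  rw [Finset.sum_mul]
  refine (norm_sum_le _ _).trans (Finset.sum_le_sum fun n hn => ?_)
  rw [Finset.sum_mul]
  refine (norm_sum_le _ _).trans (Finset.sum_le_sum fun α _ => ?_)
  rw [norm_smul, mul_comm]
  exact mul_le_mul_of_nonneg_left (hb n (Nat.lt_succ_iff.1 (Finset.mem_range.1 hn)))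
    (norm_nonneg _)

theorem coeFn_sum_ae {ι : Type*} (s : Finset ι) (F : ι → L2m m) (G : ι → Plane → ℝ)
    (h : ∀ i ∈ s, F i =ᵐ[volume] G i) :
    ⇑(∑ i ∈ s, F i) =ᵐ[volume] fun ξ => ∑ i ∈ s, G i ξ := by
  classical
  induction s using Finset.induction_on with
  | empty =>
    simp only [Finset.sum_empty]
    exact ae_weight_iff.1 (Lp.coeFn_zero ℝ 2 (weightMeasure m))
  | insert i s hi ih =>
    have h1 := ih fun j hj => h j (Finset.mem_insert_of_mem hj)
    rw [Finset.sum_insert hi]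
    filter_upwards [coeFn_add_ae (F i) (∑ j ∈ s, F j), h1, h i (Finset.mem_insert_self i s)]
      with ξ h2 h3 h4
    rw [h2, h3, h4, Finset.sum_insert hi]

/-- The spectral projection as an operator on `L²(m)`. -/
noncomputable def specP (m : ℝ) (k : ℕ) : L2m m →L[ℝ] L2m m := specMul m k fun _ => 1

theorem specP_coe (hm : (k : ℝ) + 2 ≤ m) (f : L2m m) :
    specP m k f =ᵐ[volume] specProj k f := by
  have hk : (0 : ℝ) ≤ k := Nat.cast_nonneg _
  rw [specP, specMul_apply]
  refine coeFn_sum_ae _ _ _ fun n hn => coeFn_sum_ae _ _ (fun α ξ =>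
    (∫ η, hermitePoly α η * f η) * hermiteFun α ξ) fun α hα => ?_
  filter_upwards [coeFn_smul_ae (1 * coefL m α f) (hermL m α),
    hermL_coe (show 0 ≤ m by linarith) α] with ξ h1 h2
  rw [h1, h2, one_mul, coefL_apply α (index_lt hm hn hα)]

theorem specP_specP (hm : (k : ℝ) + 2 ≤ m) (f : L2m m) :
    specP m k (specP m k f) = specP m k f := by
  rw [specP, specMul_specMul hm]; simp only [mul_one]

theorem specP_mem_centerSpace (hm : (k : ℝ) + 2 ≤ m) (f : L2m m) :
    specP m k f ∈ centerSpace k m := by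
  have hk : (0 : ℝ) ≤ k := Nat.cast_nonneg _
  rw [specP, specMul_apply]
  refine Submodule.sum_mem _ fun n hn => Submodule.sum_mem _ fun α hα =>
    Submodule.smul_mem _ _ (Submodule.subset_span ⟨α, ?_, hermL_coe (by linarith) α⟩)
  rw [mem_antidiagonal.1 hα]
  exact Nat.lt_succ_iff.1 (Finset.mem_range.1 hn)

theorem specP_of_mem_centerSpace (hm : (k : ℝ) + 2 ≤ m) {f : L2m m} (hf : f ∈ centerSpace k m) :
    specP m k f = f := by
  have hk : (0 : ℝ) ≤ k := Nat.cast_nonneg _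
  induction hf using Submodule.span_induction with
  | mem f hf =>
    obtain ⟨α, hα, h⟩ := hf
    have hfα : f = hermL m α := ext_ae (EventuallyEq.trans h (hermL_coe (by linarith) α).symm)
    have hrange : α.1 + α.2 ∈ Finset.range (k + 1) := Finset.mem_range.2 (Nat.lt_succ_of_le hα)
    have hc := fun n hn β hβ => coefL_hermL (m := m) β α (index_lt hm (n := n) hn hβ)
    rw [hfα, specP, specMul_apply, Finset.sum_eq_single (α.1 + α.2), Finset.sum_eq_single α]
    · rw [hc _ hrange _ (mem_antidiagonal.2 rfl), if_pos rfl, mul_one, one_smul]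
    · intro β hβ hne
      rw [hc _ hrange _ hβ, if_neg hne, mul_zero, zero_smul]
    · intro h; exact absurd (mem_antidiagonal.2 rfl) h
    · intro n hn hne
      refine Finset.sum_eq_zero fun β hβ => ?_
      rw [hc _ hn _ hβ, if_neg, mul_zero, zero_smul]
      rintro rfl
      exact hne (mem_antidiagonal.1 hβ).symm
    · intro h; exact absurd hrange h
  | zero => exact map_zero _
  | add f g _ _ h1 h2 => rw [map_add, h1, h2]
  | smul a f _ h => rw [map_smul, h]

theorem mem_stableSpace_iff (hm : (k : ℝ) + 2 ≤ m) {f : L2m m} :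
    f ∈ stableSpace k m ↔ specP m k f = 0 := by
  have h0 : ⇑(0 : L2m m) =ᵐ[volume] fun _ => (0 : ℝ) :=
    ae_weight_iff.1 (Lp.coeFn_zero ℝ 2 (weightMeasure m))
  constructor
  · intro h
    exact ext_ae ((specP_coe hm f).trans (EventuallyEq.trans h h0.symm))
  · intro h
    have h1 := specP_coe hm f
    rw [h] at h1
    exact h1.symm.trans h0

/-- Polynomials of degree at most `k`. -/
def polySpace (k : ℕ) : Submodule ℝ (Plane → ℝ) :=
  Submodule.span ℝ {F | ∃ α : ℕ × ℕ, α.1 + α.2 ≤ k ∧ F = hermP α}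

theorem polySpace_mono {k l : ℕ} (h : k ≤ l) : polySpace k ≤ polySpace l :=
  Submodule.span_mono fun _ ⟨α, hα, hF⟩ => ⟨α, hα.trans h, hF⟩

theorem hermP_mem {k : ℕ} {α : ℕ × ℕ} (h : α.1 + α.2 ≤ k) : hermP α ∈ polySpace k :=
  Submodule.subset_span ⟨α, h, rfl⟩

theorem exists_X_mul_hq (n : ℕ) : ∃ a b : ℝ, ∃ i ≤ n, ∀ x,
    x * (hq n).eval x = a * (hq i).eval x + b * (hq (n + 1)).eval x := by
  rcases n with _ | n
  · refine ⟨0, -2, 0, le_rfl, fun x => ?_⟩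
    have := congrArg (Polynomial.eval x) X_mul_hq_zero
    simpa using this
  · refine ⟨-(n + 1 : ℝ), -2, n, Nat.le_succ n, fun x => ?_⟩
    have := congrArg (Polynomial.eval x) (X_mul_hq_succ n)
    simpa only [Polynomial.eval_mul, Polynomial.eval_add, Polynomial.eval_X, Polynomial.eval_C]
      using this

theorem coord_mul_mem (i : Fin 2) {F : Plane → ℝ} (hF : F ∈ polySpace k) :
    (fun ξ => ξ i * F ξ) ∈ polySpace (k + 1) := by
  induction hF using Submodule.span_induction with
  | mem F hF =>
    obtain ⟨α, hα, rfl⟩ := hF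
    fin_cases i
    · obtain ⟨a, b, j, hj, h⟩ := exists_X_mul_hq α.1
      have : (fun ξ : Plane => ξ 0 * hermP α ξ) =
          a • hermP (j, α.2) + b • hermP (α.1 + 1, α.2) := by
        ext1 ξ
        simp only [hermP, Pi.add_apply, Pi.smul_apply, smul_eq_mul]
        rw [← mul_assoc, h]; ring
      change (fun ξ : Plane => ξ 0 * hermP α ξ) ∈ _
      rw [this]
      exact Submodule.add_mem _ (Submodule.smul_mem _ _ (hermP_mem (by simp only; omega)))
        (Submodule.smul_mem _ _ (hermP_mem (by simp only; omega)))
    · obtain ⟨a, b, j, hj, h⟩ := exists_X_mul_hq α.2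
      have : (fun ξ : Plane => ξ 1 * hermP α ξ) =
          a • hermP (α.1, j) + b • hermP (α.1, α.2 + 1) := by
        ext1 ξ
        simp only [hermP, Pi.add_apply, Pi.smul_apply, smul_eq_mul]
        rw [mul_left_comm, h]; ring
      change (fun ξ : Plane => ξ 1 * hermP α ξ) ∈ _
      rw [this]
      exact Submodule.add_mem _ (Submodule.smul_mem _ _ (hermP_mem (by simp only; omega)))
        (Submodule.smul_mem _ _ (hermP_mem (by simp only; omega)))
  | zero =>
    convert Submodule.zero_mem (polySpace (k + 1)) using 1
    ext1 ξ; simp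
  | add F G _ _ h1 h2 =>
    convert Submodule.add_mem _ h1 h2 using 1
    ext1 ξ; simp only [Pi.add_apply]; ring
  | smul a F _ h =>
    convert Submodule.smul_mem _ a h using 1
    ext1 ξ; simp only [Pi.smul_apply, smul_eq_mul]; ring

theorem inner_mul_mem (z : Plane) {F : Plane → ℝ} (hF : F ∈ polySpace k) :
    (fun ξ => inner ℝ z ξ * F ξ) ∈ polySpace (k + 1) := by
  have : (fun ξ => inner ℝ z ξ * F ξ) =
      z 0 • (fun ξ => ξ 0 * F ξ) + z 1 • fun ξ => ξ 1 * F ξ := by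
    ext1 ξ
    simp only [PiLp.inner_apply, Fin.sum_univ_two, Pi.add_apply, Pi.smul_apply, smul_eq_mul]
    simp; ring
  rw [this]
  exact Submodule.add_mem _ (Submodule.smul_mem _ _ (coord_mul_mem 0 hF))
    (Submodule.smul_mem _ _ (coord_mul_mem 1 hF))

theorem norm_sq_mul_mem {F : Plane → ℝ} (hF : F ∈ polySpace k) :
    (fun ξ => ‖ξ‖ ^ 2 * F ξ) ∈ polySpace (k + 2) := by
  have : (fun ξ : Plane => ‖ξ‖ ^ 2 * F ξ) =
      (fun ξ => ξ 0 * (ξ 0 * F ξ)) + fun ξ => ξ 1 * (ξ 1 * F ξ) := by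
    ext1 ξ
    simp only [norm_sq_plane, Pi.add_apply]; ring
  rw [this]
  exact Submodule.add_mem _ (coord_mul_mem 0 (coord_mul_mem 0 hF))
    (coord_mul_mem 1 (coord_mul_mem 1 hF))

/-- These are the monomials of the Taylor expansion of the heat kernel in y; the square of the norm
counts as degree two. -/
theorem pow_mul_pow_mem (z : Plane) (i l : ℕ) :
    (fun ξ => inner ℝ z ξ ^ i * (‖ξ‖ ^ 2) ^ l) ∈ polySpace (i + 2 * l) := by
  induction i with
  | zero =>
    induction l with
    | zero =>
      convert hermP_mem (k := 0) (α := (0, 0)) le_rfl using 1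
      ext1 ξ; simp [hermP, hq]
    | succ l ih =>
      rw [show 0 + 2 * (l + 1) = 0 + 2 * l + 2 by ring]
      convert norm_sq_mul_mem ih using 1
      ext1 ξ; ring
  | succ i ih =>
    rw [show i + 1 + 2 * l = i + 2 * l + 1 by ring]
    convert inner_mul_mem z ih using 1
    ext1 ξ; ring

theorem integral_polySpace_mul (hm : (k : ℝ) + 2 ≤ m) {f : L2m m} (hf : specP m k f = 0)
    {F : Plane → ℝ} (hF : F ∈ polySpace k) :
    Integrable (fun ξ => F ξ * f ξ) ∧ ∫ ξ, F ξ * f ξ = 0 := by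
  induction hF using Submodule.span_induction with
  | mem F hF =>
    obtain ⟨α, hα, rfl⟩ := hF
    have hαm : ((α.1 + α.2 : ℕ) : ℝ) + 1 < m := by
      have : ((α.1 + α.2 : ℕ) : ℝ) ≤ k := by exact_mod_cast hα
      linarith
    refine ⟨integrable_hermP_mul α hαm f, ?_⟩
    have h1 := coefL_specMul hm (fun _ => 1) f hα
    change coefL m α (specP m k f) = _ at h1
    rw [hf, map_zero, one_mul, coefL_apply α hαm, integral_hermitePoly_mul] at h1
    exact (mul_eq_zero.1 h1.symm).resolve_left (hermC_pos α).ne'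
  | zero => simp
  | add F G _ _ h1 h2 =>
    simp only [Pi.add_apply, add_mul]
    exact ⟨h1.1.add h2.1, by rw [integral_add h1.1 h2.1, h1.2, h2.2, add_zero]⟩
  | smul a F _ h =>
    simp only [Pi.smul_apply, smul_eq_mul, mul_assoc]
    exact ⟨h.1.const_mul a, by rw [integral_const_mul, h.2, mul_zero]⟩

end Projection

/-! ### Decay of the semigroup on the stable space. -/

section Gap

/-- The terms of the double exponential series `e^u e^v`. -/
noncomputable def expTerm (u v : ℝ) (p : ℕ × ℕ) : ℝ :=
  u ^ p.1 / (p.1.factorial : ℝ) * (v ^ p.2 / (p.2.factorial : ℝ))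

/-- The terms of weighted degree at most `k`, if `u` has degree one and `v` degree two. -/
def expIdx (k : ℕ) : Finset (ℕ × ℕ) :=
  (Finset.range (k + 1) ×ˢ Finset.range (k + 1)).filter fun p => p.1 + 2 * p.2 ≤ k

theorem mem_expIdx {k : ℕ} {p : ℕ × ℕ} : p ∈ expIdx k ↔ p.1 + 2 * p.2 ≤ k := by
  simp only [expIdx, Finset.mem_filter, Finset.mem_product, Finset.mem_range]
  omega

/-- The part of weighted degree at most `k` of `e^u e^v`. -/
noncomputable def expPoly (k : ℕ) (u v : ℝ) : ℝ := ∑ p ∈ expIdx k, expTerm u v p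

theorem hasSum_expTerm (u v : ℝ) : HasSum (expTerm u v) (Real.exp (u + v)) := by
  have h : ∀ x : ℝ, HasSum (fun n : ℕ => x ^ n / (n.factorial : ℝ)) (Real.exp x) := fun x => by
    have := NormedSpace.expSeries_div_hasSum_exp x
    rwa [← Real.exp_eq_exp_ℝ] at this
  have hs := summable_mul_of_summable_norm (f := fun n : ℕ => u ^ n / (n.factorial : ℝ))
    (g := fun n : ℕ => v ^ n / (n.factorial : ℝ)) (h u).summable.norm (h v).summable.norm
  have h2 := (h u).mul (h v) hs
  rw [← Real.exp_add] at h2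
  exact h2

theorem norm_expTerm_le {u v U V r : ℝ} (hu : |u| ≤ r * U) (hv : |v| ≤ r ^ 2 * V) (p : ℕ × ℕ) :
    ‖expTerm u v p‖ ≤ r ^ (p.1 + 2 * p.2) * expTerm U V p := by
  have h1 := pow_le_pow_left₀ (abs_nonneg u) hu p.1
  have h2 := pow_le_pow_left₀ (abs_nonneg v) hv p.2
  rw [expTerm, norm_mul, norm_div, norm_div, norm_pow, norm_pow, Real.norm_natCast,
    Real.norm_natCast, Real.norm_eq_abs, Real.norm_eq_abs]
  calc _ ≤ (r * U) ^ p.1 / (p.1.factorial : ℝ) * ((r ^ 2 * V) ^ p.2 / (p.2.factorial : ℝ)) := by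
        gcongr
        exact div_nonneg ((pow_nonneg (abs_nonneg u) _).trans h1) (Nat.cast_nonneg _)
    _ = _ := by rw [expTerm, mul_pow, mul_pow, pow_add, pow_mul]; ring

theorem expTerm_nonneg {U V : ℝ} (hU : 0 ≤ U) (hV : 0 ≤ V) (p : ℕ × ℕ) : 0 ≤ expTerm U V p := by
  unfold expTerm; positivity

/-- For r < 1 only terms of weighted degree at least k + 1 remain, and each is at most r^κ times the
term at (U, V). For r ≥ 1 only degrees up to k occur, and the same bound holds because κ ≥ k. One
inequality thus serves both regions, at a fractional exponent. -/
theorem abs_exp_sub_expPoly_le {u v U V r : ℝ} (hU : 0 ≤ U) (hV : 0 ≤ V) (hr : 0 ≤ r)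
    (hu : |u| ≤ r * U) (hv : |v| ≤ r ^ 2 * V) {k : ℕ} {κ : ℝ} (hk : (k : ℝ) ≤ κ)
    (hκ : κ ≤ k + 1) :
    |(if r < 1 then Real.exp (u + v) else 0) - expPoly k u v| ≤ r ^ κ * Real.exp (U + V) := by
  have hk0 : (0 : ℝ) ≤ k := Nat.cast_nonneg _
  split_ifs with h1
  · have h2 : HasSum (fun p => expTerm u v p - if p ∈ expIdx k then expTerm u v p else 0)
        (Real.exp (u + v) - expPoly k u v) := by
      refine (hasSum_expTerm u v).sub ?_
      have h3 := hasSum_sum_of_ne_finset_zero (L := .unconditional _) (s := expIdx k)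
        (f := fun p => if p ∈ expIdx k then expTerm u v p else 0) fun p hp => if_neg hp
      rwa [Finset.sum_congr rfl fun p hp => if_pos hp] at h3
    refine h2.norm_le_of_bounded ((hasSum_expTerm U V).mul_left (r ^ κ)) fun p => ?_
    by_cases hp : p ∈ expIdx k
    · rw [if_pos hp, sub_self, norm_zero]
      exact mul_nonneg (Real.rpow_nonneg hr _) (expTerm_nonneg hU hV p)
    · rw [if_neg hp, sub_zero]
      refine (norm_expTerm_le hu hv p).trans
        (mul_le_mul_of_nonneg_right ?_ (expTerm_nonneg hU hV p))
      rw [mem_expIdx, not_le] at hp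
      rw [← Real.rpow_natCast]
      refine Real.rpow_le_rpow_of_exponent_ge' hr h1.le (hk0.trans hk) (hκ.trans ?_)
      exact_mod_cast hp
  · rw [zero_sub, abs_neg, expPoly]
    have h1 := not_lt.1 h1
    calc _ ≤ ∑ p ∈ expIdx k, r ^ κ * expTerm U V p := by
          refine (Finset.abs_sum_le_sum_abs _ _).trans (Finset.sum_le_sum fun p hp => ?_)
          refine (norm_expTerm_le hu hv p).trans
            (mul_le_mul_of_nonneg_right ?_ (expTerm_nonneg hU hV p))
          rw [← Real.rpow_natCast]
          refine Real.rpow_le_rpow_of_exponent_le h1 (le_trans ?_ hk)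
          exact_mod_cast mem_expIdx.1 hp
      _ ≤ _ := by
          rw [← Finset.mul_sum]
          exact mul_le_mul_of_nonneg_left (sum_le_hasSum _ (fun p _ => expTerm_nonneg hU hV p)
            (hasSum_expTerm U V)) (Real.rpow_nonneg hr _)

theorem expPoly_mem_polySpace (k : ℕ) (ξ : Plane) (a b : ℝ) :
    (fun y => expPoly k (a * inner ℝ ξ y) (b * ‖y‖ ^ 2)) ∈ polySpace k := by
  have h : (fun y => expPoly k (a * inner ℝ ξ y) (b * ‖y‖ ^ 2)) = ∑ p ∈ expIdx k,
      (a ^ p.1 / (p.1.factorial : ℝ) * (b ^ p.2 / (p.2.factorial : ℝ))) •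
        fun y : Plane => inner ℝ ξ y ^ p.1 * (‖y‖ ^ 2) ^ p.2 := by
    ext1 y
    simp only [expPoly, expTerm, Finset.sum_apply, Pi.smul_apply, smul_eq_mul, mul_pow]
    exact Finset.sum_congr rfl fun p _ => by ring
  rw [h]
  exact Submodule.sum_mem _ fun p hp => Submodule.smul_mem _ _
    (polySpace_mono (mem_expIdx.1 hp) (pow_mul_pow_mem ξ p.1 p.2))

theorem heatK_eq_gk_mul_exp {t : ℝ} (ht : 0 < t) (ξ y : Plane) : heatK t ξ y =
    gk (aTime t) ξ * Real.exp (Real.exp (-t / 2) / (2 * aTime t) * inner ℝ ξ y +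
      -(Real.exp (-t / 2) ^ 2 / (4 * aTime t)) * ‖y‖ ^ 2) := by
  have ha := aTime_pos ht
  rw [heatK, gk, gk, mul_assoc (1 / (4 * Real.pi * aTime t)), ← Real.exp_add, norm_sub_sq_real, norm_smul, mul_pow,
    Real.norm_eq_abs, sq_abs, inner_smul_right]
  congr 2
  field_simp
  ring

theorem half_le_aTime_of_one_le {t : ℝ} (ht : 1 ≤ t) : 1 / 2 ≤ aTime t := by
  have h1 : Real.exp (-t) ≤ Real.exp (-1) := Real.exp_le_exp.2 (by linarith)
  have h2 := Real.exp_neg_one_lt_half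
  unfold aTime; linarith

/-- The Taylor estimate applies with r = e^(-t/2)|y|, U = |ξ| and V = 1/2. For t ≥ 1 the width is at
least 1/2, so the constants are uniform in t, and the Gaussian in ξ absorbs e^|ξ|. -/
theorem abs_heatK_sub_le {t : ℝ} (ht : 1 ≤ t) {k : ℕ} {κ : ℝ} (hk : (k : ℝ) ≤ κ)
    (hκ : κ ≤ k + 1) (ξ y : Plane) :
    |(if Real.exp (-t / 2) * ‖y‖ < 1 then heatK t ξ y else 0) - gk (aTime t) ξ *
      expPoly k (Real.exp (-t / 2) / (2 * aTime t) * inner ℝ ξ y)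
        (-(Real.exp (-t / 2) ^ 2 / (4 * aTime t)) * ‖y‖ ^ 2)| ≤
      Real.exp 5 * Real.exp (-‖ξ‖ ^ 2 / 16) * (Real.exp (-t / 2) ^ κ * ‖y‖ ^ κ) := by
  have ht0 : 0 < t := by linarith
  have ha := aTime_pos ht0
  have ha2 := half_le_aTime_of_one_le ht
  have ha1 := aTime_le_one t
  set s := Real.exp (-t / 2) with hs
  have hs0 : 0 < s := Real.exp_pos _
  have hg := gk_nonneg ha ξ
  have h := abs_exp_sub_expPoly_le (u := s / (2 * aTime t) * inner ℝ ξ y)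
    (v := -(s ^ 2 / (4 * aTime t)) * ‖y‖ ^ 2) (U := ‖ξ‖) (V := 1 / 2) (r := s * ‖y‖)
    (norm_nonneg ξ) (by norm_num) (by positivity) (by
      rw [abs_mul, abs_of_pos (by positivity)]
      calc _ ≤ s / 1 * (‖ξ‖ * ‖y‖) := by
            gcongr
            · linarith
            · exact abs_real_inner_le_norm ξ y
        _ = _ := by ring) (by
      rw [abs_mul, abs_neg, abs_of_pos (by positivity), abs_of_nonneg (by positivity)]
      calc _ ≤ s ^ 2 / 2 * ‖y‖ ^ 2 := by gcongr; linarith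
        _ = _ := by ring) hk hκ
  have h2 : gk (aTime t) ξ * Real.exp (‖ξ‖ + 1 / 2) ≤ Real.exp 5 * Real.exp (-‖ξ‖ ^ 2 / 16) := by
    have h3 : 1 / (4 * Real.pi * aTime t) ≤ 1 := by
      rw [div_le_one (by positivity)]
      nlinarith [Real.pi_gt_three]
    have h4 : -‖ξ‖ ^ 2 / (4 * aTime t) ≤ -‖ξ‖ ^ 2 / 4 := by
      rw [neg_div, neg_div, neg_le_neg_iff]
      exact div_le_div_of_nonneg_left (by positivity) (by positivity) (by linarith)
    rw [gk, mul_assoc, ← Real.exp_add, ← Real.exp_add]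
    refine (mul_le_of_le_one_left (Real.exp_pos _).le h3).trans (Real.exp_le_exp.2 ?_)
    nlinarith [sq_nonneg (‖ξ‖ - 8 / 3)]
  have h5 : (if s * ‖y‖ < 1 then heatK t ξ y else 0) = gk (aTime t) ξ *
      if s * ‖y‖ < 1 then Real.exp (s / (2 * aTime t) * inner ℝ ξ y +
        -(s ^ 2 / (4 * aTime t)) * ‖y‖ ^ 2) else 0 := by
    rw [mul_ite, mul_zero, heatK_eq_gk_mul_exp ht0]
  rw [h5, ← mul_sub, abs_mul, abs_of_nonneg hg]
  calc _ ≤ gk (aTime t) ξ * ((s * ‖y‖) ^ κ * Real.exp (‖ξ‖ + 1 / 2)) :=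
        mul_le_mul_of_nonneg_left h hg
    _ = gk (aTime t) ξ * Real.exp (‖ξ‖ + 1 / 2) * (s ^ κ * ‖y‖ ^ κ) := by
        rw [Real.mul_rpow hs0.le (norm_nonneg y)]; ring
    _ ≤ _ := mul_le_mul_of_nonneg_right h2 (by positivity)

variable {m : ℝ} {k : ℕ}

theorem exists_integral_rpow_mul_le {κ : ℝ} (hκ0 : 0 ≤ κ) (hκ : κ + 1 < m) : ∃ D : ℝ, 0 ≤ D ∧
    ∀ f : L2m m, Integrable (fun y => ‖y‖ ^ κ * ‖f y‖) ∧ ∫ y, ‖y‖ ^ κ * ‖f y‖ ≤ D * ‖f‖ := by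
  have hmeas : AEStronglyMeasurable (fun y : Plane => ‖y‖ ^ κ) volume :=
    (measurable_norm.pow_const κ).aestronglyMeasurable
  set K := ∫⁻ ξ : Plane, wt (-m) ξ * ‖‖ξ‖ ^ κ‖ₑ ^ 2 with hK
  have hKt : K < ⊤ := by
    refine (lintegral_mono fun ξ => ?_).trans_lt (lintegral_wt_neg_lt_top
      (show 1 < m - κ by linarith))
    have h1 : ‖‖ξ‖ ^ κ‖ₑ ^ 2 ≤ wt κ ξ := by
      rw [Real.enorm_of_nonneg (by positivity), ← ENNReal.ofReal_pow (by positivity), wt]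
      refine ENNReal.ofReal_le_ofReal ?_
      rw [← Real.rpow_natCast, ← Real.rpow_mul (norm_nonneg _), mul_comm κ,
        Real.rpow_mul (norm_nonneg _), Real.rpow_natCast]
      exact Real.rpow_le_rpow (by positivity) (by linarith) hκ0
    refine (mul_le_mul_right h1 _).trans_eq ?_
    rw [wt_mul]
    exact congrArg (fun a => wt a ξ) (by ring)
  refine ⟨Real.sqrt K.toReal, Real.sqrt_nonneg _, fun f => ?_⟩
  have hint := (integrable_mul_coe hmeas hKt f).norm
  simp only [norm_mul, Real.norm_of_nonneg (Real.rpow_nonneg (norm_nonneg (_ : Plane)) κ)] at hint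
  refine ⟨hint, ?_⟩
  have h2 := integral_norm_eq_lintegral_enorm (integrable_mul_coe hmeas hKt f).1
  simp only [norm_mul, Real.norm_of_nonneg (Real.rpow_nonneg (norm_nonneg (_ : Plane)) κ),
    enorm_mul] at h2
  rw [h2]
  refine ENNReal.toReal_le_of_le_ofReal (by positivity) ?_
  rw [← (ENNReal.pow_right_strictMono two_ne_zero).le_iff_le, ENNReal.ofReal_mul
    (Real.sqrt_nonneg _), mul_pow, ofReal_norm, ← ENNReal.ofReal_pow (Real.sqrt_nonneg _),
    Real.sq_sqrt ENNReal.toReal_nonneg, ENNReal.ofReal_toReal hKt.ne]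
  exact lintegral_mul_coe_sq_le hmeas f

/-- The Taylor polynomial is subtracted against all of f, which changes nothing as f is orthogonal
to it, while the kernel itself acts only where |y| < e^(t/2). The strict bound κ < k + 1 keeps |y|^κ
f integrable even for m = k + 2. -/
theorem exists_norm_heatS_near_le (hm : (k : ℝ) + 2 ≤ m) {κ : ℝ} (hk : (k : ℝ) ≤ κ)
    (hκ : κ < k + 1) : ∃ C : ℝ, 0 ≤ C ∧ ∀ t, 1 ≤ t → ∀ f f₂ : L2m m, specP m k f = 0 →
      f₂ =ᵐ[volume] {y | 1 ≤ Real.exp (-t / 2) * ‖y‖}.indicator f →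
      ‖heatS m t f - heatS m t f₂‖ ≤ C * Real.exp (-(κ / 2) * t) * ‖f‖ := by
  have hk0 : (0 : ℝ) ≤ k := Nat.cast_nonneg _
  have hm1 : 1 < m := by linarith
  obtain ⟨D, hD, hDf⟩ := exists_integral_rpow_mul_le (m := m) (hk0.trans hk) (by linarith)
  have hL := lintegral_wt_exp_lt_top (m := m) (by linarith) (Real.exp 5)
  set L := ∫⁻ ξ, wt m ξ * ENNReal.ofReal (Real.exp 5 * Real.exp (-‖ξ‖ ^ 2 / 16)) ^ 2 with hLdef
  refine ⟨Real.sqrt L.toReal * D, by positivity, fun t ht f f₂ hf hf₂ => ?_⟩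
  have ht0 : 0 < t := by linarith
  set s := Real.exp (-t / 2) with hs
  have hpt : ∀ ξ, ‖heatOp t f ξ - heatOp t f₂ ξ‖ ≤
      Real.exp 5 * Real.exp (-‖ξ‖ ^ 2 / 16) * (s ^ κ * (D * ‖f‖)) := fun ξ => by
    obtain ⟨hpi, hp0⟩ := integral_polySpace_mul hm hf (expPoly_mem_polySpace k ξ
      (s / (2 * aTime t)) (-(s ^ 2 / (4 * aTime t))))
    set p : Plane → ℝ := fun y => expPoly k (s / (2 * aTime t) * inner ℝ ξ y)
      (-(s ^ 2 / (4 * aTime t)) * ‖y‖ ^ 2) with hp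
    have h1 : heatOp t f ξ - heatOp t f₂ ξ =
        ∫ y, (heatK t ξ y * f y - heatK t ξ y * f₂ y - gk (aTime t) ξ * (p y * f y)) := by
      have hi1 := integrable_heatK_mul ht0 (integrable_coe hm1 f) ξ
      have hi2 := integrable_heatK_mul ht0 (integrable_coe hm1 f₂) ξ
      have e1 := integral_sub (hi1.sub hi2) (hpi.const_mul (gk (aTime t) ξ))
      rw [integral_const_mul, hp0, mul_zero, sub_zero] at e1
      exact (e1.trans (integral_sub hi1 hi2)).symm
    rw [h1]
    refine (norm_integral_le_of_norm_le ((hDf f).1.const_mul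
      (Real.exp 5 * Real.exp (-‖ξ‖ ^ 2 / 16) * s ^ κ)) (hf₂.mono fun y hy => ?_)).trans ?_
    · have h2 := abs_heatK_sub_le ht hk hκ.le ξ y
      have h3 : heatK t ξ y * f y - heatK t ξ y * f₂ y - gk (aTime t) ξ * (p y * f y) =
          ((if s * ‖y‖ < 1 then heatK t ξ y else 0) - gk (aTime t) ξ * p y) * f y := by
        rw [hy]
        by_cases h : s * ‖y‖ < 1
        · rw [if_pos h, indicator_of_notMem (by simpa using h)]; ring
        · rw [if_neg h, indicator_of_mem (by simpa using h)]; ring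
      rw [h3, norm_mul, Real.norm_eq_abs]
      calc _ ≤ Real.exp 5 * Real.exp (-‖ξ‖ ^ 2 / 16) * (s ^ κ * ‖y‖ ^ κ) * ‖f y‖ :=
            mul_le_mul_of_nonneg_right h2 (norm_nonneg _)
        _ = _ := by ring
    · rw [integral_const_mul, mul_assoc (_ * _)]
      exact mul_le_mul_of_nonneg_left (mul_le_mul_of_nonneg_left (hDf f).2 (by positivity))
        (by positivity)
  have hsκ : s ^ κ = Real.exp (-(κ / 2) * t) := by
    rw [hs, ← Real.exp_mul]; congr 1; ring
  refine norm_le_of_lintegral (by positivity) ?_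
  calc _ ≤ ∫⁻ ξ, wt m ξ * ENNReal.ofReal (Real.exp 5 * Real.exp (-‖ξ‖ ^ 2 / 16)) ^ 2 *
        ENNReal.ofReal (s ^ κ * (D * ‖f‖)) ^ 2 := by
        refine lintegral_mono_ae ?_
        filter_upwards [heatS_coe hm1 ht0 f, heatS_coe hm1 ht0 f₂,
          coeFn_sub_ae (heatS m t f) (heatS m t f₂)] with ξ h1 h2 h3
        rw [h3, h1, h2, mul_assoc, ← mul_pow, ← ENNReal.ofReal_mul (by positivity), ← ofReal_norm]
        exact mul_le_mul_right (pow_le_pow_left₀ zero_le (ENNReal.ofReal_le_ofReal (hpt ξ)) 2) _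
    _ = L * ENNReal.ofReal (s ^ κ * (D * ‖f‖)) ^ 2 := lintegral_mul_const' _ _ (by simp)
    _ = _ := by
        have e : ∀ b : ℝ, 0 ≤ b → L * ENNReal.ofReal b ^ 2 =
            ENNReal.ofReal ((Real.sqrt L.toReal * b) ^ 2) := fun b hb => by
          rw [mul_pow, ENNReal.ofReal_mul (sq_nonneg _), Real.sq_sqrt ENNReal.toReal_nonneg,
            ENNReal.ofReal_toReal hL.ne, ENNReal.ofReal_pow hb]
        rw [e _ (by positivity), hsκ]
        congr 2
        ring

/-- Where |y| ≥ e^(t/2), the weight at e^(-t/2) y is smaller than that at y by a factor of order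
e^(-mt). The row mass e^t of the kernel is the loss, and the square root leaves the rate (m-1)/2. -/
theorem exists_norm_heatS_far_le (hm : 1 < m) : ∃ C : ℝ, 0 ≤ C ∧ ∀ t, 0 < t → ∀ f f₂ : L2m m,
      f₂ =ᵐ[volume] {y | 1 ≤ Real.exp (-t / 2) * ‖y‖}.indicator f →
      ‖heatS m t f₂‖ ≤ C * Real.exp (-((m - 1) / 2) * t) * ‖f‖ := by
  obtain ⟨C, hC⟩ := exists_lintegral_wt_gk_le (show 0 ≤ m by linarith)
  refine ⟨Real.sqrt (C * 2 ^ m), Real.sqrt_nonneg _, fun t ht f f₂ hf₂ => ?_⟩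
  set s := Real.exp (-t / 2) with hs
  have hs2 : s ^ 2 = Real.exp (-t) := exp_half_sq t
  refine norm_le_of_lintegral (by positivity) ?_
  calc _ = ∫⁻ ξ, wt m ξ * ‖heatOp t f₂ ξ‖ₑ ^ 2 :=
        lintegral_congr_ae ((heatS_coe hm ht f₂).mono fun ξ h => by simp only [h])
    _ ≤ ENNReal.ofReal (Real.exp t) * ∫⁻ y, C * wt m (s • y) * ‖f₂ y‖ₑ ^ 2 :=
        lintegral_heatOp_le ht (aestronglyMeasurable_coe f₂) fun y =>
          hC _ (aTime_pos ht) ((aTime_le_one t).trans one_le_two) _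
    _ ≤ ENNReal.ofReal (Real.exp t) * ∫⁻ y, C * ENNReal.ofReal (2 ^ m * Real.exp (-m * t)) *
          (wt m y * ‖f y‖ₑ ^ 2) := by
        refine mul_le_mul_right (lintegral_mono_ae (hf₂.mono fun y hy => ?_)) _
        rw [hy]
        by_cases h : y ∈ {y | 1 ≤ s * ‖y‖}
        · rw [indicator_of_mem h, mul_assoc (C : ℝ≥0∞), mul_assoc (C : ℝ≥0∞), ← mul_assoc _ (wt m y)]
          refine mul_le_mul_right (mul_le_mul_left ?_ _) _
          rw [wt, wt, ← ENNReal.ofReal_mul (by positivity)]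
          refine ENNReal.ofReal_le_ofReal ?_
          have h1 : (1 + ‖s • y‖ ^ 2) ≤ 2 * Real.exp (-t) * (1 + ‖y‖ ^ 2) := by
            rw [norm_smul, Real.norm_of_nonneg (Real.exp_pos _).le, ← hs2]
            have h2 : 1 ≤ s * ‖y‖ := h
            nlinarith [sq_nonneg s]
          refine (Real.rpow_le_rpow (by positivity) h1 (by linarith)).trans_eq ?_
          rw [Real.mul_rpow (by positivity) (by positivity), Real.mul_rpow (by positivity)
            (by positivity), ← Real.exp_mul]
          congr 3
          ring
        · rw [indicator_of_notMem h, enorm_zero, zero_pow two_ne_zero, mul_zero]; exact zero_le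
    _ = ENNReal.ofReal (Real.exp t) * (C * ENNReal.ofReal (2 ^ m * Real.exp (-m * t)) *
          ‖f‖ₑ ^ 2) := by
        rw [enorm_sq]
        congr 1
        exact lintegral_const_mul' _ _ (ENNReal.mul_ne_top ENNReal.coe_ne_top
          ENNReal.ofReal_ne_top)
    _ = _ := by
        rw [← ofReal_norm, ← ENNReal.ofReal_coe_nnreal, ← ENNReal.ofReal_pow (norm_nonneg _),
          ← ENNReal.ofReal_mul (by positivity), ← ENNReal.ofReal_mul (by positivity),
          ← ENNReal.ofReal_mul (by positivity), mul_pow, mul_pow, Real.sq_sqrt (by positivity),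
          ← Real.exp_nat_mul]
        congr 1
        have h : Real.exp (((2 : ℕ) : ℝ) * (-((m - 1) / 2) * t)) =
            Real.exp t * Real.exp (-m * t) := by
          rw [← Real.exp_add]; congr 1; push_cast; ring
        rw [h]
        ring

/-- The semigroup decays at any rate below `(k + 1) / 2` on the kernel of `P_k`. -/
theorem exists_norm_heatS_sub_le (hm : (k : ℝ) + 2 ≤ m) {ν : ℝ} (hk : (k : ℝ) / 2 ≤ ν)
    (hν : ν < ((k : ℝ) + 1) / 2) : ∃ C : ℝ, 0 ≤ C ∧ ∀ t, 0 ≤ t →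
      ‖heatS m t - (specP m k).comp (heatS m t)‖ ≤ C * Real.exp (-ν * t) := by
  have hk0 : (0 : ℝ) ≤ k := Nat.cast_nonneg _
  have hm1 : 1 < m := by linarith
  obtain ⟨C₀, hC₀, h₀⟩ := exists_norm_heatS_le hm1
  obtain ⟨C₁, hC₁, h₁⟩ := exists_norm_heatS_near_le hm (κ := 2 * ν) (by linarith) (by linarith)
  obtain ⟨C₂, hC₂, h₂⟩ := exists_norm_heatS_far_le hm1
  set C := C₀ * Real.exp (1 / 2) * Real.exp ν + (C₁ + C₂) with hC
  set N := ‖ContinuousLinearMap.id ℝ (L2m m) - specP m k‖ with hN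
  have key : ∀ t, 0 ≤ t → ∀ f, specP m k f = 0 → ‖heatS m t f‖ ≤ C * Real.exp (-ν * t) * ‖f‖ := by
    intro t ht f hf
    -- The estimates for the two regions are uniform for t ≥ 1; for shorter times the general growth
    -- bound is enough, with e^ν compensating the factor e^(-νt).
    refine le_trans ?_ (mul_le_mul_of_nonneg_right (?_ : (if t < 1 then
      C₀ * Real.exp (1 / 2) * Real.exp ν else C₁ + C₂) * Real.exp (-ν * t) ≤ _) (norm_nonneg f))
    · split_ifs with h
      · refine ContinuousLinearMap.le_of_opNorm_le _ ((h₀ t ht).trans ?_) f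
        rw [mul_assoc, mul_assoc, ← Real.exp_add, ← Real.exp_add]
        refine mul_le_mul_of_nonneg_left (Real.exp_le_exp.2 ?_) (by linarith)
        nlinarith
      · have ht1 := not_lt.1 h
        have hmeas : MeasurableSet {y : Plane | 1 ≤ Real.exp (-t / 2) * ‖y‖} :=
          measurableSet_le measurable_const (by fun_prop)
        have hLp := (Lp.memLp f).indicator hmeas
        have hf₂ : hLp.toLp _ =ᵐ[volume] {y | 1 ≤ Real.exp (-t / 2) * ‖y‖}.indicator f :=
          coeFn_toLp hLp
        have e1 := h₁ t ht1 f _ hf hf₂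
        have e2 := h₂ t (by linarith) f _ hf₂
        rw [show 2 * ν / 2 = ν by ring] at e1
        -- The assumption m ≥ k + 2 is used here: the rate (m-1)/2 of the remote part is then at
        -- least (k+1)/2 and exceeds ν.
        have e3 : Real.exp (-((m - 1) / 2) * t) ≤ Real.exp (-ν * t) :=
          Real.exp_le_exp.2 (mul_le_mul_of_nonneg_right (by linarith) ht)
        have e4 := mul_le_mul_of_nonneg_right (mul_le_mul_of_nonneg_left e3 hC₂) (norm_nonneg f)
        have e5 := norm_add_le (heatS m t f - heatS m t (hLp.toLp _)) (heatS m t (hLp.toLp _))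
        rw [sub_add_cancel] at e5
        linarith
    · refine mul_le_mul_of_nonneg_right ?_ (Real.exp_pos _).le
      have : 0 ≤ C₀ * Real.exp (1 / 2) * Real.exp ν := by positivity
      split_ifs <;> linarith
  refine ⟨C * N, by positivity, fun t ht => ContinuousLinearMap.opNorm_le_bound _ (by positivity)
    fun g => ?_⟩
  have h1 : (heatS m t - (specP m k).comp (heatS m t)) g = heatS m t (g - specP m k g) := by
    rw [map_sub, specP, heatS_specMul hm _ ht]
    simp only [sub_apply, ContinuousLinearMap.comp_apply]
    rw [specMul_heatS hm _ ht]
  have h2 : specP m k (g - specP m k g) = 0 := by rw [map_sub, specP_specP hm, sub_self]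
  have h3 : ‖g - specP m k g‖ ≤ N * ‖g‖ :=
    (ContinuousLinearMap.id ℝ (L2m m) - specP m k).le_opNorm g
  rw [h1]
  refine (key t ht _ h2).trans ?_
  calc _ ≤ C * Real.exp (-ν * t) * (N * ‖g‖) := by gcongr
    _ = _ := by ring

/-- The spectral splitting of `e^(t𝓛)` on `L²(m)`. -/
theorem exists_spectralSplit (hm : (k : ℝ) + 2 ≤ m) {ν : ℝ} (hk : (k : ℝ) / 2 ≤ ν)
    (hν : ν < ((k : ℝ) + 1) / 2) : ∃ C, SpectralSplit (heatS m) (transB m) (specP m k)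
      (fun t => specMul m k fun n => Real.exp ((n : ℝ) / 2 * t)) (specP m 0) C (k / 2) ν (1 / 4) := by
  have hk0 : (0 : ℝ) ≤ k := Nat.cast_nonneg _
  have hm0 : ((0 : ℕ) : ℝ) + 2 ≤ m := by push_cast; linarith
  obtain ⟨C₁, hC₁, h₁⟩ := exists_norm_heatS_sub_le hm hk hν
  -- The case k = 0 gives decay modulo the mass at every rate below 1/2; the value 1/4 is one
  -- admissible choice.
  obtain ⟨C₂, hC₂, h₂⟩ := exists_norm_heatS_sub_le hm0 (ν := 1 / 4) (by norm_num) (by norm_num)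
  obtain ⟨D, hD, hDc⟩ := exists_norm_specMul_le m k
  have hexp : ∀ (n : ℕ) (t : ℝ), Real.exp ((n : ℝ) / 2 * t) * Real.exp (-((n : ℝ) / 2) * t) = 1 :=
    fun n t => by rw [← Real.exp_add]; simp
  refine ⟨C₁ + C₂ + D, ⟨by positivity, by norm_num, specP_specP hm, fun t ht x => ?_,
    fun t ht x => ?_, fun t ht x => ?_, fun t ht x => ?_, fun t ht => ?_, fun t ht => ?_,
    fun t ht x => ?_, fun t ht x y => ?_, fun t ht => ?_⟩⟩
  · rw [specP, specMul_heatS hm _ ht, heatS_specMul hm _ ht]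
  · rw [specMul_heatS hm _ ht]; simp only [hexp]; rfl
  · rw [heatS_specMul hm _ ht]; simp only [hexp]; rfl
  · rw [specP, specMul_specMul hm]; simp only [mul_one]
  · refine (hDc _ (Real.exp (k / 2 * t)) fun n hn => ?_).trans
      (mul_le_mul_of_nonneg_right (by linarith) (Real.exp_pos _).le)
    rw [abs_of_pos (Real.exp_pos _)]
    have : (n : ℝ) ≤ k := by exact_mod_cast hn
    exact Real.exp_le_exp.2 (by gcongr)
  · exact (h₁ t ht).trans (mul_le_mul_of_nonneg_right (by linarith) (Real.exp_pos _).le)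
  · rw [specP, specMul_heatS hm0 _ ht]
    refine specMul_congr fun α hα => ?_
    rw [Nat.le_zero.1 hα]; simp
  · have h : specP m 0 (transB m t x y) = specMul m 0 (fun _ => 1) 0 := by
      refine specMul_congr fun α hα => ?_
      have h0 : α = (0, 0) := Prod.ext (by simp only; omega) (by simp only; omega)
      rw [h0, coefL_transB (by linarith) ht, map_zero]
    rw [h, map_zero]
  · exact (h₂ t ht).trans (mul_le_mul_of_nonneg_right (by linarith) (Real.exp_pos _).le)

end Gap

/-! ### The center manifold in L²(m) and the theorem. -/

section CenterManifold

variable {m : ℝ} {k : ℕ}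

theorem IsCutoff.exists_bounds {χ : L2m m → ℝ} (hχ : IsCutoff χ) :
    ∃ M K, CutoffBounds χ M K := by
  obtain ⟨M, hM⟩ := hχ.bounded
  obtain ⟨K, hK⟩ := hχ.lipschitz
  refine ⟨M, K, hχ.smooth.of_le (by exact_mod_cast le_top), (abs_nonneg _).trans (hM 0),
    K.coe_nonneg, hM, fun x y => ?_, hχ.eq_one, hχ.eq_zero⟩
  simpa [dist_eq_norm] using hK.dist_le_mul x y

theorem CutoffBounds.isFlow_semiflow (hm : 1 < m) {χ : L2m m → ℝ} {M K : ℝ}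
    (hχ : CutoffBounds χ M K) {r : ℝ} (hr : 0 < r) :
    IsFlow (heatS m) (transB m) (cutId χ r) (semiflow (rescaleCut χ r)) ∧
      ∀ x, WellPosedAt (rescaleCut χ r) x := by
  have hM := hχ.m_nonneg
  have hK := hχ.K_nonneg
  have hc : Continuous (rescaleCut χ r) := hχ.contDiff.continuous.comp (continuous_const_smul _)
  obtain ⟨M', hs⟩ := exists_smoothingPair hm
  have hu := hs.uniqueGlobalSol (hχ.contDiff_cutId r).continuous (by positivity)
    (hχ.bilLipOn_cutId hr)
  exact ⟨fun x => isPartialFlow_semiflow hm hc x (hu x).1, fun x => (wellPosedAt_iff hm hc).2 (hu x)⟩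

theorem GapFlow.isCenterManifold (hm : (k : ℝ) + 2 ≤ m) {Φ : ℝ → L2m m → L2m m}
    {Λ A : L2m m →L[ℝ] L2m m} {α β q ε t₀ μ₁ μ₂ : ℝ}
    (h : GapFlow Φ Λ A (specP m k) α β q ε t₀ μ₁ μ₂) :
    IsCenterManifold k m μ₁ μ₂ Φ h.manifold where
  graph := by
    have hR : ContDiff ℝ 1 fun x => Φ t₀ x - Λ x := h.contDiff.sub Λ.contDiff
    have hG := h.gapMap.contDiff_graphMap hR
    have hι : ContDiff ℝ 1 fun x : centerSpace k m => (x : L2m m) :=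
      (centerSpace k m).subtypeL.contDiff
    refine ⟨fun x => h.gapMap.graphMap x, fun x => (mem_stableSpace_iff hm).2
      (h.gapMap.proj_graphMap _), hG.comp hι, ⟨1 / 4, LipschitzWith.of_dist_le_mul fun x y => ?_⟩,
      h.gapMap.graphMap_zero, ?_, ?_⟩
    · simpa [dist_eq_norm] using h.gapMap.graphMap_sub_le (x : L2m m) y
    · have h0 : DifferentiableAt ℝ h.gapMap.graphMap ((centerSpace k m).subtypeL 0) :=
        (hG.differentiable one_ne_zero) _
      have h1 := fderiv_comp (𝕜 := ℝ) (0 : centerSpace k m) h0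
        (centerSpace k m).subtypeL.differentiableAt
      rw [_root_.map_zero, h.gapMap.fderiv_graphMap_zero hR h.fderiv_zero,
        ContinuousLinearMap.zero_comp] at h1
      exact h1
    · ext w
      constructor
      · intro hw
        refine ⟨⟨specP m k w, specP_mem_centerSpace hm w⟩, ?_⟩
        change w = specP m k w + h.gapMap.graphMap (specP m k w)
        rw [h.gapMap.graphMap_proj, ← show w - specP m k w = h.gapMap.graphMap w from hw,
          add_sub_cancel]
      · rintro ⟨x, rfl⟩
        have h1 : specP m k ((x : L2m m) + h.gapMap.graphMap x) = x := by
          rw [map_add, h.gapMap.proj_graphMap, add_zero, specP_of_mem_centerSpace hm x.2]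
        change _ - specP m k _ = h.gapMap.graphMap _
        rw [← h.gapMap.graphMap_proj (_ + _), h1, add_sub_cancel_left]
  flow := h.flow
  image_eq := fun _ hτ => h.image_eq hτ
  negSemiOrbit := fun _ hw => h.negSemiOrbit hw
  rate_le := fun _ hw hW => h.rate_le hw hW
  mem_of_rate_le := fun _ hw hr _ hτ => h.mem_of_rate_le hw hr hτ

end CenterManifold
end RescaledVorticity

theorem mainTheorem2 (k : ℕ) (m : ℝ) (hm : (k : ℝ) + 2 ≤ m) (μ₁ μ₂ : ℝ)
    (hμ₁ : (k : ℝ) / 2 < μ₁) (hμ₁₂ : μ₁ < μ₂) (hμ₂ : μ₂ < ((k : ℝ) + 1) / 2)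
    (χ : L2m m → ℝ) (hχ : IsCutoff χ) :
    ∃ rbar : ℝ, 0 < rbar ∧ ∀ r₀ : ℝ, 0 < r₀ → r₀ < rbar →
      -- the semiflow of the truncated equation, and that of the equation itself near the origin,
      -- are well defined
      (∀ w₀ : L2m m, WellPosedAt (rescaleCut χ r₀) w₀) ∧
      (∀ w₀ : L2m m, ‖w₀‖ < r₀ → WellPosedAt (noCut m) w₀) ∧
      -- the center manifold of the truncated equation exists
      (∃ Wc : Set (L2m m), IsCenterManifold k m μ₁ μ₂ (semiflow (rescaleCut χ r₀)) Wc) ∧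
      ∀ Wc : Set (L2m m), IsCenterManifold k m μ₁ μ₂ (semiflow (rescaleCut χ r₀)) Wc →
        -- local invariance of `Wc ∩ {‖w‖ < r₀}` under the semiflow of the equation itself
        IsLocallyInvariant (semiflow (noCut m)) r₀ (Wc ∩ {w | ‖w‖ < r₀}) ∧
        -- it contains the negative semi-orbits that stay in the ball
        (∀ w : ℝ → L2m m, IsNegSemiOrbit (semiflow (noCut m)) w → (∀ τ ≤ 0, ‖w τ‖ < r₀) →
          ∀ τ ≤ 0, w τ ∈ Wc ∩ {w | ‖w‖ < r₀}) ∧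
        -- tracking
        ∀ μ : ℝ, μ < μ₂ → ∃ r₂ C : ℝ, 0 < r₂ ∧ 0 < C ∧
          ∀ w₁ : L2m m, ‖w₁‖ ≤ r₂ →
            WellPosedAt (noCut m) w₁ ∧
            (∃ w₀, TracksIn (semiflow (noCut m)) (Wc ∩ {w | ‖w‖ < r₀}) μ C w₁ w₀) ∧
            ((k : ℝ) / 2 < μ →
              ∃! w₀, TracksIn (semiflow (noCut m)) (Wc ∩ {w | ‖w‖ < r₀}) μ C w₁ w₀) := by
  have hk : (0 : ℝ) ≤ k := Nat.cast_nonneg _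
  have hm1 : 1 < m := by linarith
  obtain ⟨M, K, hχb⟩ := hχ.exists_bounds
  obtain ⟨M', hS⟩ := exists_smoothingPair hm1
  -- The linear decay rate must lie strictly above `μ₂`, to leave room for the rate of the time map,
  -- and strictly below (k+1)/2, where the semigroup estimate stops.
  obtain ⟨ν, hν, hν'⟩ := exists_between hμ₂
  obtain ⟨C₀, hsplit⟩ := exists_spectralSplit hm (ν := ν) (by linarith) hν'
  have hid : (fun x : L2m m => noCut m x • x) = fun x => x := funext fun x => one_smul ℝ x
  have hc1 : Continuous (noCut m) := continuous_const
  have hΦ₁ := isPartialFlow_semiflow hm1 hc1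
  have hwp : ∀ x : L2m m, UniqueGlobalSol (heatS m) (transB m) (fun x => x) x →
      WellPosedAt (noCut m) x := fun x hx => (wellPosedAt_iff hm1 hc1).2 (by rw [hid]; exact hx)
  rw [hid] at hΦ₁
  obtain ⟨rbar, t₀, N, hrbar, -, hN, hmain⟩ := exists_localAgreement hS hsplit (by linarith) hμ₁
    hμ₁₂ hν hχb
  refine ⟨rbar, hrbar, fun r₀ hr₀ hr => ?_⟩
  obtain ⟨hΦ, hwell⟩ := hχb.isFlow_semiflow hm1 hr₀
  obtain ⟨⟨α, β, q, ε, hG⟩, hl, huniq⟩ := hmain r₀ hr₀ hr _ _ hΦ hΦ₁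
  refine ⟨hwell, fun w₀ hw₀ => hwp w₀ (huniq w₀ hw₀), ⟨_, hG.isCenterManifold hm⟩,
    fun Wc hWc => ?_⟩
  -- The definition of a center manifold determines it as a set, so the assertions need to be
  -- checked only for the constructed one.
  obtain rfl : Wc = hG.manifold := hG.eq_manifold hμ₁₂.le (fun w₀ hw₀ => (hWc.negSemiOrbit w₀ hw₀).1)
    hWc.rate_le hWc.mem_of_rate_le
  refine ⟨hG.isLocallyInvariant hl, fun w hw hwr τ hτ =>
    hG.mem_of_negSemiOrbit_local (by linarith) hl hw hwr hτ, fun μ hμ => ?_⟩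
  obtain ⟨r₂, C, hr₂, hC, hr₂r, htrack⟩ := exists_tracking_local hS hsplit (by positivity) hχb hN hΦ
    hl hG hμ
  exact ⟨r₂, C, hr₂, hC, fun w₁ hw₁ => ⟨hwp w₁ (huniq w₁ (hw₁.trans_lt hr₂r)), htrack w₁ hw₁⟩⟩
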